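/- **Setting.** Let $\mathfrak g=\mathfrak{osp}(2|2)$ be the complex Lie superalgebra with even basis $f_3,h_1,h_2,e_3$ and odd basis $e_1,e_2,f_1,f_2$, realised in $\mathfrak{sl}(2|2)$ (rows and columns $1,2$ even, $3,4$ odd) by $e_1=E_{24}+E_{31}$, $e_2=E_{14}+E_{32}$, $f_1=E_{13}-E_{42}$, $f_2=E_{23}-E_{41}$, $e_3=[e_1,e_2]$, $f_3=[f_1,f_2]$, $h_1=[e_1,f_1]$, $h_2=[e_2,f_2]$, with the supertrace form $(a|b)=\operatorname{str}(ab)$, so $(e_1|f_1)=(e_2|f_2)=-2$, $(e_3|f_3)=4$, $(h_1|h_2)=-4$. Grade it by $\mathfrak g_1=\langle e_2,e_3\rangle$, $\mathfrak g_0=\langle f_1,h_1,h_2,e_1\rangle$, $\mathfrak g_{-1}=\langle f_2,f_3\rangle$, and put $\mathfrak n=\mathfrak m=\mathfrak g_1$, $\mathfrak b_-=\mathfrak g_{-1}\oplus\mathfrak g_0$, $f=f_2$, $s=e_2$. Let $\bar{\mathfrak g}$ be $\mathfrak g$ with reversed parity and $\mathcal P(\bar{\mathfrak g})=S(\mathbb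 C[D]\otimes\bar{\mathfrak g})$ the free supercommutative superalgebra with odd derivation $D$. It carries the two $\chi$-brackets ($\chi$ odd, $D\chi+\chi D=-2\chi^2$) which extend, by sesquilinearity and the Leibniz rules, $\{\bar a_\chi\bar b\}_1=(-1)^{p(a)}(\overline{[a,b]}+\chi(a|b))$ and $\{\bar a_\chi\bar b\}_2=(-1)^{p(a)+1}(s|[a,b])$. Let $\mathcal P=S(\mathbb C[D]\otimes\bar{\mathfrak b}_-)$, let $\mathcal I$ be the differential ideal generated by $\bar m-(f|m)$, $m\in\mathfrak m$, and let $\pi:\mathcal P(\bar{\mathfrak g})\to\mathcal P(\bar{\mathfrak g})/\mathcal I\cong\mathcal P$. The generalized W-algebra is $\mathcal W=\{a\in\mathcal P:\{\bar n_\chi a\}_1\in\mathcal I[\chi]\ \forall n\in\mathfrak n\}$, with the brackets $\{a_\chi b\}_i^{\mathcal W}=\pi(\{a_\chi b\}_i)$; $\int$ denotes the projection $\mathcal W\to\mathcal W/D\mathcal W$. On $\mathbb CD\oplus(\mathfrak g((z^{-1}))\otimes\mathcal P)$ (completed in $z^{-1}$) use $[a z^m\otimes u,b z^n\otimes v]=(-1)^{p(b)p(u)}[a,b]z^{m+n}\otimes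 uv$, $[D,az^m\otimes u]=(-1)^{p(a)}az^m\otimes Du$ and $(az^m\otimes u|bz^n\otimes v)=(-1)^{p(b)p(u)}\delta_{m+n,0}(a|b)uv$. Let $Q_u=e_3\otimes\frac{\bar f_3}4-e_2\otimes\frac{\bar f_2}2-e_1\otimes\frac{\bar f_1}2-h_1\otimes\frac{\bar h_2}4-h_2\otimes\frac{\bar h_1}4+f_1\otimes\frac{\bar e_1}2$ and $\Lambda=f_2+ze_2$. **Theorem.** (0) There are a unique even $N\in\mathfrak n\otimes\mathcal P$ and unique $w_1,\dots,w_4\in\mathcal P$ ($w_1,w_3$ even, $w_2,w_4$ odd) with $$e^{\mathrm{ad}N}(D+Q_u+f\otimes1)=D+Q^c+f\otimes1,\qquad Q^c=f_1\otimes w_1+h_1\otimes w_2+e_2\otimes w_3+e_3\otimes w_4,$$ and $w_1,\dots,w_4\in\mathcal W$. There is a unique pair $(T^c,K^c)$ with $$e^{\mathrm{ad}T^c}(D+Q^c+\Lambda\otimes1)=D+K^c+\Lambda\otimes1,$$ where $T^c$ is even, has components of positive degree only ($\deg z=-2$) and lies in $\operatorname{im}\mathrm{ad}\Lambda^2$,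 $K^c$ is odd and lies in $\ker\mathrm{ad}\Lambda^2$, and both have coefficients in $\mathcal W$. For $n\ge0$ set $\rho_n=(K^c|h_2\otimes z^n)$; it is an odd element of $\mathcal W$. (1) The super Hamiltonian equations $$\frac{dw_t}{dt_n}=\{\textstyle\int\rho_n{}_\chi w_t\}^{\mathcal W}_1|_{\chi=0},\qquad t=1,2,3,4,\quad n\ge0,$$ are pairwise compatible: the derivations $a\mapsto\{\rho_n{}_\chi a\}^{\mathcal W}_1|_{\chi=0}$ of $\mathcal W$ commute with each other. (2) The functionals $\int\rho_k$, $k\ge0$, are integrals of motion of each of these equations, i.e. $\int\{\rho_n{}_\chi\rho_k\}^{\mathcal W}_1|_{\chi=0}=0$ for all $n,k\ge0$, and they are linearly independent over $\mathbb C$ in $\mathcal W/D\mathcal W$. For $n\ge1$, $\rho_n$ is a super differential polynomial in $w_1,\dots,w_4$ with a well-defined part $(\rho_n)_{\rm quad}$ of polynomial degree two, and $\int(\rho_n)_{\rm quad}=2^{3-n}\int w_1^{(2n-2)}w_4$, where $w^{(m)}=D^mw$. (3) For all $n\ge0$ and $t=1,2,3,4$, $$\frac{dw_t}{dt_n}=\{\textstyle\int\rho_{n+1}{}_\chi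 w_t\}^{\mathcal W}_2|_{\chi=0}.$$ -/

import Mathlib

noncomputable section

namespace SuperDS

/-! ### Superalgebras of super differential polynomials -/

/-- The sign `(-1)^p`. -/
def sgn (p : ZMod 2) : ℂ := if p = 0 then 1 else -1

theorem sgn_add (p q : ZMod 2) : sgn (p + q) = sgn p * sgn q := by
  have h : ∀ p : ZMod 2, p = 0 ∨ p = 1 := by decide
  have h2 : (1 : ZMod 2) + 1 = 0 := by decide
  rcases h p with rfl | rfl <;> rcases h q with rfl | rfl <;> simp [sgn, h2]

theorem sgn_mul_self (p : ZMod 2) : sgn p * sgn p = 1 := by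
  unfold sgn
  split_ifs <;> norm_num

/-- The parity of the letter `u_i^{(n)} = D^n u_i`, where `par i` is the parity of `u_i`. -/
def letterPar {ι : Type} (par : ι → ZMod 2) (x : ι × ℕ) : ZMod 2 := par x.1 + (x.2 : ZMod 2)

/-- The relations `x y = (-1)^{p(x)p(y)} y x` between letters. -/
inductive SuperRel {ι : Type} (par : ι → ZMod 2) :
    FreeAlgebra ℂ (ι × ℕ) → FreeAlgebra ℂ (ι × ℕ) → Prop
  | swap (x y : ι × ℕ) : SuperRel par (FreeAlgebra.ι ℂ x * FreeAlgebra.ι ℂ y)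
      (sgn (letterPar par x * letterPar par y) • (FreeAlgebra.ι ℂ y * FreeAlgebra.ι ℂ x))

/-- `S(ℂ[D] ⊗ V)`, where `V` has the basis `u_i`, `i ∈ ι`, with `u_i` of parity `par i`: the free
unital associative supercommutative superalgebra on the letters `u_i^{(n)}`. -/
abbrev SDiffPoly {ι : Type} (par : ι → ZMod 2) : Type := RingQuot (SuperRel par)

section General

variable {ι : Type} {par : ι → ZMod 2}

/-- The element `u_i^{(n)}`, for the letter `(i, n)`. -/
def letter (par : ι → ZMod 2) (x : ι × ℕ) : SDiffPoly par :=
  RingQuot.mkAlgHom ℂ (SuperRel par) (FreeAlgebra.ι ℂ x)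

theorem letter_swap (x y : ι × ℕ) : letter par x * letter par y =
    sgn (letterPar par x * letterPar par y) • (letter par y * letter par x) := by
  have h := RingQuot.mkAlgHom_rel ℂ (SuperRel.swap (par := par) x y)
  simpa [letter, map_mul, map_smul] using h

/-- The universal property: an algebra morphism is given by supercommuting images of the letters. -/
def liftHom {B : Type} [Ring B] [Algebra ℂ B] (v : ι × ℕ → B)
    (hv : ∀ x y, v x * v y = sgn (letterPar par x * letterPar par y) • (v y * v x)) :
    SDiffPoly par →ₐ[ℂ] B :=
  RingQuot.liftAlgHom ℂ ⟨FreeAlgebra.lift ℂ v, by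
    rintro _ _ ⟨x, y⟩
    simpa [map_mul, map_smul] using hv x y⟩

theorem liftHom_letter {B : Type} [Ring B] [Algebra ℂ B] (v : ι × ℕ → B)
    (hv : ∀ x y, v x * v y = sgn (letterPar par x * letterPar par y) • (v y * v x)) (x : ι × ℕ) :
    liftHom v hv (letter par x) = v x := by
  simp [liftHom, letter]

theorem induct {C : SDiffPoly par → Prop} (h0 : ∀ r : ℂ, C (algebraMap ℂ _ r))
    (h1 : ∀ x, C (letter par x)) (hm : ∀ a b, C a → C b → C (a * b))
    (ha : ∀ a b, C a → C b → C (a + b)) (a : SDiffPoly par) : C a := by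
  obtain ⟨a, rfl⟩ := RingQuot.mkAlgHom_surjective ℂ (SuperRel par) a
  induction a using FreeAlgebra.induction with
  | grade0 r => simpa using h0 r
  | grade1 x => exact h1 x
  | mul a b iha ihb => rw [map_mul]; exact hm _ _ iha ihb
  | add a b iha ihb => rw [map_add]; exact ha _ _ iha ihb

/-- The parity involution `a ↦ (-1)^{p(a)} a`. -/
def sigma : SDiffPoly par →ₐ[ℂ] SDiffPoly par :=
  liftHom (fun x => sgn (letterPar par x) • letter par x) (by
    intro x y
    rw [smul_mul_smul_comm, smul_mul_smul_comm, letter_swap x y, smul_smul, smul_smul]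
    congr 1
    ring)

/-- `sigmaPow p` is the map `a ↦ (-1)^{p p(a)} a`. -/
def sigmaPow (p : ZMod 2) : SDiffPoly par →ₐ[ℂ] SDiffPoly par :=
  if p = 0 then AlgHom.id ℂ _ else sigma

/-- `a` is homogeneous of parity `p`. -/
def IsHomog (p : ZMod 2) (a : SDiffPoly par) : Prop := sigma a = sgn p • a

/-- The component of parity `p` of `a`. -/
def parityPart (p : ZMod 2) (a : SDiffPoly par) : SDiffPoly par :=
  (1 / 2 : ℂ) • (a + sgn p • sigma a)

theorem sigmaPow_of_isHomog {p : ZMod 2} {a : SDiffPoly par} (h : IsHomog p a) (q : ZMod 2) :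
    sigmaPow q a = sgn (q * p) • a := by
  unfold sigmaPow
  split_ifs with hq
  · simp [hq, sgn]
  · have : q = 1 := by
      revert q
      decide
    rw [this, one_mul]
    exact h

theorem isHomog_letter (x : ι × ℕ) : IsHomog (letterPar par x) (letter par x) := by
  simp [IsHomog, sigma, liftHom_letter]

theorem mul_letter (x : ι × ℕ) (a : SDiffPoly par) :
    a * letter par x = letter par x * sigmaPow (letterPar par x) a := by
  induction a using induct with
  | h0 r => rw [AlgHom.commutes]; exact Algebra.commutes _ _
  | h1 y =>
    rw [sigmaPow_of_isHomog (isHomog_letter y), letter_swap y x, mul_smul_comm, mul_comm]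
  | hm a b iha ihb => rw [mul_assoc, ihb, ← mul_assoc, iha, map_mul, mul_assoc]
  | ha a b iha ihb => rw [add_mul, iha, ihb, map_add, mul_add]

/-- The algebra morphism `a ↦ ((-1)^{p p(a)} a, d a; 0, a)` into `2 × 2` matrices which encodes the
left superderivation `d` of parity `p` with values `v` on the letters. -/
def superDerHom (p : ZMod 2) (v : ι × ℕ → SDiffPoly par)
    (hv : ∀ x, IsHomog (p + letterPar par x) (v x)) :
    SDiffPoly par →ₐ[ℂ] Matrix (Fin 2) (Fin 2) (SDiffPoly par) :=
  liftHom (fun x => !![sgn (p * letterPar par x) • letter par x, v x; 0, letter par x]) (by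
    intro x y
    have e1 := letter_swap (par := par) x y
    have e2 := mul_letter y (v x)
    have e3 := mul_letter x (v y)
    rw [sigmaPow_of_isHomog (hv x)] at e2
    rw [sigmaPow_of_isHomog (hv y)] at e3
    rw [Matrix.mul_fin_two, Matrix.mul_fin_two]
    ext i j
    fin_cases i <;> fin_cases j
    · simp only [Fin.zero_eta, Matrix.of_apply, Matrix.cons_val', Matrix.cons_val_zero,
        mul_zero, add_zero, Matrix.smul_apply]
      rw [smul_mul_smul_comm, smul_mul_smul_comm, e1, smul_smul, smul_smul]
      congr 1
      ring
    · simp only [Fin.zero_eta, Fin.mk_one, Matrix.of_apply, Matrix.cons_val', Matrix.cons_val_zero,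
        Matrix.cons_val_one, Matrix.smul_apply, smul_add]
      rw [e2, e3, smul_mul_assoc, smul_mul_assoc, mul_smul_comm, mul_smul_comm, smul_smul, smul_smul,
        mul_add, mul_add, sgn_add, sgn_add, mul_comm (letterPar par y) (letterPar par x),
        mul_comm (letterPar par y) p, mul_comm (letterPar par x) p, ← mul_assoc,
        mul_comm (sgn (letterPar par x * letterPar par y)) (sgn (p * letterPar par x)),
        mul_assoc, sgn_mul_self, mul_one, mul_comm (sgn (p * letterPar par y)), add_comm]
    · simp
    · simpa using e1)

/-- The unique superderivation of parity `p`, i.e. `d (a b) = d a b + (-1)^{p p(a)} a d b`, with the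
values `v` on the letters. -/
def superDer (p : ZMod 2) (v : ι × ℕ → SDiffPoly par)
    (hv : ∀ x, IsHomog (p + letterPar par x) (v x)) : SDiffPoly par →ₗ[ℂ] SDiffPoly par :=
  (Matrix.entryLinearMap ℂ (SDiffPoly par) (0 : Fin 2) (1 : Fin 2)).comp
    (superDerHom p v hv).toLinearMap

/-- The odd derivation `D`, with `D u_i^{(n)} = u_i^{(n+1)}`. -/
def D : SDiffPoly par →ₗ[ℂ] SDiffPoly par :=
  superDer 1 (fun x => letter par (x.1, x.2 + 1)) (by
    intro x
    have h := isHomog_letter (par := par) (x.1, x.2 + 1)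
    have e : letterPar par (x.1, x.2 + 1) = 1 + letterPar par x := by
      simp only [letterPar]
      push_cast
      ring
    rwa [e] at h)

/-- The partial derivative with respect to the letter `y = u_i^{(m)}`: the superderivation of the
parity of `y` which sends `y` to `1` and all other letters to `0`. -/
def pd [DecidableEq ι] (y : ι × ℕ) : SDiffPoly par →ₗ[ℂ] SDiffPoly par :=
  superDer (letterPar par y) (fun x => if x = y then 1 else 0) (by
    intro x
    by_cases h : x = y
    · subst h
      have e : letterPar par x + letterPar par x = 0 := CharTwo.add_self_eq_zero _
      simp [IsHomog, e, sgn]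
    · simp [IsHomog, h])

/-! ### The `χ`-bracket given by the super master formula

An element `∑ χ^k a_k` of `P[χ]` is represented by its sequence of coefficients `k ↦ a_k`, with the
powers of the odd indeterminate `χ` on the left. -/

/-- A constant element of `P[χ]`. -/
def chiConst (a : SDiffPoly par) : ℕ → SDiffPoly par := fun k => if k = 0 then a else 0

/-- The operator `χ + D` on `P[χ]`. As `D χ + χ D = -2 χ²`, one has
`(χ + D) χ^k a = (-1)^k (χ^k D a + χ^{k+1} a)`. -/
def chiAddD (x : ℕ → SDiffPoly par) : ℕ → SDiffPoly par
  | 0 => D (x 0)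
  | k + 1 => sgn ((k + 1 : ℕ) : ZMod 2) • D (x (k + 1)) + sgn (k : ZMod 2) • x k

/-- Left multiplication by `c ∈ P` on `P[χ]`: `c χ^k a = (-1)^{k p(c)} χ^k c a`. -/
def chiMul (c : SDiffPoly par) (x : ℕ → SDiffPoly par) : ℕ → SDiffPoly par :=
  fun k => sigmaPow (k : ZMod 2) c * x k

/-- For brackets of generators of the form `{u_i χ u_j} = g₀ i j + χ g₁ i j`, with `g₁ i j` constant:
the operator `{u_i _{χ+D} u_j}_→ = g₀ i j + (-1)^{p(u_i)+p(u_j)} g₁ i j (χ + D)` on `P[χ]`. -/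
def genArrow (g₀ : ι → ι → SDiffPoly par) (g₁ : ι → ι → ℂ) (i j : ι) (x : ℕ → SDiffPoly par) :
    ℕ → SDiffPoly par :=
  fun k => chiMul (g₀ i j) x k + (sgn (par i + par j) * g₁ i j) • chiAddD x k

/-- The term of the super master formula for `{a χ b}` which belongs to the letters `u_i^{(m)}` of
`a` and `u_j^{(n)}` of `b`, when `a` and `b` have the parities `pa` and `pb`. -/
def masterTerm [DecidableEq ι] (g₀ : ι → ι → SDiffPoly par) (g₁ : ι → ι → ℂ) (pa pb : ZMod 2)
    (a b : SDiffPoly par) (i : ι) (m : ℕ) (j : ι) (n : ℕ) : ℕ → SDiffPoly par :=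
  fun k =>
    sgn (pb * (pa + 1) + (pb + par i + m) * (par j + n) + n * (par i + m + 1)
        + m * (par i + par j + 1) + (m.choose 2 : ℕ)) •
      chiMul (pd (j, n) b)
        (chiAddD^[n] (genArrow g₀ g₁ i j (chiAddD^[m] (chiConst (pd (i, m) a))))) k

/-- The `χ`-bracket on `P` determined by `{u_i χ u_j} = g₀ i j + χ g₁ i j` through sesquilinearity and
the Leibniz rules: `chiBracket g₀ g₁ a b k` is the coefficient of `χ^k` in `{a χ b}`. -/
def chiBracket [DecidableEq ι] (g₀ : ι → ι → SDiffPoly par) (g₁ : ι → ι → ℂ)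
    (a b : SDiffPoly par) : ℕ → SDiffPoly par :=
  fun k => ∑ pa : ZMod 2, ∑ pb : ZMod 2, ∑ᶠ xy : (ι × ℕ) × (ι × ℕ),
    masterTerm g₀ g₁ pa pb (parityPart pa a) (parityPart pb b)
      xy.1.1 xy.1.2 xy.2.1 xy.2.2 k

end General

/-! ### The Lie superalgebra `osp(2|2)` -/

/-- Names of the basis elements of `osp(2|2)`. -/
inductive B
  | f3 | h1 | h2 | e3 | e1 | e2 | f1 | f2
  deriving DecidableEq

instance : Fintype B := ⟨{.f3, .h1, .h2, .e3, .e1, .e2, .f1, .f2}, by intro b; cases b <;> decide⟩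

/-- Parities of the basis elements. -/
def B.par : B → ZMod 2
  | .f3 | .h1 | .h2 | .e3 => 0
  | .e1 | .e2 | .f1 | .f2 => 1

/-- The basis elements as supermatrices in `sl(2|2)`; the first two rows and columns are even, the
last two odd. -/
def B.mat : B → Matrix (Fin 4) (Fin 4) ℚ
  | .e1 => !![0, 0, 0, 0; 0, 0, 0, 1; 1, 0, 0, 0; 0, 0, 0, 0]
  | .e2 => !![0, 0, 0, 1; 0, 0, 0, 0; 0, 1, 0, 0; 0, 0, 0, 0]
  | .f1 => !![0, 0, 1, 0; 0, 0, 0, 0; 0, 0, 0, 0; 0, -1, 0, 0]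
  | .f2 => !![0, 0, 0, 0; 0, 0, 1, 0; 0, 0, 0, 0; -1, 0, 0, 0]
  | .e3 => !![0, 0, 0, 0; 0, 0, 0, 0; 0, 0, 0, 2; 0, 0, 0, 0]
  | .f3 => !![0, 0, 0, 0; 0, 0, 0, 0; 0, 0, 0, 0; 0, 0, -2, 0]
  | .h1 => !![1, 0, 0, 0; 0, -1, 0, 0; 0, 0, 1, 0; 0, 0, 0, -1]
  | .h2 => !![-1, 0, 0, 0; 0, 1, 0, 0; 0, 0, 1, 0; 0, 0, 0, -1]

/-- The supercommutator `[i, j] = i j - (-1)^{p(i)p(j)} j i` of two basis elements. -/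
def superComm (i j : B) : Matrix (Fin 4) (Fin 4) ℚ :=
  i.mat * j.mat - (if i.par * j.par = 0 then 1 else -1 : ℚ) • (j.mat * i.mat)

/-- The coordinates of a matrix of the span of the basis. -/
def coord (M : Matrix (Fin 4) (Fin 4) ℚ) : B → ℚ
  | .e1 => M 2 0
  | .e2 => M 2 1
  | .f1 => M 0 2
  | .f2 => M 1 2
  | .e3 => M 2 3 / 2
  | .f3 => -(M 3 2) / 2
  | .h1 => (M 0 0 + M 2 2) / 2
  | .h2 => (M 2 2 - M 0 0) / 2

/-- The structure constants: `[i, j] = ∑ k, struc i j k • k`. -/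
def struc (i j k : B) : ℚ := coord (superComm i j) k

theorem superComm_eq (i j : B) : superComm i j = ∑ k : B, struc i j k • k.mat := by
  revert i j
  decide +kernel

/-- The invariant bilinear form: the supertrace form `(i | j) = str (i j)`. -/
def form (i j : B) : ℚ :=
  (i.mat * j.mat) 0 0 + (i.mat * j.mat) 1 1 - (i.mat * j.mat) 2 2 - (i.mat * j.mat) 3 3

/-- The grading `g = g_{-1} ⊕ g_0 ⊕ g_1`. -/
def B.deg : B → ℤ
  | .e2 | .e3 => 1
  | .f1 | .h1 | .h2 | .e1 => 0
  | .f2 | .f3 => -1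

/-- The basis elements that span `n = m = g_1`. -/
def B.inN (b : B) : Prop := b.deg = 1

instance : DecidablePred B.inN := fun b => inferInstanceAs (Decidable (b.deg = 1))

/-! ### The affine SUSY PVA and the generalized W-algebra -/

/-- The parity of `b̄` in the parity reversed superspace. -/
def barPar (b : B) : ZMod 2 := b.par + 1

/-- `P(ḡ) = S(ℂ[D] ⊗ ḡ)`. -/
abbrev PA : Type := SDiffPoly barPar

/-- The element `b̄` of `P(ḡ)`. -/
def bar (b : B) : PA := letter barPar (b, 0)

/-- The first affine `χ`-bracket: `{ā χ b̄}₁ = (-1)^{p(a)} (\overline{[a,b]} + χ (a|b))`. -/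
def affine₁ : PA → PA → ℕ → PA :=
  chiBracket (fun a b => sgn a.par • ∑ k : B, (struc a b k : ℂ) • bar k)
    (fun a b => sgn a.par * (form a b : ℂ))

/-- The second affine `χ`-bracket, for `s = e₂`: `{ā χ b̄}₂ = (-1)^{p(a)+1} (s|[a,b])`. -/
def affine₂ : PA → PA → ℕ → PA :=
  chiBracket
    (fun a b => algebraMap ℂ PA
      (sgn (a.par + 1) * ∑ k : B, (struc a b k : ℂ) * (form .e2 k : ℂ)))
    (fun _ _ => 0)

/-- The differential subalgebra `P = S(ℂ[D] ⊗ b̄_-)` of `P(ḡ)`, where `b_- = g_{-1} ⊕ g_0`. -/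
def P : Subalgebra ℂ PA :=
  Algebra.adjoin ℂ {a | ∃ (b : B) (n : ℕ), ¬ b.inN ∧ a = letter barPar (b, n)}

/-- The morphism of differential superalgebras `P(ḡ) → P` with `m̄ ↦ (f|m)` for `m ∈ m`, `f = f₂`,
which is the identity on `P`. Its kernel is the differential ideal generated by the elements
`m̄ - (f|m)`, so that it is the quotient map `P(ḡ) → P(ḡ)/I ≅ P`. -/
def proj : PA →ₐ[ℂ] PA :=
  liftHom (fun x => if x.1.inN then (if x.2 = 0 then algebraMap ℂ PA (form .f2 x.1 : ℂ) else 0)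
      else letter barPar x) (by
    have key : ∀ x : B × ℕ, x.1.inN → x.2 = 0 → (form .f2 x.1 : ℂ) ≠ 0 →
        letterPar barPar x = 0 := by
      have h : ∀ b : B, b.inN → form .f2 b ≠ 0 → barPar b = 0 := by decide +kernel
      rintro ⟨b, n⟩ hb hn hf
      simp only at hb hn hf
      subst hn
      simpa [letterPar] using h b hb (by exact_mod_cast hf)
    have central : ∀ (x y : B × ℕ) (u : PA), x.1.inN → x.2 = 0 →
        algebraMap ℂ PA (form .f2 x.1 : ℂ) * u =
          sgn (letterPar barPar x * letterPar barPar y) •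
            (u * algebraMap ℂ PA (form .f2 x.1 : ℂ)) := by
      intro x y u hx hn
      by_cases h : (form .f2 x.1 : ℂ) = 0
      · simp [h]
      · rw [key x hx hn h, zero_mul, sgn, if_pos rfl, one_smul]
        exact Algebra.commutes _ _
    intro x y
    by_cases hx : x.1.inN
    · by_cases hn : x.2 = 0
      · rw [if_pos hx, if_pos hn]
        exact central x y _ hx hn
      · simp [hx, hn]
    · by_cases hy : y.1.inN
      · by_cases hn : y.2 = 0
        · rw [if_pos hy, if_pos hn, central y x _ hy hn, smul_smul,
            mul_comm (letterPar barPar y), sgn_mul_self, one_smul]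
        · simp [hy, hn]
      · rw [if_neg hx, if_neg hy]
        exact letter_swap x y)

/-- The generalized W-algebra `W(g, n, m, f)`, regarded as a subset of `P ≅ P(ḡ)/I`: the elements
`a` with `{n̄ χ a}₁ ⊆ I[χ]`. -/
def W : Set PA := {a | a ∈ P ∧ ∀ b : B, b.inN → ∀ k : ℕ, proj (affine₁ (bar b) a k) = 0}

/-- The first reduced bracket: the coefficient of `χ^k` in `{a χ b}₁^W`. -/
def bracketW₁ (a b : PA) (k : ℕ) : PA := proj (affine₁ a b k)

/-- The second reduced bracket: the coefficient of `χ^k` in `{a χ b}₂^W`. -/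
def bracketW₂ (a b : PA) (k : ℕ) : PA := proj (affine₂ a b k)

/-- The subspace `D W` of total derivatives of elements of `W`. -/
def DW : Submodule ℂ PA := Submodule.span ℂ (D '' W)

/-- The class `∫ a` of `a ∈ W`. The space of functionals `W / D W` is a subspace of `P(ḡ) / D W`. -/
def functional (a : PA) : PA ⧸ DW := DW.mkQ a

/-! ### Lax operators -/

/-- `ĝ ⊗ P(ḡ)`, with `ĝ = g((z⁻¹))` (completed in `z⁻¹`): the coordinate of `X` along the basis
element `b` is a Laurent series in `z⁻¹` with coefficients in `P(ḡ)`. The coefficient with index `k`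
belongs to `z^{-k}`. -/
abbrev Loop : Type := B → HahnSeries ℤ PA

/-- The element `b z^m ⊗ u`. -/
def el (b : B) (m : ℤ) (u : PA) : Loop := Pi.single b (HahnSeries.single (-m) u)

/-- `[a z^m ⊗ u, b z^n ⊗ v] = (-1)^{p(b)p(u)} [a,b] z^{m+n} ⊗ u v`. -/
def loopBracket (X Y : Loop) : Loop := fun k =>
  ∑ i : B, ∑ j : B, (struc i j k : ℂ) • ((X i).map (sigmaPow (par := barPar) j.par) * Y j)

/-- `(a z^m ⊗ u | b z^n ⊗ v) = (-1)^{p(b)p(u)} δ_{m+n,0} (a|b) u v`. -/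
def loopForm (X Y : Loop) : PA :=
  ∑ i : B, ∑ j : B, (form i j : ℂ) • ((X i).map (sigmaPow (par := barPar) j.par) * Y j).coeff 0

/-- `[D, a z^m ⊗ u] = (-1)^{p(a)} a z^m ⊗ D u`. -/
def loopD (X : Loop) : Loop := fun k => sgn k.par • (X k).map (D (par := barPar))

/-- `X` is homogeneous of parity `p`, where `a z^m ⊗ u` has the parity `p(a) + p(u)`. -/
def Loop.IsHomog (p : ZMod 2) (X : Loop) : Prop :=
  ∀ (b : B) (k : ℤ), SuperDS.IsHomog (p + b.par) ((X b).coeff k)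

/-- For an even `T`, the operator `ad T` on `ℂ D ⊕ (ĝ ⊗ P(ḡ))`, whose elements `c D + X` are
represented by `(c, X)`: it sends `c D + X` to `[T, X] - c [D, T]`. -/
def adOp (T : Loop) (L : ℂ × Loop) : ℂ × Loop := (0, loopBracket T L.2 - L.1 • loopD T)

/-- `e^{ad T} (D + X) = D + Y` for an even `T`: in each coefficient, the exponential series is a
finite sum, with value that of `Y`. -/
def ExpAd (T X Y : Loop) : Prop :=
  ∀ (b : B) (k : ℤ),
    (Function.support fun h : ℕ => (((adOp T)^[h] (1, X)).2 b).coeff k).Finite ∧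
    ∑ᶠ h : ℕ, ((h.factorial : ℂ)⁻¹) • (((adOp T)^[h] (1, X)).2 b).coeff k = (Y b).coeff k

/-- `f ⊗ 1` with `f = f₂`. -/
def fLoop : Loop := el .f2 0 1

/-- `Λ ⊗ 1`, where `Λ = f + z s` with `f = f₂` and `s = e₂`. -/
def Lam : Loop := fLoop + el .e2 1 1

/-- `Λ² ⊗ 1`, where `Λ² = [Λ, Λ] / 2`. -/
def LamSq : Loop := (1 / 2 : ℂ) • loopBracket Lam Lam

/-- `Q_u = ∑ q^t ⊗ q̄_t`, for the bases `(e₃, e₂, e₁, h₁, h₂, f₁)` of `b = g_0 ⊕ g_1` and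
`(f₃/4, -f₂/2, -f₁/2, -h₂/4, -h₁/4, e₁/2)` of `b_-`, which are dual: `(q^t | q_{t'}) = δ_{t t'}`.
The universal Lax operator is `D + Q_u + f ⊗ 1`. -/
def Qu : Loop :=
  el .e3 0 ((1 / 4 : ℂ) • bar .f3) - el .e2 0 ((1 / 2 : ℂ) • bar .f2)
    - el .e1 0 ((1 / 2 : ℂ) • bar .f1) - el .h1 0 ((1 / 4 : ℂ) • bar .h2)
    - el .h2 0 ((1 / 4 : ℂ) • bar .h1) + el .f1 0 ((1 / 2 : ℂ) • bar .e1)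

/-- `Q^c = f₁ ⊗ w₁ + h₁ ⊗ w₂ + e₂ ⊗ w₃ + e₃ ⊗ w₄` (`w t` stands for `w_{t+1}`). -/
def Qc (w : Fin 4 → PA) : Loop :=
  el .f1 0 (w 0) + el .h1 0 (w 1) + el .e2 0 (w 2) + el .e3 0 (w 3)

/-- `D + Q^c + f ⊗ 1` is the canonical form of the universal Lax operator, `N ∈ (n ⊗ P)_0` being the
gauge transformation: `e^{ad N} (D + Q_u + f ⊗ 1) = D + Q^c + f ⊗ 1`, with `Q^c` odd. -/
def IsCanonicalForm (N : Loop) (w : Fin 4 → PA) : Prop :=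
  (∀ b : B, ¬ b.inN → N b = 0) ∧ (∀ (b : B) (k : ℤ), k ≠ 0 → (N b).coeff k = 0) ∧
  (∀ b : B, (N b).coeff 0 ∈ P) ∧ N.IsHomog 0 ∧
  (∀ t, w t ∈ P) ∧ (Qc w).IsHomog 1 ∧
  ExpAd N (Qu + fLoop) (Qc w + fLoop)

/-- The solution `(T^c, K^c)` of `e^{ad T} (D + Q^c + Λ ⊗ 1) = D + K + Λ ⊗ 1`, where `T` is an even
element of `im ad Λ² ⊗ W` all of whose homogeneous components have positive degree (`z` having the
degree `-2`) and `K` is an odd element of `ker ad Λ² ⊗ W`. -/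
def IsDressing (w : Fin 4 → PA) (T K : Loop) : Prop :=
  T.IsHomog 0 ∧ (∀ (b : B) (k : ℤ), (T b).coeff k ∈ W) ∧
  (∀ (b : B) (k : ℤ), (T b).coeff k ≠ 0 → 0 < b.deg + 2 * k) ∧
  (∃ Y : Loop, T = loopBracket LamSq Y) ∧
  K.IsHomog 1 ∧ (∀ (b : B) (k : ℤ), (K b).coeff k ∈ W) ∧ loopBracket LamSq K = 0 ∧
  ExpAd T (Qc w + Lam) (K + Lam)

/-- `ρ_n = (K | h₂ ⊗ z^n)`. -/
def rho (K : Loop) (n : ℕ) : PA := loopForm K (el .h2 n 1)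

/-- The derivation `X_{∫h} = {h χ ·}₁|_{χ=0}` of `W`. -/
def flow₁ (h a : PA) : PA := bracketW₁ h a 0

/-- The derivation `{h χ ·}₂|_{χ=0}` of `W`. -/
def flow₂ (h a : PA) : PA := bracketW₂ h a 0

/-- The span of the variables `w_t^{(m)}`; its `k`-th power is the space of super differential
polynomials in the `w_t` that are homogeneous of polynomial degree `k`. -/
def varSpan (w : Fin 4 → PA) : Submodule ℂ PA :=
  Submodule.span ℂ {a | ∃ (t : Fin 4) (m : ℕ), a = D^[m] (w t)}

/-- `q` is the quadratic part of the super differential polynomial `a` in the `w_t`. -/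
def IsQuadraticPart (w : Fin 4 → PA) (a q : PA) : Prop :=
  q ∈ varSpan w ^ 2 ∧ ∃ l ∈ (1 : Submodule ℂ PA) ⊔ varSpan w, ∃ c ∈ ⨆ k : ℕ, varSpan w ^ (k + 3),
    a = l + q + c

end SuperDS

end

/-!
The proof replaces loops with values in `g ⊗ P(ḡ)` by power series in `ζ = z⁻¹` whose coefficients are
operators on `ℂ^{2|2} ⊗ P(ḡ)` (`rep`, `gser`, `ser`). In this realisation `D + X`, multiplied by `ζ`,
is itself such a series, the bracket with an even element is a commutator, and `e^{ad T}` is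
conjugation by an exponential (`expAd_iff`). Convergence and all inductions "by degree" refer to the
filtration `Ser.Fil`.

*Canonical form.* Products of elements of `n` vanish as matrices, so a gauge transformation is
conjugation by `1 + n`, its effect is an explicit quadratic expression (`gaugeT_components`), and the
canonical form can be solved for and is unique (`gaugeT_nv_qv`, `IsCanonicalForm.eq`). An
infinitesimal gauge transformation is a combination of the operators `π {n̄ χ ·}₁` and hence kills `W`
(`IsEvol.eq_zero_of_gauge`).

*Dressing.* `Λ² = z h₂`, and `ad Λ` is invertible on the image of `ad Λ²` (`tauOf_commutator`), so that
the dressing is found degree by degree (`dressStep_spec`, `dressed_dressing`). Conversely an operator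
that anticommutes with `h₂` is controlled by its commutator with `Λ` (`mem_Fil_of_commutator`), which
gives uniqueness (`Loop.eq_of_antiPart_dressed`) and also shows that whatever commutes with the dressed
operator commutes with `h₂` (`commute_Js_of_commute_Kh`).

*Variational derivatives.* Conjugating `h₂` back gives the resolvent `A = ∑ ζ^n a_n`, which commutes with
`L = D + Q_u + Λ` and satisfies `A² = 1`. The density `ρ_n` is the trace of the dressed operator against
`h₂`. Modulo total derivatives, the trace of a commutator vanishes, so the variation of `ρ_n` is the
pairing of `a_n` with the variation of `Q_u` (`IsEvol.rho_variation`), and the variational derivatives of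
`ρ_n` are the components of `a_n` (`varDer_rho`).

*Flows.* For an odd `h` the map `{h χ ·}|_{χ=0}` is an even derivation commuting with `D`, determined by
the variational derivatives of `h` (`chiBracket_zero_eq_evol`). It follows that `ρ_n` changes `L` by
`[a_n, e₂]` in the second structure (`dd₂_qv`) and, by the recursion that expresses `[A, L] = 0`, by
`[a_{n+1}, e₂]` up to an infinitesimal gauge transformation in the first one (`dd₁_qv`). On the canonical
form the gauge part is determined by the rest (`IsEvol.map_cv_eq`), whence the bi-Hamiltonian recursion
(`flow₁_wv`).

*Commutativity and integrals of motion.* The flow of `ρ_n` has a zero curvature representation: an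
operator `Δ_n`, equal to the derivation minus the tail of `ζ^{-n} A` up to a gauge term, commutes with `L`
(`Del_mul_Lax`), and therefore with `A`. As `ζ^n Δ_n + A` is a polynomial of degree `n` in `ζ`, the
commutator `[Δ_m, Δ_n]` does not involve `ζ` (`coeff_Del_commutator`); being an operator that commutes
with `L`, it exhibits the commutator of two flows as an infinitesimal gauge transformation, which vanishes
on `W` (`dd₁_comm`). Conjugating `Δ_n` to the dressed side and taking the trace shows that `ρ_k` changes by a
total derivative along the flow of `ρ_n` (`dd₁_rho`). A retraction onto the algebra generated by the `w_t`
turns total derivatives in `P(ḡ)` into total derivatives in `W` (`phi_psi`, `mem_DW_of_eq_D`).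

*Quadratic parts and independence.* The recursion and `A² = 1` determine the constant and linear parts of
the resolvent (`gr_zero_av`, `gr_one_av`). The variation of `ρ_n` under the Euler derivation then gives its
quadratic part (`gr_two_rho`), and independence of the functionals is read off from their variational
derivatives (`linearIndependent_functional_rho`).
-/

noncomputable section

namespace SuperDS

/-! ### Superderivations of free supercommutative superalgebras -/

theorem sgn_zero : sgn 0 = 1 := by simp [sgn]

theorem sgn_one : sgn 1 = -1 := by simp [sgn]

theorem zmod2_cases (p : ZMod 2) : p = 0 ∨ p = 1 := by
  revert p
  decide

section General

variable {ι : Type} {par : ι → ZMod 2}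

/-- The ring structure on super differential polynomials, arranged so that its semiring reduct is,
at reducible transparency, the one that carries the `ℂ`-algebra structure. -/
scoped instance instRingSDiffPoly : Ring (SDiffPoly par) :=
  { RingQuot.instSemiring (SuperRel par) with
    neg := fun a => -a
    sub := fun a b => a - b
    neg_add_cancel := neg_add_cancel
    sub_eq_add_neg := sub_eq_add_neg
    zsmul := fun n a => n • a
    zsmul_zero' := SubNegMonoid.zsmul_zero'
    zsmul_succ' := SubNegMonoid.zsmul_succ'
    zsmul_neg' := SubNegMonoid.zsmul_neg'
    intCast := fun n => (n : SDiffPoly par)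
    intCast_ofNat := Int.cast_natCast
    intCast_negSucc := Int.cast_negSucc }

theorem sigma_letter (x : ι × ℕ) :
    sigma (letter par x) = sgn (letterPar par x) • letter par x := by
  simp [sigma, liftHom_letter]

theorem sigma_sigma (a : SDiffPoly par) : sigma (sigma a) = a := by
  induction a using induct with
  | h0 r => simp
  | h1 x => rw [sigma_letter, map_smul, sigma_letter, smul_smul, sgn_mul_self, one_smul]
  | hm a b ha hb => simp [ha, hb]
  | ha a b ha hb => simp [ha, hb]

theorem sigmaPow_zero (a : SDiffPoly par) : sigmaPow 0 a = a := by simp [sigmaPow]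

theorem sigmaPow_one (a : SDiffPoly par) : sigmaPow 1 a = sigma a := by simp [sigmaPow]

theorem sigmaPow_sigmaPow (p q : ZMod 2) (a : SDiffPoly par) :
    sigmaPow p (sigmaPow q a) = sigmaPow (p + q) a := by
  have h2 : (1 : ZMod 2) + 1 = 0 := by decide
  rcases zmod2_cases p with rfl | rfl <;> rcases zmod2_cases q with rfl | rfl <;>
    simp [sigmaPow_zero, sigmaPow_one, sigma_sigma, h2]

theorem IsHomog.zero (p : ZMod 2) : IsHomog p (0 : SDiffPoly par) := by simp [IsHomog]

theorem IsHomog.add {p : ZMod 2} {a b : SDiffPoly par} (ha : IsHomog p a) (hb : IsHomog p b) :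
    IsHomog p (a + b) := by
  rw [IsHomog, map_add, ha, hb, smul_add]

theorem IsHomog.smul {p : ZMod 2} {a : SDiffPoly par} (c : ℂ) (ha : IsHomog p a) :
    IsHomog p (c • a) := by
  rw [IsHomog, map_smul, ha, smul_comm]

theorem IsHomog.neg {p : ZMod 2} {a : SDiffPoly par} (ha : IsHomog p a) : IsHomog p (-a) := by
  rw [IsHomog, map_neg, ha, smul_neg]

theorem IsHomog.sub {p : ZMod 2} {a b : SDiffPoly par} (ha : IsHomog p a) (hb : IsHomog p b) :
    IsHomog p (a - b) := by
  rw [sub_eq_add_neg]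
  exact ha.add hb.neg

theorem IsHomog.mul {p q : ZMod 2} {a b : SDiffPoly par} (ha : IsHomog p a) (hb : IsHomog q b) :
    IsHomog (p + q) (a * b) := by
  rw [IsHomog, map_mul, ha, hb, smul_mul_smul_comm, sgn_add]

theorem IsHomog.sum {p : ZMod 2} {κ : Type*} (s : Finset κ) (f : κ → SDiffPoly par)
    (h : ∀ i ∈ s, IsHomog p (f i)) : IsHomog p (∑ i ∈ s, f i) := by
  rw [IsHomog, map_sum, Finset.smul_sum]
  exact Finset.sum_congr rfl h

theorem isHomog_algebraMap (c : ℂ) : IsHomog 0 (algebraMap ℂ (SDiffPoly par) c) := by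
  simp [IsHomog, sgn_zero]

theorem isHomog_one : IsHomog 0 (1 : SDiffPoly par) := by
  simp [IsHomog, sgn_zero]

theorem IsHomog.sigmaPow {p : ZMod 2} {a : SDiffPoly par} (q : ZMod 2) (ha : IsHomog p a) :
    IsHomog p (SuperDS.sigmaPow q a) := by
  rw [sigmaPow_of_isHomog ha]
  exact ha.smul _

theorem isHomog_parityPart (p : ZMod 2) (a : SDiffPoly par) : IsHomog p (parityPart p a) := by
  rw [IsHomog, parityPart, map_smul, map_add, map_smul, sigma_sigma, smul_comm, smul_add (sgn p),
    smul_smul (sgn p), sgn_mul_self, one_smul, add_comm]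

theorem parityPart_add (a : SDiffPoly par) : parityPart 0 a + parityPart 1 a = a := by
  simp only [parityPart, sgn_zero, sgn_one]
  module

theorem parityPart_self {p : ZMod 2} {a : SDiffPoly par} (h : IsHomog p a) :
    parityPart p a = a := by
  rw [parityPart, h, smul_smul, sgn_mul_self]
  module

theorem parityPart_ne {p q : ZMod 2} {a : SDiffPoly par} (h : IsHomog p a) (hpq : q ≠ p) :
    parityPart q a = 0 := by
  have e : sgn q * sgn p = -1 := by
    rcases zmod2_cases p with rfl | rfl <;> rcases zmod2_cases q with rfl | rfl <;>
      simp_all [sgn]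
  rw [parityPart, h, smul_smul, e]
  module

theorem homog_mul_eq {p : ZMod 2} {a : SDiffPoly par} (ha : IsHomog p a) (b : SDiffPoly par) :
    a * b = sigmaPow p b * a := by
  induction b using induct with
  | h0 r => rw [AlgHom.commutes]; exact (Algebra.commutes _ _).symm
  | h1 x =>
    rw [mul_letter, sigmaPow_of_isHomog ha, sigmaPow_of_isHomog (isHomog_letter x),
      mul_smul_comm, smul_mul_assoc, mul_comm p]
  | hm b c hb hc => rw [← mul_assoc, hb, mul_assoc, hc, map_mul, mul_assoc]
  | ha b c hb hc => rw [mul_add, hb, hc, map_add, add_mul]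

theorem homog_comm {p q : ZMod 2} {a b : SDiffPoly par} (ha : IsHomog p a) (hb : IsHomog q b) :
    a * b = sgn (p * q) • (b * a) := by
  rw [homog_mul_eq ha, sigmaPow_of_isHomog hb, smul_mul_assoc]

/-- `d` is a (left) superderivation of parity `p`. -/
structure IsSuperDer (p : ZMod 2) (d : SDiffPoly par →ₗ[ℂ] SDiffPoly par) : Prop where
  leib : ∀ a b, d (a * b) = d a * b + sigmaPow p a * d b
  par : ∀ a, sigma (d a) = sgn p • d (sigma a)

theorem superDerHom_apply (p : ZMod 2) (v : ι × ℕ → SDiffPoly par)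
    (hv : ∀ x, IsHomog (p + letterPar par x) (v x)) (a : SDiffPoly par) :
    superDerHom p v hv a 0 0 = sigmaPow p a ∧ superDerHom p v hv a 1 0 = 0 ∧
      superDerHom p v hv a 1 1 = a := by
  induction a using induct with
  | h0 r => simp [Matrix.algebraMap_matrix_apply]
  | h1 x =>
    simp [superDerHom, liftHom_letter, sigmaPow_of_isHomog (isHomog_letter x)]
  | hm a b ha hb =>
    simp [Matrix.mul_apply, Fin.sum_univ_two, ha, hb]
  | ha a b ha hb => simp [ha, hb]

theorem superDer_letter (p : ZMod 2) (v : ι × ℕ → SDiffPoly par)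
    (hv : ∀ x, IsHomog (p + letterPar par x) (v x)) (x : ι × ℕ) :
    superDer p v hv (letter par x) = v x := by
  simp [superDer, superDerHom, liftHom_letter]

theorem superDer_mul (p : ZMod 2) (v : ι × ℕ → SDiffPoly par)
    (hv : ∀ x, IsHomog (p + letterPar par x) (v x)) (a b : SDiffPoly par) :
    superDer p v hv (a * b) = superDer p v hv a * b + sigmaPow p a * superDer p v hv b := by
  obtain ⟨h1, -, -⟩ := superDerHom_apply p v hv a
  obtain ⟨-, -, h2⟩ := superDerHom_apply p v hv b
  simp [superDer, Matrix.mul_apply, Fin.sum_univ_two, h1, h2, add_comm]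

theorem superDer_algebraMap (p : ZMod 2) (v : ι × ℕ → SDiffPoly par)
    (hv : ∀ x, IsHomog (p + letterPar par x) (v x)) (c : ℂ) :
    superDer p v hv (algebraMap ℂ _ c) = 0 := by
  simp [superDer, Matrix.algebraMap_matrix_apply]

theorem isSuperDer_superDer (p : ZMod 2) (v : ι × ℕ → SDiffPoly par)
    (hv : ∀ x, IsHomog (p + letterPar par x) (v x)) : IsSuperDer p (superDer p v hv) where
  leib := superDer_mul p v hv
  par a := by
    induction a using induct with
    | h0 r => simp [superDer_algebraMap]
    | h1 x =>
      rw [superDer_letter, hv x, sigma_letter, map_smul, superDer_letter, smul_smul, sgn_add]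
    | hm a b ha hb =>
      have e : sigma (sigmaPow p a) = sigmaPow p (sigma a) := by
        rw [← sigmaPow_one, ← sigmaPow_one, sigmaPow_sigmaPow, sigmaPow_sigmaPow, add_comm]
      rw [superDer_mul, map_add, map_mul, map_mul, map_mul, superDer_mul, ha, hb, e, smul_add,
        smul_mul_assoc, mul_smul_comm]
    | ha a b ha hb => simp [ha, hb]

namespace IsSuperDer

variable {p q : ZMod 2} {d e : SDiffPoly par →ₗ[ℂ] SDiffPoly par}

theorem map_one (hd : IsSuperDer p d) : d 1 = 0 := by
  have h := hd.leib 1 1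
  rwa [mul_one, mul_one, _root_.map_one (sigmaPow p), one_mul, left_eq_add] at h

theorem map_algebraMap (hd : IsSuperDer p d) (c : ℂ) : d (algebraMap ℂ _ c) = 0 := by
  rw [Algebra.algebraMap_eq_smul_one, map_smul, hd.map_one, smul_zero]

theorem isHomog (hd : IsSuperDer p d) {a : SDiffPoly par} (ha : IsHomog q a) :
    IsHomog (p + q) (d a) := by
  rw [IsHomog, hd.par, ha, map_smul, smul_smul, sgn_add]

theorem sigmaPow_apply (hd : IsSuperDer p d) (q : ZMod 2) (a : SDiffPoly par) :
    sigmaPow q (d a) = sgn (q * p) • d (sigmaPow q a) := by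
  rcases zmod2_cases q with rfl | rfl
  · simp [sigmaPow_zero, sgn_zero]
  · simp [sigmaPow_one, hd.par]

/-- Two superderivations with the same values on letters are equal. -/
theorem ext (hd : IsSuperDer p d) (he : IsSuperDer p e)
    (h : ∀ x, d (letter par x) = e (letter par x)) (a : SDiffPoly par) : d a = e a := by
  induction a using induct with
  | h0 r => rw [hd.map_algebraMap, he.map_algebraMap]
  | h1 x => exact h x
  | hm a b ha hb => rw [hd.leib, he.leib, ha, hb]
  | ha a b ha hb => rw [map_add, map_add, ha, hb]

theorem smul (hd : IsSuperDer p d) (c : ℂ) : IsSuperDer p (c • d) where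
  leib a b := by simp [hd.leib, smul_add]
  par a := by simp [hd.par, smul_comm c]

/-- The supercommutator of two superderivations is a superderivation. -/
theorem superCommutator (hd : IsSuperDer p d) (he : IsSuperDer q e) :
    IsSuperDer (p + q) (d ∘ₗ e - sgn (p * q) • (e ∘ₗ d)) where
  leib a b := by
    have e1 : sgn (p * q) * sgn (q * p) = 1 := by rw [mul_comm q p, sgn_mul_self]
    rw [mul_comm q p] at e1
    simp only [LinearMap.sub_apply, LinearMap.comp_apply, LinearMap.smul_apply, hd.leib, he.leib,
      map_add, hd.sigmaPow_apply, he.sigmaPow_apply, sigmaPow_sigmaPow, smul_add, sub_mul, mul_sub,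
      smul_mul_assoc, mul_smul_comm, smul_smul, mul_comm q p, add_comm q p, e1, one_smul]
    abel
  par a := by
    simp only [LinearMap.sub_apply, LinearMap.comp_apply, LinearMap.smul_apply, map_sub, map_smul,
      hd.par, he.par, smul_sub, smul_smul, sgn_add]
    congr 2
    ring

end IsSuperDer

theorem isSuperDer_zero (p : ZMod 2) :
    IsSuperDer p (0 : SDiffPoly par →ₗ[ℂ] SDiffPoly par) where
  leib a b := by simp
  par a := by simp

theorem isSuperDer_D : IsSuperDer 1 (D (par := par)) := isSuperDer_superDer _ _ _

theorem D_letter (x : ι × ℕ) : D (letter par x) = letter par (x.1, x.2 + 1) :=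
  superDer_letter _ _ _ _

theorem iterate_D_letter (i : ι) (m n : ℕ) : D^[n] (letter par (i, m)) = letter par (i, m + n) := by
  induction n with
  | zero => rfl
  | succ n ih => rw [Function.iterate_succ_apply', ih, D_letter]; rfl

theorem iterate_D_eq_pow (n : ℕ) (a : SDiffPoly par) : D^[n] a = (D ^ n) a := by
  rw [Module.End.pow_apply]

theorem IsHomog.D {p : ZMod 2} {a : SDiffPoly par} (ha : IsHomog p a) :
    IsHomog (p + 1) (SuperDS.D a) := by
  rw [add_comm]
  exact isSuperDer_D.isHomog ha

theorem IsHomog.iterate_D {p : ZMod 2} {a : SDiffPoly par} (n : ℕ) (ha : IsHomog p a) :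
    IsHomog (p + n) (SuperDS.D^[n] a) := by
  induction n with
  | zero => simpa using ha
  | succ n ih =>
    rw [Function.iterate_succ_apply']
    convert ih.D using 1
    push_cast
    ring

/-- A superderivation of even parity which commutes with `D`. -/
structure IsEvol (d : SDiffPoly par →ₗ[ℂ] SDiffPoly par) : Prop extends IsSuperDer 0 d where
  comm : ∀ a, d (D a) = D (d a)

namespace IsEvol

variable {d e : SDiffPoly par →ₗ[ℂ] SDiffPoly par}

theorem leibniz (hd : IsEvol d) (a b : SDiffPoly par) : d (a * b) = d a * b + a * d b := by
  rw [hd.leib, sigmaPow_zero]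

theorem homog (hd : IsEvol d) {p : ZMod 2} {a : SDiffPoly par} (ha : IsHomog p a) :
    IsHomog p (d a) := by
  simpa using hd.isHomog ha

theorem iterate_D (hd : IsEvol d) (n : ℕ) (a : SDiffPoly par) : d (D^[n] a) = D^[n] (d a) := by
  induction n generalizing a with
  | zero => rfl
  | succ n ih => rw [Function.iterate_succ_apply, ih, hd.comm]; rfl

theorem commutator (hd : IsEvol d) (he : IsEvol e) : IsEvol (d ∘ₗ e - e ∘ₗ d) where
  toIsSuperDer := by
    have h := hd.toIsSuperDer.superCommutator he.toIsSuperDer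
    simpa [sgn_zero] using h
  comm a := by simp [hd.comm, he.comm]

end IsEvol

/-- The even superderivation commuting with `D` that sends `u_i` to `v i`. -/
def evol (v : ι → SDiffPoly par) (hv : ∀ i, IsHomog (par i) (v i)) :
    SDiffPoly par →ₗ[ℂ] SDiffPoly par :=
  superDer 0 (fun x => D^[x.2] (v x.1)) (by
    intro x
    rw [zero_add]
    exact (hv x.1).iterate_D x.2)

theorem evol_letter (v : ι → SDiffPoly par) (hv : ∀ i, IsHomog (par i) (v i)) (x : ι × ℕ) :
    evol v hv (letter par x) = D^[x.2] (v x.1) := superDer_letter _ _ _ _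

theorem isEvol_evol (v : ι → SDiffPoly par) (hv : ∀ i, IsHomog (par i) (v i)) :
    IsEvol (evol v hv) where
  toIsSuperDer := isSuperDer_superDer _ _ _
  comm a := by
    have h := (isSuperDer_superDer 0 (fun x => D^[x.2] (v x.1)) (by
      intro x
      rw [zero_add]
      exact (hv x.1).iterate_D x.2)).superCommutator (isSuperDer_D (par := par))
    have h2 := h.ext (isSuperDer_zero _) (by
      intro x
      have e1 := evol_letter v hv
      simp only [evol] at e1
      simp only [LinearMap.sub_apply, LinearMap.comp_apply, zero_mul,
        sgn_zero, one_smul, D_letter, e1, Function.iterate_succ_apply', sub_self,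
        LinearMap.zero_apply]) a
    simpa [sgn_zero, sub_eq_zero, evol] using h2

/-! ### Partial derivatives and variational derivatives -/

section Pd

variable [DecidableEq ι]

theorem isSuperDer_pd (y : ι × ℕ) : IsSuperDer (letterPar par y) (pd (par := par) y) :=
  isSuperDer_superDer _ _ _

theorem pd_letter (y x : ι × ℕ) : pd y (letter par x) = if x = y then 1 else 0 :=
  superDer_letter _ _ _ _

/-- The commutation relation `[∂/∂u_i^{(m+1)}, D] = ∂/∂u_i^{(m)}`, up to signs. -/
theorem pd_D_succ (i : ι) (m : ℕ) (a : SDiffPoly par) : pd (i, m + 1) (D a) =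
    pd (i, m) a - sgn (par i + m) • D (pd (i, m + 1) a) := by
  have h := (isSuperDer_pd (par := par) (i, m + 1)).superCommutator isSuperDer_D
  have e : letterPar par (i, m + 1) + 1 = letterPar par (i, m) := by
    have h2 : (1 : ZMod 2) + 1 = 0 := by decide
    simp only [letterPar]
    push_cast
    rw [add_assoc, add_assoc, h2, add_zero]
  have e2 : sgn (letterPar par (i, m + 1)) = -sgn (par i + m) := by
    simp only [letterPar]
    push_cast
    rw [← add_assoc, sgn_add, sgn_one, mul_neg_one]
  rw [e] at h
  have h2 := h.ext (isSuperDer_pd _) (by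
    intro x
    rw [LinearMap.sub_apply, LinearMap.comp_apply, LinearMap.smul_apply, LinearMap.comp_apply,
      D_letter, pd_letter, pd_letter, pd_letter]
    have e3 : D (if x = (i, m + 1) then 1 else 0 : SDiffPoly par) = 0 := by
      split_ifs
      · exact isSuperDer_D.map_one
      · exact map_zero _
    rw [e3, smul_zero, sub_zero]
    obtain ⟨j, n⟩ := x
    simp) a
  rw [LinearMap.sub_apply, LinearMap.comp_apply, LinearMap.smul_apply, LinearMap.comp_apply,
    mul_one, e2, neg_smul, sub_neg_eq_add] at h2
  rw [← h2, add_sub_cancel_right]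

theorem pd_D_zero (i : ι) (a : SDiffPoly par) : pd (i, 0) (D a) =
    sgn (par i) • D (pd (i, 0) a) := by
  have h := (isSuperDer_pd (par := par) (i, 0)).superCommutator isSuperDer_D
  have h2 := h.ext (isSuperDer_zero _) (by
    intro x
    rw [LinearMap.sub_apply, LinearMap.comp_apply, LinearMap.smul_apply, LinearMap.comp_apply,
      D_letter, pd_letter, pd_letter]
    have e3 : D (if x = (i, 0) then 1 else 0 : SDiffPoly par) = 0 := by
      split_ifs
      · exact isSuperDer_D.map_one
      · exact map_zero _
    rw [e3, smul_zero, sub_zero]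
    obtain ⟨j, n⟩ := x
    simp) a
  rw [LinearMap.sub_apply, LinearMap.comp_apply, LinearMap.smul_apply, LinearMap.comp_apply,
    mul_one, LinearMap.zero_apply, sub_eq_zero] at h2
  simpa [letterPar] using h2

theorem finite_support_pd (a : SDiffPoly par) : {y | pd y a ≠ 0}.Finite := by
  induction a using induct with
  | h0 r =>
    convert Set.finite_empty
    ext y
    simp [(isSuperDer_pd y).map_algebraMap]
  | h1 x =>
    refine (Set.finite_singleton x).subset ?_
    intro y hy
    by_contra h
    apply hy
    rw [pd_letter, if_neg]
    rintro rfl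
    exact h rfl
  | hm a b ha hb =>
    refine (ha.union hb).subset ?_
    intro y hy
    by_contra h
    simp only [Set.mem_union, Set.mem_ofPred_eq, not_or, not_not] at h
    apply hy
    rw [(isSuperDer_pd y).leib, h.1, h.2]
    simp
  | ha a b ha hb =>
    refine (ha.union hb).subset ?_
    intro y hy
    by_contra h
    simp only [Set.mem_union, Set.mem_ofPred_eq, not_or, not_not] at h
    apply hy
    rw [map_add, h.1, h.2, add_zero]

/-- A superderivation is determined by its values on letters through the partial derivatives. -/
theorem IsSuperDer.eq_sum_pd {p : ZMod 2} {d : SDiffPoly par →ₗ[ℂ] SDiffPoly par}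
    (hd : IsSuperDer p d) (a : SDiffPoly par) :
    ∀ s : Finset (ι × ℕ), {y | pd y a ≠ 0} ⊆ s → d a = ∑ y ∈ s, d (letter par y) * pd y a := by
  have key : ∃ s₀ : Finset (ι × ℕ), ∀ s, s₀ ⊆ s → d a = ∑ y ∈ s, d (letter par y) * pd y a := by
    induction a using induct with
    | h0 r =>
      refine ⟨∅, fun s _ => ?_⟩
      rw [hd.map_algebraMap]
      simp [(isSuperDer_pd _).map_algebraMap]
    | h1 x =>
      refine ⟨{x}, fun s hs => ?_⟩
      simp only [pd_letter, mul_ite, mul_one, mul_zero]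
      rw [Finset.sum_ite_eq, if_pos (hs (Finset.mem_singleton_self x))]
    | hm a b ha hb =>
      obtain ⟨s₁, h₁⟩ := ha
      obtain ⟨s₂, h₂⟩ := hb
      refine ⟨s₁ ∪ s₂, fun s hs => ?_⟩
      rw [hd.leib, h₁ s (Finset.union_subset_left hs), h₂ s (Finset.union_subset_right hs),
        Finset.sum_mul, Finset.mul_sum, ← Finset.sum_add_distrib]
      refine Finset.sum_congr rfl fun y _ => ?_
      have hy : IsHomog (p + letterPar par y) (d (letter par y)) := hd.isHomog (isHomog_letter y)
      rw [(isSuperDer_pd y).leib, mul_add, mul_assoc, ← mul_assoc (d (letter par y)) (sigmaPow _ a),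
        homog_mul_eq hy (sigmaPow _ a), sigmaPow_sigmaPow, mul_assoc, add_assoc,
        CharTwo.add_self_eq_zero, add_zero]
    | ha a b ha hb =>
      obtain ⟨s₁, h₁⟩ := ha
      obtain ⟨s₂, h₂⟩ := hb
      refine ⟨s₁ ∪ s₂, fun s hs => ?_⟩
      rw [map_add, h₁ s (Finset.union_subset_left hs), h₂ s (Finset.union_subset_right hs),
        ← Finset.sum_add_distrib]
      exact Finset.sum_congr rfl fun y _ => by rw [map_add, mul_add]
  intro s hs
  obtain ⟨s₀, h₀⟩ := key
  rw [h₀ (s ∪ s₀) Finset.subset_union_right]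
  refine (Finset.sum_subset Finset.subset_union_left fun y _ hy => ?_).symm
  have : pd y a = 0 := by
    by_contra h
    exact hy (hs h)
  rw [this, mul_zero]

/-- An element depends on finitely many letters, so the orders of the derivatives that occur in it
are bounded. -/
theorem exists_order (a : SDiffPoly par) : ∃ M : ℕ, ∀ i m, M ≤ m → pd (i, m) a = 0 := by
  obtain ⟨M, hM⟩ := ((finite_support_pd a).image Prod.snd).bddAbove
  refine ⟨M + 1, fun i m hm => ?_⟩
  by_contra h
  have := hM ⟨(i, m), h, rfl⟩
  simp only at this
  omega

/-- The sign with which `D^m ∂/∂u_i^{(m)}` enters the variational derivative. -/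
def varSgn (p : ZMod 2) (m : ℕ) : ℂ := sgn (m * (p + 1) + (m.choose 2 : ℕ))

theorem varSgn_succ (p : ZMod 2) (m : ℕ) : varSgn p (m + 1) = -(sgn (p + m) * varSgn p m) := by
  have : sgn (p + m) * varSgn p m = -varSgn p (m + 1) := by
    rw [varSgn, varSgn, ← sgn_add, ← neg_one_mul, ← sgn_one, ← sgn_add, Nat.choose_succ_succ' m 1,
      Nat.choose_one_right]
    push_cast
    congr 1
    generalize (m : ZMod 2) = x, ((m.choose 2 : ℕ) : ZMod 2) = y
    revert p x y
    decide
  rw [this, neg_neg]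

/-- The variational derivative `δa/δu_i`. -/
def varDer (i : ι) (a : SDiffPoly par) : SDiffPoly par :=
  ∑ᶠ m : ℕ, varSgn (par i) m • D^[m] (pd (i, m) a)

theorem varDer_eq_sum (i : ι) (a : SDiffPoly par) (M : ℕ) (hM : ∀ m, M ≤ m → pd (i, m) a = 0) :
    varDer i a = ∑ m ∈ Finset.range M, varSgn (par i) m • D^[m] (pd (i, m) a) := by
  apply finsum_eq_sum_of_support_subset
  intro m hm
  by_contra h
  apply hm
  have h' : M ≤ m := by simpa using h
  simp only [hM m h', iterate_map_zero, smul_zero]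

theorem varDer_add (i : ι) (a b : SDiffPoly par) : varDer i (a + b) = varDer i a + varDer i b := by
  obtain ⟨M, hM⟩ := exists_order a
  obtain ⟨N, hN⟩ := exists_order b
  rw [varDer_eq_sum i a (max M N) fun m hm => hM i m (le_trans (le_max_left _ _) hm),
    varDer_eq_sum i b (max M N) fun m hm => hN i m (le_trans (le_max_right _ _) hm),
    varDer_eq_sum i (a + b) (max M N) fun m hm => by
      rw [map_add, hM i m (le_trans (le_max_left _ _) hm), hN i m (le_trans (le_max_right _ _) hm),
        add_zero], ← Finset.sum_add_distrib]
  refine Finset.sum_congr rfl fun m _ => ?_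
  rw [map_add, iterate_D_eq_pow, iterate_D_eq_pow, iterate_D_eq_pow, map_add, smul_add]

theorem varDer_smul (i : ι) (c : ℂ) (a : SDiffPoly par) : varDer i (c • a) = c • varDer i a := by
  obtain ⟨M, hM⟩ := exists_order a
  rw [varDer_eq_sum i a M fun m hm => hM i m hm, varDer_eq_sum i (c • a) M fun m hm => by
      rw [map_smul, hM i m hm, smul_zero], Finset.smul_sum]
  refine Finset.sum_congr rfl fun m _ => ?_
  rw [map_smul, iterate_D_eq_pow, iterate_D_eq_pow, map_smul, smul_comm]

variable (par) in
/-- The variational derivative as a linear map. -/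
def varDerLin (i : ι) : SDiffPoly par →ₗ[ℂ] SDiffPoly par where
  toFun := varDer i
  map_add' := varDer_add i
  map_smul' := varDer_smul i

theorem isHomog_varDer {p : ZMod 2} (i : ι) {a : SDiffPoly par} (ha : IsHomog p a) :
    IsHomog (p + par i) (varDer i a) := by
  obtain ⟨M, hM⟩ := exists_order a
  rw [varDer_eq_sum i a M fun m hm => hM i m hm]
  refine IsHomog.sum _ _ fun m _ => IsHomog.smul _ ?_
  have h := ((isSuperDer_pd (i, m)).isHomog ha).iterate_D m
  convert h using 1
  simp only [letterPar]
  rw [add_right_comm, add_assoc (par i), CharTwo.add_self_eq_zero, add_zero, add_comm]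

/-- The variational derivatives annihilate total derivatives. -/
theorem varDer_D (i : ι) (a : SDiffPoly par) : varDer i (D a) = 0 := by
  obtain ⟨M, hM⟩ := exists_order a
  have hM2 : ∀ m, M + 1 ≤ m → pd (i, m) (D a) = 0 := by
    intro m hm
    obtain ⟨m, rfl⟩ : ∃ k, m = k + 1 := ⟨m - 1, by omega⟩
    rw [pd_D_succ, hM i m (by omega), hM i (m + 1) (by omega), map_zero, smul_zero, sub_zero]
  rw [varDer_eq_sum i (D a) (M + 1) hM2, Finset.sum_range_succ']
  -- By the commutation relation of `D` with the partial derivatives the sum telescopes.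
  have e : ∀ m, varSgn (par i) (m + 1) • D^[m + 1] (pd (i, m + 1) (D a)) =
      varSgn (par i) (m + 1) • D^[m + 1] (pd (i, m) a) -
        varSgn (par i) (m + 2) • D^[m + 2] (pd (i, m + 1) a) := by
    intro m
    have e2 : sgn (par i + (m + 1 : ℕ)) = -sgn (par i + m) := by
      push_cast
      rw [← add_assoc, sgn_add, sgn_one, mul_neg_one]
    rw [pd_D_succ, iterate_D_eq_pow, map_sub, map_smul, smul_sub, smul_smul,
      varSgn_succ (par i) (m + 1), iterate_D_eq_pow, iterate_D_eq_pow, e2, pow_succ D (m + 1),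
      Module.End.mul_apply]
    module
  rw [Finset.sum_congr rfl fun m _ => e m,
    Finset.sum_range_sub' fun m => varSgn (par i) (m + 1) • D^[m + 1] (pd (i, m) a),
    hM i M le_rfl, pd_D_zero, varSgn_succ]
  simp only [iterate_map_zero, smul_zero, sub_zero, zero_add, Function.iterate_one,
    Function.iterate_zero, id, Nat.cast_zero, add_zero, smul_smul]
  module

end Pd

end General

/-! ### The `χ`-bracket at `χ = 0` and the bracket with a generator -/

section Bracket

variable {ι : Type} {par : ι → ZMod 2}

theorem sum_zmod2 {M : Type*} [AddCommMonoid M] (f : ZMod 2 → M) : ∑ p, f p = f 0 + f 1 := by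
  have h : (Finset.univ : Finset (ZMod 2)) = {0, 1} := by decide
  rw [h, Finset.sum_pair (by decide)]

theorem iterate_chiAddD_zero (n : ℕ) (x : ℕ → SDiffPoly par) :
    chiAddD^[n] x 0 = D^[n] (x 0) := by
  induction n generalizing x with
  | zero => rfl
  | succ n ih => rw [Function.iterate_succ_apply, ih, Function.iterate_succ_apply]; rfl

theorem chiMul_zero (c : SDiffPoly par) (x : ℕ → SDiffPoly par) : chiMul c x 0 = c * x 0 := by
  simp [chiMul, sigmaPow_zero]

theorem genArrow_zero (g₀ : ι → ι → SDiffPoly par) (g₁ : ι → ι → ℂ) (i j : ι)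
    (x : ℕ → SDiffPoly par) : genArrow g₀ g₁ i j x 0 =
      g₀ i j * x 0 + (sgn (par i + par j) * g₁ i j) • D (x 0) := by
  rw [genArrow, chiMul_zero]
  rfl

theorem chiAddD_zero_seq : chiAddD (0 : ℕ → SDiffPoly par) = 0 := by
  funext k
  cases k <;> simp [chiAddD]

theorem iterate_chiAddD_zero_seq (n : ℕ) : chiAddD^[n] (0 : ℕ → SDiffPoly par) = 0 := by
  induction n with
  | zero => rfl
  | succ n ih => rw [Function.iterate_succ_apply, chiAddD_zero_seq, ih]

theorem genArrow_zero_seq (g₀ : ι → ι → SDiffPoly par) (g₁ : ι → ι → ℂ) (i j : ι) :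
    genArrow g₀ g₁ i j (0 : ℕ → SDiffPoly par) = 0 := by
  funext k
  simp [genArrow, chiMul, chiAddD_zero_seq]

theorem chiConst_zero : chiConst (0 : SDiffPoly par) = 0 := by
  funext k
  simp [chiConst]

/-- `x ∈ P[χ]` is homogeneous of parity `p`, where `χ` is odd. -/
def IsChiHomog (p : ZMod 2) (x : ℕ → SDiffPoly par) : Prop := ∀ k : ℕ, IsHomog (p + k) (x k)

theorem IsChiHomog.chiAddD {p : ZMod 2} {x : ℕ → SDiffPoly par} (hx : IsChiHomog p x) :
    IsChiHomog (p + 1) (SuperDS.chiAddD x) := by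
  intro k
  cases k with
  | zero => simpa [SuperDS.chiAddD] using (hx 0).D
  | succ k =>
    refine IsHomog.add (IsHomog.smul _ ?_) (IsHomog.smul _ ?_)
    · convert (hx (k + 1)).D using 1
      ring
    · convert hx k using 1
      push_cast
      generalize (k : ZMod 2) = k
      clear hx
      revert p k
      decide

theorem IsChiHomog.iterate {p : ZMod 2} {x : ℕ → SDiffPoly par} (hx : IsChiHomog p x) (n : ℕ) :
    IsChiHomog (p + n) (SuperDS.chiAddD^[n] x) := by
  induction n with
  | zero => simpa using hx
  | succ n ih =>
    rw [Function.iterate_succ_apply']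
    convert ih.chiAddD using 1
    push_cast
    ring

/-- `{u_i χ u_j} = g₀ i j + χ g₁ i j` as an element of `P[χ]`. -/
def genSeq (g₀ : ι → ι → SDiffPoly par) (g₁ : ι → ι → ℂ) (i j : ι) : ℕ → SDiffPoly par
  | 0 => g₀ i j
  | 1 => algebraMap ℂ _ (g₁ i j)
  | _ => 0

theorem genArrow_chiConst_one {g₀ : ι → ι → SDiffPoly par} {g₁ : ι → ι → ℂ}
    (h₁ : ∀ i j, g₁ i j ≠ 0 → par i = par j) (i j : ι) :
    genArrow g₀ g₁ i j (chiConst 1) = genSeq g₀ g₁ i j := by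
  funext k
  have h : sgn (par i + par j) * g₁ i j = g₁ i j := by
    by_cases hg : g₁ i j = 0
    · simp [hg]
    · rw [h₁ i j hg, CharTwo.add_self_eq_zero, sgn_zero, one_mul]
  rw [genArrow, h]
  match k with
  | 0 => simp [chiMul, chiConst, chiAddD, genSeq, sigmaPow_zero, isSuperDer_D.map_one]
  | 1 => simp [chiMul, chiConst, chiAddD, genSeq, sgn_zero, Algebra.algebraMap_eq_smul_one]
  | k + 2 => simp [chiMul, chiConst, chiAddD, genSeq]

theorem isChiHomog_genSeq {g₀ : ι → ι → SDiffPoly par} {g₁ : ι → ι → ℂ}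
    (h₀ : ∀ i j, IsHomog (par i + par j + 1) (g₀ i j)) (h₁ : ∀ i j, g₁ i j ≠ 0 → par i = par j)
    (i j : ι) : IsChiHomog (par i + par j + 1) (genSeq g₀ g₁ i j) := by
  intro k
  match k with
  | 0 => simpa [genSeq] using h₀ i j
  | 1 =>
    by_cases hg : g₁ i j = 0
    · simpa [genSeq, hg] using IsHomog.zero _
    · rw [h₁ i j hg, CharTwo.add_self_eq_zero, genSeq]
      have h2 : (0 : ZMod 2) + 1 + (1 : ℕ) = 0 := by decide
      rw [h2]
      exact isHomog_algebraMap _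
  | k + 2 => exact IsHomog.zero _

theorem genDer_homog {g₀ : ι → ι → SDiffPoly par} {g₁ : ι → ι → ℂ}
    (h₀ : ∀ i j, IsHomog (par i + par j + 1) (g₀ i j)) (h₁ : ∀ i j, g₁ i j ≠ 0 → par i = par j)
    (i : ι) (k : ℕ) (y : ι × ℕ) : IsHomog (par i + 1 + k + letterPar par y)
      (sgn (y.2 * (par i + 1)) • (chiAddD^[y.2] (genSeq g₀ g₁ i y.1)) k) := by
  refine IsHomog.smul _ ?_
  convert (isChiHomog_genSeq h₀ h₁ i y.1).iterate y.2 k using 1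
  simp only [letterPar]
  ring

/-- The coefficient of `χ^k` in `{u_i χ ·}`, as a superderivation. -/
def genDer {g₀ : ι → ι → SDiffPoly par} {g₁ : ι → ι → ℂ}
    (h₀ : ∀ i j, IsHomog (par i + par j + 1) (g₀ i j)) (h₁ : ∀ i j, g₁ i j ≠ 0 → par i = par j)
    (i : ι) (k : ℕ) : SDiffPoly par →ₗ[ℂ] SDiffPoly par :=
  superDer (par i + 1 + k)
    (fun y => sgn (y.2 * (par i + 1)) • (chiAddD^[y.2] (genSeq g₀ g₁ i y.1)) k)
    (genDer_homog h₀ h₁ i k)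

theorem isSuperDer_genDer {g₀ : ι → ι → SDiffPoly par} {g₁ : ι → ι → ℂ}
    (h₀ : ∀ i j, IsHomog (par i + par j + 1) (g₀ i j)) (h₁ : ∀ i j, g₁ i j ≠ 0 → par i = par j)
    (i : ι) (k : ℕ) : IsSuperDer (par i + 1 + k) (genDer h₀ h₁ i k) :=
  isSuperDer_superDer _ _ _

theorem genDer_letter_zero {g₀ : ι → ι → SDiffPoly par} {g₁ : ι → ι → ℂ}
    (h₀ : ∀ i j, IsHomog (par i + par j + 1) (g₀ i j)) (h₁ : ∀ i j, g₁ i j ≠ 0 → par i = par j)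
    (i j : ι) (k : ℕ) : genDer h₀ h₁ i k (letter par (j, 0)) = genSeq g₀ g₁ i j k := by
  rw [genDer, superDer_letter]
  simp [sgn_zero]

/-- Sesquilinearity in the second argument. -/
theorem genDer_D {g₀ : ι → ι → SDiffPoly par} {g₁ : ι → ι → ℂ}
    (h₀ : ∀ i j, IsHomog (par i + par j + 1) (g₀ i j)) (h₁ : ∀ i j, g₁ i j ≠ 0 → par i = par j)
    (i : ι) (k : ℕ) (a : SDiffPoly par) : genDer h₀ h₁ i k (D a) =
      sgn (par i + 1) • chiAddD (fun k => genDer h₀ h₁ i k a) k := by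
  have hd := isSuperDer_genDer h₀ h₁ i
  have hl : ∀ k y, genDer h₀ h₁ i k (D (letter par y)) =
      sgn (par i + 1) • chiAddD (fun k => genDer h₀ h₁ i k (letter par y)) k := by
    intro k y
    simp only [genDer, D_letter, superDer_letter, Function.iterate_succ_apply']
    have e : sgn (((y.2 + 1 : ℕ) : ZMod 2) * (par i + 1)) =
        sgn (par i + 1) * sgn (y.2 * (par i + 1)) := by
      rw [← sgn_add]
      congr 1
      push_cast
      ring
    rw [e, mul_smul]
    cases k with
    | zero => simp [chiAddD]
    | succ k =>
      simp only [chiAddD, map_smul]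
      module
  cases k with
  | zero =>
    have h := ((hd 0).superCommutator isSuperDer_D).ext (isSuperDer_zero _) (by
      intro x
      have := hl 0 x
      simp only [chiAddD] at this
      simp only [LinearMap.sub_apply, LinearMap.comp_apply, LinearMap.smul_apply,
        LinearMap.zero_apply, this]
      simp) a
    simp only [LinearMap.sub_apply, LinearMap.comp_apply, LinearMap.smul_apply,
        LinearMap.zero_apply, sub_eq_zero] at h
    simp only [chiAddD]
    rw [h]
    simp
  | succ k =>
    have e1 : par i + 1 + ((k + 1 : ℕ) : ZMod 2) + 1 = par i + 1 + k := by
      push_cast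
      generalize (k : ZMod 2) = k, par i = p
      revert k p
      decide
    have e2 : sgn ((par i + 1 + ((k + 1 : ℕ) : ZMod 2)) * 1) =
        sgn (par i + 1) * sgn ((k + 1 : ℕ) : ZMod 2) := by
      rw [← sgn_add, mul_one]
    have h0 := (hd (k + 1)).superCommutator (isSuperDer_D (par := par))
    rw [e1] at h0
    have h := h0.ext ((hd k).smul (sgn (par i + 1) * sgn k)) (by
      intro x
      have := hl (k + 1) x
      simp only [chiAddD] at this
      simp only [LinearMap.sub_apply, LinearMap.comp_apply, LinearMap.smul_apply, this, e2]
      module) a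
    simp only [LinearMap.sub_apply, LinearMap.comp_apply, LinearMap.smul_apply, e2,
      sub_eq_iff_eq_add] at h
    simp only [chiAddD]
    rw [h]
    module

variable [DecidableEq ι]

theorem masterTerm_eq_zero_left (g₀ : ι → ι → SDiffPoly par) (g₁ : ι → ι → ℂ) (pa pb : ZMod 2)
    (a b : SDiffPoly par) (i : ι) (m : ℕ) (j : ι) (n k : ℕ) (h : pd (i, m) a = 0) :
    masterTerm g₀ g₁ pa pb a b i m j n k = 0 := by
  rw [masterTerm, h, chiConst_zero, iterate_chiAddD_zero_seq, genArrow_zero_seq,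
    iterate_chiAddD_zero_seq, chiMul, Pi.zero_apply, mul_zero, smul_zero]

theorem masterTerm_eq_zero_right (g₀ : ι → ι → SDiffPoly par) (g₁ : ι → ι → ℂ) (pa pb : ZMod 2)
    (a b : SDiffPoly par) (i : ι) (m : ℕ) (j : ι) (n k : ℕ) (h : pd (j, n) b = 0) :
    masterTerm g₀ g₁ pa pb a b i m j n k = 0 := by
  rw [masterTerm, h, chiMul, map_zero, zero_mul, smul_zero]

/-- The sum over letters in the super master formula, restricted to finite sets of letters that
contain those on which `a` and `b` depend. -/
theorem finsum_masterTerm (g₀ : ι → ι → SDiffPoly par) (g₁ : ι → ι → ℂ) (pa pb : ZMod 2)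
    (a b : SDiffPoly par) (k : ℕ) (s t : Finset (ι × ℕ)) (hs : {y | pd y a ≠ 0} ⊆ s)
    (ht : {y | pd y b ≠ 0} ⊆ t) :
    ∑ᶠ xy : (ι × ℕ) × (ι × ℕ), masterTerm g₀ g₁ pa pb a b xy.1.1 xy.1.2 xy.2.1 xy.2.2 k =
      ∑ x ∈ s, ∑ y ∈ t, masterTerm g₀ g₁ pa pb a b x.1 x.2 y.1 y.2 k := by
  rw [← Finset.sum_product']
  apply finsum_eq_sum_of_support_subset
  rintro ⟨x, y⟩ h
  rw [Finset.coe_product]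
  refine ⟨hs fun hx => h ?_, ht fun hy => h ?_⟩
  · exact masterTerm_eq_zero_left _ _ _ _ _ _ _ _ _ _ _ hx
  · exact masterTerm_eq_zero_right _ _ _ _ _ _ _ _ _ _ _ hy

/-- For homogeneous `a` only the parity of `a` contributes to the bracket. -/
theorem chiBracket_of_isHomog (g₀ : ι → ι → SDiffPoly par) (g₁ : ι → ι → ℂ) {p : ZMod 2}
    {a : SDiffPoly par} (ha : IsHomog p a) (b : SDiffPoly par) (k : ℕ) (s t : Finset (ι × ℕ))
    (hs : {y | pd y a ≠ 0} ⊆ s) (ht : {y | pd y b ≠ 0} ⊆ t)  :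
    chiBracket g₀ g₁ a b k = ∑ pb : ZMod 2, ∑ x ∈ s, ∑ y ∈ t,
      masterTerm g₀ g₁ p pb a (parityPart pb b) x.1 x.2 y.1 y.2 k := by
  have hb : ∀ pb, {y | pd y (parityPart pb b) ≠ 0} ⊆ (t : Set (ι × ℕ)) := by
    intro pb y hy
    apply ht
    intro h
    apply hy
    have h2 : pd y (sigma b) = 0 := by
      have := (isSuperDer_pd y).par b
      rw [h, map_zero] at this
      have h3 : sgn (letterPar par y) ≠ 0 := by
        intro h4
        have := sgn_mul_self (letterPar par y)
        rw [h4, zero_mul] at this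
        exact zero_ne_one this
      exact (smul_eq_zero.1 this.symm).resolve_left h3
    rw [parityPart, map_smul, map_add, map_smul, h, h2]
    simp
  have hne : ∀ q, q ≠ p → ∑ pb : ZMod 2, ∑ᶠ xy : (ι × ℕ) × (ι × ℕ),
      masterTerm g₀ g₁ q pb (parityPart q a) (parityPart pb b)
        xy.1.1 xy.1.2 xy.2.1 xy.2.2 k = 0 := by
    intro q hq
    refine Finset.sum_eq_zero fun pb _ => ?_
    rw [parityPart_ne ha hq]
    exact finsum_eq_zero_of_forall_eq_zero fun xy =>
      masterTerm_eq_zero_left _ _ _ _ _ _ _ _ _ _ _ (map_zero _)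
  rw [chiBracket, Finset.sum_eq_single p (fun q _ hq => hne q hq) (by simp)]
  refine Finset.sum_congr rfl fun pb _ => ?_
  rw [parityPart_self ha]
  exact finsum_masterTerm _ _ _ _ _ _ _ _ _ hs (hb pb)

section Ham

variable [Fintype ι]

/-- The value on `u_j` of the derivation `{h χ ·}|_{χ=0}`, for an odd `h`. -/
def hamVec (g₀ : ι → ι → SDiffPoly par) (g₁ : ι → ι → ℂ) (h : SDiffPoly par) (j : ι) :
    SDiffPoly par :=
  sgn (par j) • ∑ i, sgn (par i * par j) •
    (g₀ i j * varDer i h + (sgn (par i + par j) * g₁ i j) • D (varDer i h))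

theorem isHomog_hamVec {g₀ : ι → ι → SDiffPoly par} {g₁ : ι → ι → ℂ}
    (h₀ : ∀ i j, IsHomog (par i + par j + 1) (g₀ i j)) (h₁ : ∀ i j, g₁ i j ≠ 0 → par i = par j)
    {h : SDiffPoly par} (hh : IsHomog 1 h) (j : ι) : IsHomog (par j) (hamVec g₀ g₁ h j) := by
  refine IsHomog.smul _ (IsHomog.sum _ _ fun i _ => IsHomog.smul _ (IsHomog.add ?_ ?_))
  · convert (h₀ i j).mul (isHomog_varDer i hh) using 1
    generalize par i = x, par j = y
    revert x y
    decide
  · by_cases hg : g₁ i j = 0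
    · simpa [hg] using IsHomog.zero _
    · refine IsHomog.smul _ ?_
      convert (isHomog_varDer i hh).D using 1
      rw [h₁ i j hg]
      generalize par j = y
      revert y
      decide

/-- For an odd `h`, the map `{h χ ·}|_{χ=0}` is an even derivation commuting with `D`. -/
theorem chiBracket_zero_eq_evol {g₀ : ι → ι → SDiffPoly par} {g₁ : ι → ι → ℂ}
    (h₀ : ∀ i j, IsHomog (par i + par j + 1) (g₀ i j)) (h₁ : ∀ i j, g₁ i j ≠ 0 → par i = par j)
    {h : SDiffPoly par} (hh : IsHomog 1 h) (b : SDiffPoly par) :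
    chiBracket g₀ g₁ h b 0 = evol (hamVec g₀ g₁ h) (isHomog_hamVec h₀ h₁ hh) b := by
  obtain ⟨M, hM⟩ := exists_order h
  set t : Finset (ι × ℕ) := (finite_support_pd b).toFinset with ht
  have hs : {y | pd y h ≠ 0} ⊆ ((Finset.univ ×ˢ Finset.range M : Finset (ι × ℕ)) : Set _) := by
    rintro ⟨i, m⟩ hy
    by_contra hc
    simp only [Finset.coe_product, Finset.coe_univ, Finset.coe_range, Set.mem_prod, Set.mem_univ,
      true_and, Set.mem_Iio, not_lt] at hc
    exact hy (hM i m hc)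
  rw [chiBracket_of_isHomog g₀ g₁ hh b 0 _ t hs (by simp [ht])]
  -- Each term of the master formula is `d u_j^{(n)}` times `∂b/∂u_j^{(n)}`, so that the sum is the
  -- expansion of `d b` for the derivation `d` with `d u_j = hamVec j`.
  have key : ∀ pb, ∑ x ∈ Finset.univ ×ˢ Finset.range M, ∑ y ∈ t,
      masterTerm g₀ g₁ 1 pb h (parityPart pb b) x.1 x.2 y.1 y.2 0 =
      ∑ y ∈ t, evol (hamVec g₀ g₁ h) (isHomog_hamVec h₀ h₁ hh) (letter par y) *
        pd y (parityPart pb b) := by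
    intro pb
    rw [Finset.sum_comm]
    refine Finset.sum_congr rfl fun y _ => ?_
    obtain ⟨j, n⟩ := y
    have hB : IsHomog (letterPar par (j, n) + pb) (pd (j, n) (parityPart pb b)) :=
      (isSuperDer_pd (j, n)).isHomog (isHomog_parityPart pb b)
    have hV : IsHomog (par j + n) (D^[n] (hamVec g₀ g₁ h j)) :=
      (isHomog_hamVec h₀ h₁ hh j).iterate_D n
    rw [evol_letter, homog_comm hV hB]
    simp only [masterTerm, chiMul_zero, iterate_chiAddD_zero, genArrow_zero]
    rw [Finset.sum_product]
    -- The sign of the master formula at `χ = 0`: a factor that does not involve `m`, and the sign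
    -- with which `D^m ∂/∂u_i^{(m)}` enters the variational derivative.
    have e : ∀ (i : ι) (m : ℕ), sgn (pb * (1 + 1) + (pb + par i + m) * (par j + n) + n * (par i + m + 1)
        + m * (par i + par j + 1) + (m.choose 2 : ℕ)) =
        sgn (pb * (par j + n) + n) * (sgn (par i * par j) * varSgn (par i) m) := by
      intro i m
      rw [varSgn, ← sgn_add, ← sgn_add]
      congr 1
      generalize ((m.choose 2 : ℕ) : ZMod 2) = y, (m : ZMod 2) = m, (n : ZMod 2) = n, par i = pi
      generalize par j = pj
      clear hB
      revert pb y m n pi pj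
      decide
    simp only [e, chiConst, if_pos]
    have e2 : ∀ i, ∑ m ∈ Finset.range M, (sgn (pb * (par j + n) + n) *
        (sgn (par i * par j) * varSgn (par i) m)) • (pd (j, n) (parityPart pb b) *
          D^[n] (g₀ i j * D^[m] (pd (i, m) h) + (sgn (par i + par j) * g₁ i j) •
            D (D^[m] (pd (i, m) h)))) =
        sgn (pb * (par j + n) + n) • (pd (j, n) (parityPart pb b) * D^[n] (sgn (par i * par j) •
          (g₀ i j * varDer i h + (sgn (par i + par j) * g₁ i j) • D (varDer i h)))) := by
      intro i
      rw [varDer_eq_sum i h M (hM i)]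
      simp only [iterate_D_eq_pow, map_sum, map_smul, Finset.mul_sum, Finset.smul_sum,
        ← Finset.sum_add_distrib]
      refine Finset.sum_congr rfl fun m _ => ?_
      simp only [mul_smul_comm, map_smul, map_add, smul_add, mul_add]
      module
    rw [Finset.sum_congr rfl fun i _ => e2 i, ← Finset.smul_sum, ← Finset.mul_sum]
    simp only [iterate_D_eq_pow]
    rw [← map_sum, hamVec, map_smul, mul_smul_comm, smul_smul]
    congr 1
    have e3 : sgn ((par j + n) * (letterPar par (j, n) + pb)) * sgn (par j) =
        sgn (pb * (par j + n) + n) := by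
      rw [← sgn_add, letterPar]
      congr 1
      generalize (n : ZMod 2) = n, par j = pj
      clear hB e e2
      revert pb n pj
      decide
    exact e3.symm
  have hb : b = parityPart 0 b + parityPart 1 b := (parityPart_add b).symm
  rw [sum_zmod2, key, key, ← Finset.sum_add_distrib,
    (isEvol_evol (hamVec g₀ g₁ h) (isHomog_hamVec h₀ h₁ hh)).toIsSuperDer.eq_sum_pd b t
      (by simp [ht])]
  refine Finset.sum_congr rfl fun y _ => ?_
  rw [← mul_add, ← map_add, parityPart_add]

end Ham

/-! ### Bracket with a generator -/

/-- The bracket with a generator is given, coefficient by coefficient in `χ`, by superderivations.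
-/
theorem chiBracket_letter {g₀ : ι → ι → SDiffPoly par} {g₁ : ι → ι → ℂ}
    (h₀ : ∀ i j, IsHomog (par i + par j + 1) (g₀ i j)) (h₁ : ∀ i j, g₁ i j ≠ 0 → par i = par j)
    (i : ι) (k : ℕ) (b : SDiffPoly par) :
    chiBracket g₀ g₁ (letter par (i, 0)) b k = genDer h₀ h₁ i k b := by
  set t : Finset (ι × ℕ) := (finite_support_pd b).toFinset with ht
  have hl : IsHomog (par i) (letter par (i, 0)) := by
    simpa [letterPar] using isHomog_letter (par := par) (i, 0)
  have hs : {y | pd y (letter par (i, 0)) ≠ 0} ⊆ (({(i, 0)} : Finset (ι × ℕ)) : Set _) := by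
    intro y hy
    by_contra h
    apply hy
    rw [pd_letter, if_neg]
    rintro rfl
    simp at h
  rw [chiBracket_of_isHomog g₀ g₁ hl b k _ t hs (by simp [ht])]
  have key : ∀ pb, ∑ x ∈ ({(i, 0)} : Finset (ι × ℕ)), ∑ y ∈ t,
      masterTerm g₀ g₁ (par i) pb (letter par (i, 0)) (parityPart pb b) x.1 x.2 y.1 y.2 k =
      ∑ y ∈ t, genDer h₀ h₁ i k (letter par y) * pd y (parityPart pb b) := by
    intro pb
    rw [Finset.sum_singleton]
    refine Finset.sum_congr rfl fun y _ => ?_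
    obtain ⟨j, n⟩ := y
    have hB : IsHomog (letterPar par (j, n) + pb) (pd (j, n) (parityPart pb b)) :=
      (isSuperDer_pd (j, n)).isHomog (isHomog_parityPart pb b)
    have hV := genDer_homog h₀ h₁ i k (j, n)
    rw [genDer, superDer_letter, homog_comm hV hB]
    simp only [masterTerm, pd_letter, if_pos, Function.iterate_zero, id,
      genArrow_chiConst_one h₁, chiMul]
    rw [sigmaPow_of_isHomog hB, smul_mul_assoc, smul_smul, mul_smul_comm, smul_smul, ← sgn_add,
      ← sgn_add, letterPar]
    congr 2
    generalize (n : ZMod 2) = n, (k : ZMod 2) = k, par i = pi, par j = pj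
    simp only [Nat.choose_zero_succ, Nat.cast_zero, zero_mul, add_zero]
    clear hB
    revert pb k n pi pj
    decide
  rw [sum_zmod2, key, key, ← Finset.sum_add_distrib,
    (isSuperDer_genDer h₀ h₁ i k).eq_sum_pd b t (by simp [ht])]
  refine Finset.sum_congr rfl fun y _ => ?_
  rw [← mul_add, ← map_add, parityPart_add]

end Bracket

/-! ### Filtered power series of operators -/

/-- The algebra of linear operators on `P(ḡ)`. -/
def E : Type := Module.End ℂ PA

instance : Ring E := inferInstanceAs (Ring (Module.End ℂ PA))

instance : Algebra ℂ E := inferInstanceAs (Algebra ℂ (Module.End ℂ PA))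

/-- A linear map as an element of `E`. -/
def opE (f : PA →ₗ[ℂ] PA) : E := f

/-- Operators on `P(ḡ)^{2|2}`, as matrices of operators on `P(ḡ)`. -/
abbrev Op : Type := Matrix (Fin 4) (Fin 4) E

/-- Power series in `ζ = z⁻¹` with operator coefficients. -/
abbrev Ser : Type := PowerSeries Op

/-- The parities of the basis vectors of `ℂ^{2|2}`. -/
def vpar : Fin 4 → ZMod 2 := ![0, 0, 1, 1]

/-- Degrees of the basis vectors of `ℂ^{2|2}`, such that a nonzero matrix entry `(i, j)` of an element
of `g` of degree `d` satisfies `d = vdeg i - vdeg j`. -/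
def vdeg : Fin 4 → ℤ := ![1, 0, 1, 0]

theorem vdeg_sub_le (i j : Fin 4) : vdeg i - vdeg j ≤ 1 := by
  revert i j
  decide

theorem neg_one_le_vdeg_sub (i j : Fin 4) : -1 ≤ vdeg i - vdeg j := by
  revert i j
  decide

namespace Ser

open PowerSeries

theorem coeff_smul' (c : ℂ) (n : ℕ) (M : Ser) : coeff n (c • M) = c • coeff n M := rfl

/-- The subspace of series all of whose components have degree at least `d`, where the entry `(i, j)`
of the coefficient of `ζ^k` has the degree `vdeg i - vdeg j + 2 k`. -/
def Fil (d : ℤ) : AddSubgroup Ser where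
  carrier := {M | ∀ (k : ℕ) (i j : Fin 4), vdeg i - vdeg j + 2 * k < d → coeff k M i j = 0}
  zero_mem' := by simp
  add_mem' := by
    intro M N hM hN k i j h
    rw [map_add, Matrix.add_apply, hM k i j h, hN k i j h, add_zero]
  neg_mem' := by
    intro M hM k i j h
    rw [map_neg, Matrix.neg_apply, hM k i j h, neg_zero]

theorem smul_mem_Fil {d : ℤ} (c : ℂ) {M : Ser} (hM : M ∈ Fil d) : c • M ∈ Fil d := by
  intro k i j h
  rw [coeff_smul', Matrix.smul_apply, hM k i j h, smul_zero]

theorem Fil_anti {d e : ℤ} (h : d ≤ e) {M : Ser} (hM : M ∈ Fil e) : M ∈ Fil d :=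
  fun k i j hk => hM k i j (lt_of_lt_of_le hk h)

theorem mem_Fil_neg_one (M : Ser) : M ∈ Fil (-1) := by
  intro k i j h
  have := neg_one_le_vdeg_sub i j
  omega

theorem mul_mem_Fil {d e : ℤ} {M N : Ser} (hM : M ∈ Fil d) (hN : N ∈ Fil e) :
    M * N ∈ Fil (d + e) := by
  intro k i j h
  rw [coeff_mul, Matrix.sum_apply]
  refine Finset.sum_eq_zero fun ab hab => ?_
  rw [Matrix.mul_apply]
  refine Finset.sum_eq_zero fun l _ => ?_
  have hk : ab.1 + ab.2 = k := by simpa using hab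
  by_cases h1 : vdeg i - vdeg l + 2 * (ab.1 : ℤ) < d
  · rw [hM _ _ _ h1, zero_mul]
  · rw [hN _ _ _ (by omega), mul_zero]

theorem one_mem_Fil : (1 : Ser) ∈ Fil 0 := by
  intro k i j h
  rw [coeff_one]
  split_ifs with hk
  · rw [Matrix.one_apply_ne]
    rintro rfl
    subst hk
    simp at h
  · rfl

theorem pow_mem_Fil {M : Ser} (hM : M ∈ Fil 1) (n : ℕ) : M ^ n ∈ Fil n := by
  induction n with
  | zero => simpa using one_mem_Fil
  | succ n ih =>
    rw [pow_succ, Nat.cast_succ]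
    exact mul_mem_Fil ih hM

theorem eq_zero_of_forall_mem_Fil {M : Ser} (h : ∀ n : ℕ, M ∈ Fil n) : M = 0 := by
  ext k i j
  rw [h (2 * k + 2) k i j (by have := vdeg_sub_le i j; push_cast; omega)]
  simp

theorem coeff_eq_zero_of_mem_Fil {M : Ser} {k h : ℕ} (hM : M ∈ Fil h) (hk : 2 * k + 2 ≤ h) :
    coeff k M = 0 := by
  ext1 i j
  rw [hM k i j (by have := vdeg_sub_le i j; omega)]
  rfl

theorem C_mem_Fil {A : Op} {d : ℤ} (h : ∀ i j, vdeg i - vdeg j < d → A i j = 0) :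
    (C A : Ser) ∈ Fil d := by
  intro k i j hk
  rw [coeff_C]
  split_ifs with h0
  · exact h i j (by subst h0; simpa using hk)
  · rfl

theorem X_mul_mem_Fil_iff {d : ℤ} {M : Ser} : (X * M : Ser) ∈ Fil (d + 2) ↔ M ∈ Fil d := by
  constructor
  · intro h k i j hk
    have := h (k + 1) i j (by push_cast; omega)
    rwa [coeff_succ_X_mul] at this
  · intro h k i j hk
    cases k with
    | zero => rw [coeff_zero_X_mul]; rfl
    | succ k =>
      rw [coeff_succ_X_mul]
      exact h k i j (by push_cast at hk; omega)

/-! ### Exponentials -/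

/-- A family of series with `f h` of degree at least `h`. -/
def Adm (f : ℕ → Ser) : Prop := ∀ h : ℕ, f h ∈ Fil h

/-- The sum of an admissible family. The entries of the coefficient of `ζ^k` have degree at most `2
k + 1`, so only the terms with `h ≤ 2 k + 1` contribute to it. -/
def fsum (f : ℕ → Ser) : Ser :=
  PowerSeries.mk fun k => ∑ h ∈ Finset.range (2 * k + 2), coeff k (f h)

theorem coeff_fsum {f : ℕ → Ser} (hf : Adm f) (k N : ℕ) (hN : 2 * k + 2 ≤ N) :
    coeff k (fsum f) = ∑ h ∈ Finset.range N, coeff k (f h) := by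
  rw [fsum, coeff_mk]
  refine Finset.sum_subset (by simpa using hN) fun h _ hh => ?_
  exact coeff_eq_zero_of_mem_Fil (hf h) (by simpa using hh)

theorem fsum_mem_Fil {d : ℤ} {f : ℕ → Ser} (hf : ∀ h, f h ∈ Fil d) : fsum f ∈ Fil d := by
  intro k i j hk
  rw [fsum, coeff_mk, Matrix.sum_apply]
  exact Finset.sum_eq_zero fun h _ => hf h k i j hk

theorem Adm.mul {f g : ℕ → Ser} (hf : Adm f) (hg : Adm g) :
    Adm fun h => ∑ ab ∈ Finset.HasAntidiagonal.antidiagonal h, f ab.1 * g ab.2 := by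
  intro h
  refine sum_mem fun ab hab => ?_
  have hk : ab.1 + ab.2 = h := by simpa using hab
  rw [← hk, Nat.cast_add]
  exact mul_mem_Fil (hf _) (hg _)

/-- The Cauchy product of two sums. -/
theorem fsum_mul {f g : ℕ → Ser} (hf : Adm f) (hg : Adm g) :
    fsum f * fsum g = fsum fun h => ∑ ab ∈ Finset.HasAntidiagonal.antidiagonal h, f ab.1 * g ab.2 := by
  ext1 k
  set N := 2 * k + 2 with hN
  have e1 : coeff k (fsum f * fsum g) = ∑ a ∈ Finset.range N, ∑ b ∈ Finset.range N,
      coeff k (f a * g b) := by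
    simp only [coeff_mul]
    rw [Finset.sum_congr rfl fun a _ => Finset.sum_comm, Finset.sum_comm]
    refine Finset.sum_congr rfl fun cd hcd => ?_
    have hk : cd.1 + cd.2 = k := by simpa using hcd
    rw [coeff_fsum hf cd.1 N (by omega), coeff_fsum hg cd.2 N (by omega), Finset.sum_mul_sum]
  rw [e1, coeff_fsum (hf.mul hg) k N le_rfl]
  simp only [map_sum]
  rw [← Finset.sum_product', Finset.sum_sigma']
  -- Products of total degree `2 k + 2` or more have no `ζ^k`, so the square of summation may be
  -- replaced by the triangle.
  have hz : ∀ a b, N ≤ a + b → coeff k (f a * g b) = 0 := by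
    intro a b hab
    have := mul_mem_Fil (hf a) (hg b)
    rw [← Nat.cast_add] at this
    exact coeff_eq_zero_of_mem_Fil this (by omega)
  symm
  refine Finset.sum_bij_ne_zero (fun x _ _ => x.2) ?_ ?_ ?_ ?_
  · rintro ⟨h, a, b⟩ hx -
    simp only [Finset.mem_sigma, Finset.mem_range, Finset.HasAntidiagonal.mem_antidiagonal] at hx
    simp only [Finset.mem_product, Finset.mem_range]
    omega
  · rintro ⟨h, a, b⟩ hx - ⟨h', a', b'⟩ hx' - heq
    simp only [Finset.mem_sigma, Finset.mem_range, Finset.HasAntidiagonal.mem_antidiagonal] at hx hx'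
    simp only [Prod.mk.injEq] at heq
    obtain ⟨rfl, rfl⟩ := heq
    obtain rfl : h = h' := by omega
    rfl
  · rintro ⟨a, b⟩ - hne
    refine ⟨⟨a + b, a, b⟩, ?_, hne, rfl⟩
    simp only [Finset.mem_sigma, Finset.mem_range, Finset.HasAntidiagonal.mem_antidiagonal, and_true]
    by_contra hc
    exact hne (hz a b (by omega))
  · intros
    rfl

theorem adm_single {M : Ser} (hM : M ∈ Fil 0) : Adm (Pi.single 0 M) := by
  intro h
  by_cases hh : h = 0
  · subst hh
    simpa using hM
  · rw [Pi.single_eq_of_ne hh]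
    exact zero_mem _

theorem fsum_single (M : Ser) : fsum (Pi.single 0 M) = M := by
  ext1 k
  rw [fsum, coeff_mk, Finset.sum_eq_single_of_mem 0 (by simp), Pi.single_eq_same]
  intro h _ hh
  rw [Pi.single_eq_of_ne hh, map_zero]

theorem fsum_mul_right {f : ℕ → Ser} (hf : Adm f) {M : Ser} (hM : M ∈ Fil 0) :
    fsum f * M = fsum fun h => f h * M := by
  conv_lhs => rw [← fsum_single M]
  rw [fsum_mul hf (adm_single hM)]
  congr 1
  funext h
  rw [Finset.sum_eq_single_of_mem (h, 0) (by simp), Pi.single_eq_same]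
  rintro ⟨a, b⟩ hab hne
  have hk : a + b = h := by simpa using hab
  have hb : b ≠ 0 := by
    rintro rfl
    exact hne (by simp [← hk])
  rw [Pi.single_eq_of_ne hb, mul_zero]

/-- The exponential series of `T`. -/
def expSer (T : Ser) : Ser := fsum fun h => ((h.factorial : ℂ)⁻¹) • T ^ h

theorem adm_exp {T : Ser} (hT : T ∈ Fil 1) : Adm fun h => ((h.factorial : ℂ)⁻¹) • T ^ h :=
  fun h => smul_mem_Fil _ (pow_mem_Fil hT h)

/-- `ad T`. -/
def adS (T M : Ser) : Ser := T * M - M * T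

theorem adS_mem {T M : Ser} {d e : ℤ} (hT : T ∈ Fil d) (hM : M ∈ Fil e) :
    adS T M ∈ Fil (d + e) := by
  refine sub_mem (mul_mem_Fil hT hM) ?_
  rw [add_comm]
  exact mul_mem_Fil hM hT

theorem iterate_adS_mem {T M : Ser} {e : ℤ} (hT : T ∈ Fil 1) (hM : M ∈ Fil e) (h : ℕ) :
    (adS T)^[h] M ∈ Fil (h + e) := by
  induction h with
  | zero => simpa using hM
  | succ h ih =>
    rw [Function.iterate_succ_apply']
    refine Fil_anti (le_of_eq ?_) (adS_mem hT ih)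
    push_cast
    ring

theorem adm_ad {T M : Ser} (hT : T ∈ Fil 1) (hM : M ∈ Fil 0) :
    Adm fun h => ((h.factorial : ℂ)⁻¹) • (adS T)^[h] M := fun h =>
  smul_mem_Fil _ (by simpa using iterate_adS_mem hT hM h)

/-- The binomial theorem in divided powers. -/
theorem divided_add_pow {A : Type*} [Ring A] [Algebra ℂ A] {x y : A} (h : Commute x y) (n : ℕ) :
    ((n.factorial : ℂ)⁻¹) • (x + y) ^ n = ∑ ab ∈ Finset.HasAntidiagonal.antidiagonal n,
      (((ab.1.factorial : ℂ)⁻¹) • x ^ ab.1) * (((ab.2.factorial : ℂ)⁻¹) • y ^ ab.2) := by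
  rw [h.add_pow', Finset.smul_sum]
  refine Finset.sum_congr rfl fun ab hab => ?_
  have hk : ab.1 + ab.2 = n := by simpa using hab
  rw [smul_mul_smul_comm, ← Nat.cast_smul_eq_nsmul ℂ, smul_smul]
  congr 1
  have h1 : (n.factorial : ℂ) ≠ 0 := by exact_mod_cast n.factorial_ne_zero
  have h2 : (ab.1.factorial : ℂ) ≠ 0 := by exact_mod_cast ab.1.factorial_ne_zero
  have h3 : (ab.2.factorial : ℂ) ≠ 0 := by exact_mod_cast ab.2.factorial_ne_zero
  have h4 : ((n.choose ab.1 : ℕ) : ℂ) * ab.1.factorial * ab.2.factorial = n.factorial := by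
    rw [← hk, Nat.choose_symm_add]
    exact_mod_cast Nat.add_choose_mul_factorial_mul_factorial ab.1 ab.2
  field_simp
  rw [← h4]

/-- Left multiplication by `T` is the sum of the commuting operators `ad T` and right
multiplication by `T`. -/
theorem divided_pow_mul {A : Type*} [Ring A] [Algebra ℂ A] (T M : A) (h : ℕ) :
    ((h.factorial : ℂ)⁻¹) • T ^ h * M = ∑ ab ∈ Finset.HasAntidiagonal.antidiagonal h,
      (((ab.1.factorial : ℂ)⁻¹) • (fun x => T * x - x * T)^[ab.1] M) *
        (((ab.2.factorial : ℂ)⁻¹) • T ^ ab.2) := by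
  set L : Module.End ℂ A := LinearMap.mulLeft ℂ T
  set R : Module.End ℂ A := LinearMap.mulRight ℂ T
  have hc : Commute (L - R) R := by
    apply Commute.sub_left _ (Commute.refl R)
    apply LinearMap.ext
    intro x
    simp [L, R, mul_assoc]
  have e := divided_add_pow hc h
  rw [sub_add_cancel] at e
  have e1 := LinearMap.congr_fun e M
  have hL : ∀ n, (L ^ n) M = T ^ n * M := by
    intro n
    simp [L, LinearMap.pow_mulLeft]
  have hR : ∀ n x, (R ^ n) x = x * T ^ n := by
    intro n x
    simp [R, LinearMap.pow_mulRight]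
  have hA : ∀ n x, ((L - R) ^ n) x = (fun x => T * x - x * T)^[n] x := by
    intro n x
    rw [Module.End.pow_apply]
    rfl
  have hc2 : ∀ a b, Commute ((L - R) ^ a) (R ^ b) := fun a b => hc.pow_pow a b
  rw [LinearMap.smul_apply, hL, LinearMap.sum_apply] at e1
  rw [smul_mul_assoc, e1]
  refine Finset.sum_congr rfl fun ab _ => ?_
  rw [smul_mul_smul_comm, (hc2 _ _).eq, LinearMap.smul_apply, Module.End.mul_apply, hA, hR,
    smul_mul_smul_comm]

theorem expSer_mul_expSer_neg {T : Ser} (hT : T ∈ Fil 1) : expSer T * expSer (-T) = 1 := by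
  have hT' : -T ∈ Fil 1 := neg_mem hT
  rw [expSer, expSer, fsum_mul (adm_exp hT) (adm_exp hT'), ← fsum_single 1]
  congr 1
  funext h
  refine (divided_add_pow (Commute.neg_right (Commute.refl T)) h).symm.trans ?_
  rw [add_neg_cancel]
  cases h with
  | zero => simp
  | succ h => simp

theorem expSer_neg_mul_expSer {T : Ser} (hT : T ∈ Fil 1) : expSer (-T) * expSer T = 1 := by
  simpa using expSer_mul_expSer_neg (T := -T) (neg_mem hT)

theorem expSer_mem {T : Ser} (hT : T ∈ Fil 1) : expSer T ∈ Fil 0 :=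
  fsum_mem_Fil fun h => Fil_anti (by positivity) (adm_exp hT h)

/-- Conjugation by an exponential is the exponential of the adjoint action. -/
theorem expSer_mul {T M : Ser} (hT : T ∈ Fil 1) (hM : M ∈ Fil 0) :
    expSer T * M = (fsum fun h => ((h.factorial : ℂ)⁻¹) • (adS T)^[h] M) * expSer T := by
  rw [expSer, fsum_mul_right (adm_exp hT) hM, fsum_mul (adm_ad hT hM) (adm_exp hT)]
  congr 1
  funext h
  exact divided_pow_mul T M h

end Ser

open PowerSeries

/-! ### The matrix realisation of `g ⊗ P(ḡ)` -/

/-- `x` represents the element `∑ b ⊗ x b` of `g ⊗ P(ḡ)`; `GHom q x` says that it has parity `q`. -/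
def GHom (q : ZMod 2) (x : B → PA) : Prop := ∀ b, IsHomog (q + b.par) (x b)

/-- The bracket `[a ⊗ u, b ⊗ v] = (-1)^{p(b)p(u)} [a,b] ⊗ uv` of `g ⊗ P(ḡ)`. -/
def gBr (x y : B → PA) : B → PA := fun k =>
  ∑ i : B, ∑ j : B, (struc i j k : ℂ) • (sigmaPow j.par (x i) * y j)

/-- `[D, a ⊗ u] = (-1)^{p(a)} a ⊗ D u`. -/
def gD (x : B → PA) : B → PA := fun k => sgn k.par • D (x k)

/-- The matrix over `P(ḡ)` by which `∑ b ⊗ x b` acts on `ℂ^{2|2} ⊗ P(ḡ)`. -/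
def ent (x : B → PA) : Matrix (Fin 4) (Fin 4) PA := Matrix.of fun i j =>
  ∑ b : B, ((b.mat i j : ℚ) : ℂ) • sigmaPow (vpar j) (x b)

/-- Left multiplication operators. -/
def lm : PA →ₐ[ℂ] E := (Algebra.lmul ℂ PA : PA →ₐ[ℂ] Module.End ℂ PA)

theorem opE_injective : Function.Injective opE := fun _ _ h => h

theorem lm_injective : Function.Injective lm := fun u v h => by
  have : u * 1 = v * 1 := LinearMap.congr_fun (show LinearMap.mulLeft ℂ u = _ from h) 1
  simpa using this

/-- The operator by which an element of `g ⊗ P(ḡ)` acts on `ℂ^{2|2} ⊗ P(ḡ)`. -/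
def rep (x : B → PA) : Op := (ent x).map lm

theorem rep_apply (x : B → PA) (i j : Fin 4) : rep x i j = lm (ent x i j) := rfl

theorem ent_add (x y : B → PA) : ent (x + y) = ent x + ent y := by
  ext i j
  simp [ent, Finset.sum_add_distrib]

theorem ent_smul (c : ℂ) (x : B → PA) : ent (c • x) = c • ent x := by
  ext i j
  simp only [ent, Matrix.of_apply, Pi.smul_apply, map_smul, Matrix.smul_apply, Finset.smul_sum]
  exact Finset.sum_congr rfl fun b _ => smul_comm _ _ _

/-- `rep` as a linear map. -/
def repLin : (B → PA) →ₗ[ℂ] Op where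
  toFun := rep
  map_add' x y := by
    ext1 i j
    simp [rep_apply, ent_add]
  map_smul' c x := by
    ext1 i j
    simp [rep_apply, ent_smul]

theorem rep_add (x y : B → PA) : rep (x + y) = rep x + rep y := repLin.map_add x y

theorem rep_sub (x y : B → PA) : rep (x - y) = rep x - rep y := repLin.map_sub x y

theorem rep_neg (x : B → PA) : rep (-x) = -rep x := repLin.map_neg x

theorem rep_smul (c : ℂ) (x : B → PA) : rep (c • x) = c • rep x := repLin.map_smul c x

theorem rep_zero : rep 0 = 0 := repLin.map_zero

theorem rep_sum {κ : Type*} (s : Finset κ) (f : κ → B → PA) :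
    rep (∑ i ∈ s, f i) = ∑ i ∈ s, rep (f i) := map_sum repLin f s

theorem sum_B {M : Type*} [AddCommMonoid M] (f : B → M) :
    ∑ b, f b = f .f3 + (f .h1 + (f .h2 + (f .e3 + (f .e1 + (f .e2 + (f .f1 + f .f2)))))) := by
  have h : (Finset.univ : Finset B) = {.f3, .h1, .h2, .e3, .e1, .e2, .f1, .f2} := rfl
  rw [h]
  simp

/-- The matrices of the basis of `g` are linearly independent, also over `P(ḡ)`. -/
theorem ent_eq_zero {x : B → PA} (h : ent x = 0) : x = 0 := by
  have e : ∀ i j, ent x i j = 0 := fun i j => by rw [h]; rfl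
  simp only [ent, Matrix.of_apply, sum_B] at e
  have e00 := e 0 0
  have e22 := e 2 2
  have e13 := e 1 3
  have e03 := e 0 3
  have e02 := e 0 2
  have e12 := e 1 2
  have e23 := e 2 3
  have e32 := e 3 2
  simp [B.mat, vpar, sigmaPow_zero, sigmaPow_one] at e00 e22 e13 e03 e02 e12 e23 e32
  have inj : ∀ a : PA, sigma a = 0 → a = 0 := fun a ha => by
    rw [← sigma_sigma a, ha, map_zero]
  have k1 : x .h1 = x .h2 := by
    rwa [← sub_eq_add_neg, sub_eq_zero] at e00
  rw [k1, ← map_add] at e22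
  have k2 : x .h2 = 0 := by
    have := inj _ e22
    rw [← two_smul ℂ] at this
    exact (smul_eq_zero.1 this).resolve_left two_ne_zero
  funext b
  cases b
  · exact inj _ (by simpa using e32)
  · rw [k1, k2]; rfl
  · exact k2
  · exact inj _ (by simpa using e23)
  · exact inj _ (by simpa using e13)
  · exact inj _ (by simpa using e03)
  · exact inj _ (by simpa using e02)
  · exact inj _ (by simpa using e12)

theorem rep_injective : Function.Injective rep := by
  intro x y h
  rw [← sub_eq_zero, ← rep_sub] at h
  rw [← sub_eq_zero]
  apply ent_eq_zero
  ext1 i j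
  apply lm_injective
  rw [← rep_apply, h]
  simp

/-- The matrices of the basis are homogeneous for the parity and for the grading of `g`. -/
theorem mat_ne_zero_par (b : B) (i j : Fin 4) (h : b.mat i j ≠ 0) :
    b.par = vpar i + vpar j ∧ b.deg = vdeg i - vdeg j := by
  have h1 : ∀ (b : B) (i j : Fin 4), (b.mat i j).num ≠ 0 →
      b.par = vpar i + vpar j ∧ b.deg = vdeg i - vdeg j := by
    decide +kernel
  exact h1 b i j fun h0 => h (Rat.num_eq_zero.1 h0)

theorem ent_of_GHom {q : ZMod 2} {x : B → PA} (hx : GHom q x) (i j : Fin 4) : ent x i j =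
    ∑ b : B, ((b.mat i j : ℂ) * sgn (vpar j * (q + b.par))) • x b := by
  rw [ent, Matrix.of_apply]
  refine Finset.sum_congr rfl fun b _ => ?_
  rw [sigmaPow_of_isHomog (hx b), smul_smul]

theorem isHomog_ent {q : ZMod 2} {x : B → PA} (hx : GHom q x) (i j : Fin 4) :
    IsHomog (q + vpar i + vpar j) (ent x i j) := by
  rw [ent, Matrix.of_apply]
  refine IsHomog.sum _ _ fun b _ => ?_
  by_cases h : b.mat i j = 0
  · simpa [h] using IsHomog.zero _
  · rw [add_assoc, ← (mat_ne_zero_par b i j h).1]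
    exact ((hx b).sigmaPow _).smul _

theorem mat_eq_zero_of_par {b : B} {i j : Fin 4} (h : b.par ≠ vpar i + vpar j) :
    (b.mat i j : ℂ) = 0 := by
  rw [Rat.cast_eq_zero]
  by_contra hc
  exact h (mat_ne_zero_par b i j hc).1

/-- The signs in the matrix entries of a supercommutator: for `x = b ⊗ u` even and `y = c ⊗ v` of
parity `q`, the ordinary commutator of the matrices over `P(ḡ)` is the supercommutator in
`sl(2|2)`. -/
theorem bracket_scalars (q : ZMod 2) (b c : B) (i j : Fin 4) :
    (∑ k, ((b.mat i k : ℂ) * sgn (vpar k * (0 + b.par))) *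
        ((c.mat k j : ℂ) * sgn (vpar j * (q + c.par)))) -
      (∑ k, ((c.mat i k : ℂ) * sgn (vpar k * (q + c.par))) *
        ((b.mat k j : ℂ) * sgn (vpar j * (0 + b.par)))) * sgn ((q + c.par) * (0 + b.par)) =
    ∑ k : B, (k.mat i j : ℂ) * ((struc b c k : ℂ) * sgn (c.par * (0 + b.par)) *
      sgn (vpar j * (0 + b.par + (q + c.par)))) := by
  have h := congrFun (congrFun (superComm_eq b c) i) j
  rw [Matrix.sum_apply, superComm, Matrix.sub_apply, Matrix.smul_apply, Matrix.mul_apply,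
    Matrix.mul_apply] at h
  have h2 := congrArg (fun t : ℚ => (t : ℂ)) h
  simp only [Matrix.smul_apply, smul_eq_mul] at h2
  push_cast at h2
  have e1 : ∀ k, ((b.mat i k : ℂ) * sgn (vpar k * (0 + b.par))) *
        ((c.mat k j : ℂ) * sgn (vpar j * (q + c.par))) =
      (sgn (c.par * (0 + b.par)) * sgn (vpar j * (0 + b.par + (q + c.par)))) *
        ((b.mat i k : ℂ) * c.mat k j) := by
    intro k
    by_cases hc : c.par = vpar k + vpar j
    · have : sgn (vpar k * (0 + b.par)) * sgn (vpar j * (q + c.par)) =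
          sgn (c.par * (0 + b.par)) * sgn (vpar j * (0 + b.par + (q + c.par))) := by
        rw [← sgn_add, ← sgn_add, hc]
        congr 1
        generalize vpar k = x, vpar j = y, b.par = z
        revert q x y z
        clear * -
        decide
      linear_combination (b.mat i k : ℂ) * c.mat k j * this
    · simp [mat_eq_zero_of_par hc]
  have e2 : ∀ k, ((c.mat i k : ℂ) * sgn (vpar k * (q + c.par))) *
        ((b.mat k j : ℂ) * sgn (vpar j * (0 + b.par))) * sgn ((q + c.par) * (0 + b.par)) =
      (sgn (c.par * (0 + b.par)) * sgn (vpar j * (0 + b.par + (q + c.par)))) *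
        (sgn (b.par * c.par) * ((c.mat i k : ℂ) * b.mat k j)) := by
    intro k
    by_cases hb : b.par = vpar k + vpar j
    · have : sgn (vpar k * (q + c.par)) * sgn (vpar j * (0 + b.par)) *
            sgn ((q + c.par) * (0 + b.par)) =
          sgn (c.par * (0 + b.par)) * sgn (vpar j * (0 + b.par + (q + c.par))) *
            sgn (b.par * c.par) := by
        rw [← sgn_add, ← sgn_add, ← sgn_add, ← sgn_add, hb]
        congr 1
        generalize vpar k = x, vpar j = y, c.par = z
        clear e1
        revert q x y z
        clear * -
        decide
      linear_combination (c.mat i k : ℂ) * b.mat k j * this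
    · simp [mat_eq_zero_of_par hb]
  rw [Finset.sum_mul, Finset.sum_congr rfl fun k _ => e1 k, Finset.sum_congr rfl fun k _ => e2 k,
    ← Finset.mul_sum, ← Finset.mul_sum, ← Finset.mul_sum, ← mul_sub]
  have e3 : ((if b.par * c.par = 0 then 1 else -1 : ℚ) : ℂ) = sgn (b.par * c.par) := by
    unfold sgn
    split_ifs <;> simp
  rw [e3] at h2
  rw [h2, Finset.mul_sum]
  refine Finset.sum_congr rfl fun k _ => ?_
  ring

/-- The signs in `ent` turn the bracket of `g ⊗ P(ḡ)` with an even element into a commutator of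
matrices over `P(ḡ)`. -/
theorem ent_gBr {q : ZMod 2} {x y : B → PA} (hx : GHom 0 x) (hy : GHom q y) :
    ent x * ent y - ent y * ent x = ent (gBr x y) := by
  ext1 i j
  have e1 : (ent x * ent y) i j = ∑ b, ∑ c, (∑ k, ((b.mat i k : ℂ) * sgn (vpar k * (0 + b.par))) *
      ((c.mat k j : ℂ) * sgn (vpar j * (q + c.par)))) • (x b * y c) := by
    simp only [Matrix.mul_apply, ent_of_GHom hx, ent_of_GHom hy, Finset.sum_mul_sum,
      smul_mul_smul_comm, Finset.sum_smul]
    rw [Finset.sum_comm]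
    exact Finset.sum_congr rfl fun b _ => Finset.sum_comm
  have e2 : (ent y * ent x) i j = ∑ b, ∑ c, ((∑ k, ((c.mat i k : ℂ) * sgn (vpar k * (q + c.par))) *
      ((b.mat k j : ℂ) * sgn (vpar j * (0 + b.par)))) * sgn ((q + c.par) * (0 + b.par))) •
        (x b * y c) := by
    simp only [Matrix.mul_apply, ent_of_GHom hx, ent_of_GHom hy, Finset.sum_mul_sum,
      smul_mul_smul_comm]
    simp only [Finset.sum_mul, Finset.sum_smul]
    rw [Finset.sum_congr rfl fun k _ => Finset.sum_comm, Finset.sum_comm]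
    refine Finset.sum_congr rfl fun b _ => ?_
    rw [Finset.sum_comm]
    refine Finset.sum_congr rfl fun c _ => Finset.sum_congr rfl fun k _ => ?_
    rw [homog_comm (hy c) (hx b), smul_smul]
  have e3 : ent (gBr x y) i j = ∑ b, ∑ c, (∑ k : B, (k.mat i j : ℂ) * ((struc b c k : ℂ) *
      sgn (c.par * (0 + b.par)) * sgn (vpar j * (0 + b.par + (q + c.par))))) • (x b * y c) := by
    simp only [ent, Matrix.of_apply, gBr, map_sum, map_smul, Finset.smul_sum, Finset.sum_smul]
    rw [Finset.sum_comm]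
    refine Finset.sum_congr rfl fun b _ => ?_
    rw [Finset.sum_comm]
    refine Finset.sum_congr rfl fun c _ => Finset.sum_congr rfl fun k _ => ?_
    rw [sigmaPow_of_isHomog (hx b), smul_mul_assoc, map_smul,
      sigmaPow_of_isHomog ((hx b).mul (hy c)), smul_smul, smul_smul, smul_smul]
    congr 1
    ring
  rw [Matrix.sub_apply, e1, e2, e3, ← Finset.sum_sub_distrib]
  refine Finset.sum_congr rfl fun b _ => ?_
  rw [← Finset.sum_sub_distrib]
  refine Finset.sum_congr rfl fun c _ => ?_
  rw [← sub_smul]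
  congr 1
  exact bracket_scalars q b c i j

/-- The commutator with an even element. -/
theorem rep_gBr {q : ZMod 2} {x y : B → PA} (hx : GHom 0 x) (hy : GHom q y) :
    rep x * rep y - rep y * rep x = rep (gBr x y) := by
  rw [rep, rep, rep, ← ent_gBr hx hy, ← Matrix.map_mul, ← Matrix.map_mul,
    ← Matrix.map_sub _ (fun a b => map_sub lm a b)]

theorem GHom.gBr {q : ZMod 2} {x y : B → PA} (hx : GHom 0 x) (hy : GHom q y) :
    GHom q (SuperDS.gBr x y) := by
  have key : ∀ i j k : B, struc i j k ≠ 0 → i.par + j.par = k.par := by decide +kernel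
  intro k
  refine IsHomog.sum _ _ fun i _ => IsHomog.sum _ _ fun j _ => ?_
  by_cases h : struc i j k = 0
  · simpa [h] using IsHomog.zero _
  · refine IsHomog.smul _ ?_
    convert ((hx i).sigmaPow j.par).mul (hy j) using 1
    rw [← key i j k h]
    ring

theorem GHom.gD {q : ZMod 2} {x : B → PA} (hx : GHom q x) : GHom (q + 1) (SuperDS.gD x) := by
  intro k
  refine IsHomog.smul _ ?_
  convert (hx k).D using 1
  ring

theorem GHom.sub {q : ZMod 2} {x y : B → PA} (hx : GHom q x) (hy : GHom q y) : GHom q (x - y) :=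
  fun b => (hx b).sub (hy b)

theorem GHom.add {q : ZMod 2} {x y : B → PA} (hx : GHom q x) (hy : GHom q y) : GHom q (x + y) :=
  fun b => (hx b).add (hy b)

theorem GHom.smul {q : ZMod 2} {x : B → PA} (c : ℂ) (hx : GHom q x) : GHom q (c • x) :=
  fun b => (hx b).smul c

theorem GHom.zero (q : ZMod 2) : GHom q 0 := fun _ => IsHomog.zero _

/-- The operator `D`, which acts by `D (e_i ⊗ u) = (-1)^{p(e_i)} e_i ⊗ D u`. -/
def Dhat : Op := Matrix.diagonal fun i => sgn (vpar i) • opE D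

/-- The super Leibniz rule as an identity of operators. -/
theorem D_mul_lm {p : ZMod 2} {u : PA} (hu : IsHomog p u) :
    opE D * lm u = lm (D u) + sgn p • (lm u * opE D) := by
  apply opE_injective
  apply LinearMap.ext
  intro v
  change D (u * v) = D u * v + sgn p • (u * D v)
  rw [isSuperDer_D.leib, sigmaPow_one, hu, smul_mul_assoc]

theorem Dhat_commutator_apply {m : Matrix (Fin 4) (Fin 4) PA}
    (hm : ∀ i j, IsHomog (vpar i + vpar j) (m i j)) (i j : Fin 4) :
    (Dhat * m.map lm - m.map lm * Dhat) i j = sgn (vpar i) • lm (D (m i j)) := by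
  rw [Matrix.sub_apply, Dhat, Matrix.diagonal_mul, Matrix.mul_diagonal, Matrix.map_apply,
    smul_mul_assoc, D_mul_lm (hm i j), mul_smul_comm, smul_add, smul_smul, ← sgn_add, ← add_assoc,
    CharTwo.add_self_eq_zero, zero_add, add_sub_cancel_right]

/-- The action of `D` on even elements of `g ⊗ P(ḡ)` is the commutator with the operator `D`. -/
theorem rep_gD {x : B → PA} (hx : GHom 0 x) :
    Dhat * rep x - rep x * Dhat = rep (gD x) := by
  have hm : ∀ i j, IsHomog (vpar i + vpar j) (ent x i j) := fun i j => by
    simpa using isHomog_ent hx i j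
  ext1 i j
  rw [rep, Dhat_commutator_apply hm, rep_apply, ← map_smul]
  congr 1
  have hD := GHom.gD hx
  rw [ent_of_GHom hD, ent_of_GHom hx, map_sum, Finset.smul_sum]
  refine Finset.sum_congr rfl fun b _ => ?_
  by_cases h : b.mat i j = 0
  · simp [h]
  · rw [gD, map_smul, smul_smul, smul_smul]
    congr 1
    rw [(mat_ne_zero_par b i j h).1]
    have : sgn (vpar i) * sgn (vpar j * (0 + (vpar i + vpar j))) =
        sgn (vpar j * (0 + 1 + (vpar i + vpar j))) * sgn (vpar i + vpar j) := by
      rw [← sgn_add, ← sgn_add]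
      congr 1
      generalize vpar i = p, vpar j = q
      revert p q
      decide
    linear_combination (b.mat i j : ℂ) * this

/-! ### Loops as power series of operators -/

/-- The power series `∑ ζ^k x_k` of operators, for `x_k ∈ g ⊗ P(ḡ)`. -/
def gser (x : ℕ → B → PA) : Ser := PowerSeries.mk fun k => rep (x k)

theorem coeff_gser (x : ℕ → B → PA) (k : ℕ) : coeff k (gser x) = rep (x k) := coeff_mk _ _

theorem gser_injective : Function.Injective gser := by
  intro x y h
  funext k
  apply rep_injective
  rw [← coeff_gser, h, coeff_gser]

/-- The degree of the component `b ⊗ u ζ^k` is `deg b + 2 k`; by linear independence of the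
matrices of the basis the filtration of series is that of their components. -/
theorem gser_mem_Fil {d : ℤ} {x : ℕ → B → PA} :
    gser x ∈ Ser.Fil d ↔ ∀ (k : ℕ) (b : B), b.deg + 2 * k < d → x k b = 0 := by
  constructor
  · intro h k b hb
    set y : B → PA := fun c => if c.deg + 2 * k < d then x k c else 0 with hy
    have : rep y = 0 := by
      ext1 i j
      by_cases hd : vdeg i - vdeg j + 2 * k < d
      · have h1 := h k i j hd
        rw [coeff_gser, rep_apply] at h1
        rw [rep_apply, Matrix.zero_apply, ← h1]
        congr 1
        rw [ent, ent, Matrix.of_apply, Matrix.of_apply]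
        refine Finset.sum_congr rfl fun c _ => ?_
        by_cases hc : c.mat i j = 0
        · simp [hc]
        · rw [hy]
          simp only
          rw [(mat_ne_zero_par c i j hc).2, if_pos hd]
      · rw [rep_apply, ent, Matrix.of_apply]
        rw [Finset.sum_eq_zero, map_zero, Matrix.zero_apply]
        intro c _
        by_cases hc : c.mat i j = 0
        · simp [hc]
        · rw [hy]
          simp only
          rw [(mat_ne_zero_par c i j hc).2, if_neg hd, map_zero, smul_zero]
    have h0 := congrFun (rep_injective (this.trans rep_zero.symm)) b
    simpa [hy, hb] using h0
  · intro h k i j hd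
    rw [coeff_gser, rep_apply, ent, Matrix.of_apply, Finset.sum_eq_zero, map_zero]
    intro b _
    by_cases hc : b.mat i j = 0
    · simp [hc]
    · rw [h k b (by rw [(mat_ne_zero_par b i j hc).2]; exact hd), map_zero, smul_zero]

/-- The coefficients of a loop, with the index shifted by `s`. -/
def lcoef (s : ℤ) (X : Loop) : ℕ → B → PA := fun k b => (X b).coeff (k - s)

/-- `ζ^s X` as a power series of operators. -/
def ser (s : ℤ) (X : Loop) : Ser := gser (lcoef s X)

/-- `X` has no components below `ζ^{-s}`. -/
def LowBd (s : ℤ) (X : Loop) : Prop := ∀ (b : B) (k : ℤ), k < -s → (X b).coeff k = 0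

theorem LowBd.ext {s : ℤ} {X Y : Loop} (hX : LowBd s X) (hY : LowBd s Y)
    (h : lcoef s X = lcoef s Y) : X = Y := by
  funext b
  ext k
  by_cases hk : k < -s
  · rw [hX b k hk, hY b k hk]
  · obtain ⟨n, hn⟩ := Int.eq_ofNat_of_zero_le (show 0 ≤ k + s by omega)
    have := congrFun (congrFun h n) b
    simp only [lcoef] at this
    rwa [← hn, add_sub_cancel_right] at this

theorem hahn_coeff_mul {x y : HahnSeries ℤ PA} {s : ℤ} (hx : ∀ k < 0, x.coeff k = 0)
    (hy : ∀ k < -s, y.coeff k = 0) (n : ℕ) : (x * y).coeff (n - s) =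
      ∑ ab ∈ Finset.HasAntidiagonal.antidiagonal n, x.coeff ab.1 * y.coeff (ab.2 - s) := by
  rw [HahnSeries.coeff_mul]
  refine Finset.sum_bij_ne_zero (fun ab _ _ => (ab.1.toNat, (ab.2 + s).toNat)) ?_ ?_ ?_ ?_
  · rintro ⟨a, b⟩ h hne
    simp only [Finset.mem_antidiagonal] at h
    have ha : 0 ≤ a := by
      by_contra hc
      exact hne (by simp [hx a (by omega)])
    have hb : -s ≤ b := by
      by_contra hc
      exact hne (by simp [hy b (by omega)])
    simp only [Finset.HasAntidiagonal.mem_antidiagonal]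
    omega
  · rintro ⟨a, b⟩ h hne ⟨a', b'⟩ h' hne' heq
    have ha : 0 ≤ a := by
      by_contra hc
      exact hne (by simp [hx a (by omega)])
    have hb : -s ≤ b := by
      by_contra hc
      exact hne (by simp [hy b (by omega)])
    have ha' : 0 ≤ a' := by
      by_contra hc
      exact hne' (by simp [hx a' (by omega)])
    have hb' : -s ≤ b' := by
      by_contra hc
      exact hne' (by simp [hy b' (by omega)])
    simp only [Prod.mk.injEq] at heq ⊢
    omega
  · rintro ⟨a, b⟩ h hne
    refine ⟨((a : ℤ), (b : ℤ) - s), ?_, hne, ?_⟩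
    · simp only [Finset.HasAntidiagonal.mem_antidiagonal] at h
      simp only [Finset.mem_antidiagonal, HahnSeries.mem_support]
      refine ⟨fun h0 => hne (by simp [h0]), fun h0 => hne (by simp [h0]), ?_⟩
      rw [← h]
      push_cast
      ring
    · simp
  · rintro ⟨a, b⟩ h hne
    have ha : 0 ≤ a := by
      by_contra hc
      exact hne (by simp [hx a (by omega)])
    have hb : -s ≤ b := by
      by_contra hc
      exact hne (by simp [hy b (by omega)])
    have e1 : ((a.toNat : ℕ) : ℤ) = a := Int.toNat_of_nonneg ha
    have e2 : (((b + s).toNat : ℕ) : ℤ) = b + s := Int.toNat_of_nonneg (by omega)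
    simp only [e1, e2, add_sub_cancel_right]

/-- The product of a series without terms below `ζ^0` and one without terms below `ζ^{-s}` has no
terms below `ζ^{-s}`. -/
theorem hahn_coeff_mul_low {x y : HahnSeries ℤ PA} {s : ℤ} (hx : ∀ k < 0, x.coeff k = 0)
    (hy : ∀ k < -s, y.coeff k = 0) (n : ℤ) (hn : n < -s) : (x * y).coeff n = 0 := by
  rw [HahnSeries.coeff_mul]
  refine Finset.sum_eq_zero ?_
  rintro ⟨a, b⟩ h
  simp only [Finset.mem_antidiagonal] at h
  by_cases ha : a < 0
  · simp [hx a ha]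
  · simp [hy b (by omega)]

theorem loopBracket_coeff (X Y : Loop) (k : B) (n : ℤ) : (loopBracket X Y k).coeff n =
    ∑ i : B, ∑ j : B, (struc i j k : ℂ) •
      ((X i).map (sigmaPow (par := barPar) j.par) * Y j).coeff n := by
  rw [loopBracket, HahnSeries.coeff_sum]
  refine Finset.sum_congr rfl fun i _ => ?_
  rw [HahnSeries.coeff_sum]
  rfl

theorem lcoef_loopBracket {s : ℤ} {T X : Loop} (hT : LowBd 0 T) (hX : LowBd s X) (n : ℕ) :
    lcoef s (loopBracket T X) n = ∑ ab ∈ Finset.HasAntidiagonal.antidiagonal n,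
      gBr (lcoef 0 T ab.1) (lcoef s X ab.2) := by
  funext k
  rw [lcoef, loopBracket_coeff, Finset.sum_apply]
  simp only [gBr]
  symm
  rw [Finset.sum_comm]
  refine Finset.sum_congr rfl fun i _ => ?_
  rw [Finset.sum_comm]
  refine Finset.sum_congr rfl fun j _ => ?_
  symm
  rw [hahn_coeff_mul (s := s) _ (fun k hk => hX j k hk), Finset.smul_sum]
  · simp [lcoef]
  · intro l hl
    rw [HahnSeries.map_coeff, hT i l (by simpa using hl), map_zero]

theorem LowBd.loopBracket {s : ℤ} {T X : Loop} (hT : LowBd 0 T) (hX : LowBd s X) :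
    LowBd s (SuperDS.loopBracket T X) := by
  intro b k hk
  rw [loopBracket_coeff]
  refine Finset.sum_eq_zero fun i _ => Finset.sum_eq_zero fun j _ => ?_
  rw [hahn_coeff_mul_low (s := s) _ (fun k hk => hX j k hk) _ hk, smul_zero]
  intro l hl
  rw [HahnSeries.map_coeff, hT i l (by simpa using hl), map_zero]

theorem Loop.IsHomog.lcoef {q : ZMod 2} {X : Loop} (hX : X.IsHomog q) (s : ℤ) (n : ℕ) :
    GHom q (SuperDS.lcoef s X n) := fun b => hX b _

theorem isHomog_of_lcoef {q : ZMod 2} {s : ℤ} {X : Loop} (hX : LowBd s X)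
    (h : ∀ n, GHom q (lcoef s X n)) : X.IsHomog q := by
  intro b k
  by_cases hk : k < -s
  · rw [hX b k hk]
    exact IsHomog.zero _
  · obtain ⟨n, hn⟩ := Int.eq_ofNat_of_zero_le (show 0 ≤ k + s by omega)
    have := h n b
    simp only [lcoef] at this
    rwa [← hn, add_sub_cancel_right] at this

theorem ser_loopBracket {q : ZMod 2} {s : ℤ} {T X : Loop} (hT : LowBd 0 T) (hX : LowBd s X)
    (hT' : T.IsHomog 0) (hX' : X.IsHomog q) :
    ser s (loopBracket T X) = Ser.adS (ser 0 T) (ser s X) := by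
  ext1 n
  rw [ser, coeff_gser, lcoef_loopBracket hT hX, rep_sum, Ser.adS, map_sub, coeff_mul, coeff_mul,
    ← Finset.Nat.sum_antidiagonal_swap, ← Finset.Nat.sum_antidiagonal_swap (n := n)
      (f := fun p => coeff p.1 (ser s X) * coeff p.2 (ser 0 T)), ← Finset.sum_sub_distrib]
  rw [← Finset.Nat.sum_antidiagonal_swap]
  refine Finset.sum_congr rfl fun ab _ => ?_
  rw [← rep_gBr (hT'.lcoef 0 _) (hX'.lcoef s _)]
  simp [ser, coeff_gser]

theorem homog_loopBracket {q : ZMod 2} {s : ℤ} {T X : Loop} (hT : LowBd 0 T) (hX : LowBd s X)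
    (hT' : T.IsHomog 0) (hX' : X.IsHomog q) : (loopBracket T X).IsHomog q := by
  apply isHomog_of_lcoef (hT.loopBracket hX)
  intro n
  rw [lcoef_loopBracket hT hX]
  intro b
  rw [Finset.sum_apply]
  exact IsHomog.sum _ _ fun ab _ => (hT'.lcoef 0 _).gBr (hX'.lcoef s _) b

/-- All components of `T` have positive degree. -/
def PosDeg (T : Loop) : Prop := ∀ (b : B) (k : ℤ), (T b).coeff k ≠ 0 → 0 < b.deg + 2 * k

theorem deg_le_one : ∀ b : B, b.deg ≤ 1 := by decide

theorem PosDeg.lowBd {T : Loop} (hT : PosDeg T) : LowBd 0 T := by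
  intro b k hk
  by_contra h
  have := hT b k h
  have := deg_le_one b
  omega

theorem PosDeg.mem_Fil {T : Loop} (hT : PosDeg T) : ser 0 T ∈ Ser.Fil 1 := by
  rw [ser, gser_mem_Fil]
  intro k b hk
  by_contra h
  have := hT b (k - 0) h
  omega

/-- The operator `ζ (D + X)`, where `X` has no components below `ζ⁻¹`. -/
def LX (X : Loop) : Ser := PowerSeries.X * C Dhat + ser 1 X

theorem C_Dhat_mem : (C Dhat : Ser) ∈ Ser.Fil 0 := by
  apply Ser.C_mem_Fil
  intro i j h
  rw [Dhat, Matrix.diagonal_apply_ne]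
  rintro rfl
  simp at h

theorem X_mul_Dhat_mem : (PowerSeries.X * C Dhat : Ser) ∈ Ser.Fil 2 := by
  have := (Ser.X_mul_mem_Fil_iff (d := 0)).2 C_Dhat_mem
  simpa using this

theorem LX_mem {X : Loop} {d : ℤ} (hd : d ≤ 2) (hX : ser 1 X ∈ Ser.Fil d) : LX X ∈ Ser.Fil d :=
  add_mem (Ser.Fil_anti hd X_mul_Dhat_mem) hX

theorem adS_Dhat {T : Loop} (hT : LowBd 0 T) (hT' : T.IsHomog 0) :
    Ser.adS (ser 0 T) (PowerSeries.X * C Dhat) = -ser 1 (loopD T) := by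
  have h0 : ser 1 (loopD T) = PowerSeries.X * gser fun n => gD (lcoef 0 T n) := by
    ext1 n
    rw [ser, coeff_gser]
    cases n with
    | zero =>
      rw [coeff_zero_X_mul, ← rep_zero]
      congr 1
      funext b
      simp only [lcoef, loopD, HahnSeries.coeff_smul, HahnSeries.map_coeff]
      rw [hT b _ (by simp), map_zero, smul_zero]
      rfl
    | succ n =>
      rw [coeff_succ_X_mul, coeff_gser]
      congr 1
      funext b
      simp only [lcoef, loopD, HahnSeries.coeff_smul, HahnSeries.map_coeff, gD]
      have e : ((n + 1 : ℕ) : ℤ) - 1 = (n : ℤ) - 0 := by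
        push_cast
        ring
      rw [e]
  rw [h0, Ser.adS, ← mul_assoc, PowerSeries.commute_X (ser 0 T), mul_assoc, mul_assoc, ← mul_sub,
    ← mul_neg]
  congr 1
  ext1 n
  rw [map_sub, coeff_mul_C, coeff_C_mul, map_neg, coeff_gser, ser, coeff_gser,
    ← rep_gD (hT'.lcoef 0 n), neg_sub]

theorem loopD_lowBd {T : Loop} (hT : LowBd 0 T) : LowBd 0 (loopD T) := by
  intro b k hk
  simp only [loopD, HahnSeries.coeff_smul, HahnSeries.map_coeff]
  rw [hT b k hk, map_zero, smul_zero]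

theorem loopD_homog {T : Loop} {q : ZMod 2} (hT : T.IsHomog q) : (loopD T).IsHomog (q + 1) := by
  intro b k
  simp only [loopD, HahnSeries.coeff_smul, HahnSeries.map_coeff]
  refine IsHomog.smul _ ?_
  convert (hT b k).D using 1
  ring

theorem ser_sub (s : ℤ) (X Y : Loop) : ser s (X - Y) = ser s X - ser s Y := by
  ext1 n
  rw [map_sub, ser, ser, ser, coeff_gser, coeff_gser, coeff_gser, ← rep_sub]
  rfl

/-- The iterates of `ad T` on `D + X`. The coefficient of `D` survives only in the term of order
zero, and the remaining part is an iterated commutator of power series. -/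
theorem adOp_iterate {T X : Loop} (hT : PosDeg T) (hT' : T.IsHomog 0) (hX : LowBd 1 X)
    (hX' : X.IsHomog 1) (h : ℕ) :
    LowBd 1 ((adOp T)^[h] (1, X)).2 ∧ ((adOp T)^[h] (1, X)).2.IsHomog 1 ∧
      ((adOp T)^[h] (1, X)).1 = (if h = 0 then 1 else 0) ∧
      ser 1 ((adOp T)^[h] (1, X)).2 = (Ser.adS (ser 0 T))^[h] (LX X) -
        (if h = 0 then PowerSeries.X * C Dhat else 0) := by
  have hT0 := hT.lowBd
  induction h with
  | zero => exact ⟨hX, hX', rfl, by simp [LX]⟩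
  | succ h ih =>
    obtain ⟨h1, h2, h3, h4⟩ := ih
    rw [Function.iterate_succ_apply', Function.iterate_succ_apply']
    simp only [adOp, h3]
    have hD : LowBd 1 (loopD T) := fun b k hk => loopD_lowBd hT0 b k (by omega)
    refine ⟨?_, ?_, by simp, ?_⟩
    · intro b k hk
      simp only [Pi.sub_apply, Pi.smul_apply, HahnSeries.coeff_sub, HahnSeries.coeff_smul]
      rw [hT0.loopBracket h1 b k hk, hD b k hk, smul_zero, sub_zero]
    · intro b k
      simp only [Pi.sub_apply, Pi.smul_apply, HahnSeries.coeff_sub, HahnSeries.coeff_smul]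
      exact (homog_loopBracket hT0 h1 hT' h2 b k).sub ((loopD_homog hT' b k).smul _)
    · rw [ser_sub, ser_loopBracket hT0 h1 hT' h2, h4]
      -- The first application of `ad T` also produces `[T, D] = -D T`.
      by_cases hh : h = 0
      · subst hh
        have e := adS_Dhat hT0 hT'
        simp only [if_true, one_smul, Function.iterate_zero, id, zero_add, one_ne_zero, if_false,
          sub_zero]
        rw [← neg_eq_iff_eq_neg] at e
        rw [← e, Ser.adS, Ser.adS, Ser.adS]
        noncomm_ring
      · have e : ser 1 ((0 : ℂ) • loopD T) = 0 := by
          have e0 : (0 : ℂ) • loopD T = 0 := by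
            funext b
            ext k
            rw [Pi.smul_apply, HahnSeries.coeff_smul, zero_smul]
            rfl
          rw [e0]
          ext1 n
          rw [ser, coeff_gser, map_zero, ← rep_zero]
          rfl
        simp [hh, e]

/-! ### The exponential of the adjoint action as a conjugation -/

section ExpAd

variable {T X Y : Loop}

/-- The coefficients of `e^{ad T} (D + X) - D`, with the index shifted by one. -/
def expCoef (T X : Loop) (n : ℕ) : B → PA :=
  ∑ h ∈ Finset.range (2 * n + 2), ((h.factorial : ℂ)⁻¹) • lcoef 1 ((adOp T)^[h] (1, X)).2 n

theorem rep_lcoef_adOp (hT : PosDeg T) (hT' : T.IsHomog 0) (hX : LowBd 1 X) (hX' : X.IsHomog 1)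
    (h n : ℕ) : rep (lcoef 1 ((adOp T)^[h] (1, X)).2 n) =
      coeff n ((Ser.adS (ser 0 T))^[h] (LX X)) -
        (if h = 0 then coeff n (PowerSeries.X * C Dhat : Ser) else 0) := by
  have := (adOp_iterate hT hT' hX hX' h).2.2.2
  rw [← coeff_gser, ← ser, this, map_sub]
  split_ifs <;> simp

/-- The iterates of `ad T` raise the degree, so each coefficient of `e^{ad T} (D + X)` is a finite
sum. -/
theorem lcoef_adOp_eq_zero (hT : PosDeg T) (hT' : T.IsHomog 0) (hX : LowBd 1 X)
    (hX' : X.IsHomog 1) (hX0 : ser 1 X ∈ Ser.Fil 0) {h n : ℕ} (hh : 2 * n + 2 ≤ h) :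
    lcoef 1 ((adOp T)^[h] (1, X)).2 n = 0 := by
  apply rep_injective
  rw [rep_lcoef_adOp hT hT' hX hX', if_neg (by omega), rep_zero, sub_zero]
  have := Ser.iterate_adS_mem hT.mem_Fil (LX_mem (by norm_num) hX0) h
  rw [add_zero] at this
  exact Ser.coeff_eq_zero_of_mem_Fil this hh

/-- The series `e^{ad T} (D + X)` computed with operators. -/
theorem gser_expCoef (hT : PosDeg T) (hT' : T.IsHomog 0) (hX : LowBd 1 X) (hX' : X.IsHomog 1)
    (hX0 : ser 1 X ∈ Ser.Fil 0) : PowerSeries.X * C Dhat + gser (expCoef T X) =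
      Ser.fsum fun h => ((h.factorial : ℂ)⁻¹) • (Ser.adS (ser 0 T))^[h] (LX X) := by
  ext1 n
  rw [Ser.coeff_fsum (Ser.adm_ad hT.mem_Fil (LX_mem (by norm_num) hX0)) n _ le_rfl, map_add,
    coeff_gser, expCoef, rep_sum]
  simp only [rep_smul, rep_lcoef_adOp hT hT' hX hX', smul_sub, Finset.sum_sub_distrib]
  rw [Finset.sum_eq_single_of_mem (a := 0) (by simp) (f := fun h : ℕ => ((h.factorial : ℂ)⁻¹) •
    (if h = 0 then coeff n (PowerSeries.X * C Dhat : Ser) else 0))]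
  · simp
  · intro h _ hh
    rw [if_neg hh, smul_zero]

/-- The sums in the exponential of the adjoint action are finite, with the values `expCoef`. -/
theorem expAd_coeff (hT : PosDeg T) (hT' : T.IsHomog 0) (hX : LowBd 1 X) (hX' : X.IsHomog 1)
    (hX0 : ser 1 X ∈ Ser.Fil 0) (b : B) (n : ℕ) :
    (Function.support fun h : ℕ => (((adOp T)^[h] (1, X)).2 b).coeff ((n : ℤ) - 1)).Finite ∧
    ∑ᶠ h : ℕ, ((h.factorial : ℂ)⁻¹) • (((adOp T)^[h] (1, X)).2 b).coeff ((n : ℤ) - 1) =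
      expCoef T X n b := by
  have hs : ∀ h, (((adOp T)^[h] (1, X)).2 b).coeff ((n : ℤ) - 1) ≠ 0 → h < 2 * n + 2 := by
    intro h hh
    by_contra hc
    exact hh (congrFun (lcoef_adOp_eq_zero hT hT' hX hX' hX0 (not_lt.1 hc)) b)
  constructor
  · exact (Finset.finite_toSet (Finset.range (2 * n + 2))).subset fun h hh => by
      simpa using hs h hh
  · rw [finsum_eq_sum_of_support_subset (s := Finset.range (2 * n + 2)), expCoef, Finset.sum_apply]
    · rfl
    · intro h hh
      have := hs h fun h0 => hh (by simp only [h0, smul_zero])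
      simpa using this

theorem ExpAd.lowBd (hT : PosDeg T) (hT' : T.IsHomog 0) (hX : LowBd 1 X) (hX' : X.IsHomog 1)
    (h : ExpAd T X Y) : LowBd 1 Y := by
  intro b k hk
  rw [← (h b k).2]
  apply finsum_eq_zero_of_forall_eq_zero
  intro n
  rw [(adOp_iterate hT hT' hX hX' n).1 b k hk, smul_zero]

theorem expAd_iff_expCoef (hT : PosDeg T) (hT' : T.IsHomog 0) (hX : LowBd 1 X) (hX' : X.IsHomog 1)
    (hX0 : ser 1 X ∈ Ser.Fil 0) (hY : LowBd 1 Y) : ExpAd T X Y ↔ lcoef 1 Y = expCoef T X := by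
  constructor
  · intro h
    funext n b
    rw [← (expAd_coeff hT hT' hX hX' hX0 b n).2]
    exact (h b _).2.symm
  · intro h b k
    by_cases hk : k < -1
    · have hz : ∀ n, (((adOp T)^[n] (1, X)).2 b).coeff k = 0 := fun n =>
        (adOp_iterate hT hT' hX hX' n).1 b k hk
      constructor
      · convert Set.finite_empty
        ext n
        simp [hz]
      · rw [hY b k hk]
        exact finsum_eq_zero_of_forall_eq_zero fun n => by rw [hz, smul_zero]
    · obtain ⟨n, hn⟩ := Int.eq_ofNat_of_zero_le (show 0 ≤ k + 1 by omega)
      obtain rfl : k = (n : ℤ) - 1 := by omega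
      refine ⟨(expAd_coeff hT hT' hX hX' hX0 b n).1, ?_⟩
      rw [(expAd_coeff hT hT' hX hX' hX0 b n).2, ← h]
      rfl

/-- `e^{ad T} (D + X) = D + Y` is the conjugation of `ζ (D + X)` into `ζ (D + Y)` by `e^T`. -/
theorem expAd_iff (hT : PosDeg T) (hT' : T.IsHomog 0) (hX : LowBd 1 X) (hX' : X.IsHomog 1)
    (hX0 : ser 1 X ∈ Ser.Fil 0) (hY : LowBd 1 Y) :
    ExpAd T X Y ↔ Ser.expSer (ser 0 T) * LX X = LX Y * Ser.expSer (ser 0 T) := by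
  rw [expAd_iff_expCoef hT hT' hX hX' hX0 hY, Ser.expSer_mul hT.mem_Fil (LX_mem (by norm_num) hX0),
    ← gser_expCoef hT hT' hX hX' hX0]
  constructor
  · intro h
    rw [← h]
    rfl
  · intro h
    have h2 := congrArg (fun M => M * Ser.expSer (-ser 0 T)) h
    simp only [mul_assoc, Ser.expSer_mul_expSer_neg hT.mem_Fil, mul_one] at h2
    apply gser_injective
    exact (add_left_cancel h2).symm

end ExpAd

/-! ### Brackets in components -/

/-- The nonzero structure constants. -/
def strucT : B → B → B → ℚ
  | .f3, .h1, .f3 => 2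
  | .f3, .h2, .f3 => 2
  | .h1, .f3, .f3 => -2
  | .h2, .f3, .f3 => -2
  | .f1, .f2, .f3 => 1
  | .f2, .f1, .f3 => 1
  | .f3, .e1, .f2 => 2
  | .h1, .f2, .f2 => -2
  | .e1, .f3, .f2 => -2
  | .f2, .h1, .f2 => 2
  | .f3, .e2, .f1 => 2
  | .h2, .f1, .f1 => -2
  | .e2, .f3, .f1 => -2
  | .f1, .h2, .f1 => 2
  | .f3, .e3, .h1 => 2
  | .e3, .f3, .h1 => -2
  | .e1, .f1, .h1 => 1
  | .f1, .e1, .h1 => 1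
  | .f3, .e3, .h2 => 2
  | .e3, .f3, .h2 => -2
  | .e2, .f2, .h2 => 1
  | .f2, .e2, .h2 => 1
  | .h2, .e1, .e1 => 2
  | .e3, .f2, .e1 => -2
  | .e1, .h2, .e1 => -2
  | .f2, .e3, .e1 => 2
  | .h1, .e2, .e2 => 2
  | .e3, .f1, .e2 => -2
  | .e2, .h1, .e2 => -2
  | .f1, .e3, .e2 => 2
  | .h1, .e3, .e3 => 2
  | .h2, .e3, .e3 => 2
  | .e3, .h1, .e3 => -2
  | .e3, .h2, .e3 => -2
  | .e1, .e2, .e3 => 1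
  | .e2, .e1, .e3 => 1
  | _, _, _ => 0

theorem struc_eq (i j k : B) : struc i j k = strucT i j k := by
  revert i j k
  decide +kernel

/-- The nonzero values of the invariant form. -/
def formT : B → B → ℚ
  | .f3, .e3 => 4
  | .e3, .f3 => 4
  | .h1, .h2 => -4
  | .h2, .h1 => -4
  | .e1, .f1 => -2
  | .e2, .f2 => -2
  | .f1, .e1 => 2
  | .f2, .e2 => 2
  | _, _ => 0

theorem form_eq (i j : B) : form i j = formT i j := by
  revert i j
  decide +kernel

theorem gBr_f3 {x : B → PA} (hx : GHom 0 x) (y : B → PA) : gBr x y .f3 =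
    (2 : ℂ) • (x .f3 * y .h1) + (2 : ℂ) • (x .f3 * y .h2) - (2 : ℂ) • (x .h1 * y .f3)
    - (2 : ℂ) • (x .h2 * y .f3) - x .f1 * y .f2 - x .f2 * y .f1 := by
  simp only [gBr, sum_B, struc_eq, strucT, fun i j => sigmaPow_of_isHomog (hx i) j, B.par, mul_zero,
    zero_mul, mul_one, zero_add, sgn_zero, sgn_one]
  push_cast
  simp only [zero_smul, one_smul, neg_smul, neg_mul]
  abel

theorem gBr_f2 {x : B → PA} (hx : GHom 0 x) (y : B → PA) : gBr x y .f2 =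
    (2 : ℂ) • (x .f3 * y .e1) + (2 : ℂ) • (x .f2 * y .h1) - (2 : ℂ) • (x .h1 * y .f2)
    - (2 : ℂ) • (x .e1 * y .f3) := by
  simp only [gBr, sum_B, struc_eq, strucT, fun i j => sigmaPow_of_isHomog (hx i) j, B.par, mul_zero,
    zero_mul, mul_one, zero_add, sgn_zero, sgn_one]
  push_cast
  simp only [zero_smul, one_smul, neg_smul, neg_mul]
  abel

theorem gBr_f1 {x : B → PA} (hx : GHom 0 x) (y : B → PA) : gBr x y .f1 =
    (2 : ℂ) • (x .f3 * y .e2) + (2 : ℂ) • (x .f1 * y .h2) - (2 : ℂ) • (x .h2 * y .f1)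
    - (2 : ℂ) • (x .e2 * y .f3) := by
  simp only [gBr, sum_B, struc_eq, strucT, fun i j => sigmaPow_of_isHomog (hx i) j, B.par, mul_zero,
    zero_mul, mul_one, zero_add, sgn_zero, sgn_one]
  push_cast
  simp only [zero_smul, one_smul, neg_smul, neg_mul]
  abel

theorem gBr_h1 {x : B → PA} (hx : GHom 0 x) (y : B → PA) : gBr x y .h1 =
    (2 : ℂ) • (x .f3 * y .e3) - (2 : ℂ) • (x .e3 * y .f3) - x .e1 * y .f1
    - x .f1 * y .e1 := by
  simp only [gBr, sum_B, struc_eq, strucT, fun i j => sigmaPow_of_isHomog (hx i) j, B.par, mul_zero,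
    zero_mul, mul_one, zero_add, sgn_zero, sgn_one]
  push_cast
  simp only [zero_smul, one_smul, neg_smul, neg_mul]
  abel

theorem gBr_h2 {x : B → PA} (hx : GHom 0 x) (y : B → PA) : gBr x y .h2 =
    (2 : ℂ) • (x .f3 * y .e3) - (2 : ℂ) • (x .e3 * y .f3) - x .e2 * y .f2
    - x .f2 * y .e2 := by
  simp only [gBr, sum_B, struc_eq, strucT, fun i j => sigmaPow_of_isHomog (hx i) j, B.par, mul_zero,
    zero_mul, mul_one, zero_add, sgn_zero, sgn_one]
  push_cast
  simp only [zero_smul, one_smul, neg_smul, neg_mul]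
  abel

theorem gBr_e1 {x : B → PA} (hx : GHom 0 x) (y : B → PA) : gBr x y .e1 =
    (2 : ℂ) • (x .h2 * y .e1) + (2 : ℂ) • (x .f2 * y .e3) - (2 : ℂ) • (x .e3 * y .f2)
    - (2 : ℂ) • (x .e1 * y .h2) := by
  simp only [gBr, sum_B, struc_eq, strucT, fun i j => sigmaPow_of_isHomog (hx i) j, B.par, mul_zero,
    zero_mul, mul_one, zero_add, sgn_zero, sgn_one]
  push_cast
  simp only [zero_smul, one_smul, neg_smul, neg_mul]
  abel

theorem gBr_e2 {x : B → PA} (hx : GHom 0 x) (y : B → PA) : gBr x y .e2 =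
    (2 : ℂ) • (x .h1 * y .e2) + (2 : ℂ) • (x .f1 * y .e3) - (2 : ℂ) • (x .e3 * y .f1)
    - (2 : ℂ) • (x .e2 * y .h1) := by
  simp only [gBr, sum_B, struc_eq, strucT, fun i j => sigmaPow_of_isHomog (hx i) j, B.par, mul_zero,
    zero_mul, mul_one, zero_add, sgn_zero, sgn_one]
  push_cast
  simp only [zero_smul, one_smul, neg_smul, neg_mul]
  abel

theorem gBr_e3 {x : B → PA} (hx : GHom 0 x) (y : B → PA) : gBr x y .e3 =
    (2 : ℂ) • (x .h1 * y .e3) + (2 : ℂ) • (x .h2 * y .e3) - (2 : ℂ) • (x .e3 * y .h1)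
    - (2 : ℂ) • (x .e3 * y .h2) - x .e1 * y .e2 - x .e2 * y .e1 := by
  simp only [gBr, sum_B, struc_eq, strucT, fun i j => sigmaPow_of_isHomog (hx i) j, B.par, mul_zero,
    zero_mul, mul_one, zero_add, sgn_zero, sgn_one]
  push_cast
  simp only [zero_smul, one_smul, neg_smul, neg_mul]
  abel

/-! ### The canonical form of the universal Lax operator -/

/-- The loop `∑ b ⊗ x b`, which does not depend on `z`. -/
def cst (x : B → PA) : Loop := fun b => HahnSeries.single 0 (x b)

theorem coeff_cst (x : B → PA) (b : B) (k : ℤ) : (cst x b).coeff k = if k = 0 then x b else 0 := by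
  rw [cst, HahnSeries.coeff_single]
  split_ifs <;> rfl

theorem coeff_el (b c : B) (m k : ℤ) (u : PA) :
    (el b m u c).coeff k = if c = b ∧ k = -m then u else 0 := by
  rw [el]
  by_cases hb : c = b
  · subst hb
    rw [Pi.single_eq_same, HahnSeries.coeff_single]
    simp
  · rw [Pi.single_eq_of_ne hb]
    simp [hb]

/-- The components of `Q_u + f ⊗ 1`. -/
def qv : B → PA
  | .f3 => 0
  | .h1 => -((1 / 4 : ℂ) • bar .h2)
  | .h2 => -((1 / 4 : ℂ) • bar .h1)
  | .e3 => (1 / 4 : ℂ) • bar .f3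
  | .e1 => -((1 / 2 : ℂ) • bar .f1)
  | .e2 => -((1 / 2 : ℂ) • bar .f2)
  | .f1 => (1 / 2 : ℂ) • bar .e1
  | .f2 => 1

/-- The components of `Q^c + f ⊗ 1`. -/
def cv (w : Fin 4 → PA) : B → PA
  | .f3 => 0
  | .h1 => w 1
  | .h2 => 0
  | .e3 => w 3
  | .e1 => 0
  | .e2 => w 2
  | .f1 => w 0
  | .f2 => 1

theorem Qu_add_fLoop : Qu + fLoop = cst qv := by
  funext b
  ext k
  simp only [Qu, fLoop, Pi.add_apply, Pi.sub_apply, HahnSeries.coeff_add, HahnSeries.coeff_sub,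
    coeff_el, coeff_cst]
  cases b <;> by_cases hk : k = 0 <;> simp [hk, qv]

theorem Qc_add_fLoop (w : Fin 4 → PA) : Qc w + fLoop = cst (cv w) := by
  funext b
  ext k
  simp only [Qc, fLoop, Pi.add_apply, HahnSeries.coeff_add, coeff_el, coeff_cst]
  cases b <;> by_cases hk : k = 0 <;> simp [hk, cv]

theorem isHomog_bar (b : B) : IsHomog (b.par + 1) (bar b) := by
  have := isHomog_letter (par := barPar) (b, 0)
  simpa [letterPar, barPar, bar] using this

theorem gHom_qv : GHom 1 qv := by
  have h2 : (1 : ZMod 2) + 1 = 0 := by decide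
  intro b
  cases b <;> simp only [qv, B.par, add_zero, h2]
  · exact IsHomog.zero _
  · exact ((isHomog_bar .h2).smul _).neg
  · exact ((isHomog_bar .h1).smul _).neg
  · exact (isHomog_bar .f3).smul _
  · exact ((isHomog_bar .f1).smul _).neg
  · exact ((isHomog_bar .f2).smul _).neg
  · exact (isHomog_bar .e1).smul _
  · exact isHomog_one

theorem lowBd_cst (x : B → PA) : LowBd 1 (cst x) := by
  intro b k hk
  rw [coeff_cst, if_neg (by omega)]

theorem ser_one_cst (x : B → PA) : ser 1 (cst x) = PowerSeries.X * C (rep x) := by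
  ext1 n
  rw [ser, coeff_gser]
  cases n with
  | zero =>
    rw [coeff_zero_X_mul, ← rep_zero]
    congr 1
    funext b
    rw [lcoef, coeff_cst, if_neg (by simp)]
    rfl
  | succ n =>
    rw [coeff_succ_X_mul, coeff_C]
    by_cases hn : n = 0
    · subst hn
      rw [if_pos rfl]
      congr 1
      funext b
      rw [lcoef, coeff_cst, if_pos (by simp)]
    · rw [if_neg hn, ← rep_zero]
      congr 1
      funext b
      rw [lcoef, coeff_cst, if_neg (by push_cast; omega)]
      rfl

theorem ser_zero_cst (x : B → PA) : ser 0 (cst x) = C (rep x) := by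
  ext1 n
  rw [ser, coeff_gser, coeff_C]
  by_cases hn : n = 0
  · subst hn
    rw [if_pos rfl]
    congr 1
    funext b
    rw [lcoef, coeff_cst, if_pos (by simp)]
  · rw [if_neg hn, ← rep_zero]
    congr 1
    funext b
    rw [lcoef, coeff_cst, if_neg (by omega)]
    rfl

theorem homog_cst {q : ZMod 2} {x : B → PA} (hx : GHom q x) : (cst x).IsHomog q := by
  intro b k
  rw [coeff_cst]
  split_ifs
  · exact hx b
  · exact IsHomog.zero _

theorem ser_one_cst_mem (x : B → PA) : ser 1 (cst x) ∈ Ser.Fil 1 := by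
  rw [ser_one_cst]
  exact (Ser.X_mul_mem_Fil_iff (d := -1)).2 (Ser.mem_Fil_neg_one _)

/-- `x` belongs to `n ⊗ P(ḡ)`. -/
def InN (x : B → PA) : Prop := ∀ b : B, ¬ b.inN → x b = 0

theorem InN.sub {x y : B → PA} (hx : InN x) (hy : InN y) : InN (x - y) := fun b hb => by
  rw [Pi.sub_apply, hx b hb, hy b hb, sub_zero]

theorem InN.add {x y : B → PA} (hx : InN x) (hy : InN y) : InN (x + y) := fun b hb => by
  rw [Pi.add_apply, hx b hb, hy b hb, add_zero]

theorem not_inN_f3 : ¬ B.f3.inN := by decide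
theorem not_inN_h1 : ¬ B.h1.inN := by decide
theorem not_inN_h2 : ¬ B.h2.inN := by decide
theorem not_inN_e1 : ¬ B.e1.inN := by decide
theorem not_inN_f1 : ¬ B.f1.inN := by decide
theorem not_inN_f2 : ¬ B.f2.inN := by decide

/-- Products of elements of `n` vanish in `sl(2|2)`, since `n` is the span of strictly upper triangular
blocks. -/
theorem rep_mul_rep_of_InN {x y : B → PA} (hx : InN x) (hy : InN y) : rep x * rep y = 0 := by
  ext1 i j
  rw [Matrix.mul_apply]
  refine Finset.sum_eq_zero fun k _ => ?_
  have key : ∀ {x : B → PA}, InN x → ∀ i k, vdeg i - vdeg k ≠ 1 → rep x i k = 0 := by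
    intro x hx i k hik
    rw [rep_apply, ent, Matrix.of_apply, Finset.sum_eq_zero, map_zero]
    intro b _
    by_cases hb : b.inN
    · by_cases hm : b.mat i k = 0
      · simp [hm]
      · exact absurd ((mat_ne_zero_par b i k hm).2.symm.trans hb) hik
    · rw [hx b hb, map_zero, smul_zero]
  by_cases h : vdeg i - vdeg k = 1
  · rw [key hy k j, mul_zero]
    have h0 : ∀ l, 0 ≤ vdeg l ∧ vdeg l ≤ 1 := by decide
    have := h0 i
    have := h0 k
    have := h0 j
    omega
  · rw [key hx i k h, zero_mul]

theorem posDeg_cst {x : B → PA} (hx : InN x) : PosDeg (cst x) := by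
  intro b k hk
  rw [coeff_cst] at hk
  have h0 : k = 0 := by
    by_contra h
    exact hk (if_neg h)
  have hb : b.deg = 1 := by
    by_contra h
    exact hk (by rw [hx b h, ite_self])
  omega

/-- The exponential of an element of `n`. -/
theorem expSer_of_InN {x : B → PA} (hx : InN x) :
    Ser.expSer (ser 0 (cst x)) = 1 + C (rep x) := by
  have hadm := Ser.adm_exp (posDeg_cst hx).mem_Fil
  rw [ser_zero_cst] at hadm ⊢
  have hp : ∀ h, 2 ≤ h → (C (rep x) : Ser) ^ h = 0 := by
    intro h hh
    obtain ⟨m, rfl⟩ := Nat.exists_eq_add_of_le hh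
    rw [pow_add, pow_two, ← map_mul, rep_mul_rep_of_InN hx hx, map_zero, zero_mul]
  ext1 k
  have hsub : Finset.range 2 ⊆ Finset.range (2 * k + 2) := by simp
  rw [Ser.expSer, Ser.coeff_fsum hadm k _ le_rfl, ← Finset.sum_subset hsub]
  · simp [Finset.sum_range_succ]
  · intro h _ hh
    rw [hp h (by simpa [Nat.lt_iff_add_one_le] using hh), smul_zero, map_zero]

/-- The image `e^{ad n} (D + x)` for `n ∈ n ⊗ P(ḡ)`, without the summand `D`. Terms of order three
and higher are absent: products of elements of `n` vanish in the matrix realisation, and `a² = 0`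
gives `(ad a)³ = 0`. -/
def gaugeT (n x : B → PA) : B → PA :=
  x + (gBr n x - gD n) + (1 / 2 : ℂ) • gBr n (gBr n x - gD n)

/-- A gauge transformation by `n` is conjugation by `1 + n`. -/
theorem gauge_conj {n x : B → PA} (hn : InN n) (hn' : GHom 0 n) (hx : GHom 1 x) :
    (1 + rep n) * (Dhat + rep x) = (Dhat + rep (gaugeT n x)) * (1 + rep n) := by
  set a := rep n with ha
  set M := Dhat + rep x with hM
  have haa : a * a = 0 := rep_mul_rep_of_InN hn hn
  have hu : rep (gBr n x - gD n) = a * M - M * a := by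
    rw [rep_sub, ← rep_gBr hn' hx, ← rep_gD hn', hM]
    noncomm_ring
  have hu' : GHom 1 (gBr n x - gD n) := (hn'.gBr hx).sub (by simpa using hn'.gD)
  have h1 : rep (gBr n (gBr n x - gD n)) = (2 : ℂ) • -(a * M * a) := by
    rw [← rep_gBr hn' hu', hu, ← ha, mul_sub, sub_mul, ← mul_assoc, haa, mul_assoc M, haa, two_smul]
    noncomm_ring
  have h2 : Dhat + rep (gaugeT n x) = M + (a * M - M * a) - a * M * a := by
    rw [gaugeT, rep_add, rep_add, rep_smul, hu, h1, smul_smul, hM]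
    norm_num
    abel
  have h3 : a * M * a * a = 0 := by rw [mul_assoc, haa, mul_zero]
  have h4 : M * a * a = 0 := by rw [mul_assoc, haa, mul_zero]
  rw [h2]
  simp only [add_mul, sub_mul, mul_add, mul_one, one_mul, h3, h4]
  abel

theorem LX_cst (x : B → PA) : LX (cst x) = PowerSeries.X * C (Dhat + rep x) := by
  rw [LX, ser_one_cst, map_add, mul_add]

/-- For `n ∈ n ⊗ P(ḡ)` the exponential of the adjoint action is the explicit quadratic expression
`gaugeT`. -/
theorem expAd_cst_iff {n x y : B → PA} (hn : InN n) (hn' : GHom 0 n) (hx : GHom 1 x) :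
    ExpAd (cst n) (cst x) (cst y) ↔ y = gaugeT n x := by
  rw [expAd_iff (posDeg_cst hn) (homog_cst hn') (lowBd_cst x) (homog_cst hx)
    (Ser.Fil_anti (by norm_num) (ser_one_cst_mem x)) (lowBd_cst y), expSer_of_InN hn, LX_cst, LX_cst]
  have e1 : (1 + C (rep n) : Ser) * (PowerSeries.X * C (Dhat + rep x)) =
      PowerSeries.X * C ((Dhat + rep (gaugeT n x)) * (1 + rep n)) := by
    rw [← gauge_conj hn hn' hx, ← mul_assoc, PowerSeries.commute_X (1 + C (rep n)), mul_assoc]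
    simp
  have e2 : (PowerSeries.X * C (Dhat + rep y) : Ser) * (1 + C (rep n)) =
      PowerSeries.X * C ((Dhat + rep y) * (1 + rep n)) := by
    rw [mul_assoc]
    simp
  rw [e1, e2]
  constructor
  · intro h
    have h1 := congrArg (coeff 1) h
    rw [coeff_succ_X_mul, coeff_succ_X_mul, coeff_zero_C, coeff_zero_C] at h1
    have h2 := congrArg (fun M => M * (1 - rep n)) h1
    have h3 : (1 + rep n) * (1 - rep n) = 1 := by
      have := rep_mul_rep_of_InN hn hn
      rw [add_mul, mul_sub, mul_sub, this]
      simp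
    simp only [mul_assoc, h3, mul_one] at h2
    exact rep_injective (add_left_cancel h2).symm
  · rintro rfl
    rfl

section Components

variable {n x : B → PA}

/-- The components of `[n, D + x]`. Those of `h₂` and `e₁` depend on `n` algebraically and
determine it. -/
theorem gauge_first_order (hn : InN n) (hn' : GHom 0 n) (h3 : x .f3 = 0) (h2 : x .f2 = 1) :
    let u := gBr n x - gD n
    u .f3 = 0 ∧ u .f2 = 0 ∧ u .f1 = 0 ∧ u .h1 = 0 ∧ u .h2 = -n .e2 ∧ u .e1 = -((2 : ℂ) • n .e3) ∧
    u .e2 = -((2 : ℂ) • (n .e3 * x .f1)) - (2 : ℂ) • (n .e2 * x .h1) + D (n .e2) ∧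
    u .e3 = -((2 : ℂ) • (n .e3 * x .h1)) - (2 : ℂ) • (n .e3 * x .h2) - n .e2 * x .e1
      - D (n .e3) := by
  have k1 := hn .f3 not_inN_f3
  have k2 := hn .h1 not_inN_h1
  have k3 := hn .h2 not_inN_h2
  have k4 := hn .e1 not_inN_e1
  have k5 := hn .f1 not_inN_f1
  have k6 := hn .f2 not_inN_f2
  simp only [Pi.sub_apply, gBr_f3 hn', gBr_f2 hn', gBr_f1 hn', gBr_h1 hn', gBr_h2 hn', gBr_e1 hn',
    gBr_e2 hn', gBr_e3 hn', gD, k1, k2, k3, k4, k5, k6, h2, h3, B.par, sgn_zero, sgn_one, zero_mul,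
    mul_zero, smul_zero, mul_one, map_zero]
  refine ⟨?_, ?_, ?_, ?_, ?_, ?_, ?_, ?_⟩ <;> module

/-- The components of a gauge transform. The component of `h₂` changes by `-n_{e₂}` and that of
`e₁` by `-2 n_{e₃}`, so there is exactly one gauge in which both vanish. -/
theorem gaugeT_components (hn : InN n) (hn' : GHom 0 n) (h3 : x .f3 = 0) (h2 : x .f2 = 1) :
    gaugeT n x .f3 = 0 ∧ gaugeT n x .f2 = 1 ∧ gaugeT n x .f1 = x .f1 ∧ gaugeT n x .h1 = x .h1 ∧
    gaugeT n x .h2 = x .h2 - n .e2 ∧ gaugeT n x .e1 = x .e1 - (2 : ℂ) • n .e3 ∧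
    gaugeT n x .e2 = x .e2 - (2 : ℂ) • (n .e3 * x .f1) - (2 : ℂ) • (n .e2 * x .h1) + D (n .e2) ∧
    gaugeT n x .e3 = x .e3 - (2 : ℂ) • (n .e3 * x .h1) - (2 : ℂ) • (n .e3 * x .h2) - n .e2 * x .e1
      - D (n .e3) + (2 : ℂ) • (n .e2 * n .e3) := by
  have k1 := hn .f3 not_inN_f3
  have k2 := hn .h1 not_inN_h1
  have k3 := hn .h2 not_inN_h2
  have k4 := hn .e1 not_inN_e1
  have k5 := hn .f1 not_inN_f1
  have k6 := hn .f2 not_inN_f2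
  have hc : n .e3 * n .e2 = n .e2 * n .e3 := by
    have := homog_comm (hn' .e3) (hn' .e2)
    simpa [B.par, sgn_zero] using this
  obtain ⟨u1, u2, u3, u4, u5, u6, u7, u8⟩ := gauge_first_order hn hn' h3 h2
  simp only [gaugeT, Pi.add_apply, Pi.smul_apply, gBr_f3 hn', gBr_f2 hn', gBr_f1 hn', gBr_h1 hn',
    gBr_h2 hn', gBr_e1 hn', gBr_e2 hn', gBr_e3 hn' (gBr n x - gD n), u1, u2, u3, u4, u5, u6, u7, u8,
    k1, k2, k3, k4, k5, k6, h2, h3, zero_mul, mul_zero, smul_zero, mul_neg, mul_smul_comm, hc]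
  refine ⟨?_, ?_, ?_, ?_, ?_, ?_, ?_, ?_⟩ <;> module

end Components

section Differential

variable {ι : Type} {par : ι → ZMod 2}

/-- A subalgebra which is stable under the parity involution and under `D`. -/
structure IsDiffStable (S : Subalgebra ℂ (SDiffPoly par)) : Prop where
  sigma_mem : ∀ a ∈ S, sigma a ∈ S
  D_mem : ∀ a ∈ S, D a ∈ S

theorem IsDiffStable.sigmaPow_mem {S : Subalgebra ℂ (SDiffPoly par)} (hS : IsDiffStable S)
    (q : ZMod 2) {a : SDiffPoly par} (ha : a ∈ S) : sigmaPow q a ∈ S := by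
  rcases zmod2_cases q with rfl | rfl
  · rwa [sigmaPow_zero]
  · rw [sigmaPow_one]
    exact hS.sigma_mem a ha

theorem IsDiffStable.iterate_D_mem {S : Subalgebra ℂ (SDiffPoly par)} (hS : IsDiffStable S)
    (n : ℕ) {a : SDiffPoly par} (ha : a ∈ S) : D^[n] a ∈ S := by
  induction n with
  | zero => exact ha
  | succ n ih =>
    rw [Function.iterate_succ_apply']
    exact hS.D_mem _ ih

theorem isDiffStable_adjoin {s : Set (SDiffPoly par)} (h1 : ∀ a ∈ s, ∃ p, IsHomog p a)
    (h2 : ∀ a ∈ s, D a ∈ Algebra.adjoin ℂ s) : IsDiffStable (Algebra.adjoin ℂ s) := by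
  have hs : ∀ a ∈ Algebra.adjoin ℂ s, sigma a ∈ Algebra.adjoin ℂ s := by
    intro a ha
    induction ha using Algebra.adjoin_induction with
    | mem a ha =>
      obtain ⟨p, hp⟩ := h1 a ha
      rw [hp]
      exact Subalgebra.smul_mem _ (Algebra.subset_adjoin ha) _
    | algebraMap r =>
      rw [AlgHom.commutes]
      exact Subalgebra.algebraMap_mem _ r
    | add a b _ _ ha hb =>
      rw [map_add]
      exact add_mem ha hb
    | mul a b _ _ ha hb =>
      rw [map_mul]
      exact mul_mem ha hb
  refine ⟨hs, fun a ha => ?_⟩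
  induction ha using Algebra.adjoin_induction with
  | mem a ha => exact h2 a ha
  | algebraMap r =>
    rw [isSuperDer_D.map_algebraMap]
    exact zero_mem _
  | add a b _ _ ha hb =>
    rw [map_add]
    exact add_mem ha hb
  | mul a b ha' hb' ha hb =>
    rw [isSuperDer_D.leib, sigmaPow_one]
    exact add_mem (mul_mem ha hb') (mul_mem (hs a ha') hb)

/-- Two algebra morphisms which agree on letters are equal. -/
theorem algHom_ext_letter {A : Type} [Ring A] [Algebra ℂ A] {f g : SDiffPoly par →ₐ[ℂ] A}
    (h : ∀ x, f (letter par x) = g (letter par x)) : f = g := by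
  refine AlgHom.ext fun a => ?_
  induction a using induct with
  | h0 r => rw [AlgHom.commutes, AlgHom.commutes]
  | h1 x => exact h x
  | hm a b ha hb => rw [map_mul, map_mul, ha, hb]
  | ha a b ha hb => rw [map_add, map_add, ha, hb]

theorem algHom_sigma {f : SDiffPoly par →ₐ[ℂ] SDiffPoly par}
    (h : ∀ x, IsHomog (letterPar par x) (f (letter par x))) (a : SDiffPoly par) :
    f (sigma a) = sigma (f a) := by
  have : f.comp sigma = sigma.comp f := by
    apply algHom_ext_letter
    intro x
    rw [AlgHom.comp_apply, AlgHom.comp_apply, sigma_letter, map_smul, h x]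
  exact DFunLike.congr_fun this a

/-- A homogeneous algebra morphism which commutes with `D` on letters commutes with `D`. -/
theorem algHom_D {f : SDiffPoly par →ₐ[ℂ] SDiffPoly par}
    (h : ∀ x, IsHomog (letterPar par x) (f (letter par x)))
    (hD : ∀ x, f (letter par (x.1, x.2 + 1)) = D (f (letter par x))) (a : SDiffPoly par) :
    f (D a) = D (f a) := by
  induction a using induct with
  | h0 r => rw [AlgHom.commutes, isSuperDer_D.map_algebraMap, map_zero]
  | h1 x => rw [D_letter, hD]
  | hm a b ha hb =>
    rw [isSuperDer_D.leib, map_add, map_mul, map_mul, map_mul, isSuperDer_D.leib, sigmaPow_one,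
      sigmaPow_one, algHom_sigma h, ha, hb]
  | ha a b ha hb => rw [map_add, map_add, map_add, map_add, ha, hb]

theorem algHom_isHomog {f : SDiffPoly par →ₐ[ℂ] SDiffPoly par}
    (h : ∀ x, IsHomog (letterPar par x) (f (letter par x))) {p : ZMod 2} {a : SDiffPoly par}
    (ha : IsHomog p a) : IsHomog p (f a) := by
  rw [IsHomog, ← algHom_sigma h, ha, map_smul]

end Differential

theorem isDiffStable_P : IsDiffStable P := by
  apply isDiffStable_adjoin
  · rintro a ⟨b, n, hb, rfl⟩
    exact ⟨_, isHomog_letter _⟩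
  · rintro a ⟨b, n, hb, rfl⟩
    rw [D_letter]
    exact Algebra.subset_adjoin ⟨b, n + 1, hb, rfl⟩

theorem letter_mem_P {b : B} (hb : ¬ b.inN) (n : ℕ) : letter barPar (b, n) ∈ P :=
  Algebra.subset_adjoin ⟨b, n, hb, rfl⟩

theorem bar_mem_P {b : B} (hb : ¬ b.inN) : bar b ∈ P := letter_mem_P hb 0

theorem proj_letter (x : B × ℕ) : proj (letter barPar x) = if x.1.inN then
    (if x.2 = 0 then algebraMap ℂ PA (form .f2 x.1 : ℂ) else 0) else letter barPar x :=
  liftHom_letter _ _ _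

theorem isHomog_proj_letter (x : B × ℕ) :
    IsHomog (letterPar barPar x) (proj (letter barPar x)) := by
  rw [proj_letter]
  split_ifs with hx hn
  · obtain ⟨b, n⟩ := x
    simp only at hx hn ⊢
    subst hn
    cases b <;> simp [B.inN, B.deg] at hx
    · rw [form_eq]
      simp [formT, IsHomog.zero]
    · have : letterPar barPar (B.e2, 0) = 0 := by decide
      rw [this]
      exact isHomog_algebraMap _
  · exact IsHomog.zero _
  · exact isHomog_letter x

theorem proj_D (a : PA) : proj (D a) = D (proj a) := by
  apply algHom_D isHomog_proj_letter
  rintro ⟨b, n⟩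
  rw [proj_letter, proj_letter]
  by_cases hb : b.inN
  · by_cases hn : n = 0
    · simp [hb, hn, isSuperDer_D.map_algebraMap]
    · simp [hb, hn]
  · simp [hb, D_letter]

theorem isHomog_proj {p : ZMod 2} {a : PA} (ha : IsHomog p a) : IsHomog p (proj a) :=
  algHom_isHomog isHomog_proj_letter ha

theorem proj_of_mem_P {a : PA} (ha : a ∈ P) : proj a = a := by
  induction ha using Algebra.adjoin_induction with
  | mem a ha =>
    obtain ⟨b, n, hb, rfl⟩ := ha
    rw [proj_letter, if_neg hb]
  | algebraMap r => rw [AlgHom.commutes]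
  | add a b _ _ ha hb => rw [map_add, ha, hb]
  | mul a b _ _ ha hb => rw [map_mul, ha, hb]

theorem proj_mem_P (a : PA) : proj a ∈ P := by
  induction a using induct with
  | h0 r =>
    rw [AlgHom.commutes]
    exact Subalgebra.algebraMap_mem _ r
  | h1 x =>
    rw [proj_letter]
    split_ifs with hx hn
    · exact Subalgebra.algebraMap_mem _ _
    · exact zero_mem _
    · exact letter_mem_P hx x.2
  | hm a b ha hb =>
    rw [map_mul]
    exact mul_mem ha hb
  | ha a b ha hb =>
    rw [map_add]
    exact add_mem ha hb

/-! ### Existence and uniqueness of the canonical form -/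

/-- The gauge parameter which brings the universal Lax operator to its canonical form. -/
def nv : B → PA
  | .e2 => -((1 / 4 : ℂ) • bar .h1)
  | .e3 => -((1 / 4 : ℂ) • bar .f1)
  | _ => 0

/-- The generators `w₁, …, w₄` of the generalized W-algebra. -/
def wv : Fin 4 → PA
  | 0 => (1 / 2 : ℂ) • bar .e1
  | 1 => -((1 / 4 : ℂ) • bar .h2)
  | 2 => -((1 / 2 : ℂ) • bar .f2) + (1 / 4 : ℂ) • (bar .f1 * bar .e1)
      - (1 / 8 : ℂ) • (bar .h1 * bar .h2) - (1 / 4 : ℂ) • D (bar .h1)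
  | 3 => (1 / 4 : ℂ) • bar .f3 - (1 / 8 : ℂ) • (bar .f1 * bar .h1)
      - (1 / 8 : ℂ) • (bar .f1 * bar .h2) + (1 / 4 : ℂ) • D (bar .f1)

theorem inN_nv : InN nv := by
  intro b hb
  cases b <;> first | rfl | exact absurd (by decide) hb

theorem gHom_nv : GHom 0 nv := by
  have h2 : (1 : ZMod 2) + 1 = 0 := by decide
  intro b
  cases b <;> simp only [nv, B.par, add_zero, zero_add]
  · exact IsHomog.zero _
  · exact IsHomog.zero _
  · exact IsHomog.zero _
  · have := isHomog_bar .f1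
    simp only [B.par, h2] at this
    exact (this.smul _).neg
  · exact IsHomog.zero _
  · have := isHomog_bar .h1
    simp only [B.par, zero_add] at this
    exact (this.smul _).neg
  · exact IsHomog.zero _
  · exact IsHomog.zero _

theorem h1_mul_f1 : bar .h1 * bar .f1 = bar .f1 * bar .h1 := by
  have := homog_comm (isHomog_bar .h1) (isHomog_bar .f1)
  rw [this]
  have : ((B.h1.par + 1) * (B.f1.par + 1)) = 0 := by decide
  rw [this, sgn_zero, one_smul]

/-- The gauge transform of the universal Lax operator by `nv` is the canonical form. -/
theorem gaugeT_nv_qv : gaugeT nv qv = cv wv := by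
  obtain ⟨u1, u2, u3, u4, u5, u6, u7, u8⟩ := gaugeT_components (x := qv) inN_nv gHom_nv rfl rfl
  funext b
  cases b
  · rw [u1]; rfl
  · rw [u4]; rfl
  · rw [u5]; simp [qv, nv, cv]
  · rw [u8]
    simp only [qv, nv, cv, wv, map_neg, map_smul, neg_mul, mul_neg, smul_mul_assoc, mul_smul_comm,
      h1_mul_f1]
    module
  · rw [u6]
    simp only [qv, nv, cv]
    module
  · rw [u7]
    simp only [qv, nv, cv, wv, map_neg, map_smul, neg_mul, mul_neg, smul_mul_assoc, mul_smul_comm]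
    module
  · rw [u3]; rfl
  · rw [u2]; rfl

theorem wv_mem_P (t : Fin 4) : wv t ∈ P := by
  have m := fun b hb => bar_mem_P (b := b) hb
  have mD := fun b hb => isDiffStable_P.D_mem _ (bar_mem_P (b := b) hb)
  have m1 := m .h1 not_inN_h1
  have m2 := m .h2 not_inN_h2
  have m3 := m .f1 not_inN_f1
  have m4 := m .f2 not_inN_f2
  have m5 := m .f3 not_inN_f3
  have m6 := m .e1 not_inN_e1
  have s : ∀ (c : ℂ) {a : PA}, a ∈ P → c • a ∈ P := fun c a h => Subalgebra.smul_mem _ h c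
  fin_cases t
  · exact s _ m6
  · exact neg_mem (s _ m2)
  · exact sub_mem (sub_mem (add_mem (neg_mem (s _ m4)) (s _ (mul_mem m3 m6)))
      (s _ (mul_mem m1 m2))) (s _ (mD _ not_inN_h1))
  · exact add_mem (sub_mem (sub_mem (s _ m5) (s _ (mul_mem m3 m1))) (s _ (mul_mem m3 m2)))
      (s _ (mD _ not_inN_f1))

theorem nv_mem_P (b : B) : nv b ∈ P := by
  cases b <;> first | exact zero_mem P | skip
  · exact neg_mem (Subalgebra.smul_mem _ (bar_mem_P not_inN_f1) _)
  · exact neg_mem (Subalgebra.smul_mem _ (bar_mem_P not_inN_h1) _)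

theorem gHom_gaugeT {n x : B → PA} (hn : GHom 0 n) (hx : GHom 1 x) : GHom 1 (gaugeT n x) := by
  have hu' : GHom 1 (gBr n x - gD n) := (hn.gBr hx).sub (by simpa using hn.gD)
  exact (hx.add hu').add ((hn.gBr hu').smul _)

theorem gHom_cv : GHom 1 (cv wv) := by
  rw [← gaugeT_nv_qv]
  exact gHom_gaugeT gHom_nv gHom_qv

theorem homog_fLoop : fLoop.IsHomog 1 := by
  intro b k
  rw [fLoop, coeff_el]
  split_ifs with h
  · rw [h.1]
    exact isHomog_one
  · exact IsHomog.zero _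

theorem isCanonicalForm_nv : IsCanonicalForm (cst nv) wv := by
  refine ⟨fun b hb => ?_, fun b k hk => ?_, fun b => ?_, homog_cst gHom_nv, wv_mem_P, ?_, ?_⟩
  · rw [cst, inN_nv b hb, HahnSeries.single_eq_zero]
  · rw [coeff_cst, if_neg hk]
  · rw [coeff_cst, if_pos rfl]
    exact nv_mem_P b
  · have e : Qc wv = cst (cv wv) - fLoop := by rw [← Qc_add_fLoop, add_sub_cancel_right]
    rw [e]
    exact fun b k => (homog_cst gHom_cv b k).sub (homog_fLoop b k)
  · rw [Qu_add_fLoop, Qc_add_fLoop, expAd_cst_iff inN_nv gHom_nv gHom_qv, gaugeT_nv_qv]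

theorem IsCanonicalForm.eq {N : Loop} {w : Fin 4 → PA} (h : IsCanonicalForm N w) :
    N = cst nv ∧ w = wv := by
  obtain ⟨h1, h2, -, h4, -, -, h7⟩ := h
  set n : B → PA := fun b => (N b).coeff 0 with hn
  have hN : N = cst n := by
    funext b
    ext k
    rw [coeff_cst]
    split_ifs with hk
    · rw [hk]
    · exact h2 b k hk
  have hn1 : InN n := fun b hb => by rw [hn]; simp only [h1 b hb, HahnSeries.coeff_zero]
  have hn2 : GHom 0 n := fun b => h4 b 0
  rw [Qu_add_fLoop, Qc_add_fLoop, hN, expAd_cst_iff hn1 hn2 gHom_qv] at h7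
  obtain ⟨-, -, -, -, u5, u6, -, -⟩ := gaugeT_components (x := qv) hn1 hn2 rfl rfl
  -- The vanishing of the components of `h₂` and `e₁` determines the gauge parameter.
  have hnv : n = nv := by
    funext b
    cases b
    · exact hn1 _ not_inN_f3
    · exact hn1 _ not_inN_h1
    · exact hn1 _ not_inN_h2
    · rw [← h7] at u6
      simp only [cv, qv] at u6
      have : n .e3 = (1 / 2 : ℂ) • ((2 : ℂ) • n .e3) := by module
      rw [this, ← sub_eq_zero.1 u6.symm, nv]
      module
    · exact hn1 _ not_inN_e1
    · rw [← h7] at u5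
      simp only [cv, qv] at u5
      rw [← sub_eq_zero.1 u5.symm, nv]
    · exact hn1 _ not_inN_f1
    · exact hn1 _ not_inN_f2
  rw [hnv, gaugeT_nv_qv] at h7
  refine ⟨by rw [hN, hnv], ?_⟩
  funext t
  fin_cases t
  · exact congrFun h7 .f1
  · exact congrFun h7 .h1
  · exact congrFun h7 .e2
  · exact congrFun h7 .e3

/-! ### The generalized W-algebra -/

theorem barPar_add_barPar (a b : B) : barPar a + barPar b + 1 = a.par + b.par + 1 := by
  simp only [barPar]
  generalize a.par = x, b.par = y
  revert x y
  decide

theorem affine₁_homog (a b : B) : IsHomog (barPar a + barPar b + 1)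
    (sgn a.par • ∑ k : B, (struc a b k : ℂ) • bar k) := by
  have key : ∀ i j k : B, strucT i j k ≠ 0 → i.par + j.par = k.par := by decide +kernel
  rw [barPar_add_barPar]
  refine IsHomog.smul _ (IsHomog.sum _ _ fun k _ => ?_)
  by_cases h : strucT a b k = 0
  · rw [struc_eq, h, Rat.cast_zero, zero_smul]
    exact IsHomog.zero _
  · rw [key a b k h]
    exact (isHomog_bar k).smul _

theorem affine₁_par (a b : B) (h : sgn a.par * (form a b : ℂ) ≠ 0) : barPar a = barPar b := by
  have key : ∀ i j : B, formT i j ≠ 0 → barPar i = barPar j := by decide +kernel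
  apply key
  intro h0
  apply h
  rw [form_eq, h0, Rat.cast_zero, mul_zero]

theorem affine₂_homog (a b : B) : IsHomog (barPar a + barPar b + 1) (algebraMap ℂ PA
    (sgn (a.par + 1) * ∑ k : B, (struc a b k : ℂ) * (form .e2 k : ℂ))) := by
  have key : ∀ i j k : B, strucT i j k ≠ 0 → formT .e2 k ≠ 0 → i.par + j.par + 1 = 0 := by
    decide +kernel
  rw [barPar_add_barPar]
  by_cases h : a.par + b.par + 1 = 0
  · rw [h]
    exact isHomog_algebraMap _
  · rw [Finset.sum_eq_zero, mul_zero, map_zero]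
    · exact IsHomog.zero _
    · intro k _
      rw [struc_eq, form_eq]
      by_contra hc
      have h1 := left_ne_zero_of_mul hc
      have h2 := right_ne_zero_of_mul hc
      exact h (key a b k (by exact_mod_cast h1) (by exact_mod_cast h2))

/-- The coefficient of `χ^k` in `π {b̄ χ ·}₁`. -/
def Zder (b : B) (k : ℕ) : PA →ₗ[ℂ] PA :=
  proj.toLinearMap ∘ₗ genDer affine₁_homog affine₁_par b k

theorem proj_affine₁_bar (b : B) (a : PA) (k : ℕ) : proj (affine₁ (bar b) a k) = Zder b k a := by
  rw [affine₁, bar, chiBracket_letter affine₁_homog affine₁_par]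
  rfl

/-- An element of `P` belongs to `W` when the operators `π {b̄ χ ·}₁`, `b ∈ n`, vanish on it,
coefficient by coefficient in `χ`. -/
theorem mem_W_iff (a : PA) : a ∈ W ↔ a ∈ P ∧ ∀ b : B, b.inN → ∀ k, Zder b k a = 0 := by
  simp only [W, Set.mem_ofPred_eq, proj_affine₁_bar]

theorem Zder_mul (b : B) (k : ℕ) (x y : PA) : Zder b k (x * y) =
    Zder b k x * proj y + proj (sigmaPow (b.par + k) x) * Zder b k y := by
  have h2 : barPar b + 1 = b.par := by
    rw [barPar, add_assoc, CharTwo.add_self_eq_zero, add_zero]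
  simp only [Zder, LinearMap.comp_apply, AlgHom.toLinearMap_apply,
    (isSuperDer_genDer affine₁_homog affine₁_par b k).leib, map_add, map_mul, h2]

theorem Zder_algebraMap (b : B) (k : ℕ) (c : ℂ) : Zder b k (algebraMap ℂ PA c) = 0 := by
  simp only [Zder, LinearMap.comp_apply,
    (isSuperDer_genDer affine₁_homog affine₁_par b k).map_algebraMap, map_zero]

theorem Zder_D_zero (b : B) (x : PA) : Zder b 0 (D x) = sgn b.par • D (Zder b 0 x) := by
  have h2 : barPar b + 1 = b.par := by
    rw [barPar, add_assoc, CharTwo.add_self_eq_zero, add_zero]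
  simp only [Zder, LinearMap.comp_apply, AlgHom.toLinearMap_apply, genDer_D, chiAddD, map_smul,
    proj_D, h2]

theorem Zder_D_succ (b : B) (k : ℕ) (x : PA) : Zder b (k + 1) (D x) =
    sgn b.par • (sgn ((k + 1 : ℕ) : ZMod 2) • D (Zder b (k + 1) x) +
      sgn (k : ZMod 2) • Zder b k x) := by
  have h2 : barPar b + 1 = b.par := by
    rw [barPar, add_assoc, CharTwo.add_self_eq_zero, add_zero]
  simp only [Zder, LinearMap.comp_apply, AlgHom.toLinearMap_apply, genDer_D, chiAddD, map_smul,
    map_add, proj_D, h2]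

theorem proj_bar {b : B} (hb : ¬ b.inN) : proj (bar b) = bar b := proj_of_mem_P (bar_mem_P hb)

theorem proj_bar_e2 : proj (bar .e2) = algebraMap ℂ PA 2 := by
  rw [bar, proj_letter, if_pos (by decide), if_pos rfl, form_eq]
  norm_num [formT]

theorem proj_bar_e3 : proj (bar .e3) = 0 := by
  rw [bar, proj_letter, if_pos (by decide), if_pos rfl, form_eq]
  simp [formT]

theorem Zder_bar_zero (b c : B) : Zder b 0 (bar c) =
    sgn b.par • ∑ k : B, (strucT b c k : ℂ) • proj (bar k) := by
  simp only [Zder, LinearMap.comp_apply, AlgHom.toLinearMap_apply, bar, genDer_letter_zero, genSeq,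
    map_smul, map_sum, struc_eq]

theorem Zder_bar_one (b c : B) : Zder b 1 (bar c) = algebraMap ℂ PA (sgn b.par * formT b c) := by
  simp only [Zder, LinearMap.comp_apply, AlgHom.toLinearMap_apply, bar, genDer_letter_zero, genSeq,
    AlgHom.commutes, form_eq]

theorem Zder_bar_add_two (b c : B) (k : ℕ) : Zder b (k + 2) (bar c) = 0 := by
  simp only [Zder, LinearMap.comp_apply, bar, genDer_letter_zero, genSeq, map_zero]

/-- The values of `π {ē₂ χ ·}₁` and `π {ē₃ χ ·}₁` on the generators of `P`. -/
theorem Zder_table :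
    (Zder .e2 0 (bar .e1) = 0 ∧ Zder .e2 0 (bar .f1) = 0 ∧ Zder .e2 0 (bar .h1) = (4 : ℂ) • 1 ∧
      Zder .e2 0 (bar .h2) = 0 ∧ Zder .e2 0 (bar .f2) = -bar .h2 ∧
      Zder .e2 0 (bar .f3) = (2 : ℂ) • bar .f1) ∧
    (Zder .e3 0 (bar .e1) = 0 ∧ Zder .e3 0 (bar .f1) = -((4 : ℂ) • 1) ∧
      Zder .e3 0 (bar .h1) = 0 ∧ Zder .e3 0 (bar .h2) = 0 ∧
      Zder .e3 0 (bar .f2) = -((2 : ℂ) • bar .e1) ∧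
      Zder .e3 0 (bar .f3) = -((2 : ℂ) • bar .h1) - (2 : ℂ) • bar .h2) ∧
    (Zder .e2 1 (bar .e1) = 0 ∧ Zder .e2 1 (bar .f1) = 0 ∧ Zder .e2 1 (bar .h1) = 0 ∧
      Zder .e2 1 (bar .h2) = 0 ∧ Zder .e2 1 (bar .f2) = (2 : ℂ) • 1 ∧ Zder .e2 1 (bar .f3) = 0) ∧
    (Zder .e3 1 (bar .e1) = 0 ∧ Zder .e3 1 (bar .f1) = 0 ∧ Zder .e3 1 (bar .h1) = 0 ∧
      Zder .e3 1 (bar .h2) = 0 ∧ Zder .e3 1 (bar .f2) = 0 ∧ Zder .e3 1 (bar .f3) = (4 : ℂ) • 1) := by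
  have p1 := proj_bar not_inN_e1
  have p2 := proj_bar not_inN_f1
  have p3 := proj_bar not_inN_h1
  have p4 := proj_bar not_inN_h2
  have p5 := proj_bar not_inN_f2
  have p6 := proj_bar not_inN_f3
  simp only [Zder_bar_zero, Zder_bar_one, sum_B, strucT, formT, B.par, sgn_zero, sgn_one, p1, p2,
    p3, p4, p5, p6, proj_bar_e2, proj_bar_e3, Algebra.algebraMap_eq_smul_one]
  push_cast
  refine ⟨⟨?_, ?_, ?_, ?_, ?_, ?_⟩, ⟨?_, ?_, ?_, ?_, ?_, ?_⟩, ⟨?_, ?_, ?_, ?_, ?_, ?_⟩,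
    ⟨?_, ?_, ?_, ?_, ?_, ?_⟩⟩ <;> module

theorem wv_mem_W (t : Fin 4) : wv t ∈ W := by
  obtain ⟨⟨a1, a2, a3, a4, a5, a6⟩, ⟨b1, b2, b3, b4, b5, b6⟩, ⟨c1, c2, c3, c4, c5, c6⟩,
    ⟨d1, d2, d3, d4, d5, d6⟩⟩ := Zder_table
  have p1 := proj_bar not_inN_e1
  have p2 := proj_bar not_inN_f1
  have p3 := proj_bar not_inN_h1
  have p4 := proj_bar not_inN_h2
  have hD1 : D (1 : PA) = 0 := isSuperDer_D.map_one
  have q1 : sigma (bar .f1) = bar .f1 := by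
    have := isHomog_bar .f1
    have h2 : B.f1.par + 1 = 0 := by decide
    rwa [h2, IsHomog, sgn_zero, one_smul] at this
  have h2 : (1 : ZMod 2) + 1 = 0 := by decide
  rw [mem_W_iff]
  refine ⟨wv_mem_P t, fun b hb k => ?_⟩
  have hcase : ∀ b : B, b.inN → b = .e2 ∨ b = .e3 := by decide
  rcases hcase b hb with rfl | rfl <;> rcases k with _ | _ | _ | k <;> fin_cases t <;>
  simp only [wv, map_add, map_sub, map_neg, map_smul, Zder_mul, Zder_D_zero, Zder_D_succ, zero_add,
    a1, a2, a3, a4, a5, a6, b1, b2, b3, b4, b5, b6, c1, c2, c3, c4, c5, c6, d1, d2, d3, d4, d5, d6,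
    Zder_bar_add_two, p1, p2, p3, p4, map_smul, hD1, smul_zero, mul_zero, zero_mul, B.par,
    sgn_zero, sgn_one, add_zero, sub_zero, neg_zero, smul_mul_assoc, one_mul, mul_smul_comm, mul_one,
    sigmaPow_zero, sigmaPow_one, q1, map_zero, Nat.cast_zero, Nat.cast_one, h2, neg_mul] <;>
  module

/-- The differential algebra generated by `w₁, …, w₄`. -/
def WA : Subalgebra ℂ PA := Algebra.adjoin ℂ {a | ∃ (t : Fin 4) (n : ℕ), a = D^[n] (wv t)}

theorem exists_isHomog_wv (t : Fin 4) : ∃ p, IsHomog p (wv t) := by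
  have h := gHom_cv
  fin_cases t
  · exact ⟨_, h .f1⟩
  · exact ⟨_, h .h1⟩
  · exact ⟨_, h .e2⟩
  · exact ⟨_, h .e3⟩

theorem isDiffStable_WA : IsDiffStable WA := by
  apply isDiffStable_adjoin
  · rintro a ⟨t, n, rfl⟩
    obtain ⟨p, hp⟩ := exists_isHomog_wv t
    exact ⟨_, hp.iterate_D n⟩
  · rintro a ⟨t, n, rfl⟩
    rw [← Function.iterate_succ_apply' D]
    exact Algebra.subset_adjoin ⟨t, n + 1, rfl⟩

theorem wv_mem_WA (t : Fin 4) : wv t ∈ WA := Algebra.subset_adjoin ⟨t, 0, rfl⟩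

theorem D_mem_W {a : PA} (ha : a ∈ W) : D a ∈ W := by
  rw [mem_W_iff] at ha ⊢
  refine ⟨isDiffStable_P.D_mem _ ha.1, fun b hb k => ?_⟩
  cases k with
  | zero => rw [Zder_D_zero, ha.2 b hb 0, map_zero, smul_zero]
  | succ k => rw [Zder_D_succ, ha.2 b hb k, ha.2 b hb (k + 1), map_zero, smul_zero, smul_zero,
      add_zero, smul_zero]

/-- `W` is closed under products and `D`. Only this inclusion is needed: all the objects of the
theorem have coefficients in the differential algebra generated by the `w_t`. -/
theorem WA_subset_W {a : PA} (ha : a ∈ WA) : a ∈ W := by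
  induction ha using Algebra.adjoin_induction with
  | mem a ha =>
    obtain ⟨t, n, rfl⟩ := ha
    induction n with
    | zero => exact wv_mem_W t
    | succ n ih =>
      rw [Function.iterate_succ_apply']
      exact D_mem_W ih
  | algebraMap r =>
    rw [mem_W_iff]
    exact ⟨Subalgebra.algebraMap_mem _ r, fun b _ k => Zder_algebraMap b k r⟩
  | add a b _ _ ha hb =>
    rw [mem_W_iff] at ha hb ⊢
    refine ⟨add_mem ha.1 hb.1, fun c hc k => ?_⟩
    rw [map_add, ha.2 c hc k, hb.2 c hc k, add_zero]
  | mul a b _ _ ha hb =>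
    rw [mem_W_iff] at ha hb ⊢
    refine ⟨mul_mem ha.1 hb.1, fun c hc k => ?_⟩
    rw [Zder_mul, ha.2 c hc k, hb.2 c hc k, mul_zero, zero_mul, add_zero]

theorem WA_subset_P {a : PA} (ha : a ∈ WA) : a ∈ P := (WA_subset_W ha).1

/-! ### Infinitesimal gauge transformations -/

/-- The coefficients of the expansion of an infinitesimal gauge transformation in terms of the
operators `Zder b k`. -/
def gaugeCoef (b : B) : ℕ → ℂ
  | 0 => 1
  | k + 1 => sgn b.par * sgn (k : ZMod 2) * gaugeCoef b k

/-- The sum `∑_{k < K} ± D^k r · π {b̄ χ ·}₁` over the coefficients of `χ^k`. -/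
def gaugeSum (b : B) (r : PA) (K : ℕ) (a : PA) : PA :=
  ∑ k ∈ Finset.range K, gaugeCoef b k • (D^[k] r * Zder b k a)

theorem gaugeSum_succ (b : B) (r : PA) (K : ℕ) (a : PA) : gaugeSum b r (K + 1) a =
    gaugeSum b r K a + gaugeCoef b K • (D^[K] r * Zder b K a) := Finset.sum_range_succ _ _

theorem gaugeSum_add (b : B) (r : PA) (K : ℕ) (x y : PA) :
    gaugeSum b r K (x + y) = gaugeSum b r K x + gaugeSum b r K y := by
  simp only [gaugeSum, map_add, mul_add, smul_add, Finset.sum_add_distrib]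

/-- On `P` the operators `D^k r · π {b̄ χ ·}₁` are even derivations. -/
theorem gaugeSum_mul (b : B) {r : PA} (hr : IsHomog b.par r) (K : ℕ) {x y : PA} (hx : x ∈ P)
    (hy : y ∈ P) : gaugeSum b r K (x * y) = gaugeSum b r K x * y + x * gaugeSum b r K y := by
  simp only [gaugeSum, Finset.sum_mul, Finset.mul_sum, ← Finset.sum_add_distrib]
  refine Finset.sum_congr rfl fun k _ => ?_
  have h := homog_mul_eq (hr.iterate_D k) (sigmaPow (b.par + k) x)
  rw [sigmaPow_sigmaPow, CharTwo.add_self_eq_zero, sigmaPow_zero] at h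
  rw [Zder_mul, proj_of_mem_P hy, proj_of_mem_P (isDiffStable_P.sigmaPow_mem _ hx), mul_add,
    ← mul_assoc, ← mul_assoc, h, smul_add, mul_assoc x, smul_mul_assoc, mul_smul_comm]

/-- The sums commute with `D` up to a boundary term: differentiating `D^k r` cancels against the
sesquilinearity of the bracket, and the sum telescopes. -/
theorem gaugeSum_D (b : B) {r : PA} (hr : IsHomog b.par r) (K : ℕ) (x : PA) :
    gaugeSum b r (K + 1) (D x) + gaugeCoef b K • (D^[K + 1] r * Zder b K x) =
      D (gaugeSum b r (K + 1) x) := by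
  have hs : sgn b.par * sgn b.par = 1 := sgn_mul_self _
  have key : ∀ k : ℕ, D (gaugeCoef b k • (D^[k] r * Zder b k x)) = gaugeCoef b k •
      (D^[k + 1] r * Zder b k x) + (gaugeCoef b k * (sgn b.par * sgn (k : ZMod 2))) •
        (D^[k] r * D (Zder b k x)) := by
    intro k
    rw [map_smul, isSuperDer_D.leib, sigmaPow_one, hr.iterate_D k, ← Function.iterate_succ_apply' D,
      smul_mul_assoc, smul_add, smul_smul, sgn_add]
  induction K with
  | zero =>
    have h0 := key 0
    simp only [gaugeSum, zero_add, Finset.sum_range_one, gaugeCoef, one_smul, Function.iterate_zero,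
      id, Zder_D_zero, mul_smul_comm] at h0 ⊢
    rw [h0]
    simp only [Nat.cast_zero, sgn_zero]
    module
  | succ K ih =>
    rw [gaugeSum_succ b r (K + 1), gaugeSum_succ b r (K + 1), map_add, ← ih, key (K + 1), Zder_D_succ]
    have e : gaugeCoef b (K + 1) = sgn b.par * sgn (K : ZMod 2) * gaugeCoef b K := rfl
    have hk : sgn (K : ZMod 2) * sgn (K : ZMod 2) = 1 := sgn_mul_self _
    have e2 : gaugeCoef b K = sgn b.par * sgn (K : ZMod 2) * gaugeCoef b (K + 1) := by
      rw [e]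
      linear_combination (-gaugeCoef b K * sgn (K : ZMod 2) * sgn (K : ZMod 2)) * hs
        - gaugeCoef b K * hk
    rw [e2]
    simp only [mul_add, mul_smul_comm]
    module

/-- An infinitesimal gauge transformation, i.e. an evolutionary derivation `d` with
`d Q_u = [R, D + Q_u + f]` for an even `R ∈ n ⊗ P(ḡ)`, is a combination of the operators
`π {b̄ χ ·}₁` with `b ∈ n`, and hence vanishes on the generalized W-algebra. -/
theorem IsEvol.eq_zero_of_gauge {d : PA →ₗ[ℂ] PA} (hd : IsEvol d) {R : B → PA} (hR : InN R)
    (hR' : GHom 0 R) (h : ∀ b, d (qv b) = (gBr R qv - gD R) b) {a : PA} (ha : a ∈ W) :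
    d a = 0 := by
  rw [mem_W_iff] at ha
  have hr2 : IsHomog B.e2.par (R .e2) := by simpa using hR' .e2
  have hr3 : IsHomog B.e3.par (-R .e3) := by simpa using (hR' .e3).neg
  -- The set of `a` on which `d` is the combination of `π {ē₂ χ ·}₁` and `π {ē₃ χ ·}₁` with
  -- coefficients `R_{e₂}`, `-R_{e₃}`, summed far enough for all nonzero terms to be present.
  let Good : PA → Prop := fun a => ∃ K₀ : ℕ, ∀ K ≥ K₀, Zder .e2 K a = 0 ∧ Zder .e3 K a = 0 ∧
    d a = gaugeSum .e2 (R .e2) K a + gaugeSum .e3 (-R .e3) K a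
  have good_D : ∀ a, Good a → Good (D a) := by
    rintro a ⟨K₀, hK⟩
    refine ⟨K₀ + 1, fun K hK1 => ?_⟩
    obtain ⟨k, rfl⟩ := Nat.exists_eq_succ_of_ne_zero (show K ≠ 0 by omega)
    obtain ⟨z1, z2, -⟩ := hK k (by omega)
    obtain ⟨z3, z4, e⟩ := hK (k + 1) (by omega)
    refine ⟨?_, ?_, ?_⟩
    · rw [Nat.succ_eq_add_one, Zder_D_succ, z1, z3, map_zero, smul_zero, smul_zero, add_zero,
        smul_zero]
    · rw [Nat.succ_eq_add_one, Zder_D_succ, z2, z4, map_zero, smul_zero, smul_zero, add_zero,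
        smul_zero]
    · rw [hd.comm, e, map_add, ← gaugeSum_D _ hr2, ← gaugeSum_D _ hr3, z1, z2]
      simp
  -- On generators this is the comparison of `[R, D + Q_u + f]` with the table of brackets.
  have good_bar : ∀ b, ¬ b.inN → Good (bar b) := by
    intro b hb
    refine ⟨2, fun K hK => ?_⟩
    obtain ⟨k, rfl⟩ := Nat.exists_eq_add_of_le' hK
    refine ⟨Zder_bar_add_two _ _ _, Zder_bar_add_two _ _ _, ?_⟩
    have hs : ∀ c r, gaugeSum c r (k + 2) (bar b) =
        r * Zder c 0 (bar b) + sgn c.par • (D r * Zder c 1 (bar b)) := by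
      intro c r
      rw [gaugeSum, add_comm, Finset.sum_range_add, Finset.sum_eq_zero (s := Finset.range k)]
      · simp [Finset.sum_range_succ, gaugeCoef, sgn_zero]
      · intro i _
        rw [add_comm, Zder_bar_add_two, mul_zero, smul_zero]
    obtain ⟨⟨a1, a2, a3, a4, a5, a6⟩, ⟨b1, b2, b3, b4, b5, b6⟩, ⟨c1, c2, c3, c4, c5, c6⟩,
      ⟨d1, d2, d3, d4, d5, d6⟩⟩ := Zder_table
    obtain ⟨-, -, u3, u4, u5, u6, u7, u8⟩ := gauge_first_order (x := qv) hR hR' rfl rfl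
    have e1 := (h .f1).trans u3
    have e2 := (h .h1).trans u4
    have e3 := (h .h2).trans u5
    have e4 := (h .e1).trans u6
    have e5 := (h .e2).trans u7
    have e6 := (h .e3).trans u8
    simp only [qv, map_neg, map_smul, mul_neg, mul_smul_comm] at e1 e2 e3 e4 e5 e6
    rw [hs, hs]
    cases b
    · rw [a6, b6, c6, d6]
      simp only [B.par, sgn_zero, sgn_one, mul_zero, mul_neg, mul_smul_comm, mul_one, map_neg,
        mul_sub, neg_mul]
      linear_combination (norm := module) (4 : ℂ) • e6
    · rw [a3, b3, c3, d3]
      simp only [mul_zero, mul_smul_comm, mul_one, smul_zero]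
      linear_combination (norm := module) (-4 : ℂ) • e3
    · rw [a4, b4, c4, d4]
      simp only [mul_zero, smul_zero]
      linear_combination (norm := module) (-4 : ℂ) • e2
    · exact absurd (by decide) hb
    · rw [a1, b1, c1, d1]
      simp only [mul_zero, smul_zero]
      linear_combination (norm := module) (2 : ℂ) • e1
    · exact absurd (by decide) hb
    · rw [a2, b2, c2, d2]
      simp only [mul_zero, mul_neg, mul_smul_comm, mul_one, smul_zero]
      linear_combination (norm := module) (-2 : ℂ) • e4
    · rw [a5, b5, c5, d5]
      simp only [B.par, sgn_zero, sgn_one, mul_zero, mul_neg, mul_smul_comm, mul_one, map_neg,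
        neg_mul]
      linear_combination (norm := module) (-2 : ℂ) • e5
  -- The set is closed under `D`, sums and products.
  have good : ∀ a ∈ P, Good a := by
    intro a ha
    induction ha using Algebra.adjoin_induction with
    | mem a ha =>
      obtain ⟨b, n, hb, rfl⟩ := ha
      have := iterate_D_letter (par := barPar) b 0 n
      rw [zero_add] at this
      rw [← this]
      clear this
      induction n with
      | zero => exact good_bar b hb
      | succ n ih =>
        rw [Function.iterate_succ_apply']
        exact good_D _ ih
    | algebraMap r =>
      refine ⟨0, fun K _ => ⟨Zder_algebraMap _ _ _, Zder_algebraMap _ _ _, ?_⟩⟩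
      simp only [gaugeSum, Zder_algebraMap, hd.map_algebraMap, mul_zero, smul_zero,
        Finset.sum_const_zero, add_zero]
    | add x y _ _ hx hy =>
      obtain ⟨K₁, h1⟩ := hx
      obtain ⟨K₂, h2⟩ := hy
      refine ⟨max K₁ K₂, fun K hK => ?_⟩
      obtain ⟨x1, x2, x3⟩ := h1 K (le_trans (le_max_left _ _) hK)
      obtain ⟨y1, y2, y3⟩ := h2 K (le_trans (le_max_right _ _) hK)
      refine ⟨by rw [map_add, x1, y1, add_zero], by rw [map_add, x2, y2, add_zero], ?_⟩
      rw [map_add, x3, y3, gaugeSum_add, gaugeSum_add]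
      abel
    | mul x y hx' hy' hx hy =>
      obtain ⟨K₁, h1⟩ := hx
      obtain ⟨K₂, h2⟩ := hy
      refine ⟨max K₁ K₂, fun K hK => ?_⟩
      obtain ⟨x1, x2, x3⟩ := h1 K (le_trans (le_max_left _ _) hK)
      obtain ⟨y1, y2, y3⟩ := h2 K (le_trans (le_max_right _ _) hK)
      refine ⟨by rw [Zder_mul, x1, y1, mul_zero, zero_mul, add_zero],
        by rw [Zder_mul, x2, y2, mul_zero, zero_mul, add_zero], ?_⟩
      rw [hd.leibniz, x3, y3, gaugeSum_mul _ hr2 _ hx' hy', gaugeSum_mul _ hr3 _ hx' hy', add_mul,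
        mul_add]
      abel
  obtain ⟨K, hK⟩ := good a ha.1
  rw [(hK K le_rfl).2.2]
  simp [gaugeSum, ha.2 .e2 (by decide), ha.2 .e3 (by decide)]

/-! ### The element `Λ` and its square -/

/-- The element `b ⊗ 1`. -/
def cb (b : B) : B → PA := Pi.single b 1

theorem rep_cb (b : B) : rep (cb b) =
    b.mat.map ((algebraMap ℂ E).comp (Rat.castHom ℂ)) := by
  ext1 i j
  have : ent (cb b) i j = ((b.mat i j : ℚ) : ℂ) • (1 : PA) := by
    rw [ent, Matrix.of_apply, Finset.sum_eq_single b]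
    · rw [cb, Pi.single_eq_same, map_one]
    · intro c _ hc
      rw [cb, Pi.single_eq_of_ne hc, map_zero, smul_zero]
    · simp
  rw [rep_apply, this, map_smul, map_one, Matrix.map_apply, Algebra.smul_def, mul_one]
  rfl

/-- The operator `h₂`, which is a multiple of `Λ²`. -/
def J : Op := rep (cb .h2)

/-- The eigenvalues of `h₂`. -/
def jv : Fin 4 → ℂ := ![-1, 1, 1, -1]

/-- The matrix of `h₂` is diagonal with eigenvalues `±1`. -/
theorem J_eq : J = Matrix.diagonal fun i => algebraMap ℂ E (jv i) := by
  rw [J, rep_cb]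
  ext1 i j
  rw [Matrix.map_apply]
  fin_cases i <;> fin_cases j <;> simp [B.mat, jv, Matrix.diagonal]

theorem J_mul_apply (M : Op) (i j : Fin 4) : (J * M) i j = jv i • M i j := by
  rw [J_eq, Matrix.diagonal_mul, Algebra.smul_def]

theorem mul_J_apply (M : Op) (i j : Fin 4) : (M * J) i j = jv j • M i j := by
  rw [J_eq, Matrix.mul_diagonal, Algebra.smul_def, Algebra.commutes]

theorem jv_mul_self (i : Fin 4) : jv i * jv i = 1 := by
  fin_cases i <;> simp [jv]

theorem J_mul_J : J * J = 1 := by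
  ext1 i j
  rw [J_mul_apply, J_eq, Matrix.diagonal_apply, Matrix.one_apply]
  split_ifs with h
  · rw [Algebra.smul_def, ← map_mul, jv_mul_self, map_one]
  · rw [smul_zero]

/-- `J` as a power series. -/
def Js : Ser := C J

theorem Js_mul_Js : Js * Js = 1 := by
  rw [Js, ← map_mul, J_mul_J, map_one]

theorem Js_mem : Js ∈ Ser.Fil 0 := by
  apply Ser.C_mem_Fil
  intro i j h
  rw [J_eq, Matrix.diagonal_apply_ne]
  rintro rfl
  simp at h

/-- `ζ Λ = ζ f₂ + e₂`. -/
def Lt : Ser := PowerSeries.X * C (rep (cb .f2)) + C (rep (cb .e2))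

/-- `Λ² = z h₂`, since `f₂² = e₂² = 0` and `[f₂, e₂] = h₂`. -/
theorem Lt_mul_Lt : Lt * Lt = PowerSeries.X * Js := by
  have m1 : B.f2.mat * B.f2.mat = 0 := by decide +kernel
  have m2 : B.e2.mat * B.e2.mat = 0 := by decide +kernel
  have m3 : B.f2.mat * B.e2.mat + B.e2.mat * B.f2.mat = B.h2.mat := by decide +kernel
  have r1 : rep (cb .f2) * rep (cb .f2) = 0 := by
    rw [rep_cb, ← Matrix.map_mul, m1, Matrix.map_zero _ (map_zero _)]
  have r2 : rep (cb .e2) * rep (cb .e2) = 0 := by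
    rw [rep_cb, ← Matrix.map_mul, m2, Matrix.map_zero _ (map_zero _)]
  have r3 : rep (cb .f2) * rep (cb .e2) + rep (cb .e2) * rep (cb .f2) = J := by
    rw [J, rep_cb, rep_cb, rep_cb, ← Matrix.map_mul, ← Matrix.map_mul, ← Matrix.map_add, m3]
    exact fun a b => map_add _ a b
  have c1 : (C (rep (cb .f2)) : Ser) * PowerSeries.X = PowerSeries.X * C (rep (cb .f2)) :=
    PowerSeries.commute_X _
  have c2 : (C (rep (cb .e2)) : Ser) * PowerSeries.X = PowerSeries.X * C (rep (cb .e2)) :=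
    PowerSeries.commute_X _
  rw [Js, ← r3, Lt, map_add, map_mul, map_mul, add_mul, mul_add, mul_add]
  have e1 : (PowerSeries.X * C (rep (cb .f2)) : Ser) * (PowerSeries.X * C (rep (cb .f2))) = 0 := by
    rw [mul_assoc, ← mul_assoc (C (rep (cb .f2)) : Ser), c1, mul_assoc, ← map_mul, r1]
    simp
  have e2 : (C (rep (cb .e2)) : Ser) * C (rep (cb .e2)) = 0 := by
    rw [← map_mul, r2, map_zero]
  rw [e1, e2, ← mul_assoc (C (rep (cb .e2)) : Ser), c2]
  noncomm_ring

theorem gser_single (y : B → PA) : gser (Pi.single 0 y) = C (rep y) := by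
  ext1 n
  rw [coeff_gser, coeff_C]
  by_cases hn : n = 0
  · subst hn
    rw [Pi.single_eq_same, if_pos rfl]
  · rw [Pi.single_eq_of_ne hn, if_neg hn, rep_zero]

theorem C_rep_mem {d : ℤ} {y : B → PA} (h : ∀ b : B, b.deg < d → y b = 0) :
    (C (rep y) : Ser) ∈ Ser.Fil d := by
  rw [← gser_single, gser_mem_Fil]
  intro k b hk
  by_cases h0 : k = 0
  · subst h0
    rw [Pi.single_eq_same]
    exact h b (by simpa using hk)
  · rw [Pi.single_eq_of_ne h0]
    rfl

theorem Lt_mem : Lt ∈ Ser.Fil 1 := by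
  refine add_mem ((Ser.X_mul_mem_Fil_iff (d := -1)).2 (Ser.mem_Fil_neg_one _)) (C_rep_mem ?_)
  intro b hb
  rw [cb, Pi.single_eq_of_ne]
  rintro rfl
  exact absurd hb (by decide)

/-- The operator `ζ (D + x + z e₂)`. -/
def Lax (x : B → PA) : Ser := PowerSeries.X * C (Dhat + rep x) + C (rep (cb .e2))

/-- The Lax operator is `Λ`, of degree `-1`, up to terms of degree zero and higher; the factor `ζ`
raises all degrees by two. -/
theorem Lax_sub_Lt_mem {x : B → PA} (h3 : x .f3 = 0) (h2 : x .f2 = 1) :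
    Lax x - Lt ∈ Ser.Fil 2 := by
  have e : Lax x - Lt = PowerSeries.X * (C Dhat + C (rep (x - cb .f2))) := by
    rw [Lax, Lt, rep_sub, map_add, map_sub]
    noncomm_ring
  rw [e]
  refine (Ser.X_mul_mem_Fil_iff (d := 0)).2 (add_mem C_Dhat_mem (C_rep_mem ?_))
  intro b hb
  have hc : b = .f3 ∨ b = .f2 := by
    revert b
    decide
  rcases hc with rfl | rfl
  · rw [Pi.sub_apply, h3, cb, Pi.single_eq_of_ne (by decide), sub_zero]
  · rw [Pi.sub_apply, h2, cb, Pi.single_eq_same, sub_self]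

/-- Since `Λ²` is a multiple of `J`, an operator that anticommutes with `J` is controlled by its
commutator with `Λ`: `[M, Λ²] = [M, Λ] Λ + Λ [M, Λ]` is a multiple of `M J`. -/
theorem mem_Fil_of_commutator {M : Ser} {e : ℤ} (hM : M * Js = -(Js * M))
    (h : M * Lt - Lt * M ∈ Ser.Fil e) : M ∈ Ser.Fil (e - 1) := by
  have h1 : M * (Lt * Lt) - Lt * Lt * M ∈ Ser.Fil (e + 1) := by
    have e1 : M * (Lt * Lt) - Lt * Lt * M =
        (M * Lt - Lt * M) * Lt + Lt * (M * Lt - Lt * M) := by noncomm_ring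
    rw [e1]
    refine add_mem (Ser.mul_mem_Fil h Lt_mem) ?_
    rw [add_comm e 1]
    exact Ser.mul_mem_Fil Lt_mem h
  have h2 : M * (Lt * Lt) - Lt * Lt * M = PowerSeries.X * ((2 : ℂ) • (M * Js)) := by
    rw [Lt_mul_Lt, ← mul_assoc, PowerSeries.commute_X M, mul_assoc, mul_assoc, ← mul_sub, two_smul]
    congr 1
    rw [hM]
    abel
  rw [h2] at h1
  have h3 := (Ser.X_mul_mem_Fil_iff (d := e - 1)).1 (by convert h1 using 2; ring)
  have h4 := Ser.mul_mem_Fil (Ser.smul_mem_Fil (1 / 2 : ℂ) h3) Js_mem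
  rw [smul_smul, smul_mul_assoc, mul_assoc, Js_mul_Js] at h4
  norm_num at h4
  exact h4

/-! ### Dependence of the exponential on its argument -/

namespace Ser

variable {T T' : Ser} {e : ℤ}

theorem pow_sub_pow_mem (hT : T ∈ Fil 1) (hT' : T' ∈ Fil 1) (h : T' - T ∈ Fil e) (n : ℕ) :
    T' ^ (n + 1) - T ^ (n + 1) ∈ Fil (e + n) := by
  induction n with
  | zero => simpa using h
  | succ n ih =>
    have e1 : T' ^ (n + 1 + 1) - T ^ (n + 1 + 1) =
        T' ^ (n + 1) * (T' - T) + (T' ^ (n + 1) - T ^ (n + 1)) * T := by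
      rw [pow_succ T' (n + 1), pow_succ T (n + 1)]
      noncomm_ring
    rw [e1]
    refine add_mem ?_ ?_
    · convert mul_mem_Fil (pow_mem_Fil hT' (n + 1)) h using 2
      ring
    · convert mul_mem_Fil ih hT using 2
      push_cast
      ring

/-- A change of `T` in degree `e` changes `e^T` by the same amount up to terms of degree `e + 1`.
-/
theorem expSer_sub_mem (hT : T ∈ Fil 1) (hT' : T' ∈ Fil 1) (h : T' - T ∈ Fil e) :
    expSer T' - expSer T - (T' - T) ∈ Fil (e + 1) := by
  have e1 : expSer T' - expSer T - (T' - T) = fsum fun h =>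
      ((h.factorial : ℂ)⁻¹) • T' ^ h - ((h.factorial : ℂ)⁻¹) • T ^ h -
        (if h = 1 then T' - T else 0) := by
    ext1 k
    have : ∑ h ∈ Finset.range (2 * k + 2), coeff k (if h = 1 then T' - T else 0) =
        coeff k (T' - T) := by
      rw [Finset.sum_eq_single_of_mem 1 (by simp)]
      · rw [if_pos rfl]
      · intro h _ hh
        rw [if_neg hh, map_zero]
    simp only [expSer, fsum, map_sub, coeff_mk, Finset.sum_sub_distrib] at this ⊢
    rw [this]
  rw [e1]
  apply fsum_mem_Fil
  intro n
  rcases n with _ | _ | n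
  · simp
  · simp
  · rw [if_neg (by omega), sub_zero, ← smul_sub]
    refine smul_mem_Fil _ (Fil_anti ?_ (pow_sub_pow_mem hT hT' h (n + 1)))
    push_cast
    have : (0 : ℤ) ≤ n := by positivity
    omega

theorem expSer_zero : expSer 0 = 1 := by
  have := expSer_mul_expSer_neg (T := 0) (zero_mem _)
  rw [neg_zero] at this
  rw [expSer, ← fsum_single 1]
  congr 1
  funext h
  cases h with
  | zero => simp
  | succ h => simp

theorem expSer_sub_one_mem (hT : T ∈ Fil 1) : expSer T - 1 ∈ Fil 1 := by
  have h := expSer_sub_mem (zero_mem (Fil 1)) hT (e := 1) (by simpa using hT)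
  rw [expSer_zero, sub_zero] at h
  have := add_mem (Fil_anti (by norm_num) h) hT
  simpa using this

end Ser

/-- Conjugation by an exponential does not change the leading term `Λ`. -/
theorem conj_sub_Lt_mem {T L K : Ser} (hT : T ∈ Ser.Fil 1) (hL : L - Lt ∈ Ser.Fil 2)
    (hK : Ser.expSer T * L = K * Ser.expSer T) : K - Lt ∈ Ser.Fil 2 := by
  set G := Ser.expSer T with hG
  set G' := Ser.expSer (-T) with hG'
  have hT' : -T ∈ Ser.Fil 1 := neg_mem hT
  have g1 : G - 1 ∈ Ser.Fil 1 := Ser.expSer_sub_one_mem hT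
  have g2 : G' - 1 ∈ Ser.Fil 1 := Ser.expSer_sub_one_mem hT'
  have g3 : G * G' = 1 := Ser.expSer_mul_expSer_neg hT
  have hL1 : L ∈ Ser.Fil 1 := by
    have := add_mem (Ser.Fil_anti (by norm_num) hL) Lt_mem
    simpa using this
  have e1 : K - Lt = (L - Lt) + (G - 1) * L * G' + L * (G' - 1) := by
    have : K = G * L * G' := by rw [hK, mul_assoc, g3, mul_one]
    rw [this]
    noncomm_ring
  rw [e1]
  refine add_mem (add_mem hL ?_) (Ser.mul_mem_Fil hL1 g2)
  have := Ser.mul_mem_Fil (Ser.mul_mem_Fil g1 hL1) (Ser.expSer_mem hT')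
  simpa using this

/-- The first order variation of a conjugate of `L = Λ + …` under a change `τ` of `T` is `[τ, Λ]`.
-/
theorem conj_variation {T T' L K K' : Ser} {e : ℤ} (hT : T ∈ Ser.Fil 1) (hT' : T' ∈ Ser.Fil 1)
    (he : T' - T ∈ Ser.Fil e) (hL : L - Lt ∈ Ser.Fil 2)
    (hK : Ser.expSer T * L = K * Ser.expSer T) (hK' : Ser.expSer T' * L = K' * Ser.expSer T') :
    K' - K - ((T' - T) * Lt - Lt * (T' - T)) ∈ Ser.Fil (e + 2) := by
  have hKL := conj_sub_Lt_mem hT hL hK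
  set τ := T' - T with hτ
  set G := Ser.expSer T with hG
  set H := Ser.expSer T' with hH
  set H' := Ser.expSer (-T') with hH'
  have g2 : H' - 1 ∈ Ser.Fil 1 := Ser.expSer_sub_one_mem (neg_mem hT')
  have g3 : H * H' = 1 := Ser.expSer_mul_expSer_neg hT'
  have hd : H - G - τ ∈ Ser.Fil (e + 1) := Ser.expSer_sub_mem hT hT' he
  have hd' : H - G ∈ Ser.Fil e := by
    have := add_mem (Ser.Fil_anti (by omega) hd) he
    simpa using this
  have c1 : τ * Lt - Lt * τ ∈ Ser.Fil (e + 1) := by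
    refine sub_mem (Ser.mul_mem_Fil he Lt_mem) ?_
    rw [add_comm]
    exact Ser.mul_mem_Fil Lt_mem he
  -- The identity `(K₂ - K) H = (H - G) L - K (H - G)` for `G = e^T`, `H = e^{T₂}` with conjugates
  -- `K`, `K₂`, in which `L`, `K` are `Λ` and `H - G` is `τ` to leading order.
  have c2 : (K' - K) * H - (τ * Lt - Lt * τ) ∈ Ser.Fil (e + 2) := by
    have e1 : (K' - K) * H - (τ * Lt - Lt * τ) = (H - G) * (L - Lt) - (K - Lt) * (H - G) +
        (H - G - τ) * Lt - Lt * (H - G - τ) := by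
      rw [sub_mul, ← hK']
      have : K * H = K * (H - G) + G * L := by rw [hK]; noncomm_ring
      rw [this]
      noncomm_ring
    rw [e1]
    refine sub_mem (add_mem (sub_mem (Ser.mul_mem_Fil hd' hL) ?_) ?_) ?_
    · rw [add_comm]
      exact Ser.mul_mem_Fil hKL hd'
    · convert Ser.mul_mem_Fil hd Lt_mem using 2
      ring
    · convert Ser.mul_mem_Fil Lt_mem hd using 2
      ring
  -- The factor `H` is the identity to leading order.
  have e2 : ∀ c, K' - K - c = ((K' - K) * H - c) * H' + c * (H' - 1) := by
    intro c
    have : (K' - K) * H * H' = K' - K := by rw [mul_assoc, g3, mul_one]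
    rw [sub_mul _ c, this]
    noncomm_ring
  rw [e2]
  refine add_mem ?_ ?_
  · have := Ser.mul_mem_Fil c2 (Ser.expSer_mem (neg_mem hT'))
    rwa [add_zero] at this
  · convert Ser.mul_mem_Fil c1 g2 using 2
    ring

/-! ### The kernel and the image of `ad Λ²` -/

/-- The basis elements which anticommute with `h₂` in `sl(2|2)`; they span the image of `ad Λ²`, and
the other ones span its kernel. -/
def B.anti (b : B) : Prop := b = .f1 ∨ b = .e1 ∨ b = .e3 ∨ b = .f3

instance : DecidablePred B.anti := fun b => by
  unfold B.anti
  infer_instance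

/-- The eigenvalues of `ad h₂`. -/
def hwt : B → ℚ
  | .f1 | .f3 => -2
  | .e1 | .e3 => 2
  | _ => 0

theorem hwt_ne_zero_iff (b : B) : hwt b ≠ 0 ↔ b.anti := by
  cases b <;> simp [hwt, B.anti]

/-- An element of the basis either commutes or anticommutes with `h₂` as a matrix. -/
theorem jv_of_mat_ne_zero {b : B} {i j : Fin 4} (h : b.mat i j ≠ 0) :
    jv j = (if b.anti then -1 else 1) * jv i := by
  have key : ∀ (b : B) (i j : Fin 4), (b.mat i j).num ≠ 0 →
      (b.anti ↔ ((i = 0 ∨ i = 3) ↔ ¬ (j = 0 ∨ j = 3))) := by decide +kernel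
  have hj : ∀ i, jv i = if i = 0 ∨ i = 3 then -1 else 1 := by
    intro i
    fin_cases i <;> simp [jv]
  have := key b i j fun h0 => h (Rat.num_eq_zero.1 h0)
  rw [hj i, hj j]
  by_cases h1 : i = 0 ∨ i = 3 <;> by_cases h2 : j = 0 ∨ j = 3 <;> simp [this, h1, h2]

theorem rep_J_apply (x : B → PA) (c : ℂ)
    (h : ∀ b : B, x b ≠ 0 → (if b.anti then -1 else 1) = c) : rep x * J = c • (J * rep x) := by
  ext1 i j
  rw [mul_J_apply, Matrix.smul_apply, J_mul_apply, rep_apply, ← map_smul, ← map_smul, ← map_smul]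
  congr 1
  simp only [ent, Matrix.of_apply, Finset.smul_sum]
  refine Finset.sum_congr rfl fun b _ => ?_
  by_cases hb : x b = 0
  · simp [hb]
  by_cases hm : b.mat i j = 0
  · simp [hm]
  rw [jv_of_mat_ne_zero hm, h b hb]
  simp only [smul_smul, mul_assoc]

theorem gser_mul_Js_of_anti {x : ℕ → B → PA} (h : ∀ n b, ¬ b.anti → x n b = 0) :
    gser x * Js = -(Js * gser x) := by
  ext1 n
  rw [Js, coeff_mul_C, map_neg, coeff_C_mul, coeff_gser, rep_J_apply (x n) (-1), neg_one_smul]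
  intro b hb
  rw [if_pos]
  by_contra hc
  exact hb (h n b hc)

theorem gser_mul_Js_of_not_anti {x : ℕ → B → PA} (h : ∀ n (b : B), b.anti → x n b = 0) :
    gser x * Js = Js * gser x := by
  ext1 n
  rw [Js, coeff_mul_C, coeff_C_mul, coeff_gser, rep_J_apply (x n) 1, one_smul]
  intro b hb
  rw [if_neg]
  intro hc
  exact hb (h n b hc)

/-- The part of `x` in the image of `ad Λ²`. -/
def antiPart (x : ℕ → B → PA) : ℕ → B → PA := fun n b => if b.anti then x n b else 0

theorem Dhat_mul_J : Dhat * J = J * Dhat := by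
  ext1 i j
  rw [mul_J_apply, J_mul_apply, Dhat, Matrix.diagonal_apply]
  split_ifs with h
  · rw [h]
  · rw [smul_zero, smul_zero]

theorem struc_h2 (j k : B) : struc .h2 j k = if j = k then hwt k else 0 := by
  rw [struc_eq]
  revert j k
  decide +kernel

theorem Lam_apply (b : B) : Lam b = (if b = .f2 then HahnSeries.single 0 1 else 0) +
    (if b = .e2 then HahnSeries.single (-1) 1 else 0) := by
  ext k
  rw [Lam, fLoop, Pi.add_apply, HahnSeries.coeff_add, HahnSeries.coeff_add, coeff_el, coeff_el]
  cases b <;> simp [HahnSeries.coeff_single]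

/-- `Λ² = ½ [Λ, Λ] = z h₂`. -/
theorem LamSq_eq : LamSq = el .h2 1 1 := by
  have s1 : ∀ k, strucT .f2 .e2 k = if k = .h2 then 1 else 0 := by decide +kernel
  have s2 : ∀ k, strucT .e2 .f2 k = if k = .h2 then 1 else 0 := by decide +kernel
  have s3 : ∀ k, strucT .f2 .f2 k = 0 := by decide +kernel
  have s4 : ∀ k, strucT .e2 .e2 k = 0 := by decide +kernel
  funext k
  have hz : ∀ p : ZMod 2, (0 : HahnSeries ℤ PA).map (sigmaPow (par := barPar) p) = 0 := by
    intro p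
    ext n
    rw [HahnSeries.map_coeff, HahnSeries.coeff_zero, map_zero]
  have hs : ∀ (p : ZMod 2) (n : ℤ), (HahnSeries.single n (1 : PA)).map (sigmaPow (par := barPar) p) =
      HahnSeries.single n 1 := by
    intro p n
    ext m
    rw [HahnSeries.map_coeff, HahnSeries.coeff_single]
    split_ifs
    · exact map_one _
    · exact map_zero _
  have hb : loopBracket Lam Lam k = (if k = .h2 then (2 : ℂ) • HahnSeries.single (-1) 1 else 0) := by
    simp only [loopBracket, sum_B, Lam_apply, struc_eq, s1, s2, s3, s4, reduceCtorEq, if_true, if_false,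
      hz, hs, mul_zero, zero_mul, add_zero, zero_add, smul_zero, Rat.cast_zero, zero_smul,
      HahnSeries.single_mul_single, mul_one]
    split_ifs
    · ext m
      simp only [Rat.cast_one, HahnSeries.coeff_add, HahnSeries.coeff_smul]
      module
    · simp
  rw [LamSq, Pi.smul_apply, hb]
  ext n
  rw [HahnSeries.coeff_smul, coeff_el]
  by_cases hk : k = .h2
  · rw [if_pos hk, HahnSeries.coeff_smul, HahnSeries.coeff_single, smul_smul]
    norm_num [hk]
  · simp [hk]

theorem loopBracket_LamSq_coeff (Y : Loop) (k : B) (n : ℤ) :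
    (loopBracket LamSq Y k).coeff n = (hwt k : ℂ) • (Y k).coeff (n + 1) := by
  rw [LamSq_eq, loopBracket_coeff, Finset.sum_eq_single .h2]
  · rw [Finset.sum_eq_single k]
    · rw [struc_h2, if_pos rfl]
      have : (el .h2 1 1 .h2).map (sigmaPow (par := barPar) k.par) = HahnSeries.single (-1) 1 := by
        ext m
        rw [HahnSeries.map_coeff, coeff_el, HahnSeries.coeff_single]
        by_cases hm : m = -1
        · simp [hm]
        · simp [hm]
      rw [this]
      congr 1
      have := HahnSeries.coeff_single_mul_add (r := (1 : PA)) (x := Y k) (a := n + 1) (b := -1)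
      rw [one_mul] at this
      rw [← this]
      congr 1
      ring
    · intro j _ hj
      rw [struc_h2, if_neg hj]
      simp
    · simp
  · intro i _ hi
    refine Finset.sum_eq_zero fun j _ => ?_
    have : (el .h2 1 1 i).map (sigmaPow (par := barPar) j.par) = 0 := by
      ext m
      rw [HahnSeries.map_coeff, coeff_el, if_neg (fun h => hi h.1), map_zero, HahnSeries.coeff_zero]
    rw [this, zero_mul, HahnSeries.coeff_zero, smul_zero]
  · simp

/-- `ad Λ² = z ad h₂` is diagonal in the basis of `g`, with nonzero eigenvalues exactly on the
`anti` elements. -/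
theorem mem_image_ad_LamSq_iff (T : Loop) :
    (∃ Y : Loop, T = loopBracket LamSq Y) ↔ ∀ b : B, ¬ b.anti → T b = 0 := by
  constructor
  · rintro ⟨Y, rfl⟩ b hb
    ext n
    have : hwt b = 0 := by
      by_contra h
      exact hb ((hwt_ne_zero_iff b).1 h)
    rw [loopBracket_LamSq_coeff, this, Rat.cast_zero, zero_smul, HahnSeries.coeff_zero]
  · intro h
    refine ⟨fun b => (hwt b : ℂ)⁻¹ • (HahnSeries.single (1 : ℤ) (1 : PA) * T b), ?_⟩
    funext b
    ext n
    rw [loopBracket_LamSq_coeff, HahnSeries.coeff_smul, HahnSeries.coeff_single_mul_add, one_mul,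
      smul_smul]
    by_cases hb : b.anti
    · rw [mul_inv_cancel₀, one_smul]
      have := (hwt_ne_zero_iff b).2 hb
      exact_mod_cast this
    · rw [h b hb, HahnSeries.coeff_zero, smul_zero]

theorem mem_kernel_ad_LamSq_iff (K : Loop) :
    loopBracket LamSq K = 0 ↔ ∀ b : B, b.anti → K b = 0 := by
  constructor
  · intro h b hb
    ext n
    have h1 := congrArg (fun X : Loop => (X b).coeff (n - 1)) h
    simp only [loopBracket_LamSq_coeff, sub_add_cancel] at h1
    have h2 : (hwt b : ℂ) ≠ 0 := by exact_mod_cast (hwt_ne_zero_iff b).2 hb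
    exact (smul_eq_zero.1 h1).resolve_left h2
  · intro h
    funext b
    ext n
    rw [loopBracket_LamSq_coeff]
    by_cases hb : b.anti
    · rw [h b hb, HahnSeries.coeff_zero, smul_zero]
      rfl
    · have : hwt b = 0 := by
        by_contra h
        exact hb ((hwt_ne_zero_iff b).1 h)
      rw [this, Rat.cast_zero, zero_smul]
      rfl

/-! ### Loops from sequences of coefficients -/

/-- The loop `∑ ζ^{n-s} x_n`. -/
def toLoop (s : ℤ) (x : ℕ → B → PA) : Loop := fun b =>
  HahnSeries.ofSuppBddBelow (fun k => if -s ≤ k then x (k + s).toNat b else 0)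
    ⟨-s, fun k hk => by
      by_contra h
      exact hk (if_neg h)⟩

theorem coeff_toLoop (s : ℤ) (x : ℕ → B → PA) (b : B) (k : ℤ) :
    (toLoop s x b).coeff k = if -s ≤ k then x (k + s).toNat b else 0 := rfl

theorem lowBd_toLoop (s : ℤ) (x : ℕ → B → PA) : LowBd s (toLoop s x) := by
  intro b k hk
  rw [coeff_toLoop, if_neg (by omega)]

theorem lcoef_toLoop (s : ℤ) (x : ℕ → B → PA) : lcoef s (toLoop s x) = x := by
  funext n b
  rw [lcoef, coeff_toLoop, if_pos (by omega), sub_add_cancel, Int.toNat_natCast]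

/-- All coefficients of `X` belong to `S`. -/
def CoefIn (S : Subalgebra ℂ PA) (X : Loop) : Prop := ∀ (b : B) (k : ℤ), (X b).coeff k ∈ S

theorem coefIn_toLoop {S : Subalgebra ℂ PA} {s : ℤ} {x : ℕ → B → PA} (h : ∀ n b, x n b ∈ S) :
    CoefIn S (toLoop s x) := by
  intro b k
  rw [coeff_toLoop]
  split_ifs
  · exact h _ _
  · exact zero_mem _

theorem homog_toLoop {q : ZMod 2} {s : ℤ} {x : ℕ → B → PA} (h : ∀ n, GHom q (x n)) :
    (toLoop s x).IsHomog q := by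
  intro b k
  rw [coeff_toLoop]
  split_ifs
  · exact h _ _
  · exact IsHomog.zero _

theorem CoefIn.loopBracket {S : Subalgebra ℂ PA} (hS : IsDiffStable S) {X Y : Loop}
    (hX : CoefIn S X) (hY : CoefIn S Y) : CoefIn S (SuperDS.loopBracket X Y) := by
  intro b k
  rw [loopBracket_coeff]
  refine sum_mem fun i _ => sum_mem fun j _ => Subalgebra.smul_mem _ ?_ _
  rw [HahnSeries.coeff_mul]
  refine sum_mem fun p _ => mul_mem ?_ (hY _ _)
  rw [HahnSeries.map_coeff]
  exact hS.sigmaPow_mem _ (hX _ _)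

theorem CoefIn.adOp {S : Subalgebra ℂ PA} (hS : IsDiffStable S) {T X : Loop} (hT : CoefIn S T)
    (hX : CoefIn S X) (h : ℕ) : CoefIn S ((adOp T)^[h] (1, X)).2 := by
  induction h with
  | zero => exact hX
  | succ h ih =>
    rw [Function.iterate_succ_apply']
    intro b k
    simp only [SuperDS.adOp, Pi.sub_apply, Pi.smul_apply, HahnSeries.coeff_sub,
      HahnSeries.coeff_smul, loopD, HahnSeries.map_coeff]
    exact sub_mem (hT.loopBracket hS ih b k) (Subalgebra.smul_mem _ (Subalgebra.smul_mem _
      (hS.D_mem _ (hT b k)) _) _)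

theorem expCoef_mem {S : Subalgebra ℂ PA} (hS : IsDiffStable S) {T X : Loop} (hT : CoefIn S T)
    (hX : CoefIn S X) (n : ℕ) (b : B) : expCoef T X n b ∈ S := by
  rw [expCoef, Finset.sum_apply]
  exact sum_mem fun h _ => Subalgebra.smul_mem _ (hT.adOp hS hX h b _) _

theorem gHom_expCoef {T X : Loop} (hT : PosDeg T) (hT' : T.IsHomog 0) (hX : LowBd 1 X)
    (hX' : X.IsHomog 1) (n : ℕ) : GHom 1 (expCoef T X n) := by
  intro b
  rw [expCoef, Finset.sum_apply]
  exact IsHomog.sum _ _ fun h _ => ((adOp_iterate hT hT' hX hX' h).2.1 b _).smul _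

theorem expSer_mul_LX {T X : Loop} (hT : PosDeg T) (hT' : T.IsHomog 0) (hX : LowBd 1 X)
    (hX' : X.IsHomog 1) (hX0 : ser 1 X ∈ Ser.Fil 0) : Ser.expSer (ser 0 T) * LX X =
      (PowerSeries.X * C Dhat + gser (expCoef T X)) * Ser.expSer (ser 0 T) := by
  rw [Ser.expSer_mul hT.mem_Fil (LX_mem (by norm_num) hX0), ← gser_expCoef hT hT' hX hX' hX0]

/-! ### Existence and uniqueness of the dressing -/

theorem gser_add (x y : ℕ → B → PA) : gser (x + y) = gser x + gser y := by
  ext1 n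
  rw [map_add, coeff_gser, coeff_gser, coeff_gser, Pi.add_apply, rep_add]

theorem gser_sub (x y : ℕ → B → PA) : gser (x - y) = gser x - gser y := by
  ext1 n
  rw [map_sub, coeff_gser, coeff_gser, coeff_gser, Pi.sub_apply, rep_sub]

theorem gser_neg (x : ℕ → B → PA) : gser (-x) = -gser x := by
  ext1 n
  rw [map_neg, coeff_gser, coeff_gser, Pi.neg_apply, rep_neg]

theorem gser_zero : gser 0 = 0 := by
  ext1 n
  rw [map_zero, coeff_gser, Pi.zero_apply, rep_zero]

/-- The sequence `x` shifted by one. -/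
def shiftS (x : ℕ → B → PA) : ℕ → B → PA
  | 0 => 0
  | n + 1 => x n

theorem X_mul_gser (x : ℕ → B → PA) : PowerSeries.X * gser x = gser (shiftS x) := by
  ext1 n
  cases n with
  | zero => rw [coeff_zero_X_mul, coeff_gser, shiftS, rep_zero]
  | succ n => rw [coeff_succ_X_mul, coeff_gser, coeff_gser, shiftS]

theorem gser_commutator_C {q : ZMod 2} {t : ℕ → B → PA} {y : B → PA} (ht : ∀ n, GHom 0 (t n))
    (hy : GHom q y) : gser t * C (rep y) - C (rep y) * gser t = gser fun n => gBr (t n) y := by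
  ext1 n
  rw [map_sub, coeff_mul_C, coeff_C_mul, coeff_gser, coeff_gser, rep_gBr (ht n) hy]

theorem gHom_cb (b : B) : GHom b.par (cb b) := by
  intro c
  by_cases h : c = b
  · subst h
    rw [cb, Pi.single_eq_same, CharTwo.add_self_eq_zero]
    exact isHomog_one
  · rw [cb, Pi.single_eq_of_ne h]
    exact IsHomog.zero _

theorem gser_commutator_Lt {t : ℕ → B → PA} (ht : ∀ n, GHom 0 (t n)) :
    gser t * Lt - Lt * gser t =
      gser (shiftS (fun n => gBr (t n) (cb .f2)) + fun n => gBr (t n) (cb .e2)) := by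
  rw [gser_add, ← X_mul_gser, ← gser_commutator_C ht (gHom_cb .f2),
    ← gser_commutator_C ht (gHom_cb .e2), Lt, mul_add, ← mul_assoc, PowerSeries.commute_X (gser t)]
  noncomm_ring

/-- The solution `τ` of `[τ, ζ Λ] = -κ` for `κ` in the image of `ad Λ²`. -/
def tauOf (κ : ℕ → B → PA) : ℕ → B → PA := fun n b =>
  match b with
  | .f1 => κ (n + 1) .f3
  | .e3 => (1 / 2 : ℂ) • κ (n + 1) .e1
  | .f3 => -((1 / 2 : ℂ) • κ n .f1)
  | .e1 => κ n .e3
  | _ => 0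

theorem gHom_tauOf {κ : ℕ → B → PA} (hκ : ∀ n, GHom 1 (κ n)) (n : ℕ) : GHom 0 (tauOf κ n) := by
  have h2 : (1 : ZMod 2) + 1 = 0 := by decide
  intro b
  cases b <;> simp only [tauOf, B.par, zero_add]
  · have := hκ n .f1
    simp only [B.par, h2] at this
    exact (this.smul _).neg
  · exact IsHomog.zero _
  · exact IsHomog.zero _
  · have := hκ (n + 1) .e1
    simp only [B.par, h2] at this
    exact this.smul _
  · simpa [B.par] using hκ n .e3
  · exact IsHomog.zero _
  · simpa [B.par] using hκ (n + 1) .f3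
  · exact IsHomog.zero _

/-- The operator `ad Λ` is invertible on the image of `ad Λ²`. The two components that are required
to vanish are those whose preimages would involve `ζ⁻¹`. -/
theorem tauOf_commutator {κ : ℕ → B → PA} (hκ : ∀ n, GHom 1 (κ n)) (h3 : κ 0 .f3 = 0)
    (h1 : κ 0 .e1 = 0) :
    gser (tauOf κ) * Lt - Lt * gser (tauOf κ) = -gser (antiPart κ) := by
  have ht := gHom_tauOf hκ
  rw [gser_commutator_Lt ht, ← gser_neg]
  congr 1
  have v1 : cb .f2 .f2 = 1 := Pi.single_eq_same _ _
  have v2 : ∀ b, b ≠ .f2 → cb .f2 b = 0 := fun b hb => Pi.single_eq_of_ne hb _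
  have v3 : cb .e2 .e2 = 1 := Pi.single_eq_same _ _
  have v4 : ∀ b, b ≠ .e2 → cb .e2 b = 0 := fun b hb => Pi.single_eq_of_ne hb _
  funext n b
  rcases n with _ | n <;> cases b <;>
  simp [shiftS, gBr_f3 (ht _), gBr_f2 (ht _), gBr_f1 (ht _), gBr_h1 (ht _), gBr_h2 (ht _),
    gBr_e1 (ht _), gBr_e2 (ht _), gBr_e3 (ht _), v1, v2, v3, v4, antiPart, B.anti, tauOf, h1, h3,
    smul_smul]

/-- Since `ζ Λ` has degree one, inverting its adjoint action lowers the degree by one. -/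
theorem tauOf_mem_Fil {κ : ℕ → B → PA} {d : ℤ} (h : gser (antiPart κ) ∈ Ser.Fil (d + 1)) :
    gser (tauOf κ) ∈ Ser.Fil d := by
  rw [gser_mem_Fil] at h ⊢
  have a1 : B.f3.anti := by decide
  have a2 : B.e1.anti := by decide
  have a3 : B.f1.anti := by decide
  have a4 : B.e3.anti := by decide
  intro k b hk
  cases b <;> simp only [B.deg] at hk <;> simp only [tauOf]
  · have := h k .f1 (by simp only [B.deg]; omega)
    rw [antiPart, if_pos a3] at this
    rw [this, smul_zero, neg_zero]
  · have := h (k + 1) .e1 (by simp only [B.deg]; push_cast; omega)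
    rw [antiPart, if_pos a2] at this
    rw [this, smul_zero]
  · have := h k .e3 (by simp only [B.deg]; omega)
    rwa [antiPart, if_pos a4] at this
  · have := h (k + 1) .f3 (by simp only [B.deg]; push_cast; omega)
    rwa [antiPart, if_pos a1] at this

/-- The loop `x + z e₂ ⊗ 1`. -/
def XL (x : B → PA) : Loop := cst x + el .e2 1 1

theorem Qc_add_Lam (w : Fin 4 → PA) : Qc w + Lam = XL (cv w) := by
  rw [Lam, ← add_assoc, Qc_add_fLoop, XL]

section Dressing

variable {x : B → PA} (hx : GHom 1 x) (h3 : x .f3 = 0) (h2 : x .f2 = 1)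

theorem lowBd_XL (x : B → PA) : LowBd 1 (XL x) := by
  intro b k hk
  rw [XL, Pi.add_apply, HahnSeries.coeff_add, coeff_cst, coeff_el, if_neg (by omega),
    if_neg (by omega), add_zero]

theorem homog_XL (hx : GHom 1 x) : (XL x).IsHomog 1 := by
  intro b k
  rw [XL, Pi.add_apply, HahnSeries.coeff_add]
  refine (homog_cst hx b k).add ?_
  rw [coeff_el]
  split_ifs with h
  · rw [h.1]
    exact isHomog_one
  · exact IsHomog.zero _

theorem ser_XL (x : B → PA) : ser 1 (XL x) = PowerSeries.X * C (rep x) + C (rep (cb .e2)) := by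
  rw [← ser_one_cst, ← gser_single, ser, ser, ← gser_add]
  congr 1
  funext n b
  rw [lcoef, XL, Pi.add_apply, HahnSeries.coeff_add, Pi.add_apply, Pi.add_apply]
  congr 1
  rw [coeff_el, cb]
  by_cases hn : n = 0
  · subst hn
    rw [Pi.single_eq_same]
    by_cases hb : b = .e2
    · subst hb
      simp
    · rw [Pi.single_eq_of_ne hb, if_neg (fun h => hb h.1)]
  · rw [Pi.single_eq_of_ne hn, if_neg (by omega)]
    rfl

theorem LX_XL (x : B → PA) : LX (XL x) = Lax x := by
  rw [LX, ser_XL, Lax, map_add]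
  noncomm_ring

theorem ser_XL_mem (x : B → PA) : ser 1 (XL x) ∈ Ser.Fil 0 := by
  rw [ser_XL]
  refine add_mem (Ser.Fil_anti (by norm_num)
    ((Ser.X_mul_mem_Fil_iff (d := -1)).2 (Ser.mem_Fil_neg_one _))) (C_rep_mem fun b hb => ?_)
  rw [cb, Pi.single_eq_of_ne]
  rintro rfl
  exact absurd hb (by decide)

/-- An even loop of positive degree with coefficients in `S` which lies in the image of `ad Λ²`. -/
structure Adapted (S : Subalgebra ℂ PA) (T : Loop) : Prop where
  posDeg : PosDeg T
  homog : T.IsHomog 0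
  coefIn : CoefIn S T
  anti : ∀ b : B, ¬ b.anti → T b = 0

/-- The components of `ζ e^{ad T} (D + x + z e₂) - ζ D`. -/
def dressed (x : B → PA) (T : Loop) : ℕ → B → PA := expCoef T (XL x)

variable {S : Subalgebra ℂ PA} {T T' : Loop}

theorem expSer_mul_Lax (hx : GHom 1 x) (hT : PosDeg T) (hT' : T.IsHomog 0) :
    Ser.expSer (ser 0 T) * Lax x =
      (PowerSeries.X * C Dhat + gser (dressed x T)) * Ser.expSer (ser 0 T) := by
  rw [← LX_XL, expSer_mul_LX hT hT' (lowBd_XL x) (homog_XL hx) (ser_XL_mem x), dressed]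

theorem gHom_dressed (hx : GHom 1 x) (hT : PosDeg T) (hT' : T.IsHomog 0) (n : ℕ) :
    GHom 1 (dressed x T n) := gHom_expCoef hT hT' (lowBd_XL x) (homog_XL hx) n

theorem dressed_mem (hS : IsDiffStable S) (hxS : ∀ b, x b ∈ S) (hT : CoefIn S T) (n : ℕ) (b : B) :
    dressed x T n b ∈ S := by
  apply expCoef_mem hS hT
  intro b k
  rw [XL, Pi.add_apply, HahnSeries.coeff_add, coeff_cst, coeff_el]
  refine add_mem ?_ ?_
  · split_ifs
    · exact hxS b
    · exact zero_mem _
  · split_ifs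
    · exact one_mem _
    · exact zero_mem _

theorem Lt_eq_gser : Lt = gser (shiftS (Pi.single 0 (cb .f2)) + Pi.single 0 (cb .e2)) := by
  rw [gser_add, ← X_mul_gser, gser_single, gser_single, Lt]

/-- The leading term `Λ` commutes with `h₂`, so the part in the image of `ad Λ²` starts in degree
two. -/
theorem antiPart_dressed_mem (hx : GHom 1 x) (h3 : x .f3 = 0) (h2 : x .f2 = 1) (hT : PosDeg T)
    (hT' : T.IsHomog 0) : gser (antiPart (dressed x T)) ∈ Ser.Fil 2 := by
  have h := conj_sub_Lt_mem hT.mem_Fil (Lax_sub_Lt_mem h3 h2) (expSer_mul_Lax hx hT hT')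
  have h' := sub_mem h X_mul_Dhat_mem
  have e : PowerSeries.X * C Dhat + gser (dressed x T) - Lt - PowerSeries.X * C Dhat =
      gser (dressed x T - (shiftS (Pi.single 0 (cb .f2)) + Pi.single 0 (cb .e2))) := by
    rw [gser_sub, ← Lt_eq_gser]
    abel
  rw [e, gser_mem_Fil] at h'
  rw [gser_mem_Fil]
  intro k b hk
  have h1 := h' k b hk
  rw [antiPart]
  split_ifs with hb
  · rw [← h1, Pi.sub_apply, Pi.sub_apply, eq_comm, sub_eq_self]
    have z1 : cb .f2 b = 0 := Pi.single_eq_of_ne (by rintro rfl; exact absurd hb (by decide)) _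
    have z2 : cb .e2 b = 0 := Pi.single_eq_of_ne (by rintro rfl; exact absurd hb (by decide)) _
    rcases k with _ | _ | k
    · simp [shiftS, z2]
    · simp [shiftS, z1]
    · simp [shiftS]
  · rfl

/-- To first order a change `τ` of `T` changes the dressed operator by `[τ, Λ]`. -/
theorem dressed_variation (hx : GHom 1 x) (h3 : x .f3 = 0) (h2 : x .f2 = 1) (hT : PosDeg T)
    (hT1 : T.IsHomog 0) (hT' : PosDeg T') (hT1' : T'.IsHomog 0) {e : ℤ}
    (he : ser 0 T' - ser 0 T ∈ Ser.Fil e) :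
    gser (dressed x T') - gser (dressed x T) -
      ((ser 0 T' - ser 0 T) * Lt - Lt * (ser 0 T' - ser 0 T)) ∈ Ser.Fil (e + 2) := by
  have h := conj_variation hT.mem_Fil hT'.mem_Fil he (Lax_sub_Lt_mem h3 h2)
    (expSer_mul_Lax hx hT hT1) (expSer_mul_Lax hx hT' hT1')
  rwa [add_sub_add_left_eq_sub] at h

theorem ser_add (s : ℤ) (X Y : Loop) : ser s (X + Y) = ser s X + ser s Y := by
  rw [ser, ser, ser, ← gser_add]
  rfl

theorem ser_toLoop (s : ℤ) (y : ℕ → B → PA) : ser s (toLoop s y) = gser y := by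
  rw [ser, lcoef_toLoop]

theorem Adapted.add (hT : Adapted S T) (hT' : Adapted S T') : Adapted S (T + T') where
  posDeg b k hk := by
    by_cases h : (T b).coeff k = 0
    · refine hT'.posDeg b k fun h' => hk ?_
      rw [Pi.add_apply, HahnSeries.coeff_add, h, h', add_zero]
    · exact hT.posDeg b k h
  homog b k := by
    rw [Pi.add_apply, HahnSeries.coeff_add]
    exact (hT.homog b k).add (hT'.homog b k)
  coefIn b k := by
    rw [Pi.add_apply, HahnSeries.coeff_add]
    exact add_mem (hT.coefIn b k) (hT'.coefIn b k)
  anti b hb := by rw [Pi.add_apply, hT.anti b hb, hT'.anti b hb, add_zero]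

theorem Adapted.zero (S : Subalgebra ℂ PA) : Adapted S 0 where
  posDeg _ _ hk := absurd rfl hk
  homog _ _ := IsHomog.zero _
  coefIn _ _ := zero_mem _
  anti _ _ := rfl

theorem adapted_tauOf {κ : ℕ → B → PA} (hκ : ∀ n, GHom 1 (κ n)) (hS : ∀ n b, κ n b ∈ S)
    (h : gser (antiPart κ) ∈ Ser.Fil 2) : Adapted S (toLoop 0 (tauOf κ)) where
  posDeg b k hk := by
    by_contra hc
    apply hk
    rw [coeff_toLoop]
    split_ifs with h0
    · have := tauOf_mem_Fil (d := 1) h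
      rw [gser_mem_Fil] at this
      exact this _ b (by omega)
    · rfl
  homog := homog_toLoop (gHom_tauOf hκ)
  coefIn := coefIn_toLoop fun n b => by
    cases b <;> simp only [tauOf]
    · exact neg_mem (Subalgebra.smul_mem _ (hS _ _) _)
    · exact zero_mem _
    · exact zero_mem _
    · exact Subalgebra.smul_mem _ (hS _ _) _
    · exact hS _ _
    · exact zero_mem _
    · exact hS _ _
    · exact zero_mem _
  anti b hb := by
    ext k
    rw [coeff_toLoop, HahnSeries.coeff_zero]
    split_ifs
    · cases b <;> first | rfl | exact absurd (by decide) hb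
    · rfl

/-- One step of the construction of the dressing: `T` is corrected by the `τ` for which `[τ, Λ]`
cancels the part of the dressed operator in the image of `ad Λ²`, to leading order. -/
def dressStep (x : B → PA) (T : Loop) : Loop := T + toLoop 0 (tauOf (dressed x T))

theorem antiPart_sub_add (κ κ' : ℕ → B → PA) :
    antiPart (κ' - κ + antiPart κ) = antiPart κ' := by
  funext n b
  simp only [antiPart, Pi.add_apply, Pi.sub_apply]
  split_ifs
  · abel
  · rfl

theorem antiPart_mem_Fil {κ : ℕ → B → PA} {d : ℤ} (h : gser κ ∈ Ser.Fil d) :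
    gser (antiPart κ) ∈ Ser.Fil d := by
  rw [gser_mem_Fil] at h ⊢
  intro k b hk
  rw [antiPart]
  split_ifs
  · exact h k b hk
  · rfl

/-- Each step raises the degree of the part of the dressed operator in the image of `ad Λ²` by one.
-/
theorem dressStep_spec (hS : IsDiffStable S) (hx : GHom 1 x) (h3 : x .f3 = 0) (h2 : x .f2 = 1)
    (hxS : ∀ b, x b ∈ S) (hT : Adapted S T) {d : ℤ}
    (hd : gser (antiPart (dressed x T)) ∈ Ser.Fil (d + 1)) :
    Adapted S (dressStep x T) ∧ ser 0 (dressStep x T) - ser 0 T ∈ Ser.Fil d ∧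
      gser (antiPart (dressed x (dressStep x T))) ∈ Ser.Fil (d + 2) := by
  have hκ := gHom_dressed hx hT.posDeg hT.homog
  have hF2 := antiPart_dressed_mem hx h3 h2 hT.posDeg hT.homog
  have hA : Adapted S (dressStep x T) :=
    hT.add (adapted_tauOf hκ (dressed_mem hS hxS hT.coefIn) hF2)
  have e1 : ser 0 (dressStep x T) - ser 0 T = gser (tauOf (dressed x T)) := by
    rw [dressStep, ser_add, ser_toLoop, add_sub_cancel_left]
  have hd1 : ser 0 (dressStep x T) - ser 0 T ∈ Ser.Fil d := by
    rw [e1]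
    exact tauOf_mem_Fil hd
  refine ⟨hA, hd1, ?_⟩
  have hv := dressed_variation hx h3 h2 hT.posDeg hT.homog hA.posDeg hA.homog hd1
  rw [gser_mem_Fil] at hF2
  have z : ∀ b : B, b.anti → b.deg < 2 → dressed x T 0 b = 0 := by
    intro b hb hb2
    have := hF2 0 b (by simpa using hb2)
    rwa [antiPart, if_pos hb] at this
  rw [e1, tauOf_commutator hκ (z _ (by decide) (by decide)) (z _ (by decide) (by decide)),
    sub_neg_eq_add, ← gser_sub, ← gser_add] at hv
  rw [← antiPart_sub_add (dressed x T)]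
  exact antiPart_mem_Fil hv

/-- The dressing up to a given degree. -/
def dressIter (x : B → PA) : ℕ → Loop
  | 0 => 0
  | n + 1 => dressStep x (dressIter x n)

theorem dressIter_spec (hS : IsDiffStable S) (hx : GHom 1 x) (h3 : x .f3 = 0) (h2 : x .f2 = 1)
    (hxS : ∀ b, x b ∈ S) (n : ℕ) : Adapted S (dressIter x n) ∧
      gser (antiPart (dressed x (dressIter x n))) ∈ Ser.Fil (n + 2) := by
  induction n with
  | zero =>
    refine ⟨Adapted.zero S, ?_⟩
    have := antiPart_dressed_mem hx h3 h2 (Adapted.zero S).posDeg (Adapted.zero S).homog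
    simpa [dressIter] using this
  | succ n ih =>
    have h := dressStep_spec hS hx h3 h2 hxS ih.1 (d := n + 1) (by convert ih.2 using 2; ring)
    refine ⟨h.1, ?_⟩
    have h' := h.2.2
    rw [show ((n + 1 : ℕ) : ℤ) + 2 = (n : ℤ) + 1 + 1 + 1 by push_cast; ring]
    exact h'

/-- The coefficients in degrees up to `n` do not change after the `n`-th step. -/
theorem dressIter_sub_mem (hS : IsDiffStable S) (hx : GHom 1 x) (h3 : x .f3 = 0) (h2 : x .f2 = 1)
    (hxS : ∀ b, x b ∈ S) (n m : ℕ) :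
    ser 0 (dressIter x (n + m)) - ser 0 (dressIter x n) ∈ Ser.Fil (n + 1) := by
  induction m with
  | zero => simp
  | succ m ih =>
    have h := dressIter_spec hS hx h3 h2 hxS (n + m)
    have h1 := (dressStep_spec hS hx h3 h2 hxS h.1 (d := (n + m : ℕ) + 1)
      (by convert h.2 using 2; ring)).2.1
    have := add_mem (Ser.Fil_anti (by push_cast; omega) h1) ih
    rwa [sub_add_sub_cancel] at this

/-- The dressing which brings the Lax operator `D + x + z e₂` into the kernel of `ad Λ²`. Its
component in degree `d` is taken from the `d`-th step, from which on it is constant. -/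
def dressing (x : B → PA) : Loop :=
  toLoop 0 fun n b => (dressIter x (b.deg + 2 * n).toNat b).coeff n

theorem dressing_sub_mem (hS : IsDiffStable S) (hx : GHom 1 x) (h3 : x .f3 = 0) (h2 : x .f2 = 1)
    (hxS : ∀ b, x b ∈ S) (n : ℕ) : ser 0 (dressing x) - ser 0 (dressIter x n) ∈ Ser.Fil (n + 1) := by
  rw [dressing, ser_toLoop, ser, ← gser_sub, gser_mem_Fil]
  intro k b hk
  obtain ⟨m, hm⟩ := Nat.exists_eq_add_of_le (show (b.deg + 2 * k).toNat ≤ n by omega)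
  have h := dressIter_sub_mem hS hx h3 h2 hxS (b.deg + 2 * k).toNat m
  rw [← hm, ser, ser, ← gser_sub, gser_mem_Fil] at h
  have := h k b (by omega)
  rw [Pi.sub_apply, Pi.sub_apply, sub_eq_zero] at this ⊢
  rw [this, lcoef, sub_zero]

theorem adapted_dressing (hS : IsDiffStable S) (hx : GHom 1 x) (h3 : x .f3 = 0) (h2 : x .f2 = 1)
    (hxS : ∀ b, x b ∈ S) : Adapted S (dressing x) where
  posDeg b k hk := by
    rw [dressing, coeff_toLoop] at hk
    split_ifs at hk with h0
    · have := (dressIter_spec hS hx h3 h2 hxS _).1.posDeg b _ hk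
      omega
    · exact absurd rfl hk
  homog := homog_toLoop fun n b => (dressIter_spec hS hx h3 h2 hxS _).1.homog b _
  coefIn := coefIn_toLoop fun n b => (dressIter_spec hS hx h3 h2 hxS _).1.coefIn b _
  anti b hb := by
    ext k
    rw [dressing, coeff_toLoop, HahnSeries.coeff_zero]
    split_ifs
    · rw [(dressIter_spec hS hx h3 h2 hxS _).1.anti b hb, HahnSeries.coeff_zero]
    · rfl

/-- The dressing brings the Lax operator into the kernel of `ad Λ²`: it agrees with the `n`-th step
up to degree `n`, for every `n`. -/
theorem dressed_dressing (hS : IsDiffStable S) (hx : GHom 1 x) (h3 : x .f3 = 0) (h2 : x .f2 = 1)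
    (hxS : ∀ b, x b ∈ S) : antiPart (dressed x (dressing x)) = 0 := by
  apply gser_injective
  rw [gser_zero]
  apply Ser.eq_zero_of_forall_mem_Fil
  intro n
  have hA := adapted_dressing hS hx h3 h2 hxS
  obtain ⟨hI, hI2⟩ := dressIter_spec hS hx h3 h2 hxS n
  have hτ := dressing_sub_mem hS hx h3 h2 hxS n
  have hv := dressed_variation hx h3 h2 hI.posDeg hI.homog hA.posDeg hA.homog hτ
  have hc : (ser 0 (dressing x) - ser 0 (dressIter x n)) * Lt -
      Lt * (ser 0 (dressing x) - ser 0 (dressIter x n)) ∈ Ser.Fil (n + 2) := by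
    refine sub_mem ?_ ?_
    · convert Ser.mul_mem_Fil hτ Lt_mem using 2
      ring
    · convert Ser.mul_mem_Fil Lt_mem hτ using 2
      ring
  have h1 := add_mem (add_mem (Ser.Fil_anti (by omega) hv) hc) hI2
  rw [sub_add_cancel, ← gser_sub, ← gser_add] at h1
  rw [← antiPart_sub_add (dressed x (dressIter x n))]
  exact Ser.Fil_anti (by omega) (antiPart_mem_Fil h1)

theorem gser_mul_Js_of_antiPart {y : ℕ → B → PA} (h : antiPart y = 0) :
    gser y * Js = Js * gser y := by
  apply gser_mul_Js_of_not_anti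
  intro n b hb
  have := congrFun (congrFun h n) b
  rwa [antiPart, if_pos hb] at this

theorem Lt_mul_Js : Lt * Js = Js * Lt := by
  rw [Lt_eq_gser]
  apply gser_mul_Js_of_not_anti
  intro n b hb
  have z1 : cb .f2 b = 0 := Pi.single_eq_of_ne (by rintro rfl; exact absurd hb (by decide)) _
  have z2 : cb .e2 b = 0 := Pi.single_eq_of_ne (by rintro rfl; exact absurd hb (by decide)) _
  rcases n with _ | _ | n
  · simp [shiftS, z2]
  · simp [shiftS, z1]
  · simp [shiftS]

theorem ser_mul_Js_of_anti (h : ∀ b : B, ¬ b.anti → T b = 0) : ser 0 T * Js = -(Js * ser 0 T) := by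
  apply gser_mul_Js_of_anti
  intro n b hb
  rw [lcoef, h b hb, HahnSeries.coeff_zero]

/-- Conjugation by `J` separates the parts that commute and anticommute with `J`, and preserves the
filtration. -/
theorem mem_Fil_of_commute_sub_anticommute {M N : Ser} {e : ℤ} (hM : M * Js = Js * M)
    (hN : N * Js = -(Js * N)) (h : M - N ∈ Ser.Fil e) : N ∈ Ser.Fil e := by
  have h1 : Js * (M - N) * Js ∈ Ser.Fil e := by
    have := Ser.mul_mem_Fil (Ser.mul_mem_Fil Js_mem h) Js_mem
    simpa using this
  have e1 : Js * (M - N) * Js = M + N := by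
    rw [mul_assoc, sub_mul, hM, hN, mul_sub, mul_neg, ← mul_assoc, ← mul_assoc, Js_mul_Js]
    simp
  rw [e1] at h1
  have h2 := Ser.smul_mem_Fil (1 / 2 : ℂ) (sub_mem h1 h)
  have e2 : (1 / 2 : ℂ) • (M + N - (M - N)) = N := by module
  rwa [e2] at h2

/-- Uniqueness of the dressing. -/
theorem Loop.eq_of_antiPart_dressed (hx : GHom 1 x) (h3 : x .f3 = 0) (h2 : x .f2 = 1)
    (hT : PosDeg T) (hT1 : T.IsHomog 0) (hTa : ∀ b : B, ¬ b.anti → T b = 0)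
    (hT' : PosDeg T') (hT1' : T'.IsHomog 0) (hTa' : ∀ b : B, ¬ b.anti → T' b = 0)
    (h : antiPart (dressed x T) = 0) (h' : antiPart (dressed x T') = 0) : T = T' := by
  have hJ : (ser 0 T' - ser 0 T) * Js = -(Js * (ser 0 T' - ser 0 T)) := by
    rw [sub_mul, mul_sub, ser_mul_Js_of_anti hTa, ser_mul_Js_of_anti hTa']
    abel
  -- If two dressings agree below some degree, the difference `τ` of the next terms satisfies `[τ,
  -- Λ] = 0` to leading order, since the dressed operators commute and `[τ, Λ]` anticommutes with
  -- `h₂`. As `τ` anticommutes with `h₂`, it vanishes to leading order.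
  have key : ∀ n : ℕ, ser 0 T' - ser 0 T ∈ Ser.Fil (n + 1) := by
    intro n
    induction n with
    | zero => simpa using sub_mem hT'.mem_Fil hT.mem_Fil
    | succ n ih =>
      have hv := dressed_variation hx h3 h2 hT hT1 hT' hT1' ih
      refine Ser.Fil_anti ?_ (mem_Fil_of_commutator hJ (mem_Fil_of_commute_sub_anticommute ?_ ?_ hv))
      · push_cast
        omega
      · rw [sub_mul, mul_sub, gser_mul_Js_of_antiPart h, gser_mul_Js_of_antiPart h']
      · generalize ser 0 T' - ser 0 T = τ at hJ ⊢
        rw [sub_mul, mul_sub, mul_assoc, Lt_mul_Js, ← mul_assoc, hJ, mul_assoc Lt, hJ, neg_mul,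
          mul_neg, ← mul_assoc Lt, Lt_mul_Js]
        noncomm_ring
  have h0 : ser 0 T' - ser 0 T = 0 :=
    Ser.eq_zero_of_forall_mem_Fil fun n => Ser.Fil_anti (by omega) (key n)
  exact (LowBd.ext hT'.lowBd hT.lowBd (gser_injective (sub_eq_zero.1 h0))).symm

end Dressing

theorem cv_mem_WA (b : B) : cv wv b ∈ WA := by
  cases b <;> simp only [cv] <;> first | exact zero_mem _ | exact wv_mem_WA _ | exact one_mem _

/-- The solution `T^c`. -/
def Tc : Loop := dressing (cv wv)

/-- The components of `ζ (D + K^c + Λ) - ζ D`. -/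
def κc : ℕ → B → PA := dressed (cv wv) Tc

/-- The solution `K^c`. -/
def Kc : Loop := toLoop 1 κc - Lam

theorem adapted_Tc : Adapted WA Tc := adapted_dressing isDiffStable_WA gHom_cv rfl rfl cv_mem_WA

theorem antiPart_κc : antiPart κc = 0 :=
  dressed_dressing isDiffStable_WA gHom_cv rfl rfl cv_mem_WA

theorem κc_mem (n : ℕ) (b : B) : κc n b ∈ WA :=
  dressed_mem isDiffStable_WA cv_mem_WA adapted_Tc.coefIn n b

theorem gHom_κc (n : ℕ) : GHom 1 (κc n) := gHom_dressed gHom_cv adapted_Tc.posDeg adapted_Tc.homog n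

theorem Lam_anti {b : B} (hb : b.anti) : Lam b = 0 := by
  rw [Lam_apply, if_neg, if_neg, add_zero]
  · rintro rfl
    exact absurd hb (by decide)
  · rintro rfl
    exact absurd hb (by decide)

theorem coeff_Lam (b : B) (k : ℤ) : (Lam b).coeff k =
    (if b = .f2 ∧ k = 0 then 1 else 0) + (if b = .e2 ∧ k = -1 then 1 else 0) := by
  rw [Lam, fLoop, Pi.add_apply, HahnSeries.coeff_add, coeff_el, coeff_el, neg_zero]

theorem homog_Lam : Lam.IsHomog 1 := by
  intro b k
  rw [coeff_Lam]
  refine IsHomog.add ?_ ?_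
  · split_ifs with h
    · rw [h.1]
      exact isHomog_one
    · exact IsHomog.zero _
  · split_ifs with h
    · rw [h.1]
      exact isHomog_one
    · exact IsHomog.zero _

theorem isDressing_Tc : IsDressing wv Tc Kc := by
  have hT := adapted_Tc
  refine ⟨hT.homog, fun b k => WA_subset_W (hT.coefIn b k), hT.posDeg,
    (mem_image_ad_LamSq_iff _).2 hT.anti, ?_, ?_, (mem_kernel_ad_LamSq_iff _).2 ?_, ?_⟩
  · intro b k
    exact (homog_toLoop gHom_κc b k).sub (homog_Lam b k)
  · intro b k
    apply WA_subset_W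
    refine sub_mem (coefIn_toLoop κc_mem b k) ?_
    change (Lam b).coeff k ∈ WA
    rw [coeff_Lam]
    refine add_mem ?_ ?_
    · split_ifs
      · exact one_mem _
      · exact zero_mem _
    · split_ifs
      · exact one_mem _
      · exact zero_mem _
  · intro b hb
    rw [Kc, Pi.sub_apply, Lam_anti hb, sub_zero]
    ext k
    rw [coeff_toLoop, HahnSeries.coeff_zero]
    split_ifs
    · have := congrFun (congrFun antiPart_κc (k + 1).toNat) b
      rwa [antiPart, if_pos hb] at this
    · rfl
  · rw [Qc_add_Lam, Kc, sub_add_cancel, expAd_iff_expCoef hT.posDeg hT.homog (lowBd_XL _)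
      (homog_XL gHom_cv) (ser_XL_mem _) (lowBd_toLoop 1 _), lcoef_toLoop]
    rfl

theorem IsDressing.eq {T K : Loop} (h : IsDressing wv T K) : T = Tc ∧ K = Kc := by
  obtain ⟨h1, -, h3, h4, -, -, h7, h8⟩ := h
  have hT : PosDeg T := h3
  have hA := adapted_Tc
  rw [mem_image_ad_LamSq_iff] at h4
  rw [mem_kernel_ad_LamSq_iff] at h7
  rw [Qc_add_Lam] at h8
  have hlow := ExpAd.lowBd hT h1 (lowBd_XL _) (homog_XL gHom_cv) h8
  rw [expAd_iff_expCoef hT h1 (lowBd_XL _) (homog_XL gHom_cv) (ser_XL_mem _) hlow] at h8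
  have ha : antiPart (dressed (cv wv) T) = 0 := by
    funext n b
    rw [dressed, ← h8, antiPart]
    split_ifs with hb
    · rw [lcoef, Pi.add_apply, h7 b hb, Lam_anti hb, add_zero, HahnSeries.coeff_zero]
      rfl
    · rfl
  have hTe : T = Tc := Loop.eq_of_antiPart_dressed gHom_cv rfl rfl hT h1 h4 hA.posDeg hA.homog
    hA.anti ha antiPart_κc
  refine ⟨hTe, ?_⟩
  rw [hTe] at h8
  rw [Kc, eq_sub_iff_add_eq]
  apply LowBd.ext hlow (lowBd_toLoop 1 _)
  rw [h8, lcoef_toLoop]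
  rfl

/-! ### The resolvent -/

/-- `M` is a series of even elements of `g ⊗ S`. -/
def GSer (S : Subalgebra ℂ PA) (M : Ser) : Prop :=
  ∃ x : ℕ → B → PA, (∀ n, GHom 0 (x n)) ∧ (∀ n b, x n b ∈ S) ∧ M = gser x

theorem GHom.sum {q : ZMod 2} {κ : Type*} (s : Finset κ) (f : κ → B → PA)
    (h : ∀ i ∈ s, GHom q (f i)) : GHom q (∑ i ∈ s, f i) := fun b => by
  rw [Finset.sum_apply]
  exact IsHomog.sum _ _ fun i hi => h i hi b

theorem gBr_mem {S : Subalgebra ℂ PA} (hS : IsDiffStable S) {x y : B → PA} (hx : ∀ b, x b ∈ S)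
    (hy : ∀ b, y b ∈ S) (b : B) : gBr x y b ∈ S :=
  sum_mem fun _ _ => sum_mem fun _ _ =>
    Subalgebra.smul_mem _ (mul_mem (hS.sigmaPow_mem _ (hx _)) (hy _)) _

namespace GSer

variable {S : Subalgebra ℂ PA} {M N T : Ser}

theorem mono {S' : Subalgebra ℂ PA} (h : ∀ a ∈ S, a ∈ S') (hM : GSer S M) : GSer S' M := by
  obtain ⟨x, h1, h2, h3⟩ := hM
  exact ⟨x, h1, fun n b => h _ (h2 n b), h3⟩

theorem smul (c : ℂ) (hM : GSer S M) : GSer S (c • M) := by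
  obtain ⟨x, h1, h2, rfl⟩ := hM
  refine ⟨fun n => c • x n, fun n => (h1 n).smul c, fun n b => Subalgebra.smul_mem _ (h2 n b) _, ?_⟩
  ext1 n
  rw [Ser.coeff_smul', coeff_gser, coeff_gser, rep_smul]

theorem neg (hM : GSer S M) : GSer S (-M) := by
  have := hM.smul (-1)
  rwa [neg_one_smul] at this

theorem adS (hS : IsDiffStable S) (hT : GSer S T) (hM : GSer S M) : GSer S (Ser.adS T M) := by
  obtain ⟨t, t1, t2, rfl⟩ := hT
  obtain ⟨x, x1, x2, rfl⟩ := hM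
  refine ⟨fun n => ∑ ab ∈ Finset.HasAntidiagonal.antidiagonal n, gBr (t ab.1) (x ab.2),
    fun n => GHom.sum _ _ fun ab _ => (t1 _).gBr (x1 _), fun n b => ?_, ?_⟩
  · beta_reduce
    rw [Finset.sum_apply]
    exact sum_mem fun ab _ => gBr_mem hS (t2 _) (x2 _) b
  · ext1 n
    rw [Ser.adS, map_sub, coeff_mul, coeff_mul, coeff_gser, rep_sum,
      ← Finset.Nat.sum_antidiagonal_swap (f := fun ab => coeff ab.1 (gser x) * coeff ab.2 (gser t)),
      ← Finset.sum_sub_distrib]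
    refine Finset.sum_congr rfl fun ab _ => ?_
    rw [← rep_gBr (t1 _) (x1 _), coeff_gser, coeff_gser, Prod.fst_swap, Prod.snd_swap, coeff_gser,
      coeff_gser]

theorem fsum {f : ℕ → Ser} (hf : ∀ h, GSer S (f h)) : GSer S (Ser.fsum f) := by
  choose x h1 h2 h3 using hf
  refine ⟨fun k => ∑ h ∈ Finset.range (2 * k + 2), x h k, fun k => GHom.sum _ _ fun h _ => h1 h k,
    fun k b => ?_, ?_⟩
  · beta_reduce
    rw [Finset.sum_apply]
    exact sum_mem fun h _ => h2 h k b
  · ext1 k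
    rw [Ser.fsum, coeff_mk, coeff_gser, rep_sum]
    refine Finset.sum_congr rfl fun h _ => ?_
    rw [h3 h, coeff_gser]

/-- Conjugation by the exponential of an even element of `g ⊗ S` preserves `g ⊗ S`. -/
theorem conj (hS : IsDiffStable S) (hT : GSer S T) (hT1 : T ∈ Ser.Fil 1) (hM : GSer S M)
    (hM0 : M ∈ Ser.Fil 0) : GSer S (Ser.expSer T * M * Ser.expSer (-T)) := by
  rw [Ser.expSer_mul hT1 hM0, mul_assoc, Ser.expSer_mul_expSer_neg hT1, mul_one]
  refine fsum fun h => smul _ ?_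
  induction h with
  | zero => exact hM
  | succ h ih =>
    rw [Function.iterate_succ_apply']
    exact adS hS hT ih

theorem of_loop {T : Loop} (h1 : T.IsHomog 0) (h2 : CoefIn S T) : GSer S (ser 0 T) :=
  ⟨lcoef 0 T, fun n => h1.lcoef 0 n, fun _ b => h2 b _, rfl⟩

theorem C_rep {x : B → PA} (h1 : GHom 0 x) (h2 : ∀ b, x b ∈ S) : GSer S (C (_root_.SuperDS.rep x)) := by
  rw [← ser_zero_cst]
  refine of_loop (homog_cst h1) fun b k => ?_
  rw [coeff_cst]
  split_ifs
  · exact h2 b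
  · exact zero_mem _

end GSer

/-- The series `N` of the gauge transformation. -/
def Ns : Ser := C (rep nv)

/-- The series `T^c` of the dressing. -/
def Ts : Ser := ser 0 Tc

theorem Ns_mem : Ns ∈ Ser.Fil 1 := by
  have := (posDeg_cst inN_nv).mem_Fil
  rwa [ser_zero_cst] at this

theorem Ts_mem : Ts ∈ Ser.Fil 1 := adapted_Tc.posDeg.mem_Fil

theorem gSer_Ns : GSer P Ns := GSer.C_rep gHom_nv nv_mem_P

theorem gSer_Ts : GSer WA Ts := GSer.of_loop adapted_Tc.homog adapted_Tc.coefIn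

theorem expSer_Ns : Ser.expSer Ns = 1 + C (rep nv) := by
  rw [← expSer_of_InN inN_nv, ser_zero_cst, Ns]

/-- The operator `ζ (D + K^c + Λ)`. -/
def Kh : Ser := PowerSeries.X * C Dhat + gser κc

theorem Kh_mul_Js : Kh * Js = Js * Kh := by
  rw [Kh, add_mul, mul_add, gser_mul_Js_of_antiPart antiPart_κc, mul_assoc, ← mul_assoc Js,
    PowerSeries.commute_X Js, mul_assoc, Js, ← map_mul, ← map_mul, Dhat_mul_J]

theorem expSer_Ts_mul_Lax : Ser.expSer Ts * Lax (cv wv) = Kh * Ser.expSer Ts :=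
  expSer_mul_Lax gHom_cv adapted_Tc.posDeg adapted_Tc.homog

theorem inN_cb_e2 : InN (cb .e2) := by
  intro b hb
  rw [cb, Pi.single_eq_of_ne]
  rintro rfl
  exact hb (by decide)

theorem expSer_Ns_mul_Lax : Ser.expSer Ns * Lax qv = Lax (cv wv) * Ser.expSer Ns := by
  have h1 := gauge_conj inN_nv gHom_nv gHom_qv
  have h2 : rep nv * rep (cb .e2) = 0 := rep_mul_rep_of_InN inN_nv inN_cb_e2
  have h3 : rep (cb .e2) * rep nv = 0 := rep_mul_rep_of_InN inN_cb_e2 inN_nv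
  rw [gaugeT_nv_qv] at h1
  have h1' : (1 + C (rep nv) : Ser) * C (Dhat + rep qv) = C (Dhat + rep (cv wv)) * (1 + C (rep nv)) := by
    have := congrArg (C : Op → Ser) h1
    rwa [map_mul, map_mul, map_add (C : Op →+* Ser) 1, map_one] at this
  have h2' : (C (rep nv) : Ser) * C (rep (cb .e2)) = 0 := by rw [← map_mul, h2, map_zero]
  have h3' : (C (rep (cb .e2)) : Ser) * C (rep nv) = 0 := by rw [← map_mul, h3, map_zero]
  rw [expSer_Ns, Lax, Lax, mul_add, ← mul_assoc, PowerSeries.commute_X (1 + C (rep nv)), mul_assoc, h1',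
    add_mul _ _ (1 + C (rep nv)), mul_assoc, mul_add (C (rep (cb .e2))), h3', add_mul 1 (C (rep nv)),
    h2', mul_one, one_mul]

/-- The operator which conjugates the universal Lax operator to its dressed form. -/
def Gg : Ser := Ser.expSer Ts * Ser.expSer Ns

/-- The inverse of `Gg`. -/
def Gi : Ser := Ser.expSer (-Ns) * Ser.expSer (-Ts)

theorem Gg_mul_Gi : Gg * Gi = 1 := by
  rw [Gg, Gi, mul_assoc, ← mul_assoc (Ser.expSer Ns), Ser.expSer_mul_expSer_neg Ns_mem, one_mul,
    Ser.expSer_mul_expSer_neg Ts_mem]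

theorem Gi_mul_Gg : Gi * Gg = 1 := by
  rw [Gg, Gi, mul_assoc, ← mul_assoc (Ser.expSer (-Ts)), Ser.expSer_neg_mul_expSer Ts_mem, one_mul,
    Ser.expSer_neg_mul_expSer Ns_mem]

theorem Gg_mul_Lax : Gg * Lax qv = Kh * Gg := by
  rw [Gg, mul_assoc, expSer_Ns_mul_Lax, ← mul_assoc, expSer_Ts_mul_Lax, mul_assoc]

theorem Gi_mem : Gi ∈ Ser.Fil 0 := by
  rw [Gi]
  simpa using Ser.mul_mem_Fil (Ser.expSer_mem (neg_mem Ns_mem)) (Ser.expSer_mem (neg_mem Ts_mem))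

/-- The resolvent of `D + Q^c + Λ`. -/
def Ac : Ser := Ser.expSer (-Ts) * Js * Ser.expSer Ts

/-- The resolvent of `D + Q_u + Λ`: the conjugate of `h₂` that commutes with this operator. -/
def A : Ser := Gi * Js * Gg

theorem A_eq : A = Ser.expSer (-Ns) * Ac * Ser.expSer Ns := by
  rw [A, Ac, Gi, Gg]
  noncomm_ring

theorem gSer_Js (S : Subalgebra ℂ PA) : GSer S Js := by
  refine GSer.C_rep (gHom_cb .h2) fun b => ?_
  by_cases h : b = .h2
  · rw [h, cb, Pi.single_eq_same]
    exact one_mem _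
  · rw [cb, Pi.single_eq_of_ne h]
    exact zero_mem _

theorem gSer_Ac : GSer WA Ac := by
  have := GSer.conj isDiffStable_WA gSer_Ts.neg (neg_mem Ts_mem) (gSer_Js WA) Js_mem
  rwa [neg_neg] at this

theorem Ac_mem : Ac ∈ Ser.Fil 0 := by
  have := Ser.mul_mem_Fil (Ser.mul_mem_Fil (Ser.expSer_mem (neg_mem Ts_mem)) Js_mem)
    (Ser.expSer_mem Ts_mem)
  rw [Ac]
  simpa using this

theorem gSer_A : GSer P A := by
  have := GSer.conj isDiffStable_P gSer_Ns.neg (neg_mem Ns_mem)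
    (gSer_Ac.mono fun _ => WA_subset_P) Ac_mem
  rwa [neg_neg, ← A_eq] at this

/-- The coefficients of the resolvent of `D + Q_u + Λ`. -/
def av : ℕ → B → PA := gSer_A.choose

theorem gHom_av (n : ℕ) : GHom 0 (av n) := gSer_A.choose_spec.1 n

theorem av_mem_P (n : ℕ) (b : B) : av n b ∈ P := gSer_A.choose_spec.2.1 n b

theorem A_eq_gser : A = gser av := gSer_A.choose_spec.2.2

/-- The coefficients of the resolvent of `D + Q^c + Λ`. -/
def acv : ℕ → B → PA := gSer_Ac.choose

theorem gHom_acv (n : ℕ) : GHom 0 (acv n) := gSer_Ac.choose_spec.1 n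

theorem acv_mem_WA (n : ℕ) (b : B) : acv n b ∈ WA := gSer_Ac.choose_spec.2.1 n b

theorem Ac_eq_gser : Ac = gser acv := gSer_Ac.choose_spec.2.2

theorem A_mul_A : A * A = 1 := by
  have : A * A = Gi * Js * (Gg * Gi) * Js * Gg := by
    rw [A]
    noncomm_ring
  rw [this, Gg_mul_Gi, mul_one, mul_assoc Gi, Js_mul_Js, mul_one, Gi_mul_Gg]

theorem Lax_eq : Lax qv = Gi * Kh * Gg := by
  rw [mul_assoc, ← Gg_mul_Lax, ← mul_assoc, Gi_mul_Gg, one_mul]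

/-- `A` commutes with the universal Lax operator, since its conjugate `h₂` commutes with the
dressed one. -/
theorem A_mul_Lax : A * Lax qv = Lax qv * A := by
  have h1 : A * Lax qv = Gi * Js * (Gg * Gi) * Kh * Gg := by
    rw [Lax_eq, A]
    noncomm_ring
  have h2 : Lax qv * A = Gi * Kh * (Gg * Gi) * Js * Gg := by
    rw [Lax_eq, A]
    noncomm_ring
  rw [h1, h2, Gg_mul_Gi, mul_one, mul_one, mul_assoc Gi, mul_assoc Gi Kh, Kh_mul_Js]

theorem coeff_succ_Lax_mul (x : B → PA) (M : Ser) (n : ℕ) :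
    coeff (n + 1) (Lax x * M) = (Dhat + rep x) * coeff n M + rep (cb .e2) * coeff (n + 1) M := by
  rw [Lax, add_mul, map_add, mul_assoc, coeff_succ_X_mul, coeff_C_mul, coeff_C_mul]

theorem coeff_succ_mul_Lax (x : B → PA) (M : Ser) (n : ℕ) :
    coeff (n + 1) (M * Lax x) = coeff n M * (Dhat + rep x) + coeff (n + 1) M * rep (cb .e2) := by
  rw [Lax, mul_add, map_add, ← mul_assoc, PowerSeries.commute_X, mul_assoc, coeff_succ_X_mul,
    coeff_mul_C, coeff_mul_C]

theorem coeff_zero_Lax_mul (x : B → PA) (M : Ser) :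
    coeff 0 (Lax x * M) = rep (cb .e2) * coeff 0 M := by
  rw [Lax, add_mul, map_add, mul_assoc, coeff_zero_X_mul, coeff_C_mul, zero_add]

theorem coeff_zero_mul_Lax (x : B → PA) (M : Ser) :
    coeff 0 (M * Lax x) = coeff 0 M * rep (cb .e2) := by
  rw [Lax, mul_add, map_add, ← mul_assoc, PowerSeries.commute_X, mul_assoc, coeff_zero_X_mul,
    coeff_mul_C, zero_add]

/-- The recursion for a series which commutes with a Lax operator. -/
theorem recursion_of_commute {x : B → PA} {a : ℕ → B → PA} (hx : GHom 1 x) (ha : ∀ n, GHom 0 (a n))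
    (h : gser a * Lax x = Lax x * gser a) : gBr (a 0) (cb .e2) = 0 ∧
      ∀ n, gBr (a n) x - gD (a n) + gBr (a (n + 1)) (cb .e2) = 0 := by
  constructor
  · apply rep_injective
    have := congrArg (coeff 0) h
    rw [coeff_zero_mul_Lax, coeff_zero_Lax_mul, coeff_gser] at this
    rw [← rep_gBr (ha 0) (gHom_cb .e2), this, sub_self, rep_zero]
  · intro n
    apply rep_injective
    have := congrArg (coeff (n + 1)) h
    rw [coeff_succ_mul_Lax, coeff_succ_Lax_mul, coeff_gser, coeff_gser] at this
    rw [rep_add, rep_sub, ← rep_gBr (ha n) hx, ← rep_gD (ha n), ← rep_gBr (ha _) (gHom_cb .e2), rep_zero]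
    linear_combination (norm := noncomm_ring) this

/-- `[a_n, D + Q_u + f] + [a_{n+1}, e₂] = 0`. -/
theorem av_recursion : gBr (av 0) (cb .e2) = 0 ∧
    ∀ n, gBr (av n) qv - gD (av n) + gBr (av (n + 1)) (cb .e2) = 0 := by
  apply recursion_of_commute gHom_qv gHom_av
  rw [← A_eq_gser, A_mul_Lax]

/-- The leading term of the resolvent is `h₂`. -/
theorem A_sub_Js_mem : A - Js ∈ Ser.Fil 1 := by
  have h1 : Gg - 1 ∈ Ser.Fil 1 := by
    have e : Gg - 1 = (Ser.expSer Ts - 1) * Ser.expSer Ns + (Ser.expSer Ns - 1) := by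
      rw [Gg]
      noncomm_ring
    rw [e]
    refine add_mem ?_ (Ser.expSer_sub_one_mem Ns_mem)
    simpa using Ser.mul_mem_Fil (Ser.expSer_sub_one_mem Ts_mem) (Ser.expSer_mem Ns_mem)
  have e : A - Js = Gi * (Js * (Gg - 1) - (Gg - 1) * Js) := by
    have : Gi * (Js * (Gg - 1) - (Gg - 1) * Js) = Gi * Js * Gg - Gi * Gg * Js := by noncomm_ring
    rw [this, Gi_mul_Gg, one_mul, A]
  rw [e]
  have := Ser.mul_mem_Fil Gi_mem (sub_mem (Ser.mul_mem_Fil Js_mem h1)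
    (Ser.Fil_anti (by norm_num) (Ser.mul_mem_Fil h1 Js_mem)))
  simpa using this

/-- The components of the zeroth coefficient of the resolvent outside `n` have degree at most zero,
and the resolvent is `h₂` up to terms of positive degree. -/
theorem av_zero_of_not_inN {b : B} (hb : ¬ b.inN) : av 0 b = cb .h2 b := by
  have h := A_sub_Js_mem
  rw [A_eq_gser, Js, J, ← gser_single, ← gser_sub, gser_mem_Fil] at h
  have := h 0 b (by have := deg_le_one b; have : b.deg ≠ 1 := hb; push_cast; omega)
  rw [Pi.sub_apply, Pi.single_eq_same, Pi.sub_apply, sub_eq_zero] at this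
  exact this

/-! ### Series of multiplication operators and their traces -/

/-- The entries of the coefficients of `M` are left multiplications by elements of `P(ḡ)`, of the
parities that correspond to the parity `q` of `M`. -/
def IsMul (q : ZMod 2) (M : Ser) : Prop :=
  ∀ (k : ℕ) (i j : Fin 4), ∃ u : PA, IsHomog (q + vpar i + vpar j) u ∧ coeff k M i j = lm u

theorem exists_lm_sum {κ : Type*} (s : Finset κ) (f : κ → E) (p : ZMod 2)
    (h : ∀ a ∈ s, ∃ u : PA, IsHomog p u ∧ f a = lm u) : ∃ u : PA, IsHomog p u ∧ ∑ a ∈ s, f a = lm u := by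
  classical
  induction s using Finset.induction_on with
  | empty => exact ⟨0, IsHomog.zero _, by simp⟩
  | insert a s ha ih =>
    obtain ⟨u, hu, e⟩ := h a (Finset.mem_insert_self _ _)
    obtain ⟨v, hv, e'⟩ := ih fun b hb => h b (Finset.mem_insert_of_mem hb)
    exact ⟨u + v, hu.add hv, by rw [Finset.sum_insert ha, e, e', map_add]⟩

namespace IsMul

variable {p q : ZMod 2} {M N T : Ser}

theorem add (hM : IsMul q M) (hN : IsMul q N) : IsMul q (M + N) := by
  intro k i j
  obtain ⟨u, hu, e⟩ := hM k i j
  obtain ⟨v, hv, e'⟩ := hN k i j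
  exact ⟨u + v, hu.add hv, by rw [map_add, Matrix.add_apply, e, e', map_add]⟩

theorem smul (c : ℂ) (hM : IsMul q M) : IsMul q (c • M) := by
  intro k i j
  obtain ⟨u, hu, e⟩ := hM k i j
  exact ⟨c • u, hu.smul c, by rw [Ser.coeff_smul', Matrix.smul_apply, e, map_smul]⟩

theorem neg (hM : IsMul q M) : IsMul q (-M) := by
  have := hM.smul (-1)
  rwa [neg_one_smul] at this

theorem mul (hM : IsMul p M) (hN : IsMul q N) : IsMul (p + q) (M * N) := by
  intro k i j
  rw [coeff_mul, Matrix.sum_apply]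
  refine exists_lm_sum _ _ _ fun ab _ => ?_
  rw [Matrix.mul_apply]
  refine exists_lm_sum _ _ _ fun l _ => ?_
  obtain ⟨u, hu, e⟩ := hM ab.1 i l
  obtain ⟨v, hv, e'⟩ := hN ab.2 l j
  refine ⟨u * v, ?_, by rw [e, e', map_mul]⟩
  convert hu.mul hv using 1
  have : vpar l + vpar l = 0 := CharTwo.add_self_eq_zero _
  linear_combination -this

theorem one : IsMul 0 1 := by
  intro k i j
  rw [coeff_one]
  split_ifs
  · by_cases h : i = j
    · subst h
      refine ⟨1, ?_, by rw [Matrix.one_apply_eq, map_one]⟩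
      rw [zero_add, CharTwo.add_self_eq_zero]
      exact isHomog_one
    · exact ⟨0, IsHomog.zero _, by rw [Matrix.one_apply_ne h, map_zero]⟩
  · exact ⟨0, IsHomog.zero _, by rw [map_zero]; rfl⟩

theorem fsum {f : ℕ → Ser} (hf : ∀ h, IsMul q (f h)) : IsMul q (Ser.fsum f) := by
  intro k i j
  rw [Ser.fsum, coeff_mk, Matrix.sum_apply]
  exact exists_lm_sum _ _ _ fun h _ => hf h k i j

theorem expSer (hT : IsMul 0 T) : IsMul 0 (Ser.expSer T) := by
  refine fsum fun h => smul _ ?_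
  induction h with
  | zero => exact one
  | succ h ih =>
    rw [pow_succ]
    simpa using ih.mul hT

theorem gser {x : ℕ → B → PA} (hx : ∀ n, GHom q (x n)) : IsMul q (gser x) := by
  intro k i j
  rw [coeff_gser, rep_apply]
  exact ⟨_, isHomog_ent (hx k) i j, rfl⟩

theorem C_rep {x : B → PA} (hx : GHom q x) : IsMul q (C (rep x)) := by
  rw [← gser_single]
  refine gser fun n => ?_
  by_cases h : n = 0
  · rw [h, Pi.single_eq_same]
    exact hx
  · rw [Pi.single_eq_of_ne h]
    exact GHom.zero q

theorem X_mul (hM : IsMul q M) : IsMul q (PowerSeries.X * M) := by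
  intro k i j
  cases k with
  | zero => exact ⟨0, IsHomog.zero _, by rw [coeff_zero_X_mul, map_zero]; rfl⟩
  | succ k =>
    rw [coeff_succ_X_mul]
    exact hM k i j

end IsMul

theorem IsMul.gSer {S : Subalgebra ℂ PA} {M : Ser} (hM : GSer S M) : IsMul 0 M := by
  obtain ⟨x, h1, -, rfl⟩ := hM
  exact IsMul.gser h1

theorem isMul_Gg : IsMul 0 Gg := by
  have := (IsMul.gSer gSer_Ts).expSer.mul (IsMul.gSer gSer_Ns).expSer
  rwa [add_zero] at this

theorem isMul_Gi : IsMul 0 Gi := by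
  have := (IsMul.gSer gSer_Ns).neg.expSer.mul (IsMul.gSer gSer_Ts).neg.expSer
  rwa [add_zero] at this

theorem isMul_Js : IsMul 0 Js := IsMul.gSer (gSer_Js P)

/-- Up to signs that cancel, the trace of a product does not depend on the order of an even and an
odd factor. -/
theorem trace_coeff_mul_comm {M N : Ser} (hM : IsMul 0 M) (hN : IsMul 1 N) (k : ℕ) :
    Matrix.trace (coeff k (M * N)) = Matrix.trace (coeff k (N * M)) := by
  rw [coeff_mul, coeff_mul, Matrix.trace_sum, Matrix.trace_sum, ← Finset.Nat.sum_antidiagonal_swap]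
  refine Finset.sum_congr rfl fun ab _ => ?_
  simp only [Matrix.trace, Matrix.diag_apply, Matrix.mul_apply]
  rw [Finset.sum_comm]
  refine Finset.sum_congr rfl fun l _ => Finset.sum_congr rfl fun i _ => ?_
  obtain ⟨u, hu, e⟩ := hM ab.2 i l
  obtain ⟨v, hv, e'⟩ := hN ab.1 l i
  rw [Prod.fst_swap, Prod.snd_swap, e, e', ← map_mul, ← map_mul, homog_comm hu hv]
  have : (0 + vpar i + vpar l) * (1 + vpar l + vpar i) = 0 := by
    clear e e' hu hv
    revert i l
    decide
  rw [this, sgn_zero, one_smul]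

/-- The trace of a commutator with `D` is a total derivative. -/
theorem trace_coeff_commutator_Dhat {M : Ser} (hM : IsMul 0 M) (k : ℕ) : ∃ y : PA,
    Matrix.trace (coeff k (M * (PowerSeries.X * C Dhat) - PowerSeries.X * C Dhat * M)) = lm (D y) := by
  cases k with
  | zero =>
    refine ⟨0, ?_⟩
    rw [map_sub, ← mul_assoc, PowerSeries.commute_X, mul_assoc, mul_assoc, coeff_zero_X_mul,
      coeff_zero_X_mul, sub_zero, Matrix.trace_zero, map_zero, map_zero]
  | succ k =>
    choose m hm hm' using hM k
    have e : coeff k M = (Matrix.of m).map lm := by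
      ext1 i j
      rw [hm', Matrix.map_apply, Matrix.of_apply]
    refine ⟨-∑ i, sgn (vpar i) • m i i, ?_⟩
    rw [map_sub, ← mul_assoc, PowerSeries.commute_X, mul_assoc, mul_assoc, coeff_succ_X_mul,
      coeff_succ_X_mul, coeff_mul_C, coeff_C_mul, ← neg_sub, Matrix.trace_neg, e, Matrix.trace]
    simp only [Matrix.diag_apply]
    rw [map_neg, map_neg, map_sum, map_sum, neg_inj]
    refine Finset.sum_congr rfl fun i _ => ?_
    rw [Dhat_commutator_apply (fun i j => by simpa using hm i j), Matrix.of_apply, map_smul, map_smul]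

/-- The trace of the commutator of `ζ (D + K^c + Λ)` with an even series of multiplication operators
is a series of total derivatives. -/
theorem trace_coeff_commutator_Kh {M : Ser} (hM : IsMul 0 M) (k : ℕ) : ∃ y : PA,
    Matrix.trace (coeff k (M * Kh - Kh * M)) = lm (D y) := by
  obtain ⟨y, hy⟩ := trace_coeff_commutator_Dhat hM k
  refine ⟨y, ?_⟩
  have h := trace_coeff_mul_comm hM (IsMul.gser gHom_κc) k
  have e : M * Kh - Kh * M = (M * (PowerSeries.X * C Dhat) - PowerSeries.X * C Dhat * M) +
      (M * gser κc - gser κc * M) := by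
    rw [Kh]
    noncomm_ring
  rw [e, map_add, Matrix.trace_add, hy, map_sub, Matrix.trace_sub, h, sub_self, add_zero]

/-- The signs in `rep` turn the trace of a product into the supertrace. -/
theorem trace_scalars (b c : B) : ∑ i, ∑ k, ((b.mat i k : ℂ) * sgn (vpar k * (1 + b.par))) *
    ((c.mat k i : ℂ) * sgn (vpar i * (0 + c.par))) = (form b c : ℂ) := by
  have h : ∀ i k, ((b.mat i k : ℂ) * sgn (vpar k * (1 + b.par))) *
      ((c.mat k i : ℂ) * sgn (vpar i * (0 + c.par))) =
        sgn (vpar i) * ((b.mat i k : ℂ) * (c.mat k i : ℂ)) := by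
    intro i k
    by_cases hb : b.mat i k = 0
    · simp [hb]
    by_cases hc : c.mat k i = 0
    · simp [hc]
    have e1 := (mat_ne_zero_par b i k hb).1
    have e2 := (mat_ne_zero_par c k i hc).1
    have e3 : sgn (vpar k * (1 + b.par)) * sgn (vpar i * (0 + c.par)) = sgn (vpar i) := by
      rw [← sgn_add, e1, e2]
      congr 1
      clear hb hc e1 e2
      revert i k
      decide
    rw [← e3]
    ring
  simp only [h, form, Matrix.mul_apply, Fin.sum_univ_four]
  simp only [show vpar 0 = 0 from rfl, show vpar 1 = 0 from rfl, show vpar 2 = 1 from rfl,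
    show vpar 3 = 1 from rfl, sgn_zero, sgn_one]
  push_cast
  ring

/-- The trace form of `ℂ^{2|2}` gives the invariant form. -/
theorem trace_rep_mul_rep {x y : B → PA} (hx : GHom 1 x) (hy : GHom 0 y) :
    Matrix.trace (rep x * rep y) = lm (∑ b, ∑ c, (form b c : ℂ) • (x b * y c)) := by
  have e : Matrix.trace (rep x * rep y) = lm (∑ i, ∑ k, ent x i k * ent y k i) := by
    simp only [Matrix.trace, Matrix.diag_apply, Matrix.mul_apply, rep_apply, map_sum, map_mul]
  rw [e]
  congr 1
  simp only [ent_of_GHom hx, ent_of_GHom hy, Finset.sum_mul_sum, smul_mul_smul_comm, ← trace_scalars,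
    Finset.sum_smul]
  rw [Finset.sum_congr rfl fun i _ => Finset.sum_comm, Finset.sum_comm]
  refine Finset.sum_congr rfl fun b _ => ?_
  rw [Finset.sum_congr rfl fun i _ => Finset.sum_comm, Finset.sum_comm]

/-! ### The variational derivatives of the Hamiltonians -/

/-- An operator on `P(ḡ)`, acting on the coefficients. -/
def dh (d : PA →ₗ[ℂ] PA) : Op := Matrix.diagonal fun _ => opE d

section Evol

variable {d : PA →ₗ[ℂ] PA}

theorem IsEvol.mul_lm (hd : IsEvol d) (u : PA) : opE d * lm u - lm u * opE d = lm (d u) := by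
  apply opE_injective
  apply LinearMap.ext
  intro v
  change d (u * v) - u * d v = d u * v
  rw [hd.leibniz, add_sub_cancel_right]

theorem IsEvol.ent (hd : IsEvol d) (x : B → PA) (i j : Fin 4) :
    ent (fun b => d (x b)) i j = d (SuperDS.ent x i j) := by
  simp only [SuperDS.ent, Matrix.of_apply, map_sum, map_smul]
  refine Finset.sum_congr rfl fun b _ => ?_
  rw [hd.sigmaPow_apply, mul_zero, sgn_zero, one_smul]

theorem IsEvol.dh_mul_rep (hd : IsEvol d) (x : B → PA) :
    dh d * rep x - rep x * dh d = rep fun b => d (x b) := by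
  ext1 i j
  rw [Matrix.sub_apply, dh, Matrix.diagonal_mul, Matrix.mul_diagonal, rep_apply, rep_apply, hd.ent,
    hd.mul_lm]

theorem IsEvol.dh_mul_Dhat (hd : IsEvol d) : dh d * Dhat = Dhat * dh d := by
  have h : opE d * opE D = opE D * opE d := by
    apply opE_injective
    apply LinearMap.ext
    intro v
    exact hd.comm v
  ext1 i j
  rw [dh, Matrix.diagonal_mul, Matrix.mul_diagonal, Dhat, Matrix.diagonal_apply]
  split_ifs
  · rw [mul_smul_comm, smul_mul_assoc, h]
  · simp

theorem IsEvol.gHom (hd : IsEvol d) {q : ZMod 2} {x : B → PA} (hx : GHom q x) :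
    GHom q fun b => d (x b) := fun b => hd.homog (hx b)

theorem IsEvol.dh_mul_gser (hd : IsEvol d) (x : ℕ → B → PA) :
    C (dh d) * gser x - gser x * C (dh d) = gser fun n b => d (x n b) := by
  ext1 n
  rw [map_sub, coeff_C_mul, coeff_mul_C, coeff_gser, coeff_gser, hd.dh_mul_rep]

theorem IsEvol.map_cb (hd : IsEvol d) (b : B) : (fun c => d (cb b c)) = 0 := by
  funext c
  by_cases h : c = b
  · rw [h, cb, Pi.single_eq_same]
    exact hd.map_one
  · rw [cb, Pi.single_eq_of_ne h, map_zero, Pi.zero_apply]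

theorem IsEvol.dh_commute_rep_cb (hd : IsEvol d) (b : B) :
    dh d * rep (cb b) = rep (cb b) * dh d := by
  rw [← sub_eq_zero, hd.dh_mul_rep, hd.map_cb, rep_zero]

theorem IsEvol.dh_mul_Lax (hd : IsEvol d) (x : B → PA) :
    C (dh d) * Lax x - Lax x * C (dh d) = PowerSeries.X * C (rep fun b => d (x b)) := by
  have h1 : dh d * (Dhat + rep x) - (Dhat + rep x) * dh d = rep fun b => d (x b) := by
    rw [← hd.dh_mul_rep, mul_add, add_mul, hd.dh_mul_Dhat]
    abel
  rw [← h1, Lax, mul_add, add_mul, ← mul_assoc, PowerSeries.commute_X, mul_assoc, mul_assoc,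
    ← map_mul, ← map_mul, ← map_mul, ← map_mul, hd.dh_commute_rep_cb, map_sub, mul_sub]
  abel

theorem IsEvol.dh_mul_Kh (hd : IsEvol d) :
    C (dh d) * Kh - Kh * C (dh d) = gser fun n b => d (κc n b) := by
  rw [← hd.dh_mul_gser, Kh, mul_add, add_mul, ← mul_assoc, PowerSeries.commute_X, mul_assoc, mul_assoc,
    ← map_mul, ← map_mul, hd.dh_mul_Dhat]
  abel

theorem IsMul.dh_commutator (hd : IsEvol d) {q : ZMod 2} {M : Ser} (hM : IsMul q M) :
    IsMul q (C (dh d) * M - M * C (dh d)) := by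
  intro k i j
  obtain ⟨u, hu, e⟩ := hM k i j
  refine ⟨d u, hd.homog hu, ?_⟩
  rw [map_sub, coeff_C_mul, coeff_mul_C, Matrix.sub_apply, dh, Matrix.diagonal_mul,
    Matrix.mul_diagonal, e, hd.mul_lm]

end Evol

/-- As `(h₁|h₂) = -4`, the density `ρ_n` is a multiple of the component of `h₁` of the dressed
operator. -/
theorem rho_Kc (n : ℕ) : rho Kc n = -((4 : ℂ) • κc (n + 1) .h1) := by
  have e : ∀ i : B, ((Kc i).map (sigmaPow (par := barPar) B.h2.par) * el .h2 n 1 .h2).coeff 0 =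
      (Kc i).coeff n := by
    intro i
    rw [el, Pi.single_eq_same]
    have := HahnSeries.coeff_mul_single_add (x := (Kc i).map (sigmaPow (par := barPar) B.h2.par))
      (r := (1 : PA)) (a := (n : ℤ)) (b := -(n : ℤ))
    rw [add_neg_cancel] at this
    rw [this, mul_one, HahnSeries.map_coeff]
    exact sigmaPow_zero _
  have z : ∀ i j : B, j ≠ .h2 →
      ((Kc i).map (sigmaPow (par := barPar) j.par) * el .h2 n 1 j).coeff 0 = 0 := by
    intro i j hj
    rw [el, Pi.single_eq_of_ne hj, mul_zero, HahnSeries.coeff_zero]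
  have s : ∀ i : B, ∑ j : B, (form i j : ℂ) •
      ((Kc i).map (sigmaPow (par := barPar) j.par) * el .h2 n 1 j).coeff 0 =
        (form i .h2 : ℂ) • (Kc i).coeff n := by
    intro i
    rw [Finset.sum_eq_single .h2 (fun j _ hj => by rw [z i j hj, smul_zero])
      (fun h => absurd (Finset.mem_univ _) h), e]
  rw [rho, loopForm, Finset.sum_congr rfl fun i _ => s i, Finset.sum_eq_single .h1]
  · have : (Kc .h1).coeff n = κc (n + 1) .h1 := by
      have h := coeff_Lam .h1 n
      simp only [reduceCtorEq, false_and, if_false, add_zero] at h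
      rw [Kc, Pi.sub_apply, HahnSeries.coeff_sub, h, sub_zero, coeff_toLoop, if_pos (by omega)]
      rfl
    rw [this, form_eq, formT]
    push_cast
    rw [neg_smul]
  · intro i _ hi
    rw [form_eq]
    cases i <;> first | exact absurd rfl hi | simp [formT]
  · exact fun h => absurd (Finset.mem_univ _) h

theorem rho_mem_WA (n : ℕ) : rho Kc n ∈ WA := by
  rw [rho_Kc]
  exact neg_mem (Subalgebra.smul_mem _ (κc_mem _ _) _)

theorem rho_mem_P (n : ℕ) : rho Kc n ∈ P := WA_subset_P (rho_mem_WA n)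

theorem isHomog_rho (n : ℕ) : IsHomog 1 (rho Kc n) := by
  rw [rho_Kc]
  have := gHom_κc (n + 1) .h1
  exact (this.smul _).neg

/-- The trace against `h₂` is the pairing `(·|h₂)` which defines the densities. -/
theorem trace_rep_mul_J {x : B → PA} (hx : GHom 1 x) :
    Matrix.trace (rep x * J) = lm (-((4 : ℂ) • x .h1)) := by
  rw [J, trace_rep_mul_rep hx (gHom_cb .h2)]
  congr 1
  simp only [sum_B, form_eq, formT, cb]
  simp

/-- If `k = g l g⁻¹` then `[d, k] = [[d, g] g⁻¹, k] + g [d, l] g⁻¹`. -/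
theorem commutator_conj {R : Type*} [Ring R] {d g g' l k : R} (h1 : g * g' = 1) (h2 : g' * g = 1)
    (h : g * l = k * g) : d * k - k * d =
      (d * g - g * d) * g' * k - k * ((d * g - g * d) * g') + g * (d * l - l * d) * g' := by
  have hk : k = g * l * g' := by rw [h, mul_assoc, h1, mul_one]
  have h3 : g' * k = l * g' := by rw [hk, ← mul_assoc, ← mul_assoc, h2, one_mul]
  have e1 : (d * g - g * d) * g' * k = d * k - g * d * l * g' := by
    rw [mul_assoc, h3, sub_mul, ← mul_assoc, mul_assoc d, h, ← mul_assoc, ← mul_assoc, mul_assoc _ g,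
      h1, mul_one]
  have e2 : k * ((d * g - g * d) * g') = k * d - g * l * d * g' := by
    rw [sub_mul, mul_sub, mul_assoc d, h1, mul_one, ← mul_assoc, ← mul_assoc, ← h]
  rw [e1, e2]
  noncomm_ring

/-- The part of the operator `D + K^c + Λ` that changes under the variation `d` is, up to a
commutator, the conjugate of the variation of the universal Lax operator. -/
theorem IsEvol.map_κc {d : PA →ₗ[ℂ] PA} (hd : IsEvol d) : ∃ M : Ser, IsMul 0 M ∧
    gser (fun n b => d (κc n b)) * Js = M * Kh - Kh * M +
      Gg * (PowerSeries.X * C (rep fun b => d (qv b)) * Gi * Js) := by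
  refine ⟨(C (dh d) * Gg - Gg * C (dh d)) * Gi * Js, ?_, ?_⟩
  · have := ((isMul_Gg.dh_commutator hd).mul isMul_Gi).mul isMul_Js
    rwa [add_zero, add_zero] at this
  · rw [← hd.dh_mul_Kh, ← hd.dh_mul_Lax, commutator_conj Gg_mul_Gi Gi_mul_Gg Gg_mul_Lax, add_mul,
      sub_mul, mul_assoc _ Kh, Kh_mul_Js, mul_assoc _ Js Kh, mul_assoc Kh, mul_assoc Gg, mul_assoc Gg]

/-- The pairing with the variation of `Q_u`: the components of `Q_u` are dual to the generators
`b̄`, so that the invariant form becomes a sum over generators. -/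
theorem rho_pairing {d : PA →ₗ[ℂ] PA} (hd : d 1 = 0) (a : B → PA) :
    ∑ b, ∑ c, (form b c : ℂ) • (d (qv b) * a c) = ∑ b, if b.inN then 0 else d (bar b) * a b := by
  have z : ∀ b : B, ∑ c, (form b c : ℂ) • (d (qv b) * a c) = match b with
      | .f3 => 0
      | .h1 => d (bar .h2) * a .h2
      | .h2 => d (bar .h1) * a .h1
      | .e3 => d (bar .f3) * a .f3
      | .e1 => d (bar .f1) * a .f1
      | .e2 => d (bar .f2) * a .f2
      | .f1 => d (bar .e1) * a .e1
      | .f2 => 0 := by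
    intro b
    cases b <;> simp only [sum_B, form_eq, formT, qv, map_neg, map_smul, map_zero, hd, zero_mul, smul_zero,
      Rat.cast_zero, zero_smul, add_zero, zero_add, neg_mul, smul_neg, smul_mul_assoc, smul_smul,
      Finset.sum_const_zero] <;> norm_num
  simp only [z, sum_B, B.inN, B.deg]
  norm_num
  abel

/-- The variation of the Hamiltonians. The density is the trace of the dressed operator against
`h₂`; commutators do not contribute modulo total derivatives, and moving the conjugation to `h₂`
turns it into the resolvent. -/
theorem IsEvol.rho_variation {d : PA →ₗ[ℂ] PA} (hd : IsEvol d) (n : ℕ) : ∃ y : PA,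
    d (rho Kc n) = ∑ b, (if b.inN then 0 else d (bar b) * av n b) + D y := by
  obtain ⟨M, hM, e⟩ := hd.map_κc
  obtain ⟨y, hy⟩ := trace_coeff_commutator_Kh hM (n + 1)
  refine ⟨y, ?_⟩
  have h : IsMul 1 (PowerSeries.X * C (rep fun b => d (qv b)) * Gi * Js) := by
    have := ((IsMul.C_rep (hd.gHom gHom_qv)).X_mul.mul isMul_Gi).mul isMul_Js
    rwa [add_zero, add_zero] at this
  have h' : PowerSeries.X * C (rep fun b => d (qv b)) * Gi * Js * Gg =
      PowerSeries.X * (C (rep fun b => d (qv b)) * A) := by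
    rw [A, mul_assoc, mul_assoc, mul_assoc, mul_assoc Gi]
  have t2 : Matrix.trace (coeff (n + 1) (gser (fun n b => d (κc n b)) * Js)) = lm (d (rho Kc n)) := by
    rw [Js, coeff_mul_C, coeff_gser, trace_rep_mul_J (hd.gHom (gHom_κc _)), rho_Kc, map_neg d, map_smul d]
  rw [e, map_add, Matrix.trace_add, hy, trace_coeff_mul_comm isMul_Gg h, h', coeff_succ_X_mul,
    coeff_C_mul, A_eq_gser, coeff_gser, trace_rep_mul_rep (hd.gHom gHom_qv) (gHom_av n), ← map_add] at t2
  rw [← lm_injective t2, add_comm, rho_pairing hd.map_one]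

/-- An evolutionary derivation which replaces the generator `b` by `e`. -/
theorem exists_evol_replace {b e : B} (h : barPar e = barPar b) : ∃ d : PA →ₗ[ℂ] PA, IsEvol d ∧
    ∀ x : B × ℕ, d (letter barPar x) = if x.1 = b then letter barPar (e, x.2) else 0 := by
  have hv : ∀ i : B, IsHomog (barPar i) (if i = b then bar e else 0) := by
    intro i
    split_ifs with hi
    · rw [hi, ← h]
      exact isHomog_bar e
    · exact IsHomog.zero _
  refine ⟨_, isEvol_evol _ hv, fun x => ?_⟩
  rw [evol_letter]
  split_ifs with hx
  · rw [bar, iterate_D_letter, zero_add]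
  · rw [iterate_D_eq_pow, map_zero]

theorem pd_of_mem_P {e : B} (he : e.inN) (m : ℕ) {a : PA} (ha : a ∈ P) : pd (e, m) a = 0 := by
  induction ha using Algebra.adjoin_induction with
  | mem a ha =>
    obtain ⟨b, n, hb, rfl⟩ := ha
    rw [pd_letter, if_neg]
    rintro h
    rw [Prod.mk.injEq] at h
    exact hb (h.1 ▸ he)
  | algebraMap r => exact (isSuperDer_pd _).map_algebraMap r
  | add a b _ _ ha hb => rw [map_add, ha, hb, add_zero]
  | mul a b _ _ ha hb => rw [(isSuperDer_pd _).leib, ha, hb, zero_mul, mul_zero, add_zero]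

theorem varDer_of_mem_P {e : B} (he : e.inN) {a : PA} (ha : a ∈ P) : varDer e a = 0 := by
  rw [varDer_eq_sum e a 0 fun m _ => pd_of_mem_P he m ha, Finset.sum_range_zero]

/-- If `d` replaces the generator `b` by a letter `e` that does not occur in `a`, the derivative of
`d a` with respect to `e` is that of `a` with respect to `b`. -/
theorem pd_replace {b e : B} (h : barPar e = barPar b) (hb : ¬ b.inN) (he : e.inN)
    {d : PA →ₗ[ℂ] PA} (hd : IsEvol d)
    (hv : ∀ x : B × ℕ, d (letter barPar x) = if x.1 = b then letter barPar (e, x.2) else 0)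
    (m : ℕ) {a : PA} (ha : a ∈ P) : pd (e, m) (d a) = pd (b, m) a := by
  have hne : e ≠ b := by
    rintro rfl
    exact hb he
  have h1 := (isSuperDer_pd (par := barPar) (e, m)).superCommutator hd.toIsSuperDer
  have h2 := isSuperDer_pd (par := barPar) (b, m)
  have hp : letterPar barPar (e, m) + 0 = letterPar barPar (b, m) := by
    simp only [letterPar, h, add_zero]
  rw [hp] at h1
  have h3 := h1.ext h2 (by
    rintro ⟨c, k⟩
    rw [LinearMap.sub_apply, LinearMap.smul_apply, LinearMap.comp_apply, LinearMap.comp_apply, hv,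
      pd_letter, pd_letter]
    have e0 : d (if (c, k) = (e, m) then 1 else 0) = 0 := by
      split_ifs
      · exact hd.map_one
      · exact map_zero _
    rw [e0, smul_zero, sub_zero]
    by_cases hc : c = b
    · subst hc
      rw [if_pos rfl, pd_letter]
      simp
    · rw [if_neg hc, map_zero, if_neg]
      simp [hc]) a
  rw [← h3, LinearMap.sub_apply, LinearMap.smul_apply, LinearMap.comp_apply, LinearMap.comp_apply,
    pd_of_mem_P he m ha, map_zero, smul_zero, sub_zero]

theorem varDer_bar_mul {e : B} (he : e.inN) {a : PA} (ha : a ∈ P) : varDer e (bar e * a) = a := by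
  have key : ∀ m, pd (e, m) (bar e * a) = if m = 0 then a else 0 := by
    intro m
    rw [(isSuperDer_pd _).leib, pd_of_mem_P he m ha, mul_zero, add_zero, bar, pd_letter]
    by_cases hm : m = 0
    · simp [hm]
    · rw [if_neg (by simp [Ne.symm hm]), if_neg hm, zero_mul]
  rw [varDer_eq_sum e _ 1 fun m hm => by rw [key, if_neg (by omega)], Finset.sum_range_one, key, if_pos rfl,
    varSgn, Nat.cast_zero, zero_mul, zero_add, Nat.choose_zero_succ, Nat.cast_zero, sgn_zero, one_smul]
  rfl

/-- The variational derivatives of the Hamiltonians are the coefficients of the resolvent. The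
elements of `P` do not contain the letters `ē₂`, `ē₃`, one of which has the parity of `b̄`;
replacing `b̄` by it in the variation formula and differentiating with respect to it isolates the
coefficient of `b̄`. -/
theorem varDer_rho {b : B} (hb : ¬ b.inN) (n : ℕ) : varDer b (rho Kc n) = av n b := by
  obtain ⟨e, he, h⟩ : ∃ e : B, e.inN ∧ barPar e = barPar b := by
    have : ∀ p : ZMod 2, ∃ e : B, e.inN ∧ barPar e = p := by
      intro p
      rcases zmod2_cases p with rfl | rfl
      · exact ⟨.e2, by decide, by decide⟩
      · exact ⟨.e3, by decide, by decide⟩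
    exact this _
  obtain ⟨d, hd, hv⟩ := exists_evol_replace h
  obtain ⟨y, hy⟩ := hd.rho_variation n
  have e1 : d (rho Kc n) = bar e * av n b + D y := by
    rw [hy, Finset.sum_eq_single b]
    · rw [if_neg hb, bar, hv, if_pos rfl]
      rfl
    · intro c _ hc
      rw [bar, hv, if_neg hc, zero_mul, ite_self]
    · exact fun h => absurd (Finset.mem_univ _) h
  -- The variational derivative with respect to `e` removes the total derivative and reads off the
  -- coefficient of `ē`.
  have e2 := congrArg (varDer e) e1
  rw [varDer_add, varDer_D, add_zero, varDer_bar_mul he (av_mem_P n b)] at e2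
  rw [← e2]
  obtain ⟨m, hm⟩ := exists_order (rho Kc n)
  rw [varDer_eq_sum b _ m fun k hk => hm b k hk, varDer_eq_sum e _ m fun k hk => by
    rw [pd_replace h hb he hd hv k (rho_mem_P n), hm b k hk]]
  refine Finset.sum_congr rfl fun k _ => ?_
  rw [pd_replace h hb he hd hv k (rho_mem_P n), h]

/-! ### The Hamiltonian flows -/

theorem isHomog_reduced {v : B → PA} (hv : ∀ b, IsHomog (barPar b) (v b)) (b : B) :
    IsHomog (barPar b) (if b.inN then 0 else proj (v b)) := by
  split_ifs
  · exact IsHomog.zero _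
  · exact isHomog_proj (hv b)

/-- The evolutionary derivation of `P` with the values `π (v b)` on the generators `b̄`, extended by
zero to the remaining generators of `P(ḡ)`. -/
def redFlow (v : B → PA) (hv : ∀ b, IsHomog (barPar b) (v b)) : PA →ₗ[ℂ] PA :=
  evol (fun b => if b.inN then 0 else proj (v b)) (isHomog_reduced hv)

theorem isEvol_redFlow (v : B → PA) (hv : ∀ b, IsHomog (barPar b) (v b)) : IsEvol (redFlow v hv) :=
  isEvol_evol _ _

theorem redFlow_bar (v : B → PA) (hv : ∀ b, IsHomog (barPar b) (v b)) {b : B} (hb : ¬ b.inN) :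
    redFlow v hv (bar b) = proj (v b) := by
  rw [redFlow, bar, evol_letter, if_neg hb]
  rfl

theorem proj_iterate_D (n : ℕ) (a : PA) : proj (D^[n] a) = D^[n] (proj a) := by
  induction n with
  | zero => rfl
  | succ n ih => rw [Function.iterate_succ_apply', Function.iterate_succ_apply', proj_D, ih]

/-- On `P`, applying `π` after an evolutionary derivation gives the derivation with the projected
values. -/
theorem proj_evol {v : B → PA} (hv : ∀ b, IsHomog (barPar b) (v b)) {a : PA} (ha : a ∈ P) :
    proj (evol v hv a) = redFlow v hv a := by
  induction ha using Algebra.adjoin_induction with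
  | mem a ha =>
    obtain ⟨b, n, hb, rfl⟩ := ha
    rw [evol_letter, redFlow, evol_letter, if_neg hb, proj_iterate_D]
  | algebraMap r => rw [(isEvol_evol v hv).map_algebraMap, (isEvol_redFlow v hv).map_algebraMap, map_zero]
  | add a b _ _ ha hb => rw [map_add, map_add, map_add, ha, hb]
  | mul a b ha' hb' ha hb =>
    rw [(isEvol_evol v hv).leibniz, (isEvol_redFlow v hv).leibniz, map_add, map_mul, map_mul, ha, hb,
      proj_of_mem_P ha', proj_of_mem_P hb']

theorem IsEvol.mem_P {d : PA →ₗ[ℂ] PA} (hd : IsEvol d) (h : ∀ b, ¬ b.inN → d (bar b) ∈ P) {a : PA}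
    (ha : a ∈ P) : d a ∈ P := by
  induction ha using Algebra.adjoin_induction with
  | mem a ha =>
    obtain ⟨b, n, hb, rfl⟩ := ha
    have : letter barPar (b, n) = D^[n] (bar b) := by rw [bar, iterate_D_letter, zero_add]
    rw [this, hd.iterate_D]
    exact isDiffStable_P.iterate_D_mem _ (h b hb)
  | algebraMap r =>
    rw [hd.map_algebraMap]
    exact zero_mem _
  | add a b _ _ ha hb =>
    rw [map_add]
    exact add_mem ha hb
  | mul a b ha' hb' ha hb =>
    rw [hd.leibniz]
    exact add_mem (mul_mem ha hb') (mul_mem ha' hb)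

/-- The part of `x` in `n ⊗ P(ḡ)`. -/
def nPart (x : B → PA) : B → PA := fun b => if b.inN then x b else 0

theorem inN_nPart (x : B → PA) : InN (nPart x) := fun _ hb => if_neg hb

theorem GHom.nPart {q : ZMod 2} {x : B → PA} (hx : GHom q x) : GHom q (nPart x) := by
  intro b
  rw [SuperDS.nPart]
  split_ifs
  · exact hx b
  · exact IsHomog.zero _

/-- The vector field of the first Hamiltonian structure that belongs to the density `ρ_n`. -/
def flowVec₁ (n : ℕ) : B → PA := hamVec
  (fun a b => sgn a.par • ∑ k : B, (struc a b k : ℂ) • bar k)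
  (fun a b => sgn a.par * (form a b : ℂ)) (rho Kc n)

/-- The vector field of the second Hamiltonian structure that belongs to the density `ρ_n`. -/
def flowVec₂ (n : ℕ) : B → PA := hamVec
  (fun a b => algebraMap ℂ PA (sgn (a.par + 1) * ∑ k : B, (struc a b k : ℂ) * (form .e2 k : ℂ)))
  (fun _ _ => 0) (rho Kc n)

theorem isHomog_flowVec₁ (n : ℕ) (b : B) : IsHomog (barPar b) (flowVec₁ n b) :=
  isHomog_hamVec affine₁_homog affine₁_par (isHomog_rho n) b

theorem isHomog_flowVec₂ (n : ℕ) (b : B) : IsHomog (barPar b) (flowVec₂ n b) :=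
  isHomog_hamVec affine₂_homog (fun _ _ h => absurd rfl h) (isHomog_rho n) b

/-- The derivation of `P(ḡ)` which restricts to `{ρ_n χ ·}₁|_{χ=0}` on `W`. -/
def dd₁ (n : ℕ) : PA →ₗ[ℂ] PA := redFlow (flowVec₁ n) (isHomog_flowVec₁ n)

/-- The derivation of `P(ḡ)` which restricts to `{ρ_n χ ·}₂|_{χ=0}` on `W`. -/
def dd₂ (n : ℕ) : PA →ₗ[ℂ] PA := redFlow (flowVec₂ n) (isHomog_flowVec₂ n)

theorem isEvol_dd₁ (n : ℕ) : IsEvol (dd₁ n) := isEvol_redFlow _ _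

theorem isEvol_dd₂ (n : ℕ) : IsEvol (dd₂ n) := isEvol_redFlow _ _

theorem bracketW₁_rho (n : ℕ) {a : PA} (ha : a ∈ P) : bracketW₁ (rho Kc n) a 0 = dd₁ n a := by
  rw [bracketW₁, affine₁, chiBracket_zero_eq_evol affine₁_homog affine₁_par (isHomog_rho n)]
  exact proj_evol _ ha

theorem bracketW₂_rho (n : ℕ) {a : PA} (ha : a ∈ P) : bracketW₂ (rho Kc n) a 0 = dd₂ n a := by
  rw [bracketW₂, affine₂, chiBracket_zero_eq_evol affine₂_homog (fun _ _ h => absurd rfl h) (isHomog_rho n)]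
  exact proj_evol _ ha

theorem dd₁_mem_P (n : ℕ) {a : PA} (ha : a ∈ P) : dd₁ n a ∈ P := by
  refine (isEvol_dd₁ n).mem_P (fun b hb => ?_) ha
  rw [dd₁, redFlow_bar _ _ hb]
  exact proj_mem_P _

/-- The part of `a_n` in `b_- ⊗ P`. -/
def xv (n : ℕ) : B → PA := fun b => if b.inN then 0 else av n b

theorem varDer_rho_eq (n : ℕ) (b : B) : varDer b (rho Kc n) = xv n b := by
  rw [xv]
  split_ifs with hb
  · exact varDer_of_mem_P hb (rho_mem_P n)
  · exact varDer_rho hb n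

theorem gHom_xv (n : ℕ) : GHom 0 (xv n) := by
  intro b
  rw [xv]
  split_ifs
  · exact IsHomog.zero _
  · exact gHom_av n b

theorem xv_mem_P (n : ℕ) (b : B) : xv n b ∈ P := by
  rw [xv]
  split_ifs
  · exact zero_mem _
  · exact av_mem_P n b

theorem xv_eq (n : ℕ) : xv n = av n - nPart (av n) := by
  funext b
  rw [xv, Pi.sub_apply, nPart]
  split_ifs
  · rw [sub_self]
  · rw [sub_zero]

theorem bar_mul_xv (n : ℕ) (k i : B) :
    bar k * xv n i = sgn ((k.par + 1) * (0 + i.par)) • (xv n i * bar k) :=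
  homog_comm (isHomog_bar k) (gHom_xv n i)

theorem dd₁_bar (n : ℕ) {j : B} (hj : ¬ j.inN) : dd₁ n (bar j) =
    sgn (barPar j) • ∑ i, sgn (barPar i * barPar j) •
      (sgn i.par • ∑ k : B, (strucT i j k : ℂ) • (proj (bar k) * xv n i) +
        (sgn (barPar i + barPar j) * (sgn i.par * formT i j)) • D (xv n i)) := by
  have hp : ∀ i, proj (xv n i) = xv n i := fun i => proj_of_mem_P (xv_mem_P n i)
  rw [dd₁, redFlow_bar _ _ hj, flowVec₁, hamVec]
  simp only [map_smul, map_sum, map_add, map_mul, proj_D, varDer_rho_eq, hp, struc_eq, form_eq,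
    Finset.sum_mul, smul_mul_assoc]

theorem dd₂_bar (n : ℕ) {j : B} (hj : ¬ j.inN) : dd₂ n (bar j) =
    sgn (barPar j) • ∑ i, sgn (barPar i * barPar j) •
      ((sgn (i.par + 1) * ∑ k : B, (strucT i j k : ℂ) * (formT .e2 k : ℂ)) • xv n i) := by
  have hp : ∀ i, proj (xv n i) = xv n i := fun i => proj_of_mem_P (xv_mem_P n i)
  rw [dd₂, redFlow_bar _ _ hj, flowVec₂, hamVec]
  simp only [map_smul proj, map_sum proj, varDer_rho_eq, hp, struc_eq, form_eq, mul_zero, zero_smul,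
    add_zero, Algebra.algebraMap_eq_smul_one, smul_mul_assoc, one_mul]

theorem xv_e2 (n : ℕ) : xv n .e2 = 0 := if_pos (by decide)

theorem xv_e3 (n : ℕ) : xv n .e3 = 0 := if_pos (by decide)

/-- The first Hamiltonian flow changes the universal Lax operator by a commutator with the part of
`a_n` in `b_-`. -/
theorem dd₁_qv_aux (n : ℕ) (b : B) (h2 : b ≠ .f2) (h3 : b ≠ .f3) :
    dd₁ n (qv b) = -(gBr (xv n) qv - gD (xv n)) b := by
  have p1 := proj_bar not_inN_e1
  have p2 := proj_bar not_inN_f1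
  have p3 := proj_bar not_inN_h1
  have p4 := proj_bar not_inN_h2
  have p5 := proj_bar not_inN_f2
  have p6 := proj_bar not_inN_f3
  have t0 : (1 : ZMod 2) + 1 = 0 := by decide
  have hx := gHom_xv n
  change _ = -(gBr (xv n) qv b - gD (xv n) b)
  rw [gD]
  cases b <;> [exact absurd rfl h3;
    rw [qv, map_neg, map_smul, dd₁_bar n not_inN_h2, gBr_h1 hx];
    rw [qv, map_neg, map_smul, dd₁_bar n not_inN_h1, gBr_h2 hx];
    rw [qv, map_smul, dd₁_bar n not_inN_f3, gBr_e3 hx];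
    rw [qv, map_neg, map_smul, dd₁_bar n not_inN_f1, gBr_e1 hx];
    rw [qv, map_neg, map_smul, dd₁_bar n not_inN_f2, gBr_e2 hx];
    rw [qv, map_smul, dd₁_bar n not_inN_e1, gBr_f1 hx];
    exact absurd rfl h2]
  all_goals
    simp only [sum_B, strucT, formT, B.par, barPar, p1, p2, p3, p4, p5, p6, proj_bar_e2, proj_bar_e3,
      bar_mul_xv, xv_e2, xv_e3, qv, t0, Algebra.algebraMap_eq_smul_one, smul_mul_assoc, zero_add,
      add_zero, mul_one, one_mul, mul_zero, zero_mul, sgn_zero, sgn_one, map_zero, smul_zero, mul_neg,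
      mul_smul_comm]
    push_cast
    module

theorem cb_e2_values : cb .e2 .f3 = 0 ∧ cb .e2 .h1 = 0 ∧ cb .e2 .h2 = 0 ∧ cb .e2 .e3 = 0 ∧
    cb .e2 .e1 = 0 ∧ cb .e2 .e2 = 1 ∧ cb .e2 .f1 = 0 ∧ cb .e2 .f2 = 0 := by
  simp [cb]

/-- The second Hamiltonian flow changes the universal Lax operator by a commutator with `e₂`. -/
theorem dd₂_qv_aux (n : ℕ) (b : B) : dd₂ n (qv b) = gBr (xv n) (cb .e2) b := by
  have t0 : (1 : ZMod 2) + 1 = 0 := by decide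
  have hx := gHom_xv n
  obtain ⟨c1, c2, c3, c4, c5, c6, c7, c8⟩ := cb_e2_values
  cases b <;> [skip;
    rw [gBr_h1 hx, qv, map_neg, map_smul, dd₂_bar n not_inN_h2];
    rw [gBr_h2 hx, qv, map_neg, map_smul, dd₂_bar n not_inN_h1];
    rw [gBr_e3 hx, qv, map_smul, dd₂_bar n not_inN_f3];
    rw [gBr_e1 hx, qv, map_neg, map_smul, dd₂_bar n not_inN_f1];
    rw [gBr_e2 hx, qv, map_neg, map_smul, dd₂_bar n not_inN_f2];
    rw [gBr_f1 hx, qv, map_smul, dd₂_bar n not_inN_e1];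
    skip]
  · rw [gBr_f3 hx, c2, c3, c1, c8, c7]
    simp [qv]
  on_goal 7 =>
    rw [gBr_f2 hx, qv, (isEvol_dd₂ n).map_one, c2, c1, c8, c5]
    simp
  all_goals
    simp only [sum_B, strucT, formT, B.par, barPar, xv_e2, xv_e3, c1, c2, c3, c4, c5, c6, c7, c8, t0,
      zero_add, add_zero, mul_one, one_mul, mul_zero, sgn_zero, sgn_one, smul_zero]
    push_cast
    module

/-! ### Gauge covariance of the flows -/

theorem InN.gBr_cb_e2 {x : B → PA} (hx : InN x) (hx' : GHom 0 x) : gBr x (cb .e2) = 0 := by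
  apply rep_injective
  rw [← rep_gBr hx' (gHom_cb .e2), rep_mul_rep_of_InN hx inN_cb_e2, rep_mul_rep_of_InN inN_cb_e2 hx,
    sub_zero, rep_zero]

theorem gBr_sub_left {x y : B → PA} (hx : GHom 0 x) (hy : GHom 0 y) {q : ZMod 2} {z : B → PA}
    (hz : GHom q z) : gBr (x - y) z = gBr x z - gBr y z := by
  apply rep_injective
  rw [rep_sub, ← rep_gBr (hx.sub hy) hz, ← rep_gBr hx hz, ← rep_gBr hy hz, rep_sub]
  noncomm_ring

theorem gD_sub (x y : B → PA) : gD (x - y) = gD x - gD y := by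
  funext b
  simp only [gD, Pi.sub_apply, map_sub, smul_sub]

/-- The algebra `n` is abelian, so the components in `n` do not contribute. -/
theorem gBr_xv_cb_e2 (n : ℕ) : gBr (xv n) (cb .e2) = gBr (av n) (cb .e2) := by
  rw [xv_eq, gBr_sub_left (gHom_av n) (gHom_av n).nPart (gHom_cb .e2),
    (inN_nPart _).gBr_cb_e2 (gHom_av n).nPart, sub_zero]

/-- The second Hamiltonian flow of `ρ_n` on the universal Lax operator. -/
theorem dd₂_qv (n : ℕ) (b : B) : dd₂ n (qv b) = gBr (av n) (cb .e2) b := by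
  rw [dd₂_qv_aux, gBr_xv_cb_e2]

/-- The first Hamiltonian flow of `ρ_n` on the universal Lax operator: by the recursion for the
resolvent, `-[x_n, D + Q_u + f]` for the part `x_n` of `a_n` in `b_-` is `[a_{n+1}, e₂]` up to the
infinitesimal gauge transformation by the remaining part of `a_n`. -/
theorem dd₁_qv (n : ℕ) (b : B) : dd₁ n (qv b) = gBr (av (n + 1)) (cb .e2) b +
    (gBr (nPart (av n)) qv - gD (nPart (av n))) b := by
  have h := congrFun (av_recursion.2 n) b
  have hx : gBr (xv n) qv - gD (xv n) =
      gBr (av n) qv - gD (av n) - (gBr (nPart (av n)) qv - gD (nPart (av n))) := by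
    rw [xv_eq, gBr_sub_left (gHom_av n) (gHom_av n).nPart gHom_qv, gD_sub]
    abel
  have key : dd₁ n (qv b) = -(gBr (xv n) qv - gD (xv n)) b := by
    obtain ⟨u1, u2, -⟩ := gauge_first_order (x := qv) (inN_nPart (av n)) (gHom_av n).nPart rfl rfl
    obtain ⟨c1, c2, c3, c4, c5, c6, c7, c8⟩ := cb_e2_values
    -- The components of `f₂` and `f₃` of `Q_u + f` are constant; there the formula is the
    -- recursion itself, since gauge transformations do not change these components.
    by_cases h2 : b = .f2
    · subst h2
      rw [Pi.add_apply, gBr_f2 (gHom_av (n + 1)), c5, c2, c8, c1] at h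
      rw [hx, Pi.sub_apply, u2, qv, (isEvol_dd₁ n).map_one]
      simp only [mul_zero, smul_zero, sub_zero, add_zero, Pi.zero_apply] at h
      rw [h, sub_zero, neg_zero]
    by_cases h3 : b = .f3
    · subst h3
      rw [Pi.add_apply, gBr_f3 (gHom_av (n + 1)), c7, c2, c3, c8, c1] at h
      rw [hx, Pi.sub_apply, u1, qv, map_zero]
      simp only [mul_zero, smul_zero, sub_zero, add_zero, Pi.zero_apply] at h
      rw [h, sub_zero, neg_zero]
    exact dd₁_qv_aux n b h2 h3
  rw [Pi.add_apply, Pi.zero_apply] at h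
  rw [key, hx, Pi.sub_apply, eq_neg_of_add_eq_zero_left h]
  abel

theorem Ac_mul_expSer_Ns : Ac * Ser.expSer Ns = Ser.expSer Ns * A := by
  rw [A_eq, mul_assoc (Ser.expSer (-Ns)), ← mul_assoc, Ser.expSer_mul_expSer_neg Ns_mem, one_mul]

/-- The resolvents of the universal Lax operator and of its canonical form are related by the gauge
transformation `1 + N`. -/
theorem acv_conj (k : ℕ) : rep (acv k) * (1 + rep nv) = (1 + rep nv) * rep (av k) := by
  have h := congrArg (coeff k) Ac_mul_expSer_Ns
  rw [expSer_Ns, Ac_eq_gser, A_eq_gser, mul_add, add_mul, map_add, map_add, mul_one, one_mul,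
    coeff_mul_C, coeff_C_mul, coeff_gser, coeff_gser] at h
  rw [mul_add, add_mul, mul_one, one_mul, h]

/-- A derivation which changes the universal Lax operator by `[a_k, e₂]` up to an infinitesimal gauge
transformation changes its canonical form in the same way. -/
theorem IsEvol.map_cv {d : PA →ₗ[ℂ] PA} (hd : IsEvol d) {R : B → PA} (hR : InN R) (hR' : GHom 0 R)
    (k : ℕ) (h : ∀ b, d (qv b) = gBr (av k) (cb .e2) b + (gBr R qv - gD R) b) :
    ∃ R' : B → PA, InN R' ∧ GHom 0 R' ∧ ∀ b, d (cv wv b) =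
      gBr (acv k) (cb .e2) b + (gBr R' (cv wv) - gD R') b := by
  set r := rep R with hr
  set ν := rep nv with hν
  set η := rep (fun b => d (nv b)) with hη
  set e := rep (cb .e2) with he
  have hn' : InN fun b => d (nv b) := fun b hb => by
    beta_reduce
    rw [inN_nv b hb, map_zero]
  have hg : GHom 0 fun b => d (nv b) := hd.gHom gHom_nv
  refine ⟨R + fun b => d (nv b), hR.add hn', hR'.add hg, ?_⟩
  have z1 : ν * ν = 0 := rep_mul_rep_of_InN inN_nv inN_nv
  have z2 : r * ν = 0 := rep_mul_rep_of_InN hR inN_nv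
  have z3 : ν * r = 0 := rep_mul_rep_of_InN inN_nv hR
  have z4 : η * ν = 0 := rep_mul_rep_of_InN hn' inN_nv
  have z5 : ν * e = 0 := rep_mul_rep_of_InN inN_nv inN_cb_e2
  have z6 : e * ν = 0 := rep_mul_rep_of_InN inN_cb_e2 inN_nv
  have hν' : dh d * ν - ν * dh d = η := hd.dh_mul_rep nv
  have hL := gauge_conj inN_nv gHom_nv gHom_qv
  rw [gaugeT_nv_qv, ← hν] at hL
  set L := Dhat + rep qv with hLd
  set L' := Dhat + rep (cv wv) with hLd'
  have c1 : (dh d - r) * L - L * (dh d - r) = rep (av k) * e - e * rep (av k) := by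
    have : rep (fun b => d (qv b)) = (rep (av k) * e - e * rep (av k)) +
        ((r * rep qv - rep qv * r) - (Dhat * r - r * Dhat)) := by
      rw [rep_gBr (gHom_av k) (gHom_cb .e2), rep_gBr hR' gHom_qv, rep_gD hR', ← rep_sub, ← rep_add]
      congr 1
      funext b
      exact h b
    rw [← hd.dh_mul_rep] at this
    have h2 := hd.dh_mul_Dhat
    rw [hLd]
    linear_combination (norm := noncomm_ring) this + h2
  -- Conjugation by `1 + ν` turns the operator `d - R` into `d - (R + d ν)`.
  have c2 : (dh d - (r + η)) * (1 + ν) = (1 + ν) * (dh d - r) := by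
    rw [add_mul 1 ν, mul_sub ν, z3, mul_add _ 1 ν, sub_mul _ _ ν, add_mul r η ν, z2, z4, ← hν']
    noncomm_ring
  have c3 : (1 + ν) * (1 - ν) = 1 := by
    rw [add_mul, mul_sub ν, z1]
    noncomm_ring
  have c4 : e * (1 + ν) = (1 + ν) * e := by rw [mul_add, add_mul, z5, z6]; noncomm_ring
  -- As `e₂` commutes with the gauge group, the commutator with it is transformed by replacing
  -- `a_k` by its gauge transform.
  have c5 := acv_conj k
  rw [← hν] at c5
  have c6 : ((dh d - (r + η)) * L' - L' * (dh d - (r + η))) * (1 + ν) =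
      (rep (acv k) * e - e * rep (acv k)) * (1 + ν) := by
    rw [sub_mul, mul_assoc _ L', ← hL, ← mul_assoc _ (1 + ν) L, c2, mul_assoc L', c2, ← mul_assoc L',
      ← hL, mul_assoc (1 + ν), mul_assoc (1 + ν), ← mul_sub, c1, sub_mul, mul_assoc _ e, c4,
      ← mul_assoc _ (1 + ν) e, c5, mul_assoc e, c5, ← mul_assoc e, c4]
    noncomm_ring
  have c7 : (dh d - (r + η)) * L' - L' * (dh d - (r + η)) = rep (acv k) * e - e * rep (acv k) := by
    have := congrArg (· * (1 - ν)) c6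
    simp only [mul_assoc _ _ (1 - ν), c3, mul_one] at this
    exact this
  have c8 : rep (fun b => d (cv wv b)) = (rep (acv k) * e - e * rep (acv k)) +
      (((r + η) * rep (cv wv) - rep (cv wv) * (r + η)) - (Dhat * (r + η) - (r + η) * Dhat)) := by
    rw [← hd.dh_mul_rep, ← c7, hLd']
    have h2 := hd.dh_mul_Dhat
    linear_combination (norm := noncomm_ring) -h2
  rw [hr, hη, ← rep_add, rep_gBr (gHom_acv k) (gHom_cb .e2), rep_gBr (hR'.add hg) gHom_cv,
    rep_gD (hR'.add hg), ← rep_sub, ← rep_add] at c8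
  exact fun b => congrFun (rep_injective c8) b

/-- The infinitesimal gauge transformation which compensates `[a_k, e₂]` in the canonical form. -/
def Rc (k : ℕ) : B → PA
  | .e2 => gBr (acv k) (cb .e2) .h2
  | .e3 => (1 / 2 : ℂ) • gBr (acv k) (cb .e2) .e1
  | _ => 0

/-- The compensating gauge transformation is determined by the components of `h₂` and `e₁`, which
vanish identically in the canonical form; hence the evolution of the `w_t` depends only on the
index `k`. -/
theorem IsEvol.map_cv_eq {d : PA →ₗ[ℂ] PA} (hd : IsEvol d) {R : B → PA} (hR : InN R) (hR' : GHom 0 R)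
    (k : ℕ) (h : ∀ b, d (qv b) = gBr (av k) (cb .e2) b + (gBr R qv - gD R) b) (b : B) :
    d (cv wv b) = gBr (acv k) (cb .e2) b + (gBr (Rc k) (cv wv) - gD (Rc k)) b := by
  obtain ⟨R', h1, h2, h3⟩ := hd.map_cv hR hR' k h
  obtain ⟨-, -, -, -, u5, u6, -⟩ := gauge_first_order (x := cv wv) h1 h2 rfl rfl
  have e : R' = Rc k := by
    have t1 := h3 .h2
    have t2 := h3 .e1
    rw [u5, cv, map_zero] at t1
    rw [u6, cv, map_zero] at t2
    funext b
    cases b <;> simp only [Rc] <;> first | exact h1 _ (by decide) | skip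
    · linear_combination (norm := module) (1 / 2 : ℂ) • t2
    · linear_combination (norm := module) (1 : ℂ) • t1
  rw [← e]
  exact h3 b

theorem gBr_acv_mem_WA (k : ℕ) (b : B) : gBr (acv k) (cb .e2) b ∈ WA := by
  refine gBr_mem isDiffStable_WA (acv_mem_WA k) (fun c => ?_) b
  by_cases h : c = .e2
  · rw [h, cb, Pi.single_eq_same]
    exact one_mem _
  · rw [cb, Pi.single_eq_of_ne h]
    exact zero_mem _

theorem Rc_mem_WA (k : ℕ) (b : B) : Rc k b ∈ WA := by
  cases b <;> simp only [Rc] <;> first | exact zero_mem _ | skip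
  · exact Subalgebra.smul_mem _ (gBr_acv_mem_WA k _) _
  · exact gBr_acv_mem_WA k _

theorem dd₁_cv (n : ℕ) (b : B) : dd₁ n (cv wv b) =
    gBr (acv (n + 1)) (cb .e2) b + (gBr (Rc (n + 1)) (cv wv) - gD (Rc (n + 1))) b :=
  (isEvol_dd₁ n).map_cv_eq (inN_nPart _) (gHom_av n).nPart (n + 1) (dd₁_qv n) b

theorem dd₂_cv (n : ℕ) (b : B) : dd₂ n (cv wv b) =
    gBr (acv n) (cb .e2) b + (gBr (Rc n) (cv wv) - gD (Rc n)) b := by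
  refine (isEvol_dd₂ n).map_cv_eq (R := 0) (fun _ _ => rfl) (GHom.zero 0) n (fun b => ?_) b
  rw [dd₂_qv]
  simp [gBr, gD]

theorem wv_eq_cv (t : Fin 4) : ∃ b, wv t = cv wv b := by
  fin_cases t
  · exact ⟨.f1, rfl⟩
  · exact ⟨.h1, rfl⟩
  · exact ⟨.e2, rfl⟩
  · exact ⟨.e3, rfl⟩

/-- Bi-Hamiltonian recursion: up to gauge transformations both sides change the Lax operator by
`[a_{n+1}, e₂]`. -/
theorem flow₁_wv (n : ℕ) (t : Fin 4) : flow₁ (rho Kc n) (wv t) = flow₂ (rho Kc (n + 1)) (wv t) := by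
  rw [flow₁, flow₂, bracketW₁_rho n (wv_mem_P t), bracketW₂_rho _ (wv_mem_P t)]
  obtain ⟨b, hb⟩ := wv_eq_cv t
  rw [hb, dd₁_cv, dd₂_cv]

theorem dd₁_mem_WA (n : ℕ) {a : PA} (ha : a ∈ WA) : dd₁ n a ∈ WA := by
  have hd := isEvol_dd₁ n
  induction ha using Algebra.adjoin_induction with
  | mem a ha =>
    obtain ⟨t, m, rfl⟩ := ha
    rw [hd.iterate_D]
    apply isDiffStable_WA.iterate_D_mem
    obtain ⟨b, hb⟩ := wv_eq_cv t
    rw [hb, dd₁_cv]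
    exact add_mem (gBr_acv_mem_WA _ _) (sub_mem (gBr_mem isDiffStable_WA (Rc_mem_WA _) cv_mem_WA b)
      (Subalgebra.smul_mem _ (isDiffStable_WA.D_mem _ (Rc_mem_WA _ b)) _))
  | algebraMap r =>
    rw [hd.map_algebraMap]
    exact zero_mem _
  | add a b _ _ ha hb =>
    rw [map_add]
    exact add_mem ha hb
  | mul a b ha' hb' ha hb =>
    rw [hd.leibniz]
    exact add_mem (mul_mem ha hb') (mul_mem ha' hb)

/-! ### Commutativity of the flows -/

/-- Everything that commutes with the dressed Lax operator commutes with `h₂`: the part which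
anticommutes with `h₂` lies in all steps of the filtration. -/
theorem commute_Js_of_commute_Kh {M : Ser} (h : M * Kh = Kh * M) : M * Js = Js * M := by
  set N := M * Js - Js * M with hN
  have hJ : N * Js = -(Js * N) := by
    have e1 : N * Js = M * (Js * Js) - Js * M * Js := by
      rw [hN]
      noncomm_ring
    have e2 : Js * N = Js * M * Js - Js * Js * M := by
      rw [hN]
      noncomm_ring
    rw [e1, e2, Js_mul_Js]
    noncomm_ring
  have hK : N * Kh = Kh * N := by
    rw [hN, sub_mul, mul_sub, mul_assoc, ← Kh_mul_Js, ← mul_assoc, h, mul_assoc Js, h, ← mul_assoc,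
      ← mul_assoc, ← Kh_mul_Js, mul_assoc Kh Js]
  have hL : Kh - Lt ∈ Ser.Fil 2 :=
    conj_sub_Lt_mem Ts_mem (Lax_sub_Lt_mem rfl rfl) expSer_Ts_mul_Lax
  -- The leading term of the dressed operator is `Λ`, so `[N, Λ]` has higher degree than `N`, and
  -- so has `N`.
  have step : ∀ e : ℤ, N ∈ Ser.Fil e → N ∈ Ser.Fil (e + 1) := by
    intro e he
    have e1 : N * Lt - Lt * N = (Kh - Lt) * N - N * (Kh - Lt) := by
      linear_combination (norm := noncomm_ring) hK
    have h1 : N * Lt - Lt * N ∈ Ser.Fil (e + 2) := by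
      rw [e1]
      refine sub_mem ?_ (Ser.mul_mem_Fil he hL)
      rw [add_comm]
      exact Ser.mul_mem_Fil hL he
    have := mem_Fil_of_commutator hJ h1
    rwa [show e + 2 - 1 = e + 1 by ring] at this
  have all : ∀ n : ℕ, N ∈ Ser.Fil ((n : ℤ) - 1) := by
    intro n
    induction n with
    | zero => simpa using Ser.mem_Fil_neg_one N
    | succ n ih =>
      have := step _ ih
      rwa [show ((n : ℤ) - 1 + 1) = ((n + 1 : ℕ) : ℤ) - 1 by push_cast; ring] at this
  have h0 : N = 0 := Ser.eq_zero_of_forall_mem_Fil fun n => Ser.Fil_anti (by push_cast; omega) (all (n + 1))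
  rwa [hN, sub_eq_zero] at h0

theorem conj_commute_Kh {M : Ser} (h : M * Lax qv = Lax qv * M) :
    Gg * M * Gi * Kh = Kh * (Gg * M * Gi) := by
  have h1 : Gi * Kh = Lax qv * Gi := by
    rw [Lax_eq, mul_assoc _ Gg, Gg_mul_Gi, mul_one]
  rw [mul_assoc _ Gi, h1, ← mul_assoc, mul_assoc Gg, h, ← mul_assoc Gg, Gg_mul_Lax, mul_assoc Kh,
    mul_assoc Kh]

/-- The resolvent commutes with everything that commutes with the universal Lax operator. -/
theorem commute_A_of_commute_Lax {M : Ser} (h : M * Lax qv = Lax qv * M) : M * A = A * M := by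
  have h2 := commute_Js_of_commute_Kh (conj_commute_Kh h)
  have e1 : M * A = Gi * (Gg * M * Gi * Js) * Gg := by
    have : Gi * (Gg * M * Gi * Js) * Gg = Gi * Gg * M * (Gi * Js * Gg) := by noncomm_ring
    rw [this, Gi_mul_Gg, one_mul, A]
  have e2 : A * M = Gi * (Js * (Gg * M * Gi)) * Gg := by
    have : Gi * (Js * (Gg * M * Gi)) * Gg = Gi * Js * Gg * M * (Gi * Gg) := by noncomm_ring
    rw [this, Gi_mul_Gg, mul_one, A]
  rw [e1, h2, e2]

/-- The coefficients of `ζ^{-n} A` at positive powers of `ζ`. -/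
def tailv (n : ℕ) : ℕ → B → PA := fun k => if k = 0 then 0 else av (n + k)

/-- The operator `Δ_n` of the zero curvature representation of the `n`-th flow: the derivation
along the flow, minus the part of `ζ^{-n} A` at positive powers of `ζ` and the part of `a_n` in
`n`. -/
def Del (n : ℕ) : Ser := C (dh (dd₁ n) - rep (nPart (av n))) - gser (tailv n)

theorem gHom_tailv (n k : ℕ) : GHom 0 (tailv n k) := by
  rw [tailv]
  split_ifs
  · exact GHom.zero 0
  · exact gHom_av _

/-- Zero curvature representation of the flows: both the derivation, corrected by its gauge part,
and the tail of `ζ^{-n} A` change the Lax operator by `[a_{n+1}, e₂]`. -/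
theorem Del_mul_Lax (n : ℕ) : Del n * Lax qv = Lax qv * Del n := by
  set R := nPart (av n) with hR
  have hR1 : InN R := inN_nPart _
  have hR2 : GHom 0 R := (gHom_av n).nPart
  have h1 : C (dh (dd₁ n) - rep R) * Lax qv - Lax qv * C (dh (dd₁ n) - rep R) =
      PowerSeries.X * C (rep (gBr (av (n + 1)) (cb .e2))) := by
    have c0 : rep R * rep (cb .e2) = 0 := rep_mul_rep_of_InN hR1 inN_cb_e2
    have c1 : rep (cb .e2) * rep R = 0 := rep_mul_rep_of_InN inN_cb_e2 hR1
    have c2 : C (rep R) * Lax qv - Lax qv * C (rep R) = PowerSeries.X * C (rep (gBr R qv - gD R)) := by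
      rw [rep_sub, ← rep_gBr hR2 gHom_qv, ← rep_gD hR2, Lax, mul_add, add_mul, ← mul_assoc,
        PowerSeries.commute_X, mul_assoc, mul_assoc, ← map_mul, ← map_mul, ← map_mul, ← map_mul, c0, c1,
        map_zero, add_zero, add_zero, ← mul_sub, ← map_sub]
      congr 2
      noncomm_ring
    have c3 := (isEvol_dd₁ n).dh_mul_Lax qv
    have c4 : (fun b => dd₁ n (qv b)) = gBr (av (n + 1)) (cb .e2) + (gBr R qv - gD R) := by
      funext b
      exact dd₁_qv n b
    rw [c4, rep_add, map_add, mul_add, ← c2] at c3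
    rw [map_sub, sub_mul, mul_sub]
    linear_combination (norm := noncomm_ring) c3
  have h2 : gser (tailv n) * Lax qv - Lax qv * gser (tailv n) =
      PowerSeries.X * C (rep (gBr (av (n + 1)) (cb .e2))) := by
    ext1 k
    rw [map_sub]
    cases k with
    | zero =>
      rw [coeff_zero_mul_Lax, coeff_zero_Lax_mul, coeff_gser, coeff_zero_X_mul, tailv, if_pos rfl,
        rep_zero, zero_mul, mul_zero, sub_zero]
    | succ k =>
      rw [coeff_succ_mul_Lax, coeff_succ_Lax_mul, coeff_gser, coeff_gser, coeff_succ_X_mul, coeff_C]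
      have r1 := rep_gBr (gHom_tailv n k) gHom_qv
      have r2 := rep_gD (gHom_tailv n k)
      have r3 := rep_gBr (gHom_tailv n (k + 1)) (gHom_cb .e2)
      have e : rep (tailv n k) * (Dhat + rep qv) + rep (tailv n (k + 1)) * rep (cb .e2) -
          ((Dhat + rep qv) * rep (tailv n k) + rep (cb .e2) * rep (tailv n (k + 1))) =
            rep (gBr (tailv n k) qv - gD (tailv n k) + gBr (tailv n (k + 1)) (cb .e2)) := by
        rw [rep_add, rep_sub, ← r1, ← r2, ← r3]
        noncomm_ring
      rw [e]
      by_cases hk : k = 0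
      · subst hk
        have z : tailv n 0 = 0 := if_pos rfl
        have z1 : tailv n (0 + 1) = av (n + 1) := if_neg (by omega)
        rw [if_pos rfl, z, z1]
        congr 1
        funext b
        simp [gBr, gD]
      · have z : tailv n k = av (n + k) := if_neg hk
        have z1 : tailv n (k + 1) = av (n + k + 1) := if_neg (by omega)
        rw [if_neg hk, z, z1, av_recursion.2, rep_zero]
  rw [Del, sub_mul, mul_sub]
  linear_combination (norm := noncomm_ring) h1 - h2

/-- `ζ^n Δ_n + A`, which is a polynomial in `ζ`. -/
def Pol (n : ℕ) : Ser := PowerSeries.X ^ n * Del n + A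

/-- Adding the resolvent cancels the tail, so `ζ^n Δ_n + A` has degree at most `n` in `ζ`. -/
theorem coeff_Pol (n k : ℕ) (hk : n < k) : coeff k (Pol n) = 0 := by
  obtain ⟨j, rfl⟩ : ∃ j, k = j + 1 + n := ⟨k - n - 1, by omega⟩
  rw [Pol, map_add, coeff_X_pow_mul, Del, map_sub, coeff_C, if_neg (by omega), A_eq_gser, coeff_gser,
    coeff_gser, tailv, if_neg (by omega), show n + (j + 1) = j + 1 + n by omega, zero_sub,
    neg_add_cancel]

theorem X_pow_comm (n : ℕ) (M : Ser) : M * PowerSeries.X ^ n = PowerSeries.X ^ n * M :=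
  ((PowerSeries.commute_X M).pow_right n).eq

/-- The resolvent commutes with all `Δ_n` and does not contribute. -/
theorem Pol_commutator (m n : ℕ) : Pol m * Pol n - Pol n * Pol m =
    PowerSeries.X ^ (m + n) * (Del m * Del n - Del n * Del m) := by
  have c1 := commute_A_of_commute_Lax (Del_mul_Lax m)
  have c2 := commute_A_of_commute_Lax (Del_mul_Lax n)
  have hm : PowerSeries.X ^ m * Del m * A = A * (PowerSeries.X ^ m * Del m) := by
    rw [mul_assoc, c1, ← mul_assoc, ← mul_assoc, X_pow_comm]
  have hn : PowerSeries.X ^ n * Del n * A = A * (PowerSeries.X ^ n * Del n) := by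
    rw [mul_assoc, c2, ← mul_assoc, ← mul_assoc, X_pow_comm]
  have e1 : PowerSeries.X ^ m * Del m * (PowerSeries.X ^ n * Del n) =
      PowerSeries.X ^ (m + n) * (Del m * Del n) := by
    rw [mul_assoc, ← mul_assoc (Del m), X_pow_comm, pow_add, mul_assoc, mul_assoc]
  have e2 : PowerSeries.X ^ n * Del n * (PowerSeries.X ^ m * Del m) =
      PowerSeries.X ^ (m + n) * (Del n * Del m) := by
    rw [mul_assoc, ← mul_assoc (Del n), X_pow_comm, add_comm, pow_add, mul_assoc, mul_assoc]
  rw [mul_sub, ← e1, ← e2, Pol, Pol]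
  linear_combination (norm := noncomm_ring) hm - hn

/-- The commutator of polynomials of degrees at most `m` and `n` in `ζ` has degree at most `m + n`;
hence `[Δ_m, Δ_n]` has no positive powers of `ζ`. -/
theorem coeff_Del_commutator (m n k : ℕ) (hk : 0 < k) :
    coeff k (Del m * Del n - Del n * Del m) = 0 := by
  have h := congrArg (coeff (k + (m + n))) (Pol_commutator m n)
  rw [coeff_X_pow_mul, map_sub, coeff_mul, coeff_mul, Finset.sum_eq_zero, Finset.sum_eq_zero,
    sub_zero] at h
  · exact h.symm
  all_goals
    intro ab hab
    have hs : ab.1 + ab.2 = k + (m + n) := by simpa using hab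
  · by_cases h1 : n < ab.1
    · rw [coeff_Pol _ _ h1, zero_mul]
    · rw [coeff_Pol m ab.2 (by omega), mul_zero]
  · by_cases h1 : m < ab.1
    · rw [coeff_Pol _ _ h1, zero_mul]
    · rw [coeff_Pol n ab.2 (by omega), mul_zero]

theorem coeff_zero_Del (n : ℕ) : coeff 0 (Del n) = dh (dd₁ n) - rep (nPart (av n)) := by
  rw [Del, map_sub, coeff_C, if_pos rfl, coeff_gser, tailv, if_pos rfl, rep_zero, sub_zero]

theorem dh_mul_dh (d e : PA →ₗ[ℂ] PA) : dh d * dh e = dh (d ∘ₗ e) := by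
  ext1 i j
  rw [dh, dh, dh, Matrix.diagonal_mul_diagonal]
  rfl

theorem dh_sub (d e : PA →ₗ[ℂ] PA) : dh (d - e) = dh d - dh e := by
  rw [dh, dh, dh, Matrix.diagonal_sub]
  rfl

/-- The flows commute on `W`: the commutator of two flows acts on the universal Lax operator by an
infinitesimal gauge transformation. -/
theorem dd₁_comm (m n : ℕ) {a : PA} (ha : a ∈ W) : dd₁ m (dd₁ n a) = dd₁ n (dd₁ m a) := by
  have hm := isEvol_dd₁ m
  have hn := isEvol_dd₁ n
  set d := dd₁ m ∘ₗ dd₁ n - dd₁ n ∘ₗ dd₁ m with hd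
  have hd1 : IsEvol d := hm.commutator hn
  set Rm := nPart (av m) with hRm
  set Rn := nPart (av n) with hRn
  set R : B → PA := (fun b => dd₁ m (Rn b)) - fun b => dd₁ n (Rm b) with hR
  have hR1 : InN R := InN.sub
    (fun b hb => by rw [hRn, inN_nPart _ b hb, map_zero]) fun b hb => by rw [hRm, inN_nPart _ b hb, map_zero]
  have hR2 : GHom 0 R := (hm.gHom (gHom_av n).nPart).sub (hn.gHom (gHom_av m).nPart)
  -- The commutator of the `Δ` is an operator without `ζ`: the commutator of the flows, corrected
  -- by an element of `n ⊗ P`.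
  have hz : Del m * Del n - Del n * Del m = C (dh d - rep R) := by
    ext1 k
    by_cases hk : k = 0
    · subst hk
      have z1 : rep Rm * rep Rn = 0 := rep_mul_rep_of_InN (inN_nPart _) (inN_nPart _)
      have z2 : rep Rn * rep Rm = 0 := rep_mul_rep_of_InN (inN_nPart _) (inN_nPart _)
      rw [coeff_C, if_pos rfl, map_sub, coeff_mul, coeff_mul, Finset.Nat.antidiagonal_zero, Finset.sum_singleton,
        Finset.sum_singleton, coeff_zero_Del, coeff_zero_Del,
        ← hRm, ← hRn, hd, hR, dh_sub, rep_sub, ← dh_mul_dh, ← dh_mul_dh, ← hm.dh_mul_rep,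
        ← hn.dh_mul_rep]
      linear_combination (norm := noncomm_ring) z1 - z2
    · rw [coeff_C, if_neg hk, coeff_Del_commutator m n k (by omega)]
  -- It commutes with the universal Lax operator.
  have hc : C (dh d - rep R) * Lax qv = Lax qv * C (dh d - rep R) := by
    have c1 := Del_mul_Lax m
    have c2 := Del_mul_Lax n
    rw [← hz, sub_mul, mul_sub, mul_assoc, c2, ← mul_assoc, c1, mul_assoc (Del n), c1, ← mul_assoc (Del n),
      c2, mul_assoc, mul_assoc]
  -- The coefficient of `ζ` in this identity says that the commutator of the flows is an
  -- infinitesimal gauge transformation.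
  have hq : rep (fun b => d (qv b)) = rep (gBr R qv - gD R) := by
    have h := congrArg (coeff 1) hc
    rw [coeff_succ_mul_Lax, coeff_succ_Lax_mul, coeff_C, coeff_C, if_pos rfl, if_neg (by omega), zero_mul,
      mul_zero, add_zero, add_zero] at h
    rw [← hd1.dh_mul_rep, rep_sub, ← rep_gBr hR2 gHom_qv, ← rep_gD hR2]
    have h2 := hd1.dh_mul_Dhat
    linear_combination (norm := noncomm_ring) h - h2
  have := hd1.eq_zero_of_gauge hR1 hR2 (fun b => congrFun (rep_injective hq) b) ha
  rw [hd, LinearMap.sub_apply, sub_eq_zero] at this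
  exact this

theorem flow₁_comm (m n : ℕ) {a : PA} (ha : a ∈ W) :
    flow₁ (rho Kc m) (flow₁ (rho Kc n) a) = flow₁ (rho Kc n) (flow₁ (rho Kc m) a) := by
  have h : ∀ k, flow₁ (rho Kc k) a = dd₁ k a := fun k => bracketW₁_rho k ha.1
  have h' : ∀ k l, flow₁ (rho Kc k) (dd₁ l a) = dd₁ k (dd₁ l a) :=
    fun k l => bracketW₁_rho k (dd₁_mem_P l ha.1)
  rw [h, h, h', h', dd₁_comm m n ha]

/-! ### Integrals of motion -/

/-- The flows change the Hamiltonian densities by total derivatives. The conjugate of `Δ_n` is the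
derivation plus a series `M` of multiplication operators and commutes with the dressed operator, so
the variation of the dressed operator is a commutator with `M`, whose trace against `h₂` is a total
derivative. -/
theorem dd₁_rho (n k : ℕ) : ∃ y : PA, dd₁ n (rho Kc k) = D y := by
  have hd := isEvol_dd₁ n
  set M : Ser := (Gg * C (dh (dd₁ n)) - C (dh (dd₁ n)) * Gg) * Gi -
    Gg * (C (rep (nPart (av n))) + gser (tailv n)) * Gi with hM
  have hM0 : IsMul 0 M := by
    have h1 := (isMul_Gg.dh_commutator hd).neg.mul isMul_Gi
    -- As `h₂` commutes with the dressed operator, multiplying by it preserves commutators.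
    have h2 := (isMul_Gg.mul ((IsMul.C_rep (gHom_av n).nPart).add (IsMul.gser (gHom_tailv n)))).mul isMul_Gi
    have h3 := h1.add h2.neg.neg.neg
    rw [neg_neg, neg_sub, ← sub_eq_add_neg] at h3
    simpa using h3
  -- The conjugate of `Δ_n`.
  have e : Gg * Del n * Gi = C (dh (dd₁ n)) + M := by
    have : C (dh (dd₁ n)) + M = C (dh (dd₁ n)) * (1 - Gg * Gi) + Gg * (C (dh (dd₁ n)) -
        (C (rep (nPart (av n))) + gser (tailv n))) * Gi := by
      rw [hM]
      noncomm_ring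
    rw [this, Gg_mul_Gi, sub_self, mul_zero, zero_add, Del, map_sub, sub_sub]
  have h1 := conj_commute_Kh (Del_mul_Lax n)
  rw [e] at h1
  have h2 : gser (fun n' b => dd₁ n (κc n' b)) * Js = Kh * (M * Js) - M * Js * Kh := by
    rw [← hd.dh_mul_Kh, mul_assoc M, ← Kh_mul_Js]
    have : C (dh (dd₁ n)) * Kh - Kh * C (dh (dd₁ n)) = Kh * M - M * Kh := by
      linear_combination (norm := noncomm_ring) h1
    rw [this]
    noncomm_ring
  have hMJ : IsMul 0 (M * Js) := by
    have := hM0.mul isMul_Js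
    rwa [add_zero] at this
  obtain ⟨y, hy⟩ := trace_coeff_commutator_Kh hMJ (k + 1)
  refine ⟨-y, ?_⟩
  have t2 : Matrix.trace (coeff (k + 1) (gser (fun n' b => dd₁ n (κc n' b)) * Js)) =
      lm (dd₁ n (rho Kc k)) := by
    rw [Js, coeff_mul_C, coeff_gser, trace_rep_mul_J (hd.gHom (gHom_κc _)), rho_Kc, map_neg (dd₁ n),
      map_smul (dd₁ n)]
  rw [h2, ← neg_sub, map_neg, Matrix.trace_neg, hy, ← map_neg] at t2
  rw [← lm_injective t2, map_neg]

/-! ### The subalgebra generated by the `w_t` as an algebra of polynomials -/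

/-- The values on letters of the morphism `ψ`: the letters `e₂, e₃, h₁, f₁` and their derivatives
go to zero, the remaining ones to themselves. -/
def psiVal (x : B × ℕ) : PA :=
  match x.1 with
  | .e1 | .h2 | .f2 | .f3 => letter barPar x
  | _ => 0

theorem isHomog_psiVal (x : B × ℕ) : IsHomog (letterPar barPar x) (psiVal x) := by
  obtain ⟨b, n⟩ := x
  cases b <;> simp only [psiVal] <;> first | exact isHomog_letter _ | exact IsHomog.zero _

/-- Morphisms given by homogeneous values on the letters. -/
def homOf (v : B × ℕ → PA) (hv : ∀ x, IsHomog (letterPar barPar x) (v x)) : PA →ₐ[ℂ] PA :=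
  liftHom v fun x y => homog_comm (hv x) (hv y)

theorem homOf_letter (v : B × ℕ → PA) (hv : ∀ x, IsHomog (letterPar barPar x) (v x)) (x : B × ℕ) :
    homOf v hv (letter barPar x) = v x := liftHom_letter _ _ _

/-- The morphism of differential superalgebras which kills `e₂, e₃, h₁, f₁` and is the identity on the
remaining generators. -/
def psi : PA →ₐ[ℂ] PA := homOf psiVal isHomog_psiVal

/-- The multiples of the `w_t` which `ψ` maps to the letters `e₁, h₂, f₂, f₃`. -/
def phiGen : B → PA
  | .e1 => (2 : ℂ) • wv 0
  | .h2 => -((4 : ℂ) • wv 1)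
  | .f2 => -((2 : ℂ) • wv 2)
  | .f3 => (4 : ℂ) • wv 3
  | _ => 0

theorem isHomog_wv : IsHomog 1 (wv 1) ∧ IsHomog 0 (wv 0) ∧ IsHomog 0 (wv 2) ∧ IsHomog 1 (wv 3) := by
  have h := gHom_cv
  exact ⟨h .h1, h .f1, h .e2, h .e3⟩

theorem isHomog_phiGen (b : B) : IsHomog (barPar b) (phiGen b) := by
  obtain ⟨h1, h0, h2, h3⟩ := isHomog_wv
  cases b <;> simp only [phiGen] <;> first | exact IsHomog.zero _ | skip
  · exact h3.smul _
  · exact (h1.smul _).neg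
  · exact h0.smul _
  · exact (h2.smul _).neg

theorem isHomog_phiVal (x : B × ℕ) : IsHomog (letterPar barPar x) (D^[x.2] (phiGen x.1)) :=
  (isHomog_phiGen x.1).iterate_D x.2

/-- The morphism of differential superalgebras from the polynomials in the letters `e₁, h₂, f₂, f₃` to
the subalgebra generated by the `w_t`. -/
def phi : PA →ₐ[ℂ] PA := homOf (fun x => D^[x.2] (phiGen x.1)) isHomog_phiVal

theorem psi_letter (x : B × ℕ) : psi (letter barPar x) = psiVal x := homOf_letter _ _ _

theorem phi_letter (x : B × ℕ) : phi (letter barPar x) = D^[x.2] (phiGen x.1) := homOf_letter _ _ _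

theorem psi_D (a : PA) : psi (D a) = D (psi a) := by
  apply algHom_D
  · intro x
    rw [psi_letter]
    exact isHomog_psiVal x
  · rintro ⟨b, n⟩
    rw [psi_letter, psi_letter]
    cases b <;> simp only [psiVal, map_zero, D_letter]

theorem phi_D (a : PA) : phi (D a) = D (phi a) := by
  apply algHom_D
  · intro x
    rw [phi_letter]
    exact isHomog_phiVal x
  · rintro ⟨b, n⟩
    rw [phi_letter, phi_letter, Function.iterate_succ_apply']

theorem psi_iterate_D (n : ℕ) (a : PA) : psi (D^[n] a) = D^[n] (psi a) := by
  induction n with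
  | zero => rfl
  | succ n ih => rw [Function.iterate_succ_apply', psi_D, ih, Function.iterate_succ_apply']

theorem phi_iterate_D (n : ℕ) (a : PA) : phi (D^[n] a) = D^[n] (phi a) := by
  induction n with
  | zero => rfl
  | succ n ih => rw [Function.iterate_succ_apply', phi_D, ih, Function.iterate_succ_apply']

theorem psi_bar : psi (bar .e1) = bar .e1 ∧ psi (bar .h2) = bar .h2 ∧ psi (bar .f2) = bar .f2 ∧
    psi (bar .f3) = bar .f3 ∧ psi (bar .h1) = 0 ∧ psi (bar .f1) = 0 := by
  simp [bar, psi_letter, psiVal]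

/-- The images of the `w_t` under `ψ` are linear. -/
theorem psi_wv : psi (wv 0) = (1 / 2 : ℂ) • bar .e1 ∧ psi (wv 1) = -((1 / 4 : ℂ) • bar .h2) ∧
    psi (wv 2) = -((1 / 2 : ℂ) • bar .f2) ∧ psi (wv 3) = (1 / 4 : ℂ) • bar .f3 := by
  obtain ⟨p1, p2, p3, p4, p5, p6⟩ := psi_bar
  refine ⟨?_, ?_, ?_, ?_⟩ <;> simp [wv, psi_D, p1, p2, p3, p4, p5, p6]

theorem phi_bar (b : B) : phi (bar b) = phiGen b := phi_letter (b, 0)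

theorem phi_psi_wv (t : Fin 4) : phi (psi (wv t)) = wv t := by
  obtain ⟨p0, p1, p2, p3⟩ := psi_wv
  fin_cases t
  · change phi (psi (wv 0)) = wv 0
    rw [p0, map_smul, phi_bar, phiGen]
    module
  · change phi (psi (wv 1)) = wv 1
    rw [p1, map_neg, map_smul, phi_bar, phiGen]
    module
  · change phi (psi (wv 2)) = wv 2
    rw [p2, map_neg, map_smul, phi_bar, phiGen]
    module
  · change phi (psi (wv 3)) = wv 3
    rw [p3, map_smul, phi_bar, phiGen]
    module

/-- The morphism `ψ` identifies the algebra generated by the `w_t` with the polynomials in the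
letters `e₁, h₂, f₂, f₃`. -/
theorem phi_psi {a : PA} (ha : a ∈ WA) : phi (psi a) = a := by
  induction ha using Algebra.adjoin_induction with
  | mem a ha =>
    obtain ⟨t, n, rfl⟩ := ha
    rw [psi_iterate_D, phi_iterate_D, phi_psi_wv]
  | algebraMap r => rw [AlgHom.commutes, AlgHom.commutes]
  | add a b _ _ ha hb => rw [map_add, map_add, ha, hb]
  | mul a b _ _ ha hb => rw [map_mul, map_mul, ha, hb]

theorem phi_mem_WA (a : PA) : phi a ∈ WA := by
  induction a using induct with
  | h0 r =>
    rw [AlgHom.commutes]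
    exact Subalgebra.algebraMap_mem _ r
  | h1 x =>
    rw [phi_letter]
    apply isDiffStable_WA.iterate_D_mem
    obtain ⟨b, n⟩ := x
    cases b <;> simp only [phiGen] <;> first | exact zero_mem _ | skip
    · exact Subalgebra.smul_mem _ (wv_mem_WA 3) _
    · exact neg_mem (Subalgebra.smul_mem _ (wv_mem_WA 1) _)
    · exact Subalgebra.smul_mem _ (wv_mem_WA 0) _
    · exact neg_mem (Subalgebra.smul_mem _ (wv_mem_WA 2) _)
  | hm a b ha hb =>
    rw [map_mul]
    exact mul_mem ha hb
  | ha a b ha hb =>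
    rw [map_add]
    exact add_mem ha hb

theorem phi_D_mem_DW (a : PA) : phi (D a) ∈ DW := by
  rw [phi_D]
  exact Submodule.subset_span ⟨_, WA_subset_W (phi_mem_WA a), rfl⟩

/-- An element of the algebra generated by the `w_t` which is a total derivative in `P(ḡ)` is the
derivative of an element of `W`: the morphism `φ ∘ ψ` commutes with `D` and fixes the element. -/
theorem mem_DW_of_eq_D {a y : PA} (ha : a ∈ WA) (h : a = D y) : a ∈ DW := by
  rw [← phi_psi ha, h, psi_D]
  exact phi_D_mem_DW _

theorem functional_bracketW₁_rho (n k : ℕ) : functional (bracketW₁ (rho Kc n) (rho Kc k) 0) = 0 := by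
  rw [bracketW₁_rho n (rho_mem_P k), functional, Submodule.mkQ_apply, Submodule.Quotient.mk_eq_zero]
  obtain ⟨y, hy⟩ := dd₁_rho n k
  exact mem_DW_of_eq_D (dd₁_mem_WA n (rho_mem_WA k)) hy

/-! ### The polynomial grading -/

/-- The morphism `ψ`, with the polynomial degree recorded by an additional variable. -/
def theta : PA →ₐ[ℂ] Polynomial PA :=
  liftHom (fun x => Polynomial.monomial 1 (psiVal x)) fun x y => by
    rw [Polynomial.monomial_mul_monomial, Polynomial.monomial_mul_monomial,
      homog_comm (isHomog_psiVal x) (isHomog_psiVal y), Polynomial.smul_monomial]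

theorem theta_letter (x : B × ℕ) : theta (letter barPar x) = Polynomial.monomial 1 (psiVal x) :=
  liftHom_letter _ _ _

/-- The component of polynomial degree `k` of `ψ a`. -/
def gr (k : ℕ) : PA →ₗ[ℂ] PA where
  toFun a := (theta a).coeff k
  map_add' a b := by rw [map_add, Polynomial.coeff_add]
  map_smul' c a := by rw [map_smul, Polynomial.coeff_smul, RingHom.id_apply]

theorem gr_mul (k : ℕ) (a b : PA) : gr k (a * b) =
    ∑ ij ∈ Finset.HasAntidiagonal.antidiagonal k, gr ij.1 a * gr ij.2 b := by
  change (theta (a * b)).coeff k = _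
  rw [map_mul, Polynomial.coeff_mul]
  rfl

theorem gr_letter (k : ℕ) (x : B × ℕ) : gr k (letter barPar x) = if k = 1 then psiVal x else 0 := by
  change (theta (letter barPar x)).coeff k = _
  rw [theta_letter, Polynomial.coeff_monomial]
  simp only [eq_comm]

theorem gr_algebraMap (k : ℕ) (c : ℂ) :
    gr k (algebraMap ℂ PA c) = if k = 0 then algebraMap ℂ PA c else 0 := by
  change (theta (algebraMap ℂ PA c)).coeff k = _
  rw [AlgHom.commutes, Polynomial.algebraMap_apply, Polynomial.coeff_C]

theorem gr_one (k : ℕ) : gr k 1 = if k = 0 then 1 else 0 := by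
  have := gr_algebraMap k 1
  rwa [map_one] at this

theorem gr_zero_mul (a b : PA) : gr 0 (a * b) = gr 0 a * gr 0 b := by
  rw [gr_mul, Finset.Nat.antidiagonal_zero, Finset.sum_singleton]

theorem gr_one_mul (a b : PA) : gr 1 (a * b) = gr 0 a * gr 1 b + gr 1 a * gr 0 b := by
  rw [gr_mul, Finset.Nat.antidiagonal_succ]
  simp

theorem gr_two_mul (a b : PA) :
    gr 2 (a * b) = gr 0 a * gr 2 b + gr 1 a * gr 1 b + gr 2 a * gr 0 b := by
  rw [gr_mul]
  simp [Finset.Nat.antidiagonal_succ, add_assoc]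

/-- The component of degree zero is a constant. -/
theorem exists_gr_zero (a : PA) : ∃ c : ℂ, gr 0 a = algebraMap ℂ PA c := by
  induction a using induct with
  | h0 r => exact ⟨r, by rw [gr_algebraMap, if_pos rfl]⟩
  | h1 x => exact ⟨0, by rw [gr_letter, if_neg (by omega), map_zero]⟩
  | hm a b iha ihb =>
    obtain ⟨c, hc⟩ := iha
    obtain ⟨c', hc'⟩ := ihb
    exact ⟨c * c', by rw [gr_zero_mul, hc, hc', map_mul]⟩
  | ha a b iha ihb =>
    obtain ⟨c, hc⟩ := iha
    obtain ⟨c', hc'⟩ := ihb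
    exact ⟨c + c', by rw [map_add, hc, hc', map_add]⟩

theorem gr_sigma (a : PA) : ∀ k, gr k (sigma a) = sigma (gr k a) := by
  induction a using induct with
  | h0 r =>
    intro k
    rw [AlgHom.commutes, gr_algebraMap]
    split_ifs
    · rw [AlgHom.commutes]
    · rw [map_zero]
  | h1 x =>
    intro k
    rw [sigma_letter, map_smul, gr_letter]
    split_ifs
    · exact (isHomog_psiVal x).symm
    · rw [map_zero, smul_zero]
  | hm a b iha ihb =>
    intro k
    rw [map_mul, gr_mul, gr_mul, map_sum]
    refine Finset.sum_congr rfl fun ij _ => ?_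
    rw [iha, ihb, map_mul]
  | ha a b iha ihb =>
    intro k
    rw [map_add, map_add, map_add, map_add, iha, ihb]

theorem gr_homog (k : ℕ) {p : ZMod 2} {a : PA} (ha : IsHomog p a) : IsHomog p (gr k a) := by
  rw [IsHomog, ← gr_sigma, ha, map_smul]

theorem gr_sigmaPow (k : ℕ) (p : ZMod 2) (a : PA) : gr k (sigmaPow p a) = sigmaPow p (gr k a) := by
  rcases zmod2_cases p with rfl | rfl
  · rw [sigmaPow_zero, sigmaPow_zero]
  · rw [sigmaPow_one, sigmaPow_one, gr_sigma]

theorem gr_D (a : PA) : ∀ k, gr k (D a) = D (gr k a) := by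
  induction a using induct with
  | h0 r =>
    intro k
    rw [isSuperDer_D.map_algebraMap, map_zero, gr_algebraMap]
    split_ifs
    · rw [isSuperDer_D.map_algebraMap]
    · rw [map_zero]
  | h1 x =>
    intro k
    rw [D_letter, gr_letter, gr_letter]
    split_ifs
    · rw [← psi_letter, ← psi_letter, ← psi_D, D_letter]
    · rw [map_zero]
  | hm a b iha ihb =>
    intro k
    rw [isSuperDer_D.leib, map_add, gr_mul, gr_mul, gr_mul, map_sum, ← Finset.sum_add_distrib]
    refine Finset.sum_congr rfl fun ij _ => ?_
    rw [iha, ihb, isSuperDer_D.leib, gr_sigmaPow]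
  | ha a b iha ihb =>
    intro k
    rw [map_add, map_add, iha, ihb, map_add, map_add]

theorem gHom_gr {q : ZMod 2} {x : B → PA} (hx : GHom q x) (k : ℕ) : GHom q fun b => gr k (x b) :=
  fun b => gr_homog k (hx b)

theorem ent_gr (k : ℕ) (x : B → PA) (i j : Fin 4) :
    gr k (ent x i j) = ent (fun b => gr k (x b)) i j := by
  simp only [ent, Matrix.of_apply, map_sum, map_smul, gr_sigmaPow]

/-- The Euler derivation, which multiplies the component of polynomial degree `k` by `k`. -/
theorem exists_euler : ∃ d : PA →ₗ[ℂ] PA, IsEvol d ∧ (∀ b, d (bar b) = bar b) ∧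
    ∀ a k, gr k (d a) = (k : ℂ) • gr k a := by
  have hv : ∀ i : B, IsHomog (barPar i) (bar i) := isHomog_bar
  have hl : ∀ x, evol bar hv (letter barPar x) = letter barPar x := by
    intro x
    rw [evol_letter, bar, iterate_D_letter, zero_add]
  refine ⟨evol bar hv, isEvol_evol _ _, fun b => hl _, fun a => ?_⟩
  induction a using induct with
  | h0 r =>
    intro k
    rw [(isEvol_evol bar hv).map_algebraMap, map_zero, gr_algebraMap]
    split_ifs with hk
    · rw [hk, Nat.cast_zero, zero_smul]
    · rw [smul_zero]
  | h1 x =>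
    intro k
    rw [hl, gr_letter]
    split_ifs with hk
    · rw [hk, Nat.cast_one, one_smul]
    · rw [smul_zero]
  | hm a b iha ihb =>
    intro k
    rw [(isEvol_evol bar hv).leibniz, map_add, gr_mul, gr_mul, gr_mul, Finset.smul_sum,
      ← Finset.sum_add_distrib]
    refine Finset.sum_congr rfl fun ij hij => ?_
    have hk : ij.1 + ij.2 = k := by simpa using hij
    rw [iha, ihb, ← hk, smul_mul_assoc, mul_smul_comm, ← add_smul, Nat.cast_add]
  | ha a b iha ihb =>
    intro k
    rw [map_add, map_add, iha, ihb, map_add, smul_add]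

/-! ### The linear part of the resolvent -/

/-- The identity `A² = 1` in matrix entries. -/
theorem av_sq (k : ℕ) (i j : Fin 4) : ∑ ab ∈ Finset.HasAntidiagonal.antidiagonal k,
    ∑ l, ent (av ab.1) i l * ent (av ab.2) l j = if k = 0 then (1 : Matrix (Fin 4) (Fin 4) PA) i j else 0 := by
  apply lm_injective
  have h : (coeff k (A * A)) i j = (coeff k (1 : Ser)) i j := by rw [A_mul_A]
  rw [A_eq_gser, coeff_mul, Matrix.sum_apply, coeff_one] at h
  have e : ∀ ab : ℕ × ℕ, (coeff ab.1 (gser av) * coeff ab.2 (gser av)) i j =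
      lm (∑ l, ent (av ab.1) i l * ent (av ab.2) l j) := by
    intro ab
    rw [coeff_gser, coeff_gser, Matrix.mul_apply, map_sum]
    refine Finset.sum_congr rfl fun l _ => ?_
    rw [map_mul, rep_apply, rep_apply]
  rw [Finset.sum_congr rfl fun ab _ => e ab, ← map_sum] at h
  rw [h]
  split_ifs
  · by_cases hij : i = j
    · rw [hij, Matrix.one_apply_eq, Matrix.one_apply_eq, map_one]
    · rw [Matrix.one_apply_ne hij, Matrix.one_apply_ne hij, map_zero]
  · rw [map_zero]
    rfl

/-- The recursion for the resolvent in the components that determine its linear part. -/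
theorem av_recursion_components (k : ℕ) :
    (2 : ℂ) • (av k .h1 * 1) = (2 : ℂ) • (av k .f3 * qv .e1) + (2 : ℂ) • (av k .f2 * qv .h1) + D (av k .f2) ∧
    av k .f1 * 1 = (2 : ℂ) • (av k .f3 * qv .h1) + (2 : ℂ) • (av k .f3 * qv .h2) - av k .f2 * qv .f1 -
      D (av k .f3) ∧
    (2 : ℂ) • av (k + 1) .f3 = (2 : ℂ) • (av k .h2 * qv .f1) - (2 : ℂ) • (av k .f3 * qv .e2) -
      (2 : ℂ) • (av k .f1 * qv .h2) - D (av k .f1) ∧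
    (2 : ℂ) • (av k .e3 * 1) = (2 : ℂ) • (av k .h2 * qv .e1) + (2 : ℂ) • (av k .f2 * qv .e3) -
      (2 : ℂ) • (av k .e1 * qv .h2) + D (av k .e1) ∧
    av (k + 1) .e1 = (2 : ℂ) • (av k .h1 * qv .e3) + (2 : ℂ) • (av k .h2 * qv .e3) -
      (2 : ℂ) • (av k .e3 * qv .h1) - (2 : ℂ) • (av k .e3 * qv .h2) - av k .e1 * qv .e2 -
      av k .e2 * qv .e1 - D (av k .e3) := by
  obtain ⟨c1, c2, c3, c4, c5, c6, c7, c8⟩ := cb_e2_values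
  have h := fun b => congrFun (av_recursion.2 k) b
  simp only [Pi.add_apply, Pi.sub_apply, Pi.zero_apply, gD] at h
  have f2 := h .f2
  have f3 := h .f3
  have f1 := h .f1
  have e1 := h .e1
  have e3 := h .e3
  have q3 : qv .f3 = 0 := rfl
  have q2 : qv .f2 = 1 := rfl
  rw [gBr_f2 (gHom_av k), gBr_f2 (gHom_av (k + 1))] at f2
  rw [gBr_f3 (gHom_av k), gBr_f3 (gHom_av (k + 1))] at f3
  rw [gBr_f1 (gHom_av k), gBr_f1 (gHom_av (k + 1))] at f1
  rw [gBr_e1 (gHom_av k), gBr_e1 (gHom_av (k + 1))] at e1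
  rw [gBr_e3 (gHom_av k), gBr_e3 (gHom_av (k + 1))] at e3
  simp only [c1, c2, c3, c4, c5, c6, c7, c8, q2, q3, B.par, sgn_zero, sgn_one, mul_zero] at f1 f2 f3 e1 e3
  refine ⟨?_, ?_, ?_, ?_, ?_⟩
  · linear_combination (norm := module) (-1 : ℂ) • f2
  · linear_combination (norm := module) (-1 : ℂ) • f3
  · rw [mul_one] at f1
    linear_combination (norm := module) (1 : ℂ) • f1
  · linear_combination (norm := module) (-1 : ℂ) • e1
  · rw [mul_one] at e3
    linear_combination (norm := module) (-1 : ℂ) • e3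

theorem gr_qv : gr 0 (qv .h1) = 0 ∧ gr 0 (qv .h2) = 0 ∧ gr 0 (qv .e3) = 0 ∧ gr 0 (qv .e1) = 0 ∧
    gr 0 (qv .e2) = 0 ∧ gr 0 (qv .f1) = 0 ∧ gr 1 (qv .f1) = (1 / 2 : ℂ) • bar .e1 ∧
    gr 1 (qv .e3) = (1 / 4 : ℂ) • bar .f3 ∧ gr 1 (qv .h2) = 0 ∧ gr 1 (qv .e1) = 0 := by
  refine ⟨?_, ?_, ?_, ?_, ?_, ?_, ?_, ?_, ?_, ?_⟩ <;>
    simp [qv, bar, gr_letter, psiVal]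

/-- A homogeneous odd element has no constant term. -/
theorem gr_zero_of_odd {a : PA} (ha : IsHomog 1 a) : gr 0 a = 0 := by
  obtain ⟨c, hc⟩ := exists_gr_zero a
  have h := gr_homog 0 ha
  rw [hc, IsHomog, AlgHom.commutes, sgn_one] at h
  rw [hc]
  linear_combination (norm := module) (1 / 2 : ℂ) • h

theorem D_gr_zero (a : PA) : D (gr 0 a) = 0 := by
  obtain ⟨c, hc⟩ := exists_gr_zero a
  rw [hc, isSuperDer_D.map_algebraMap]

theorem gr_cb (m : ℕ) (b c : B) : gr m (cb b c) = if m = 0 then cb b c else 0 := by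
  by_cases h : c = b
  · rw [h, cb, Pi.single_eq_same, gr_one]
  · rw [cb, Pi.single_eq_of_ne h, map_zero, ite_self]

/-- The recursion leaves only `h₂` in the constant term: odd components have none, and `D`
annihilates constants. -/
theorem gr_zero_av_of_ne (k : ℕ) {b : B} (hb : b ≠ .h2) : gr 0 (av k b) = 0 := by
  obtain ⟨q1, q2, q3, q4, q5, q6, -⟩ := gr_qv
  have odd : ∀ b : B, b.par = 1 → gr 0 (av k b) = 0 := fun b hp => by
    have := gHom_av k b
    rw [hp] at this
    exact gr_zero_of_odd this
  obtain ⟨f2, -, -, e1, -⟩ := av_recursion_components k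
  have f2 := congrArg (gr 0) f2
  have e1 := congrArg (gr 0) e1
  simp only [map_add, map_sub, map_smul, gr_zero_mul, gr_D, D_gr_zero, q1, q2, q3, q4, mul_zero, smul_zero,
    mul_one, add_zero, sub_zero] at f2 e1
  cases b
  · cases k with
    | zero =>
      rw [av_zero_of_not_inN not_inN_f3, gr_cb, if_pos rfl]
      exact Pi.single_eq_of_ne hb _
    | succ k =>
      obtain ⟨-, -, f1, -⟩ := av_recursion_components k
      have f1 := congrArg (gr 0) f1
      simp only [map_sub, map_smul, gr_zero_mul, gr_D, D_gr_zero, q2, q5, q6, mul_zero, smul_zero,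
        sub_zero] at f1
      linear_combination (norm := module) (1 / 2 : ℂ) • f1
  · linear_combination (norm := module) (1 / 2 : ℂ) • f2
  · exact absurd rfl hb
  · linear_combination (norm := module) (1 / 2 : ℂ) • e1
  · exact odd _ rfl
  · exact odd _ rfl
  · exact odd _ rfl
  · exact odd _ rfl

theorem ent_smul_cb (c : PA) (hc : IsHomog 0 c) (i j : Fin 4) :
    ent (fun b => if b = .h2 then c else 0) i j = if i = j then jv i • c else 0 := by
  rw [ent, Matrix.of_apply, Finset.sum_eq_single .h2]
  · rw [if_pos rfl, sigmaPow_of_isHomog hc, mul_zero, sgn_zero, one_smul]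
    fin_cases i <;> fin_cases j <;> simp [B.mat, jv]
  · intro b _ hb
    rw [if_neg hb, map_zero, smul_zero]
  · exact fun h => absurd (Finset.mem_univ _) h

/-- The constant term of the resolvent is `h₂`. The recursion does not see the constants in the
component of `h₂`; they are determined by `A² = 1`. -/
theorem gr_zero_av (k : ℕ) (b : B) : gr 0 (av k b) = if k = 0 ∧ b = .h2 then 1 else 0 := by
  by_cases hb : b = .h2
  swap
  · rw [gr_zero_av_of_ne k hb, if_neg fun h => hb h.2]
  subst hb
  have h0 : gr 0 (av 0 .h2) = 1 := by
    rw [av_zero_of_not_inN not_inN_h2, gr_cb, if_pos rfl, cb, Pi.single_eq_same]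
  induction k using Nat.strong_induction_on with
  | _ k ih =>
    by_cases hk : k = 0
    · subst hk
      rw [h0, if_pos ⟨rfl, rfl⟩]
    · rw [if_neg fun h => hk h.1]
      have h := congrArg (gr 0) (av_sq k 0 0)
      have e : ∀ ab : ℕ × ℕ, gr 0 (∑ l, ent (av ab.1) 0 l * ent (av ab.2) l 0) =
          gr 0 (av ab.1 .h2) * gr 0 (av ab.2 .h2) := by
        intro ab
        have hh : ∀ k, (fun b => gr 0 (av k b)) = fun b => if b = .h2 then gr 0 (av k .h2) else 0 := by
          intro k
          funext b
          split_ifs with hb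
          · rw [hb]
          · exact gr_zero_av_of_ne k hb
        have hp : ∀ k, IsHomog 0 (gr 0 (av k .h2)) := fun k => gr_homog 0 (gHom_av k .h2)
        simp only [map_sum, gr_zero_mul, ent_gr, hh, ent_smul_cb _ (hp _)]
        rw [Finset.sum_eq_single 0]
        · rw [if_pos rfl, if_pos rfl, smul_mul_smul_comm, jv_mul_self, one_smul]
        · intro l _ hl
          rw [if_neg (Ne.symm hl), zero_mul]
        · exact fun h => absurd (Finset.mem_univ _) h
      -- In the coefficient of `ζ^k` of `A² = 1` only the products of the zeroth and the `k`-th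
      -- coefficient remain, by induction.
      rw [map_sum, Finset.sum_congr rfl fun ab _ => e ab, if_neg hk, map_zero,
        Finset.sum_eq_add_of_mem (0, k) (k, 0) (by simp) (by simp) (fun h => hk (congrArg Prod.snd h)), h0, one_mul,
        mul_one] at h
      · linear_combination (norm := module) (1 / 2 : ℂ) • h
      · rintro ⟨a, b⟩ hab ⟨h1, h2⟩
        have hs : a + b = k := by simpa using hab
        have ha : a ≠ 0 := by
          rintro rfl
          exact h1 (by simp [← hs])
        have hb : b ≠ 0 := by
          rintro rfl
          exact h2 (by simp [← hs])
        simp only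
        rw [ih a (by omega), if_neg fun h => ha h.1, zero_mul]

/-- The components of `h₂` and `f₂` of the linear part of the resolvent vanish: by `A² = 1` the
linear part anticommutes with the constant part `h₂`. (Linear parts are taken after applying `ψ`.)
-/
theorem gr_one_av_h2 (k : ℕ) : gr 1 (av k .h2) = 0 ∧ gr 1 (av k .f2) = 0 := by
  set b : ℕ → B → PA := fun k c => gr 1 (av k c) with hb
  have hα : ∀ k i j, ent (fun c => gr 0 (av k c)) i j =
      if k = 0 then (if i = j then jv i • (1 : PA) else 0) else 0 := by
    intro k i j
    have : (fun c => gr 0 (av k c)) = fun c => if c = .h2 then (if k = 0 then 1 else 0) else 0 := by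
      funext c
      rw [gr_zero_av]
      by_cases h1 : k = 0 <;> by_cases h2 : c = .h2 <;> simp [h1, h2]
    have hh : IsHomog (par := barPar) 0 (if k = 0 then (1 : PA) else 0) := by
      split_ifs
      · exact isHomog_one
      · exact IsHomog.zero _
    rw [this, ent_smul_cb _ hh]
    split_ifs <;> simp
  -- With `h₂ = diag(j)`, the linear part of `A² = 1` is `(j_i + j_l) b_{il} = 0`.
  have key : ∀ i j, (jv i + jv j) • ent (b k) i j = 0 := by
    intro i j
    have h := congrArg (gr 1) (av_sq k i j)
    have hr : gr 1 (if k = 0 then (1 : Matrix (Fin 4) (Fin 4) PA) i j else 0) = 0 := by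
      split_ifs
      · rw [Matrix.one_apply]
        split_ifs
        · rw [gr_one, if_neg one_ne_zero]
        · rw [map_zero]
      · rw [map_zero]
    have e : ∀ ab : ℕ × ℕ, gr 1 (∑ l, ent (av ab.1) i l * ent (av ab.2) l j) =
        (if ab.1 = 0 then jv i • ent (b ab.2) i j else 0) +
          if ab.2 = 0 then jv j • ent (b ab.1) i j else 0 := by
      intro ab
      simp only [map_sum, gr_one_mul, ent_gr, hα, Finset.sum_add_distrib]
      congr 1
      · rw [Finset.sum_eq_single i]
        · split_ifs <;> simp_all
        · intro l _ hl
          rw [if_neg (Ne.symm hl), ite_self, zero_mul]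
        · exact fun h => absurd (Finset.mem_univ _) h
      · rw [Finset.sum_eq_single j]
        · split_ifs <;> simp_all
        · intro l _ hl
          rw [if_neg hl, ite_self, mul_zero]
        · exact fun h => absurd (Finset.mem_univ _) h
    rw [hr, map_sum, Finset.sum_congr rfl fun ab _ => e ab, Finset.sum_add_distrib,
      Finset.sum_eq_single (0, k), Finset.sum_eq_single (k, 0), if_pos rfl, if_pos rfl, ← add_smul] at h
    · exact h
    · rintro ⟨x, y⟩ hab hne
      have hs : x + y = k := by simpa using hab
      rw [if_neg]
      rintro (rfl : y = 0)
      exact hne (by simp [← hs])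
    · intro hne
      exact absurd (by simp) hne
    · rintro ⟨x, y⟩ hab hne
      have hs : x + y = k := by simpa using hab
      rw [if_neg]
      rintro (rfl : x = 0)
      exact hne (by simp [← hs])
    · intro hne
      exact absurd (by simp) hne
  have hg : GHom 0 (b k) := gHom_gr (gHom_av k) 1
  have k0 := key 0 0
  have k2 := key 2 2
  have k12 := key 1 2
  simp only [ent_of_GHom hg, sum_B, B.mat, jv, B.par, show vpar 0 = 0 from rfl,
    show vpar 2 = 1 from rfl] at k0 k2 k12
  simp [sgn_zero, sgn_one] at k0 k2 k12
  norm_num at k0 k2 k12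
  exact ⟨by linear_combination (norm := module) (1 / 4 : ℂ) • k2 + (1 / 4 : ℂ) • k0, k12⟩

/-- The linear part of the recursion. Eliminating the intermediate components gives second order
recursions for those of `f₃` and `e₁`, with the inhomogeneous terms from `[h₂, Q_u]` at the first
step. -/
theorem gr_one_av_succ (k : ℕ) :
    gr 1 (av (k + 1) .f3) = (1 / 2 : ℂ) • D (D (gr 1 (av k .f3))) +
      (if k = 0 then (1 / 2 : ℂ) • bar .e1 else 0) ∧
    gr 1 (av (k + 1) .e1) = -((1 / 2 : ℂ) • D (D (gr 1 (av k .e1)))) +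
      (if k = 0 then (1 / 2 : ℂ) • bar .f3 else 0) := by
  obtain ⟨q1, q2, q3, q4, q5, q6, r1, r2, r3, r4⟩ := gr_qv
  obtain ⟨-, f3, f1, e1, e3⟩ := av_recursion_components k
  have f3 := congrArg (gr 1) f3
  have f1 := congrArg (gr 1) f1
  have e1 := congrArg (gr 1) e1
  have e3 := congrArg (gr 1) e3
  simp only [map_add, map_sub, map_smul, gr_one_mul, gr_D, gr_zero_av, q1, q2, q3, q4, q5, q6, r1, r2, r3, r4,
    reduceCtorEq, and_false, if_false, and_true, mul_zero, zero_mul, zero_add, add_zero, smul_zero,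
    mul_one, zero_sub, sub_zero] at f3 f1 e1 e3
  constructor
  · have e : gr 1 (av (k + 1) .f3) = (1 / 2 : ℂ) • ((2 : ℂ) • gr 1 (av (k + 1) .f3)) := by module
    rw [e, f1, f3, map_neg]
    by_cases hk : k = 0
    · simp only [if_pos hk, one_mul]
      module
    · simp only [if_neg hk, zero_mul]
      module
  · have e' : gr 1 (av k .e3) = (1 / 2 : ℂ) • ((2 : ℂ) • gr 1 (av k .e3)) := by module
    rw [e3, e', e1, map_smul]
    by_cases hk : k = 0
    · simp only [if_pos hk, one_mul]
      module
    · simp only [if_neg hk, zero_mul]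
      module

theorem gr_one_av_zero {b : B} (hb : ¬ b.inN) : gr 1 (av 0 b) = 0 := by
  rw [av_zero_of_not_inN hb, gr_cb, if_neg one_ne_zero]

/-- The linear part of the resolvent. -/
theorem gr_one_av (k : ℕ) :
    gr 1 (av (k + 1) .f3) = ((1 / 2 : ℂ) ^ (k + 1)) • letter barPar (.e1, 2 * k) ∧
    gr 1 (av (k + 1) .e1) = ((1 / 2 : ℂ) * (-(1 / 2)) ^ k) • letter barPar (.f3, 2 * k) := by
  induction k with
  | zero =>
    obtain ⟨h1, h2⟩ := gr_one_av_succ 0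
    rw [h1, h2, gr_one_av_zero not_inN_f3, gr_one_av_zero not_inN_e1]
    simp [bar]
  | succ k ih =>
    obtain ⟨h1, h2⟩ := gr_one_av_succ (k + 1)
    rw [h1, h2, ih.1, ih.2, if_neg (by omega), if_neg (by omega), map_smul, map_smul, map_smul, map_smul,
      D_letter, D_letter, D_letter, D_letter]
    refine ⟨?_, ?_⟩
    · rw [add_zero, smul_smul, ← pow_succ']
      rfl
    · rw [add_zero, smul_smul, ← neg_smul]
      congr 1
      ring

/-! ### Quadratic parts of the Hamiltonian densities -/

theorem gr_one_bar (b : B) : gr 1 (bar b) = psi (bar b) := by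
  rw [bar, gr_letter, if_pos rfl, psi_letter]

theorem gr_bar_of_ne {k : ℕ} (hk : k ≠ 1) (b : B) : gr k (bar b) = 0 := by
  rw [bar, gr_letter, if_neg hk]

/-- Integration by parts for an even element on the left: `u ∂ᵏ v` and `(-1)ᵏ (∂ᵏ u) v`, for `∂ = D²`, differ by a
total derivative. -/
theorem exists_mul_iterate_D {u v : PA} (hu : IsHomog 0 u) (k : ℕ) :
    ∃ y, u * D^[2 * k] v = (-1 : ℂ) ^ k • (D^[2 * k] u * v) + D y := by
  induction k generalizing v with
  | zero => exact ⟨0, by simp⟩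
  | succ k ih =>
    obtain ⟨y, hy⟩ := ih (v := D (D v))
    set x := D^[2 * k] u with hx
    have hxh : IsHomog 0 x := by
      have h := hu.iterate_D (2 * k)
      have e : (0 : ZMod 2) + ((2 * k : ℕ) : ZMod 2) = 0 := by
        push_cast
        rw [show (2 : ZMod 2) = 0 from rfl, zero_mul, zero_add]
      rwa [e] at h
    have e1 : D^[2 * (k + 1)] u = D (D x) := by
      rw [Nat.mul_succ, Function.iterate_add_apply, ← Function.iterate_add_apply, Nat.add_comm,
        Function.iterate_add_apply]
      rfl
    have e2 : D^[2 * (k + 1)] v = D^[2 * k] (D (D v)) := by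
      rw [Nat.mul_succ, Function.iterate_add_apply]
      rfl
    have h1 : D (x * D v) = D x * D v + x * D (D v) := by
      rw [isSuperDer_D.leib, sigmaPow_of_isHomog hxh, mul_zero, sgn_zero, one_smul]
    have h2 : D (D x * v) = D (D x) * v - D x * D v := by
      rw [isSuperDer_D.leib, sigmaPow_of_isHomog hxh.D, zero_add, mul_one, sgn_one, neg_smul,
        one_smul, neg_mul, sub_eq_add_neg]
    refine ⟨y + (-1 : ℂ) ^ k • (x * D v + D x * v), ?_⟩
    rw [e1, e2, hy, map_add, map_smul, map_add, h1, h2, pow_succ]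
    module

/-- The quadratic parts of the densities, modulo total derivatives. For the Euler derivation, the
variation formula expresses twice the quadratic part through the linear part of the resolvent. -/
theorem gr_two_rho (k : ℕ) : ∃ y, gr 2 (rho Kc (k + 1)) =
    (1 / 2 : ℂ) ^ (k + 1) • (letter barPar (.e1, 2 * k) * bar .f3) + D y := by
  obtain ⟨d, hd, hb, hk⟩ := exists_euler
  obtain ⟨y, hy⟩ := hd.rho_variation (k + 1)
  have h := congrArg (gr 2) hy
  obtain ⟨p1, p2, p3, p4, p5, p6⟩ := psi_bar
  rw [hk, map_add, gr_D, map_sum] at h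
  have e : ∀ b : B, gr 2 (if b.inN then 0 else d (bar b) * av (k + 1) b) =
      if b.inN then 0 else psi (bar b) * gr 1 (av (k + 1) b) := by
    intro b
    split_ifs
    · rw [map_zero]
    · rw [hb, gr_two_mul, gr_bar_of_ne zero_ne_one, gr_bar_of_ne (k := 2) (by omega), gr_one_bar, zero_mul, zero_mul,
        zero_add, add_zero]
  rw [Finset.sum_congr rfl fun b _ => e b, sum_B] at h
  obtain ⟨g1, g2⟩ := gr_one_av_h2 (k + 1)
  obtain ⟨g3, g4⟩ := gr_one_av k
  have i2 : B.e2.inN := rfl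
  have i3 : B.e3.inN := rfl
  simp only [if_neg not_inN_f3, if_neg not_inN_h1, if_neg not_inN_h2, if_neg not_inN_e1, if_neg not_inN_f1,
    if_neg not_inN_f2, if_pos i2, if_pos i3, p1, p2, p3, p4, p5, p6, g1, g2, g3, g4, mul_zero, zero_mul,
    add_zero, zero_add] at h
  have hu : IsHomog 0 (bar .e1) := isHomog_bar .e1
  -- The two contributions, of `f̄₃` and of `ē₁`, agree after integration by parts.
  obtain ⟨z, hz⟩ := exists_mul_iterate_D hu (v := bar .f3) k
  have hx : D^[2 * k] (bar .e1) = letter barPar (.e1, 2 * k) := by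
    rw [bar, iterate_D_letter, zero_add]
  have hy' : D^[2 * k] (bar .f3) = letter barPar (.f3, 2 * k) := by
    rw [bar, iterate_D_letter, zero_add]
  rw [hx, hy'] at hz
  have hc : bar .f3 * letter barPar (.e1, 2 * k) = letter barPar (.e1, 2 * k) * bar .f3 := by
    have hp : letterPar barPar (B.e1, 2 * k) = 0 := by
      simp only [letterPar, barPar, B.par]
      push_cast
      rw [show (2 : ZMod 2) = 0 from rfl, zero_mul, add_zero]
      rfl
    rw [mul_letter, hp, sigmaPow_zero]
  have hs : (1 / 2 : ℂ) * (-(1 / 2)) ^ k * (-1) ^ k = (1 / 2) ^ (k + 1) := by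
    rw [mul_assoc, ← mul_pow, pow_succ']
    norm_num
  refine ⟨(1 / 2 : ℂ) • (((1 / 2 : ℂ) * (-(1 / 2)) ^ k) • z + gr 2 y), ?_⟩
  rw [map_smul, map_add, map_smul]
  rw [mul_smul_comm, mul_smul_comm, hc, hz, smul_add, smul_smul, hs] at h
  push_cast at h
  linear_combination (norm := module) (1 / 2 : ℂ) • h

/-- The elements which `ψ` makes homogeneous of polynomial degree `k`. -/
def grHomog (k : ℕ) : Submodule ℂ PA where
  carrier := {x | ∀ j, gr j x = if j = k then psi x else 0}
  add_mem' ha hb j := by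
    rw [map_add, ha j, hb j, map_add]
    split_ifs
    · rfl
    · rw [add_zero]
  zero_mem' j := by rw [map_zero, map_zero, ite_self]
  smul_mem' c a ha j := by
    rw [map_smul, ha j, map_smul]
    split_ifs
    · rfl
    · rw [smul_zero]

theorem mem_grHomog {k : ℕ} {x : PA} : x ∈ grHomog k ↔ ∀ j, gr j x = if j = k then psi x else 0 :=
  Iff.rfl

theorem mul_mem_grHomog {k l : ℕ} {x y : PA} (hx : x ∈ grHomog k) (hy : y ∈ grHomog l) :
    x * y ∈ grHomog (k + l) := by
  rw [mem_grHomog] at *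
  intro j
  have e : ∀ ij : ℕ × ℕ, gr ij.1 x * gr ij.2 y = if (k, l) = ij then psi x * psi y else 0 := by
    rintro ⟨i, j⟩
    rw [hx, hy]
    by_cases h : (k, l) = (i, j)
    · obtain ⟨rfl, rfl⟩ := Prod.mk.inj h
      simp only [if_true]
    · rw [if_neg h]
      simp only
      split_ifs with h1 h2
      · exact absurd (by rw [h1, h2]) h
      · rw [mul_zero]
      · rw [zero_mul]
      · rw [zero_mul]
  rw [gr_mul, Finset.sum_congr rfl fun ij _ => e ij, Finset.sum_ite_eq, map_mul]
  simp only [Finset.HasAntidiagonal.mem_antidiagonal, eq_comm]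

theorem bar_mem_grHomog (b : B) : bar b ∈ grHomog 1 := by
  intro j
  rw [bar, gr_letter, psi_letter]

/-- Elements of the kernel of `ψ` count as homogeneous of every degree. -/
theorem mem_grHomog_of_psi_eq_zero {k l : ℕ} {x : PA} (hx : x ∈ grHomog k) (h : psi x = 0) :
    x ∈ grHomog l := by
  intro j
  rw [hx j, h, ite_self, ite_self]

theorem iterate_D_mem_grHomog {k : ℕ} {a : PA} (ha : a ∈ grHomog k) (m : ℕ) : D^[m] a ∈ grHomog k := by
  induction m with
  | zero => exact ha
  | succ m ih =>
    rw [Function.iterate_succ_apply']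
    intro j
    rw [gr_D, ih j, psi_D]
    split_ifs
    · rfl
    · rw [map_zero]

/-- The nonlinear terms of the `w_t` contain one of the letters `h₁`, `f₁`, which `ψ` kills. -/
theorem wv_mem_grHomog (t : Fin 4) : wv t ∈ grHomog 1 := by
  obtain ⟨-, -, -, -, p5, p6⟩ := psi_bar
  have hb := bar_mem_grHomog
  have hD : ∀ b, D (bar b) ∈ grHomog 1 := fun b => iterate_D_mem_grHomog (hb b) 1
  have m1 : ∀ b, bar .f1 * bar b ∈ grHomog 1 := fun b =>
    mem_grHomog_of_psi_eq_zero (mul_mem_grHomog (hb .f1) (hb b)) (by rw [map_mul, p6, zero_mul])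
  have m2 : ∀ b, bar .h1 * bar b ∈ grHomog 1 := fun b =>
    mem_grHomog_of_psi_eq_zero (mul_mem_grHomog (hb .h1) (hb b)) (by rw [map_mul, p5, zero_mul])
  have s : ∀ (c : ℂ) {a : PA}, a ∈ grHomog 1 → c • a ∈ grHomog 1 :=
    fun c a h => Submodule.smul_mem _ c h
  fin_cases t
  · exact s _ (hb _)
  · exact neg_mem (s _ (hb _))
  · exact sub_mem (sub_mem (add_mem (neg_mem (s _ (hb _))) (s _ (m1 _))) (s _ (m2 _))) (s _ (hD _))
  · exact add_mem (sub_mem (sub_mem (s _ (hb _)) (s _ (m1 _))) (s _ (m1 _))) (s _ (hD _))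

theorem varSpan_le_grHomog : varSpan wv ≤ grHomog 1 := by
  rw [varSpan, Submodule.span_le]
  rintro _ ⟨t, m, rfl⟩
  exact iterate_D_mem_grHomog (wv_mem_grHomog t) m

theorem one_le_grHomog : (1 : Submodule ℂ PA) ≤ grHomog 0 := by
  rw [Submodule.one_eq_range]
  rintro _ ⟨c, rfl⟩ j
  rw [Algebra.linearMap_apply, gr_algebraMap, AlgHom.commutes]

theorem varSpan_pow_le_grHomog (k : ℕ) : varSpan wv ^ k ≤ grHomog k := by
  induction k with
  | zero =>
    rw [pow_zero]
    exact one_le_grHomog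
  | succ k ih =>
    rw [pow_succ, Submodule.mul_le]
    exact fun x hx y hy => mul_mem_grHomog (ih hx) (varSpan_le_grHomog hy)

theorem varSpan_pow_le_WA (k : ℕ) : varSpan wv ^ k ≤ Subalgebra.toSubmodule WA := by
  have h1 : varSpan wv ≤ Subalgebra.toSubmodule WA := by
    rw [varSpan, Submodule.span_le]
    rintro _ ⟨t, m, rfl⟩
    exact isDiffStable_WA.iterate_D_mem m (wv_mem_WA t)
  induction k with
  | zero =>
    rw [pow_zero, Submodule.one_le]
    exact one_mem WA
  | succ k ih =>
    rw [pow_succ, Submodule.mul_le]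
    exact fun x hx y hy => mul_mem (S := Subalgebra ℂ PA) (ih hx) (h1 hy)

theorem mem_iSup_varSpan {a : PA} (ha : a ∈ WA) : a ∈ ⨆ k : ℕ, varSpan wv ^ k := by
  have hle : ∀ k : ℕ, varSpan wv ^ k ≤ ⨆ k : ℕ, varSpan wv ^ k := le_iSup _
  induction ha using Algebra.adjoin_induction with
  | mem a ha =>
    obtain ⟨t, n, rfl⟩ := ha
    refine hle 1 ?_
    rw [pow_one]
    exact Submodule.subset_span ⟨t, n, rfl⟩
  | algebraMap r =>
    refine hle 0 ?_
    rw [pow_zero]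
    exact Submodule.algebraMap_mem r
  | add a b _ _ ha hb => exact add_mem ha hb
  | mul a b _ _ ha hb =>
    have h := Submodule.mul_mem_mul ha hb
    rw [Submodule.iSup_mul] at h
    refine (iSup_le fun k => ?_ : (⨆ k : ℕ, varSpan wv ^ k * ⨆ l : ℕ, varSpan wv ^ l) ≤ _) h
    rw [Submodule.mul_iSup]
    refine iSup_le fun l => ?_
    rw [← pow_add]
    exact hle (k + l)

theorem iSup_varSpan_le : ⨆ k : ℕ, varSpan wv ^ k ≤
    ((1 : Submodule ℂ PA) ⊔ varSpan wv) ⊔ varSpan wv ^ 2 ⊔ ⨆ k : ℕ, varSpan wv ^ (k + 3) := by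
  refine iSup_le fun k => ?_
  match k with
  | 0 =>
    rw [pow_zero]
    exact le_sup_of_le_left (le_sup_of_le_left le_sup_left)
  | 1 =>
    rw [pow_one]
    exact le_sup_of_le_left (le_sup_of_le_left le_sup_right)
  | 2 => exact le_sup_of_le_left le_sup_right
  | k + 3 => exact le_sup_of_le_right (le_iSup (fun k => varSpan wv ^ (k + 3)) k)

theorem exists_isQuadraticPart {a : PA} (ha : a ∈ WA) : ∃ q, IsQuadraticPart wv a q := by
  obtain ⟨x, hx, c, hc, rfl⟩ := Submodule.mem_sup.1 (iSup_varSpan_le (mem_iSup_varSpan ha))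
  obtain ⟨l, hl, q, hq, rfl⟩ := Submodule.mem_sup.1 hx
  exact ⟨q, hq, l, hl, c, hc, rfl⟩

theorem gr_two_of_mem_iSup {c : PA} (hc : c ∈ ⨆ k : ℕ, varSpan wv ^ (k + 3)) : gr 2 c = 0 := by
  have h : (⨆ k : ℕ, varSpan wv ^ (k + 3)) ≤ LinearMap.ker (gr 2) := by
    refine iSup_le fun k x hx => ?_
    rw [LinearMap.mem_ker, varSpan_pow_le_grHomog _ hx, if_neg (by omega)]
  exact h hc

/-- The quadratic part of a super differential polynomial is determined by the component of degree two of
its image under `ψ`. -/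
theorem IsQuadraticPart.eq {a q : PA} (h : IsQuadraticPart wv a q) : q = phi (gr 2 a) := by
  obtain ⟨hq, l, hl, c, hc, rfl⟩ := h
  have h1 : gr 2 l = 0 := by
    obtain ⟨x, hx, y, hy, rfl⟩ := Submodule.mem_sup.1 hl
    rw [map_add, one_le_grHomog hx, varSpan_le_grHomog hy, if_neg (by omega), if_neg (by omega), add_zero]
  rw [map_add (gr 2), map_add (gr 2), h1, zero_add, gr_two_of_mem_iSup hc, varSpan_pow_le_grHomog _ hq, if_pos rfl, add_zero]
  exact (phi_psi (varSpan_pow_le_WA _ hq)).symm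

/-- The quadratic parts of the Hamiltonians in terms of the `w_t`. -/
theorem functional_phi_gr_two_rho (n : ℕ) (hn : 1 ≤ n) : functional (phi (gr 2 (rho Kc n))) =
    functional ((2 : ℂ) ^ (3 - (n : ℤ)) • (D^[2 * n - 2] (wv 0) * wv 3)) := by
  obtain ⟨k, rfl⟩ := Nat.exists_eq_add_of_le' hn
  obtain ⟨y, hy⟩ := gr_two_rho k
  have hp : phi (letter barPar (.e1, 2 * k)) = (2 : ℂ) • D^[2 * k] (wv 0) := by
    rw [phi_letter, phiGen, iterate_D_eq_pow, map_smul, ← iterate_D_eq_pow]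
  have hs : (1 / 2 : ℂ) ^ (k + 1) * 8 = (2 : ℂ) ^ (3 - ((k + 1 : ℕ) : ℤ)) := by
    rw [zpow_sub₀ two_ne_zero, zpow_natCast, one_div, inv_pow]
    norm_num
    ring
  have e : phi ((1 / 2 : ℂ) ^ (k + 1) • (letter barPar (.e1, 2 * k) * bar .f3)) =
      (2 : ℂ) ^ (3 - ((k + 1 : ℕ) : ℤ)) • (D^[2 * (k + 1) - 2] (wv 0) * wv 3) := by
    rw [map_smul, map_mul, hp, phi_bar, phiGen, smul_mul_smul_comm, smul_smul, ← hs,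
      show 2 * (k + 1) - 2 = 2 * k by omega]
    norm_num
  have z : functional (phi (D y)) = 0 := by
    rw [functional, Submodule.mkQ_apply, Submodule.Quotient.mk_eq_zero]
    exact phi_D_mem_DW y
  rw [hy, map_add, e, functional, map_add, ← functional, ← functional, z, add_zero]

/-! ### Linear independence -/

theorem eq_zero_of_smul_one_eq_zero {c : ℂ} (h : c • (1 : PA) = 0) : c = 0 := by
  have e := congrArg (liftHom (par := barPar) (B := ℂ) (fun _ => 0) fun _ _ => by simp) h
  rw [map_smul, map_one, map_zero, smul_eq_mul, mul_one] at e
  exact e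

/-- Linear independence is seen on the variational derivatives, i.e. on the resolvent: the
component of `h₂` has a constant term for `n = 0` only, and the linear part of the component of
`f₃` is a multiple of the letter `e₁^{(2n-2)}` for `n ≥ 1`. -/
theorem linearIndependent_functional_rho :
    LinearIndependent ℂ fun k : ℕ => functional (rho Kc k) := by
  rw [linearIndependent_iff']
  intro s c hs
  have hDW : ∀ x ∈ DW, ∀ b, varDer b x = 0 := by
    intro x hx b
    have hle : DW ≤ LinearMap.ker (varDerLin (par := barPar) b) := by
      rw [DW, Submodule.span_le]
      rintro _ ⟨a, _, rfl⟩
      exact varDer_D b a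
    exact hle hx
  have hmem : ∑ k ∈ s, c k • rho Kc k ∈ DW := by
    rw [← Submodule.Quotient.mk_eq_zero, ← Submodule.mkQ_apply, map_sum]
    simpa only [map_smul, functional] using hs
  -- Variational derivatives annihilate `D W`, so they may be applied to a linear relation.
  have hv : ∀ b : B, ¬ b.inN → ∑ k ∈ s, c k • av k b = 0 := by
    intro b hb
    have h := hDW _ hmem b
    change varDerLin (par := barPar) b _ = 0 at h
    rw [map_sum] at h
    rw [← h]
    refine Finset.sum_congr rfl fun k _ => ?_
    rw [map_smul]
    exact congrArg (c k • ·) (varDer_rho hb k).symm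
  have h0 : ∀ k ∈ s, k = 0 → c k = 0 := by
    intro k hk hk0
    have h := congrArg (gr 0) (hv .h2 not_inN_h2)
    simp only [map_sum, map_smul, gr_zero_av, and_true, map_zero] at h
    rw [Finset.sum_eq_single k, if_pos hk0] at h
    · exact eq_zero_of_smul_one_eq_zero h
    · intro l _ hl
      rw [if_neg (fun e => hl (e.trans hk0.symm)), smul_zero]
    · exact fun hk' => absurd hk hk'
  intro k hk
  cases k with
  | zero => exact h0 0 hk rfl
  | succ k =>
    have h := congrArg (fun x => pd (B.e1, 2 * k) (gr 1 x)) (hv .f3 not_inN_f3)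
    simp only [map_sum, map_smul, map_zero] at h
    rw [Finset.sum_eq_single (k + 1), (gr_one_av k).1, map_smul, pd_letter, if_pos rfl, smul_smul] at h
    · exact (mul_eq_zero.1 (eq_zero_of_smul_one_eq_zero h)).resolve_right (pow_ne_zero _ (by norm_num))
    · intro l _ hl
      cases l with
      | zero => rw [gr_one_av_zero not_inN_f3, map_zero, smul_zero]
      | succ l =>
        rw [(gr_one_av l).1, map_smul, pd_letter, if_neg, smul_zero, smul_zero]
        intro e
        have := congrArg Prod.snd e
        simp only at this
        omega
    · exact fun hk' => absurd hk hk'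

end SuperDS

end

theorem mainTheorem8 :
    (∃! p : SuperDS.Loop × (Fin 4 → SuperDS.PA), SuperDS.IsCanonicalForm p.1 p.2) ∧
    ∀ (N : SuperDS.Loop) (w : Fin 4 → SuperDS.PA), SuperDS.IsCanonicalForm N w →
      (∀ t, w t ∈ SuperDS.W) ∧
      (∃! q : SuperDS.Loop × SuperDS.Loop, SuperDS.IsDressing w q.1 q.2) ∧
      ∀ T K : SuperDS.Loop, SuperDS.IsDressing w T K →
        (∀ n, SuperDS.rho K n ∈ SuperDS.W ∧ SuperDS.IsHomog 1 (SuperDS.rho K n)) ∧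
        -- the equations are pairwise compatible
        (∀ m n, ∀ a ∈ SuperDS.W,
          SuperDS.flow₁ (SuperDS.rho K m) (SuperDS.flow₁ (SuperDS.rho K n) a) =
            SuperDS.flow₁ (SuperDS.rho K n) (SuperDS.flow₁ (SuperDS.rho K m) a)) ∧
        -- integrals of motion
        (∀ n k, SuperDS.functional
          (SuperDS.bracketW₁ (SuperDS.rho K n) (SuperDS.rho K k) 0) = 0) ∧
        -- linear independence
        LinearIndependent ℂ (fun k : ℕ => SuperDS.functional (SuperDS.rho K k)) ∧
        -- quadratic parts
        (∀ n : ℕ, 1 ≤ n →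
          (∃! q, SuperDS.IsQuadraticPart w (SuperDS.rho K n) q) ∧
          ∀ q, SuperDS.IsQuadraticPart w (SuperDS.rho K n) q →
            SuperDS.functional q = SuperDS.functional
              ((2 : ℂ) ^ (3 - (n : ℤ)) • (SuperDS.D^[2 * n - 2] (w 0) * w 3))) ∧
        -- the second Hamiltonian form
        (∀ n t, SuperDS.flow₁ (SuperDS.rho K n) (w t) =
          SuperDS.flow₂ (SuperDS.rho K (n + 1)) (w t)) := by
  refine ⟨⟨(SuperDS.cst SuperDS.nv, SuperDS.wv), SuperDS.isCanonicalForm_nv, ?_⟩, ?_⟩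
  · rintro ⟨N, w⟩ h
    exact Prod.ext h.eq.1 h.eq.2
  rintro N w h
  obtain ⟨rfl, rfl⟩ := h.eq
  refine ⟨SuperDS.wv_mem_W, ⟨(SuperDS.Tc, SuperDS.Kc), SuperDS.isDressing_Tc, ?_⟩, ?_⟩
  · rintro ⟨T, K⟩ hT
    exact Prod.ext hT.eq.1 hT.eq.2
  rintro T K hT
  obtain ⟨rfl, rfl⟩ := hT.eq
  refine ⟨fun n => ⟨SuperDS.WA_subset_W (SuperDS.rho_mem_WA n), SuperDS.isHomog_rho n⟩,
    fun m n a ha => SuperDS.flow₁_comm m n ha, SuperDS.functional_bracketW₁_rho,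
    SuperDS.linearIndependent_functional_rho, fun n hn => ⟨?_, fun q hq => ?_⟩, SuperDS.flow₁_wv⟩
  · obtain ⟨q, hq⟩ := SuperDS.exists_isQuadraticPart (SuperDS.rho_mem_WA n)
    exact ⟨q, hq, fun q' hq' => hq'.eq.trans hq.eq.symm⟩
  · rw [hq.eq]
    exact SuperDS.functional_phi_gr_two_rho n hn
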